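/- For $\sigma,\tau>0$ write $\mathbb T_\sigma=\{|\operatorname{Im} z|<\sigma\}\subset\mathbb C/\mathbb Z$ and $B_\tau=\{z\in\mathbb C:|z|<\tau\}$. Let $D>1$ and let $\Omega\subset\mathbb R^2$ be a bounded strictly convex domain whose boundary has length one and is parametrized counterclockwise by arclength by the simple closed curve $r:\mathbb T=\mathbb R/\mathbb Z\to\mathbb R^2$. Assume that its curvature satisfies $\kappa\ge D^{-1}$ and that, for some $\sigma_0>0$, $r$ extends holomorphically to $\mathbb T_{\sigma_0}$ with $\|r^{(j)}\|\le D$ on $\mathbb T_{\sigma_0}$ for $0\le j\le 3$. Let $T(s,\vartheta)=(s^+,\vartheta^+)$ be the billiard map in $\Omega$, where $s$ is the arclength parameter of the impact point and $\vartheta\in(0,\pi)$ is the angle between the outgoing ray and the positive tangent vector. There is a constant $C_5>1$ depending only on $D$ and, for each integer $k\ge0$, there are constants $c_1,c_2>0$ and $C_6>1$ depending only on $D$ and $k$, such that the following holds whenever $\sigma_0<C_5^{-1}$. There is a real-analytic coordinate change $\Phi=\Phi_{2k+4}:(s,\vartheta)\mapsto(x,y)$ of the cylinder near its boundary, which extends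 to a biholomorphic map of $\mathbb T_{\sigma_0/2}\times B_{c_1\sigma_0}$ onto an open subset $V$ of $(\mathbb C/\mathbb Z)\times\mathbb C$, whose lift to the universal cover commutes with $(s,\vartheta)\mapsto(s+1,\vartheta)$ in the sense $\Phi(s+1,\vartheta)=\Phi(s,\vartheta)+(1,0)$, and which takes $\{\vartheta=0\}$ into $\{y=0\}$ and real points with $\vartheta>0$ to real points with $y>0$; and there are holomorphic functions $f,g$ on $V$, real at real points, such that $T_{\mathrm{laz}}=\Phi\circ T\circ\Phi^{-1}$ takes the form $$T_{\mathrm{laz}}(x,y)=\bigl(x+y+y^{2k+4}f(x,y),\;y+y^{2k+4}g(x,y)\bigr)$$ at all real points $(x,y)=\Phi(s,\vartheta)$ for which $0<\vartheta<c_1\sigma_0$ and $0<\vartheta^+<c_1\sigma_0$. Moreover, for every $0<\sigma<\sigma_0/2$, $$\|f\|_\sigma,\ \|g\|_\sigma\le C_6\left(\tfrac{\sigma_0}{2}-\sigma\right)^{-2k-3},$$ where $\|\cdot\|_\sigma$ is the supremum over the set $\Phi(\mathbb T_\sigma\times B_{c_1\sigma_0})$, that is, over $(s,\vartheta)\in\mathbb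 T_\sigma\times B_{c_1\sigma_0}$ in the original coordinates. This set contains $\mathbb T_{c_2\sigma}\times B_{c_2\sigma}$ in the coordinates $(x,y)$, so the same bound holds there. -/

import Mathlib

open Set

/-- The Euclidean plane. -/
abbrev Plane : Type := EuclideanSpace ℝ (Fin 2)

/-- The complex strip `|Im z| < σ`: the universal cover of the complex neighbourhood `𝕋_σ` of the
circle `𝕋 = ℝ / ℤ`. -/
def strip (σ : ℝ) : Set ℂ := {z | |z.im| < σ}

/-- The product `𝕋_σ × B_τ` (on the universal cover), with `B_τ` the complex disc of radius `τ`. -/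
def stripProd (σ τ : ℝ) : Set (ℂ × ℂ) := strip σ ×ˢ Metric.ball (0 : ℂ) τ

/-- `Ω` is a bounded strictly convex domain of the plane, and `r : ℝ / ℤ → ∂Ω` is a parametrization
of its boundary as a simple closed curve. -/
structure IsBilliardBoundary (Ω : Set Plane) (r : ℝ → Plane) : Prop where
  isOpen : IsOpen Ω
  nonempty : Ω.Nonempty
  isBounded : Bornology.IsBounded Ω
  -- every open set that is convex is `StrictConvex`, so the condition is put on the closure
  strictConvex : StrictConvex ℝ (closure Ω)
  frontier_eq : frontier Ω = range r
  periodic : Function.Periodic r 1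
  injOn : InjOn r (Ico 0 1)

/-- Rotation of the plane by a right angle, counterclockwise. -/
def rotLeft (v : Plane) : Plane := !₂[-(v 1), v 0]

/-- The unit tangent vector of `r`. -/
noncomputable def unitTangent (r : ℝ → Plane) (s : ℝ) : Plane := ‖deriv r s‖⁻¹ • deriv r s

/-- The signed curvature of `r`; it is nonnegative for a counterclockwise convex curve. -/
noncomputable def signedCurvature (r : ℝ → Plane) (s : ℝ) : ℝ :=
  (deriv r s 0 * deriv (deriv r) s 1 - deriv r s 1 * deriv (deriv r) s 0) / ‖deriv r s‖ ^ 3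

/-- Speed and curvature of the boundary are at least `D⁻¹`. -/
def SpeedCurvatureBound (D : ℝ) (r : ℝ → Plane) : Prop :=
  ∀ s : ℝ, D⁻¹ ≤ ‖deriv r s‖ ∧ D⁻¹ ≤ signedCurvature r s

/-- `r` extends to a holomorphic map from the strip of width `σ₀` to `ℂ²`, and the extension and
its derivatives up to order three have Hermitian norm at most `D` there: `‖r‖_{σ₀, 3} ≤ D`. -/
def AnalyticBound (D σ₀ : ℝ) (r : ℝ → Plane) : Prop :=
  ∃ R : ℂ → EuclideanSpace ℂ (Fin 2),
    DifferentiableOn ℂ R (strip σ₀) ∧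
    (∀ (s : ℝ) (i : Fin 2), R (s : ℂ) i = ((r s i : ℝ) : ℂ)) ∧
    ∀ j : ℕ, j ≤ 3 → ∀ z ∈ strip σ₀, ‖iteratedDeriv j R z‖ ≤ D

/-- The graph of (the lift of) the billiard map `T (s, ϑ) = (s⁺, ϑ⁺)` inside the curve `r`, which
runs counterclockwise. The ray that leaves `r s` under the angle `ϑ` with the positive tangent hits
the boundary next at `r s⁺`, and is reflected there so that it leaves under the angle `ϑ⁺`; the
direction of the incoming ray at `r s⁺` is therefore `cos ϑ⁺ • t - sin ϑ⁺ • n`, with `t` the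
tangent and `n` the inner normal at `r s⁺`. The lift is the one with `s < s⁺ < s + 1`. -/
def IsBilliardStep (r : ℝ → Plane) (s ϑ s' ϑ' : ℝ) : Prop :=
  ϑ ∈ Ioo 0 Real.pi ∧ ϑ' ∈ Ioo 0 Real.pi ∧ s' ∈ Ioo s (s + 1) ∧
  r s' - r s = ‖r s' - r s‖ •
    (Real.cos ϑ • unitTangent r s + Real.sin ϑ • rotLeft (unitTangent r s)) ∧
  r s' - r s = ‖r s' - r s‖ •
    (Real.cos ϑ' • unitTangent r s' - Real.sin ϑ' • rotLeft (unitTangent r s'))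

/-- A real-analytic coordinate change `(s, ϑ) ↦ (x, y)` of the cylinder near its boundary `ϑ = 0`,
lifted to the universal cover and extended biholomorphically to the complex neighbourhood
`𝕋_σ × B_τ`: it commutes with the deck transformation, is real on real points, takes the boundary
`ϑ = 0` to `y = 0` and the side `ϑ > 0` to `y > 0`. -/
structure IsCoordinateChange (σ τ : ℝ) (Φ : OpenPartialHomeomorph (ℂ × ℂ) (ℂ × ℂ)) : Prop where
  source_eq : Φ.source = stripProd σ τ
  holomorphic : DifferentiableOn ℂ Φ Φ.source
  holomorphic_symm : DifferentiableOn ℂ Φ.symm Φ.target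
  equivariant : ∀ p ∈ Φ.source, Φ (p + (1, 0)) = Φ p + (1, 0)
  real : ∀ p ∈ Φ.source, Φ (star p) = star (Φ p)
  boundary : ∀ s ∈ strip σ, (Φ (s, 0)).2 = 0
  pos : ∀ s ϑ : ℝ, 0 < ϑ → ϑ < τ → 0 < (Φ ((s : ℂ), (ϑ : ℂ))).2.re

/-- `f` is a holomorphic function on `V`, `1`-periodic in the first variable and real on real
points. -/
def IsRealAnalyticPeriodic (f : ℂ × ℂ → ℂ) (V : Set (ℂ × ℂ)) : Prop :=
  DifferentiableOn ℂ f V ∧ (∀ p ∈ V, f (p + (1, 0)) = f p) ∧ ∀ p ∈ V, f (star p) = star (f p)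

/-- The map `(x, y) ↦ (x + y + y ^ m f(x, y), y + y ^ m g(x, y))`. -/
def normalFormMap (m : ℕ) (f g : ℂ × ℂ → ℂ) (p : ℂ × ℂ) : ℂ × ℂ :=
  (p.1 + p.2 + p.2 ^ m * f p, p.2 + p.2 ^ m * g p)

/-!
# Normal form of a convex analytic billiard near the boundary

The billiard map is the twist map generated by chord length. The Lazutkin parameter
`χ = const · ∫ κ^(2/3) ds` (`CurveFrame.exists_chart`) puts the generating function "arclength minus
chord length" into the form `G(a, b) = m (b - a)³ + O((b - a)⁴)` with a constant `m`
(`exists_twistGen`). Coordinates `(x, y)` in which the map is `(x, y) ↦ (x + y, y)` up to a high order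
in `y` amount to a family of curves `x ↦ X(x, y) = x + V(x, y)` for which `X(x - y), X(x), X(x + y)` are
consecutive points of an orbit up to that order, that is, for which the discrete Euler-Lagrange
equation almost holds.

These curves come from a conservation law. For any family `X(θ, ε)` the action
`J(θ, ε) = G(X, X⁺) - ∫_θ^{θ+ε} ∂₂G(X(t - ε), X(t)) X'(t) dt`, with `X⁺(θ) = X(θ + ε)`, has a
`θ`-derivative equal to `X'` times the Euler-Lagrange residual (`hasDerivAt_actionDensity`). So it
suffices to make `J` independent of `θ`. Now `J = ε³ j`, where `j = -2m + O(ε)`, and adding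
`εⁿ⁺¹ v(θ)` to `X` changes the coefficient of `εⁿ⁺¹` in `j` by `-6m v'`
(`actionDensity_variation`). Each order is therefore removed by one integration
(`exists_isParam`); there is no solvability condition besides the mean value, which is a constant.
Every domain in this induction is proportional to the width of the complex strip, and every bound
depends only on the bounds for the curve.

After `n` steps the reflection law holds along the approximate orbits to order `n + 3`
(`forwardAngle_add_backwardAngle_isBigO`). The coordinate change `Φ` is the inverse of the map that
takes `(x, y)` to the point `X(x, y)` and the angle there towards the next point
(`exists_normalChart`). After rescaling this map is close to the identity, and by construction the
conjugated billiard map differs from `(x + y, y)` only by the defect in the reflection law. The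
remainder is bounded on a domain of size comparable to the width `σ₀` of the strip, and by the Schwarz
lemma it is `y^(n+3)` times a function bounded by a multiple of `σ₀^(-n-2)`
(`NormalChart.exists_remainder`).

The connection with actual billiard steps is geometric (`IsBilliardStep.chordAngle_eq`). Along a step
the tangent turns by `ϑ + ϑ'`. As the curvature is bounded below, the curve has a tangent of this
direction at a distance `O(ϑ + ϑ')`, and a strictly convex curve has it at one point only. Hence a step
with small angles is short, and short chords are determined by the angle
(`CurveFrame.eq_of_chordAngle_eq`).
-/

open Metric Filter Topology Asymptotics

/-! ### Bounded holomorphic functions and division by powers -/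

/-- A Lipschitz bound at a point for a bounded holomorphic map on a ball. -/
theorem norm_sub_le_of_bounded_ball {E : Type*} [NormedAddCommGroup E] [NormedSpace ℂ E]
    {f : E → ℂ} {c z : E} {r M : ℝ} (hd : DifferentiableOn ℂ f (ball c r))
    (hM : ∀ w ∈ ball c r, ‖f w‖ ≤ M) (hz : z ∈ ball c r) :
    ‖f z - f c‖ ≤ 2 * M / r * ‖z - c‖ := by
  have hr : 0 < r := nonempty_ball.mp ⟨_, hz⟩
  have h := Complex.dist_le_div_mul_dist_of_mapsTo_ball (R₂ := 2 * M) hd (fun w hw => by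
    rw [mem_closedBall, dist_eq_norm]
    linarith [norm_sub_le (f w) (f c), hM w hw, hM c (mem_ball_self hr)]) hz
  simpa [dist_eq_norm] using h

/-- An integral `∫₀¹ H(p, t) dt` depends holomorphically on the parameter `p`. -/
theorem DifferentiableOn.intervalIntegral_param {E : Type*} [NormedAddCommGroup E]
    [NormedSpace ℂ E] [ProperSpace E] {W : Set E} (hW : IsOpen W) {H : E → ℝ → ℂ}
    (hc : ContinuousOn (fun q : E × ℝ => H q.1 q.2) (W ×ˢ Icc 0 1))
    (hd : ∀ t ∈ Icc (0 : ℝ) 1, DifferentiableOn ℂ (fun p => H p t) W) :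
    DifferentiableOn ℂ (fun p => ∫ t in (0 : ℝ)..1, H p t) W := by
  intro p hp
  apply DifferentiableAt.differentiableWithinAt
  obtain ⟨r, hr, hrW⟩ := Metric.nhds_basis_closedBall.mem_iff.1 (hW.mem_nhds hp)
  have hbW : ball p r ⊆ W := ball_subset_closedBall.trans hrW
  have hK : IsCompact (closedBall p r ×ˢ Icc (0 : ℝ) 1) := (isCompact_closedBall p r).prod isCompact_Icc
  have hcK : ContinuousOn (fun q : E × ℝ => H q.1 q.2) (closedBall p r ×ˢ Icc 0 1) :=
    hc.mono (prod_mono hrW subset_rfl)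
  obtain ⟨M, hM⟩ := hK.exists_bound_of_continuousOn hcK
  have hsec : ∀ x ∈ W, ContinuousOn (H x) (Icc 0 1) := fun x hx =>
    hc.comp (f := fun t : ℝ => (x, t)) (by fun_prop) (fun t ht => ⟨hx, ht⟩)
  have hcont : ContinuousOn (fun t => fderiv ℂ (fun x => H x t) p) (Icc 0 1) := by
    have huc := hK.uniformContinuousOn_of_continuous hcK
    rw [Metric.uniformContinuousOn_iff] at huc
    rw [Metric.continuousOn_iff]
    intro t ht ε hε
    obtain ⟨δ, hδ, h⟩ := huc (ε * r / 4) (by positivity)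
    refine ⟨δ, hδ, fun s hs hst => ?_⟩
    have hds : DifferentiableOn ℂ (fun x => H x s - H x t) (ball p r) :=
      ((hd s hs).sub (hd t ht)).mono hbW
    have hle : ∀ x ∈ ball p r, ‖H x s - H x t‖ ≤ ε * r / 4 := by
      intro x hx
      have := h (x, s) ⟨ball_subset_closedBall hx, hs⟩ (x, t) ⟨ball_subset_closedBall hx, ht⟩
        (by rw [Prod.dist_eq]; exact max_lt (by simpa using hδ) hst)
      rw [dist_eq_norm] at this
      exact this.le
    have hfd : fderiv ℂ (fun x => H x s - H x t) p =
        fderiv ℂ (fun x => H x s) p - fderiv ℂ (fun x => H x t) p :=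
      fderiv_fun_sub ((hd s hs).differentiableAt (hW.mem_nhds hp))
        ((hd t ht).differentiableAt (hW.mem_nhds hp))
    rw [dist_eq_norm, ← hfd]
    have h2 := Complex.norm_fderiv_le_div_of_mapsTo_ball (R₂ := ε * r / 2) hds (fun x hx => by
      rw [mem_closedBall, dist_eq_norm]
      linarith [norm_sub_le (H x s - H x t) (H p s - H p t), hle x hx, hle p (mem_ball_self hr)]) hr
    rw [div_div, mul_comm 2 r, ← div_div, mul_div_cancel_right₀ _ hr.ne'] at h2
    linarith
  have hmeas : ∀ x ∈ ball p r, MeasureTheory.AEStronglyMeasurable (H x)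
      (MeasureTheory.volume.restrict (Ioc 0 1)) := fun x hx =>
    ((hsec x (hbW hx)).mono Ioc_subset_Icc_self).aestronglyMeasurable measurableSet_Ioc
  have key := hasFDerivAt_integral_of_dominated_loc_of_lip' (𝕜 := ℂ) (E := ℂ)
    (μ := MeasureTheory.volume.restrict (Ioc (0 : ℝ) 1)) (F := H) (x₀ := p)
    (F' := fun t => fderiv ℂ (fun x => H x t) p) (s := ball p r) (bound := fun _ => 2 * M / r)
    (ball_mem_nhds p hr) hmeas
    (((hsec p hp).integrableOn_Icc).mono_set Ioc_subset_Icc_self)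
    ((hcont.mono Ioc_subset_Icc_self).aestronglyMeasurable measurableSet_Ioc)
    ((MeasureTheory.ae_restrict_mem measurableSet_Ioc).mono fun t ht x hx =>
      norm_sub_le_of_bounded_ball ((hd t (Ioc_subset_Icc_self ht)).mono hbW)
        (fun w hw => hM (w, t) ⟨ball_subset_closedBall hw, Ioc_subset_Icc_self ht⟩) hx)
    (MeasureTheory.integrable_const _)
    ((MeasureTheory.ae_restrict_mem measurableSet_Ioc).mono fun t ht =>
      ((hd t (Ioc_subset_Icc_self ht)).differentiableAt (hW.mem_nhds hp)).hasFDerivAt)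
  simpa only [intervalIntegral.integral_of_le zero_le_one] using key.2.differentiableAt

/-- A holomorphic function of one variable that is `o(tⁿ)` is divisible by `tⁿ⁺¹`. -/
theorem exists_eq_pow_mul_of_isLittleO {r : ℝ} (hr : 0 < r) {n : ℕ} {φ : ℂ → ℂ}
    (hφ : DifferentiableOn ℂ φ (ball 0 r)) (h0 : φ =o[𝓝 0] fun t : ℂ => t ^ n) :
    ∃ g : ℂ → ℂ, DifferentiableOn ℂ g (ball 0 r) ∧ ∀ t ∈ ball (0 : ℂ) r, φ t = t ^ (n + 1) * g t := by
  have hφ0 : φ 0 = 0 := by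
    rcases n.eq_zero_or_pos with rfl | hn
    · have : Tendsto φ (𝓝 0) (𝓝 0) := by simpa [isLittleO_one_iff] using h0
      exact tendsto_nhds_unique
        (hφ.continuousOn.continuousAt (ball_mem_nhds 0 hr)) this
    · obtain ⟨c, hc⟩ := h0.isBigO.bound
      have := hc.self_of_nhds
      simpa [hn.ne'] using this
  set f : ℂ → ℂ := fun t => φ t / t ^ (n + 1) with hf
  have hd : DifferentiableOn ℂ f (ball 0 r \ {0}) := by
    refine (hφ.mono sdiff_subset).div (by fun_prop) (fun t ht => pow_ne_zero _ ht.2)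
  have ho : (fun z => f z - f 0) =o[𝓝[≠] 0] fun z => (z - 0)⁻¹ := by
    have h1 : (fun z : ℂ => φ z * (z ^ (n + 1))⁻¹) =o[𝓝[≠] 0]
        fun z => z ^ n * (z ^ (n + 1))⁻¹ :=
      (h0.mono nhdsWithin_le_nhds).mul_isBigO (isBigO_refl _ _)
    refine (h1.congr' ?_ ?_)
    · filter_upwards with z
      simp [hf, hφ0, div_eq_mul_inv]
    · filter_upwards [self_mem_nhdsWithin] with z hz
      have hz : z ≠ 0 := hz
      field_simp
      ring
  refine ⟨_, Complex.differentiableOn_update_limUnder_of_isLittleO (ball_mem_nhds 0 hr) hd ho, ?_⟩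
  intro t ht
  by_cases h : t = 0
  · simp [h, hφ0]
  · rw [Function.update_of_ne h, hf]
    field_simp

/-- Division by a power of the second variable: a bounded holomorphic function on `U × B_r` that
is `o(tⁿ)` on every fibre is `tⁿ⁺¹` times a bounded holomorphic function. -/
theorem exists_eq_snd_pow_mul {U : Set ℂ} (hU : IsOpen U) {r : ℝ} (hr : 0 < r) {n : ℕ}
    {F : ℂ × ℂ → ℂ} (hF : DifferentiableOn ℂ F (U ×ˢ ball 0 r))
    (h0 : ∀ a ∈ U, (fun t => F (a, t)) =o[𝓝 0] fun t : ℂ => t ^ n) :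
    ∃ f : ℂ × ℂ → ℂ, DifferentiableOn ℂ f (U ×ˢ ball 0 (r / 2)) ∧
      (∀ p ∈ U ×ˢ ball (0 : ℂ) (r / 2), F p = p.2 ^ (n + 1) * f p) ∧
      ∀ M : ℝ, (∀ p ∈ U ×ˢ ball (0 : ℂ) r, ‖F p‖ ≤ M) →
        ∀ p ∈ U ×ˢ ball (0 : ℂ) (r / 2), ‖f p‖ ≤ M / r ^ (n + 1) := by
  have hfib : ∀ a ∈ U, DifferentiableOn ℂ (fun t => F (a, t)) (ball 0 r) := fun a ha =>
    hF.comp (f := fun t : ℂ => (a, t)) (by fun_prop) (fun t ht => ⟨ha, ht⟩)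
  -- the Cauchy integral of `F / ζⁿ⁺¹` over the circle of radius `3r/4`
  set ζ : ℝ → ℂ := fun t => circleMap 0 (3 * r / 4) (2 * Real.pi * t) with hζ
  have hζn : ∀ t, ‖ζ t‖ = 3 * r / 4 := fun t => by
    simp only [hζ, norm_circleMap_zero]
    rw [abs_of_pos (by positivity)]
  have hζc : Continuous ζ := (continuous_circleMap 0 _).comp (by fun_prop)
  have hζ0 : ∀ t, ζ t ≠ 0 := fun t h => by
    have := hζn t; rw [h, norm_zero] at this; linarith
  have hζb : ∀ t, ζ t ∈ ball (0 : ℂ) r := fun t => by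
    rw [mem_ball_zero_iff, hζn]; linarith
  have hζs : ∀ t, ∀ p ∈ U ×ˢ ball (0 : ℂ) (r / 2), ζ t - p.2 ≠ 0 := fun t p hp h => by
    have h1 := mem_ball_zero_iff.1 hp.2
    rw [← sub_eq_zero.1 h, hζn] at h1; linarith
  set H : ℂ × ℂ → ℝ → ℂ := fun p t => F (p.1, ζ t) / (ζ t) ^ (n + 1) * (ζ t / (ζ t - p.2)) with hH
  set f : ℂ × ℂ → ℂ := fun p => ∫ t in (0 : ℝ)..1, H p t with hf
  have hopen : IsOpen (U ×ˢ ball (0 : ℂ) (r / 2)) := hU.prod isOpen_ball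
  have hfd : DifferentiableOn ℂ f (U ×ˢ ball 0 (r / 2)) := by
    refine DifferentiableOn.intervalIntegral_param hopen ?_ ?_
    · refine ContinuousOn.mul (ContinuousOn.div ?_ (by fun_prop) (fun q _ => pow_ne_zero _ (hζ0 _)))
        (ContinuousOn.div (by fun_prop) (by fun_prop) (fun q hq => hζs _ _ hq.1))
      exact hF.continuousOn.comp (f := fun q : (ℂ × ℂ) × ℝ => (q.1.1, ζ q.2)) (by fun_prop)
        (fun q hq => ⟨hq.1.1, hζb _⟩)
    · intro t _
      simp only [hH, div_eq_mul_inv]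
      refine DifferentiableOn.mul (DifferentiableOn.mul_const ?_ _)
        ((DifferentiableOn.inv (by fun_prop) (fun q hq => hζs _ _ hq)).const_mul _)
      exact hF.comp (f := fun q : ℂ × ℂ => (q.1, ζ t)) (by fun_prop) (fun q hq => ⟨hq.1, hζb _⟩)
  have hfac : ∀ p ∈ U ×ˢ ball (0 : ℂ) (r / 2), F p = p.2 ^ (n + 1) * f p := by
    rintro ⟨a, t⟩ ⟨ha, ht⟩
    obtain ⟨g, hg, hgF⟩ := exists_eq_pow_mul_of_isLittleO hr (hfib a ha) (h0 a ha)
    have ht' := mem_ball_zero_iff.1 ht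
    have hgt : f (a, t) = g t := by
      have hC := (hg.mono (closedBall_subset_ball (by linarith : 3 * r / 4 < r))).diffContOnCl_ball
        (subset_rfl) |>.circleIntegral_sub_inv_smul (w := t) (by
          rw [mem_ball_zero_iff]; simp at ht'; linarith)
      have h1 : (∮ z in C(0, 3 * r / 4), (z - t)⁻¹ • g z) =
          ∫ θ in (0 : ℝ)..2 * Real.pi, Complex.I * H (a, t) (θ / (2 * Real.pi)) := by
        rw [circleIntegral]
        refine intervalIntegral.integral_congr fun θ _ => ?_
        have hz : ζ (θ / (2 * Real.pi)) = circleMap 0 (3 * r / 4) θ := by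
          simp only [hζ]; congr 1; field_simp
        have h2 := hgF _ (hζb (θ / (2 * Real.pi)))
        simp only [hH, h2, deriv_circleMap, smul_eq_mul, ← hz]
        have h3 := hζ0 (θ / (2 * Real.pi))
        have h4 := hζs (θ / (2 * Real.pi)) (a, t) ⟨ha, ht⟩
        simp only at h4
        field_simp
      rw [h1, intervalIntegral.integral_const_mul,
        intervalIntegral.integral_comp_div _ (by positivity)] at hC
      simp only [zero_div, div_self (show (2 * Real.pi) ≠ 0 by positivity), smul_eq_mul,
        Complex.real_smul] at hC
      have h5 : (2 * Real.pi : ℂ) * Complex.I ≠ 0 := by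
        simp [Real.pi_ne_zero]
      apply mul_left_cancel₀ h5
      rw [← hC]
      push_cast
      ring
    have := hgF t (ball_subset_ball (by linarith) ht)
    simp only [hgt]
    exact this
  refine ⟨f, hfd, hfac, fun M hM => ?_⟩
  -- the bound holds off `t = 0` by the Schwarz lemma, and extends by continuity
  have hb0 : ∀ p ∈ U ×ˢ ball (0 : ℂ) (r / 2), p.2 ≠ 0 → ‖f p‖ ≤ M / r ^ (n + 1) := by
    rintro ⟨a, t⟩ ⟨ha, ht⟩ hne
    have htr : t ∈ ball (0 : ℂ) r := ball_subset_ball (by linarith) ht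
    have hF0 : F (a, 0) = 0 := by simpa using hfac (a, 0) ⟨ha, mem_ball_self (by positivity)⟩
    have hS := Complex.dist_le_mul_div_pow_of_mapsTo_ball_of_isLittleO (R₂ := M) (n := n)
      (hfib a ha) (fun w hw => by simpa [hF0] using hM (a, w) ⟨ha, hw⟩)
      (by
        simp only [hF0, sub_zero]
        exact (h0 a ha).trans_isBigO
          (IsBigO.of_bound 1 (by filter_upwards with x; simp))) htr
    rw [hF0, dist_zero_right, dist_zero_right, hfac (a, t) ⟨ha, ht⟩, norm_mul, norm_pow] at hS
    have htp : 0 < ‖t‖ ^ (n + 1) := by positivity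
    have : ‖t‖ ^ (n + 1) * ‖f (a, t)‖ ≤ ‖t‖ ^ (n + 1) * (M / r ^ (n + 1)) := by
      refine hS.trans_eq ?_
      rw [div_pow]; ring
    exact le_of_mul_le_mul_left this htp
  rintro ⟨a, t⟩ ⟨ha, ht⟩
  by_cases hne : t = 0
  · subst hne
    have hcont : ContinuousAt (fun s : ℂ => f (a, s)) 0 :=
      (hfd.continuousOn.continuousAt (hopen.mem_nhds ⟨ha, ht⟩)).comp (f := fun s : ℂ => (a, s))
        (by fun_prop)
    refine le_of_tendsto (hcont.norm.tendsto.mono_left (nhdsWithin_le_nhds (s := {0}ᶜ))) ?_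
    filter_upwards [self_mem_nhdsWithin, nhdsWithin_le_nhds (ball_mem_nhds (0 : ℂ) (half_pos hr))]
      with s hs hs'
    exact hb0 (a, s) ⟨ha, hs'⟩ hs
  · exact hb0 _ ⟨ha, ht⟩ hne

/-- Cauchy's estimate for the derivative. -/
theorem norm_deriv_le_of_bounded_ball {f : ℂ → ℂ} {z : ℂ} {r M : ℝ} (hr : 0 < r)
    (hd : DifferentiableOn ℂ f (ball z r)) (hM : ∀ w ∈ ball z r, ‖f w‖ ≤ M) :
    ‖deriv f z‖ ≤ 2 * M / r := by
  refine Complex.norm_deriv_le_div_of_mapsTo_ball hd (fun w hw => ?_) hr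
  rw [mem_closedBall, dist_eq_norm]
  linarith [norm_sub_le (f w) (f z), hM w hw, hM z (mem_ball_self hr)]

/-- A holomorphic function that is bounded on the `r`-neighbourhood of a convex set is Lipschitz
there. -/
theorem norm_sub_le_of_bounded_nhd {E : Type*} [NormedAddCommGroup E] [NormedSpace ℂ E]
    {f : E → ℂ} {s W : Set E} {r M : ℝ} (hr : 0 < r)
    (hs : Convex ℝ s) (hsW : ∀ z ∈ s, ball z r ⊆ W) (hd : DifferentiableOn ℂ f W)
    (hM : ∀ w ∈ W, ‖f w‖ ≤ M) {z w : E} (hz : z ∈ s) (hw : w ∈ s) :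
    ‖f z - f w‖ ≤ 2 * M / r * ‖z - w‖ := by
  have hM0 : 0 ≤ M := (norm_nonneg _).trans (hM z (hsW z hz (mem_ball_self hr)))
  refine hs.norm_image_sub_le_of_norm_fderiv_le (𝕜 := ℂ) (fun x hx => ?_) (fun x hx => ?_) hw hz
  · exact (hd.mono (hsW x hx)).differentiableAt (ball_mem_nhds x hr)
  · refine norm_fderiv_le_of_lip' ℂ (by positivity) ?_
    filter_upwards [ball_mem_nhds x hr] with y hy
    exact norm_sub_le_of_bounded_ball (hd.mono (hsW x hx)) (fun w hw => hM w (hsW x hx hw)) hy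

theorem norm_intervalIntegral_sub_const_le {f : ℝ → ℂ} {c : ℂ} {K : ℝ}
    (hf : IntervalIntegrable f MeasureTheory.volume 0 1) (h : ∀ t ∈ Icc (0 : ℝ) 1, ‖f t - c‖ ≤ K) :
    ‖(∫ t in (0 : ℝ)..1, f t) - c‖ ≤ K := by
  have hc : (∫ _t in (0 : ℝ)..1, c) = c := by simp
  conv_lhs => rw [← hc]
  rw [← intervalIntegral.integral_sub hf (by simp)]
  refine (intervalIntegral.norm_integral_le_of_norm_le_const (C := K) (fun t ht => ?_)).trans
    (by simp)
  rw [uIoc_of_le zero_le_one] at ht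
  exact h t (Ioc_subset_Icc_self ht)

/-! ### Periodic real-analytic functions and twist generating functions -/

namespace IsRealAnalyticPeriodic

variable {f g : ℂ × ℂ → ℂ} {V W : Set (ℂ × ℂ)}

theorem mono (hf : IsRealAnalyticPeriodic f W) (h : V ⊆ W) : IsRealAnalyticPeriodic f V :=
  ⟨hf.1.mono h, fun p hp => hf.2.1 p (h hp), fun p hp => hf.2.2 p (h hp)⟩

theorem add (hf : IsRealAnalyticPeriodic f V) (hg : IsRealAnalyticPeriodic g V) :
    IsRealAnalyticPeriodic (fun p => f p + g p) V :=
  ⟨hf.1.add hg.1, fun p hp => by simp only [hf.2.1 p hp, hg.2.1 p hp],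
    fun p hp => by simp only [hf.2.2 p hp, hg.2.2 p hp, star_add]⟩

theorem sub (hf : IsRealAnalyticPeriodic f V) (hg : IsRealAnalyticPeriodic g V) :
    IsRealAnalyticPeriodic (fun p => f p - g p) V :=
  ⟨hf.1.sub hg.1, fun p hp => by simp only [hf.2.1 p hp, hg.2.1 p hp],
    fun p hp => by simp only [hf.2.2 p hp, hg.2.2 p hp, star_sub]⟩

theorem mul (hf : IsRealAnalyticPeriodic f V) (hg : IsRealAnalyticPeriodic g V) :
    IsRealAnalyticPeriodic (fun p => f p * g p) V :=
  ⟨hf.1.mul hg.1, fun p hp => by simp only [hf.2.1 p hp, hg.2.1 p hp],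
    fun p hp => by simp only [hf.2.2 p hp, hg.2.2 p hp, star_mul, mul_comm]⟩

theorem pow (hf : IsRealAnalyticPeriodic f V) (n : ℕ) :
    IsRealAnalyticPeriodic (fun p => f p ^ n) V :=
  ⟨hf.1.pow n, fun p hp => by simp only [hf.2.1 p hp],
    fun p hp => by simp only [hf.2.2 p hp, star_pow]⟩

theorem const {c : ℂ} (hc : star c = c) : IsRealAnalyticPeriodic (fun _ => c) V :=
  ⟨by fun_prop, fun _ _ => rfl, fun _ _ => hc.symm⟩

theorem snd : IsRealAnalyticPeriodic (fun p => p.2) V :=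
  ⟨by fun_prop, fun p _ => by simp, fun p _ => rfl⟩

theorem comp (hf : IsRealAnalyticPeriodic f W) {Ψ : ℂ × ℂ → ℂ × ℂ} (hd : DifferentiableOn ℂ Ψ V)
    (hm : MapsTo Ψ V W) (h1 : ∀ p ∈ V, Ψ (p + (1, 0)) = Ψ p + (1, 0))
    (hs : ∀ p ∈ V, Ψ (star p) = star (Ψ p)) : IsRealAnalyticPeriodic (fun p => f (Ψ p)) V :=
  ⟨hf.1.comp hd hm, fun p hp => by simp only [h1 p hp, hf.2.1 _ (hm hp)],
    fun p hp => by simp only [hs p hp, hf.2.2 _ (hm hp)]⟩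

theorem zero_fst {U S : Set ℂ} (hf : IsRealAnalyticPeriodic f (U ×ˢ S)) (h0 : (0 : ℂ) ∈ U) :
    IsRealAnalyticPeriodic (fun p => f (0, p.2)) (U ×ˢ S) := by
  refine ⟨hf.1.comp (f := fun p : ℂ × ℂ => ((0 : ℂ), p.2)) (by fun_prop)
    (fun p hp => ⟨h0, hp.2⟩), fun p hp => by simp, fun p hp => ?_⟩
  rw [← hf.2.2 (0, p.2) ⟨h0, hp.2⟩]
  exact congrArg f (by ext <;> simp)

end IsRealAnalyticPeriodic

/-- Division by a power of the second variable preserves reality and periodicity. -/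
theorem IsRealAnalyticPeriodic.exists_eq_snd_pow_mul {U : Set ℂ} (hU : IsOpen U)
    (hU1 : ∀ θ ∈ U, θ + 1 ∈ U) (hUs : ∀ θ ∈ U, star θ ∈ U) {r : ℝ} (hr : 0 < r) {n : ℕ}
    {F : ℂ × ℂ → ℂ} (hF : IsRealAnalyticPeriodic F (U ×ˢ ball 0 r))
    (h0 : ∀ a ∈ U, (fun t => F (a, t)) =o[𝓝 0] fun t : ℂ => t ^ n) :
    ∃ f : ℂ × ℂ → ℂ, IsRealAnalyticPeriodic f (U ×ˢ ball 0 (r / 2)) ∧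
      (∀ p ∈ U ×ˢ ball (0 : ℂ) (r / 2), F p = p.2 ^ (n + 1) * f p) ∧
      ∀ M : ℝ, (∀ p ∈ U ×ˢ ball (0 : ℂ) r, ‖F p‖ ≤ M) →
        ∀ p ∈ U ×ˢ ball (0 : ℂ) (r / 2), ‖f p‖ ≤ M / r ^ (n + 1) := by
  obtain ⟨f, hfd, hfe, hfb⟩ := _root_.exists_eq_snd_pow_mul hU hr hF.1 h0
  have hr2 : r / 2 < r := by linarith
  have hop : IsOpen (U ×ˢ ball (0 : ℂ) (r / 2)) := hU.prod isOpen_ball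
  have hsub : U ×ˢ ball (0 : ℂ) (r / 2) ⊆ U ×ˢ ball 0 r := prod_mono subset_rfl (ball_subset_ball hr2.le)
  have hcf : ∀ a ∈ U, ContinuousOn (fun t => f (a, t)) (ball 0 (r / 2)) := fun a ha =>
    hfd.continuousOn.comp (f := fun t : ℂ => (a, t)) (by fun_prop) (fun t ht => ⟨ha, ht⟩)
  -- an identity between continuous functions of `t` that holds off `t = 0` holds at `t = 0`
  have hext : ∀ φ ψ : ℂ → ℂ, ContinuousOn φ (ball 0 (r / 2)) → ContinuousOn ψ (ball 0 (r / 2)) →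
      (∀ t ∈ ball (0 : ℂ) (r / 2), t ≠ 0 → φ t = ψ t) → ∀ t ∈ ball (0 : ℂ) (r / 2), φ t = ψ t := by
    intro φ ψ hφ hψ h t ht
    by_cases h0 : t = 0
    · subst h0
      have e1 := (hφ.continuousAt (isOpen_ball.mem_nhds ht)).tendsto.mono_left
        (nhdsWithin_le_nhds (s := {0}ᶜ))
      have e2 := (hψ.continuousAt (isOpen_ball.mem_nhds ht)).tendsto.mono_left
        (nhdsWithin_le_nhds (s := {0}ᶜ))
      refine tendsto_nhds_unique (e1.congr' ?_) e2
      filter_upwards [self_mem_nhdsWithin, nhdsWithin_le_nhds (isOpen_ball.mem_nhds ht)]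
        with s hs hs'
      exact h s hs' hs
    · exact h t ht h0
  refine ⟨f, ⟨hfd, ?_, ?_⟩, hfe, hfb⟩
  · rintro ⟨a, t⟩ ⟨ha, ht⟩
    have ha1 := hU1 a ha
    simp only [Prod.mk_add_mk, add_zero]
    refine hext (fun t => f (a + 1, t)) (fun t => f (a, t)) (hcf _ ha1) (hcf _ ha) ?_ t ht
    intro t ht hne
    have h1 := hfe (a + 1, t) ⟨ha1, ht⟩
    have h2 := hfe (a, t) ⟨ha, ht⟩
    have h3 := hF.2.1 (a, t) (hsub ⟨ha, ht⟩)
    simp only [Prod.mk_add_mk, add_zero] at h1 h2 h3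
    rw [h1, h2] at h3
    exact mul_left_cancel₀ (pow_ne_zero _ hne) h3
  · rintro ⟨a, t⟩ ⟨ha, ht⟩
    have ha1 := hUs a ha
    have hst : ∀ t ∈ ball (0 : ℂ) (r / 2), star t ∈ ball (0 : ℂ) (r / 2) := fun t ht => by
      simpa using ht
    change f (star a, star t) = star (f (a, t))
    refine hext (fun t => f (star a, star t)) (fun t => star (f (a, t)))
      ((hcf _ ha1).comp (by fun_prop) hst) (hcf _ ha).star ?_ t ht
    intro t ht hne
    have h1 := hfe (star a, star t) ⟨ha1, hst t ht⟩
    have h2 := hfe (a, t) ⟨ha, ht⟩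
    have h3 := hF.2.2 (a, t) (hsub ⟨ha, ht⟩)
    change F (star a, star t) = star (F (a, t)) at h3
    simp only at h1 h2 h3
    rw [h1, h2, star_mul, star_pow, mul_comm] at h3
    exact mul_right_cancel₀ (pow_ne_zero _ (by simpa using hne)) h3

/-- A family of domains of the `θ`-plane, invariant under the translation by `1` and under
conjugation, in which `U ρ` plays the role of a strip of half-width proportional to `ρ`: the gap
between `U ρ` and the complement of `U ρ'` is at least `b (ρ' - ρ)`, and a periodic function minus
its mean has a periodic primitive of comparable size. -/
structure StripFamily (b C ρ₁ : ℝ) (U : ℝ → Set ℂ) : Prop where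
  b_pos : 0 < b
  isOpen : ∀ ρ, ρ ≤ ρ₁ → IsOpen (U ρ)
  add_mem : ∀ {ρ ρ' : ℝ} {θ t : ℂ}, ρ < ρ' → ρ' ≤ ρ₁ → θ ∈ U ρ → ‖t‖ < b * (ρ' - ρ) → θ + t ∈ U ρ'
  add_one : ∀ {ρ : ℝ} {θ : ℂ}, ρ ≤ ρ₁ → θ ∈ U ρ → θ + 1 ∈ U ρ
  star_mem : ∀ {ρ : ℝ} {θ : ℂ}, ρ ≤ ρ₁ → θ ∈ U ρ → star θ ∈ U ρ
  zero_mem : ∀ {ρ : ℝ}, 0 < ρ → 0 ∈ U ρ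
  primitive : ∀ {ρ : ℝ}, 0 < ρ → ρ ≤ ρ₁ → ∀ {B : ℝ} {f : ℂ → ℂ}, DifferentiableOn ℂ f (U ρ) →
    (∀ θ ∈ U ρ, f (θ + 1) = f θ) → (∀ θ ∈ U ρ, f (star θ) = star (f θ)) →
    (∀ θ ∈ U ρ, ‖f θ‖ ≤ B) →
    ∃ (e : ℂ) (F : ℂ → ℂ), star e = e ∧ (∀ θ ∈ U ρ, HasDerivAt F (f θ - e) θ) ∧
      (∀ θ ∈ U ρ, F (θ + 1) = F θ) ∧ (∀ θ ∈ U ρ, F (star θ) = star (F θ)) ∧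
      (∀ θ ∈ U ρ, ‖F θ‖ ≤ C * B) ∧ ∀ θ ∈ U ρ, ‖f θ - e‖ ≤ C * B

/-- The generating function `G(a, b)` of a reversible twist map close to its boundary, in the
coordinates in which the leading coefficient `m` is constant:
`G(a, b) = m (b - a)³ + (b - a)⁴ N(a, b - a)`, with `P = ∂G/∂b = 3m (b - a)² + (b - a)³ N₂(a, b - a)`
and with uniform bounds for `N` and `N₂`. -/
structure TwistGen (m K c ρ₁ : ℝ) (U : ℝ → Set ℂ) (G P : ℂ → ℂ → ℂ) (N N₂ : ℂ × ℂ → ℂ) : Prop where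
  N_irp : IsRealAnalyticPeriodic N (U ρ₁ ×ˢ ball 0 (c * ρ₁))
  N₂_irp : IsRealAnalyticPeriodic N₂ (U ρ₁ ×ˢ ball 0 (c * ρ₁))
  norm_N : ∀ p ∈ U ρ₁ ×ˢ ball (0 : ℂ) (c * ρ₁), ‖N p‖ ≤ K
  norm_N₂ : ∀ p ∈ U ρ₁ ×ˢ ball (0 : ℂ) (c * ρ₁), ‖N₂ p‖ ≤ K
  G_eq : ∀ a ∈ U ρ₁, ∀ h ∈ ball (0 : ℂ) (c * ρ₁), G a (a + h) = m * h ^ 3 + h ^ 4 * N (a, h)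
  P_eq : ∀ a ∈ U ρ₁, ∀ h ∈ ball (0 : ℂ) (c * ρ₁), P a (a + h) = 3 * m * h ^ 2 + h ^ 3 * N₂ (a, h)
  hasDerivAt : ∀ a ∈ U ρ₁, ∀ h ∈ ball (0 : ℂ) (c * ρ₁), HasDerivAt (G a) (P a (a + h)) (a + h)
  antisymm : ∀ a ∈ U ρ₁, ∀ b ∈ U ρ₁, b - a ∈ ball (0 : ℂ) (c * ρ₁) → G a b = -G b a

/-- A family of curves `θ ↦ X(θ, ε) = θ + V(θ, ε)` depending on the step `ε`. The derivative `Vd` in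
`θ` and the difference quotient `B(θ, ε) = (V(θ + ε, ε) - V(θ, ε)) / ε`, which is holomorphic across
`ε = 0`, are part of the data. -/
structure IsParam (ρ τ M : ℝ) (U : ℝ → Set ℂ) (V Vd B : ℂ × ℂ → ℂ) : Prop where
  V_irp : IsRealAnalyticPeriodic V (U ρ ×ˢ ball 0 τ)
  Vd_irp : IsRealAnalyticPeriodic Vd (U ρ ×ˢ ball 0 τ)
  B_irp : IsRealAnalyticPeriodic B (U ρ ×ˢ ball 0 τ)
  norm_V : ∀ p ∈ U ρ ×ˢ ball (0 : ℂ) τ, ‖V p‖ ≤ M * ‖p.2‖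
  norm_Vd : ∀ p ∈ U ρ ×ˢ ball (0 : ℂ) τ, ‖Vd p‖ ≤ M * ‖p.2‖
  norm_B : ∀ p ∈ U ρ ×ˢ ball (0 : ℂ) τ, ‖B p‖ ≤ M * ‖p.2‖
  hasDerivAt : ∀ p ∈ U ρ ×ˢ ball (0 : ℂ) τ, HasDerivAt (fun θ => V (θ, p.2)) (Vd p) p.1
  secant : ∀ p ∈ U ρ ×ˢ ball (0 : ℂ) τ, p.1 + p.2 ∈ U ρ →
    V (p.1 + p.2, p.2) - V p = p.2 * B p

/-- The action `J(θ, ε) = G(X, X⁺) - ∫_θ^{θ+ε} P(X(t - ε), X(t)) X'(t) dt` divided by `ε³`. Its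
`θ`-derivative is the residual of the Euler-Lagrange equation times `X'`. -/
noncomputable def actionDensity (m : ℝ) (N N₂ V Vd B : ℂ × ℂ → ℂ) (p : ℂ × ℂ) : ℂ :=
  m * (1 + B p) ^ 3 + p.2 * (1 + B p) ^ 4 * N (p.1 + V p, p.2 * (1 + B p)) -
  ∫ t in (0 : ℝ)..1,
    (3 * m * (1 + B (p.1 + (t - 1) * p.2, p.2)) ^ 2 +
      p.2 * (1 + B (p.1 + (t - 1) * p.2, p.2)) ^ 3 *
        N₂ (p.1 + (t - 1) * p.2 + V (p.1 + (t - 1) * p.2, p.2),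
          p.2 * (1 + B (p.1 + (t - 1) * p.2, p.2)))) *
    (1 + Vd (p.1 + t * p.2, p.2))

/-! ### The action density and its variation -/

/-- The action density of the deformed family `X + l V₁` is holomorphic in `(θ, ε, l)`. -/
theorem differentiableOn_actionDensity {W : Set (ℂ × ℂ × ℂ)} (hW : IsOpen W) {D E : Set (ℂ × ℂ)}
    {m : ℝ} {N N₂ V Vd B V₁ Vd₁ B₁ : ℂ × ℂ → ℂ}
    (hN : DifferentiableOn ℂ N E) (hN₂ : DifferentiableOn ℂ N₂ E)
    (hV : DifferentiableOn ℂ V D) (hVd : DifferentiableOn ℂ Vd D) (hB : DifferentiableOn ℂ B D)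
    (hV₁ : DifferentiableOn ℂ V₁ D) (hVd₁ : DifferentiableOn ℂ Vd₁ D)
    (hB₁ : DifferentiableOn ℂ B₁ D)
    (h1 : ∀ q ∈ W, ∀ t ∈ Icc (-1 : ℝ) 1, (q.1 + t * q.2.1, q.2.1) ∈ D)
    (h2 : ∀ q ∈ W, ∀ p ∈ D, p.2 = q.2.1 →
      (∃ t ∈ Icc (-1 : ℝ) 1, p.1 = q.1 + t * q.2.1) →
      (p.1 + (V p + q.2.2 * V₁ p), p.2 * (1 + (B p + q.2.2 * B₁ p))) ∈ E) :
    DifferentiableOn ℂ (fun q : ℂ × ℂ × ℂ =>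
      actionDensity m N N₂ (fun p => V p + q.2.2 * V₁ p) (fun p => Vd p + q.2.2 * Vd₁ p)
        (fun p => B p + q.2.2 * B₁ p) (q.1, q.2.1)) W := by
  -- the shift `(θ, ε) ↦ (θ + tε, ε)`, first for fixed `t`, then jointly in `t`
  have hsh : ∀ t ∈ Icc (-1 : ℝ) 1, ∀ {f : ℂ × ℂ → ℂ}, DifferentiableOn ℂ f D →
      DifferentiableOn ℂ (fun q : ℂ × ℂ × ℂ => f (q.1 + t * q.2.1, q.2.1)) W :=
    fun t ht f hf => hf.comp (f := fun q : ℂ × ℂ × ℂ => (q.1 + t * q.2.1, q.2.1)) (by fun_prop)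
      (fun q hq => h1 q hq t ht)
  have hshc : ∀ s : ℝ → ℝ, Continuous s → (∀ t ∈ Icc (0 : ℝ) 1, s t ∈ Icc (-1 : ℝ) 1) →
      ∀ {f : ℂ × ℂ → ℂ}, DifferentiableOn ℂ f D →
      ContinuousOn (fun q : (ℂ × ℂ × ℂ) × ℝ => f (q.1.1 + (s q.2 : ℂ) * q.1.2.1, q.1.2.1))
        (W ×ˢ Icc 0 1) :=
    fun s hs hm f hf => hf.continuousOn.comp
      (f := fun q : (ℂ × ℂ × ℂ) × ℝ => (q.1.1 + (s q.2 : ℂ) * q.1.2.1, q.1.2.1)) (by fun_prop)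
      (fun q hq => h1 q.1 hq.1 _ (hm _ hq.2))
  have hs0 : ∀ {f : ℂ × ℂ → ℂ}, DifferentiableOn ℂ f D →
      DifferentiableOn ℂ (fun q : ℂ × ℂ × ℂ => f (q.1, q.2.1)) W := fun hf => by
    simpa using hsh 0 (by norm_num) hf
  have hl : DifferentiableOn ℂ (fun q : ℂ × ℂ × ℂ => q.2.2) W := by fun_prop
  have he : DifferentiableOn ℂ (fun q : ℂ × ℂ × ℂ => q.2.1) W := by fun_prop
  have ht1 : ∀ t ∈ Icc (0 : ℝ) 1, t - 1 ∈ Icc (-1 : ℝ) 1 := fun t ht =>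
    ⟨by linarith [ht.1], by linarith [ht.2]⟩
  have ht0 : ∀ t ∈ Icc (0 : ℝ) 1, t ∈ Icc (-1 : ℝ) 1 := fun t ht =>
    ⟨by linarith [ht.1], by linarith [ht.2]⟩
  unfold actionDensity
  refine DifferentiableOn.sub (DifferentiableOn.add ?_ ?_) ?_
  · exact (((hs0 hB).add (hl.mul (hs0 hB₁))).const_add 1).pow 3 |>.const_mul _
  · refine (he.mul ((((hs0 hB).add (hl.mul (hs0 hB₁))).const_add 1).pow 4)).mul ?_
    refine hN.comp (f := fun q : ℂ × ℂ × ℂ => (q.1 + (V (q.1, q.2.1) + q.2.2 * V₁ (q.1, q.2.1)),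
      q.2.1 * (1 + (B (q.1, q.2.1) + q.2.2 * B₁ (q.1, q.2.1))))) ?_ ?_
    · exact DifferentiableOn.prodMk (differentiableOn_fst.add ((hs0 hV).add (hl.mul (hs0 hV₁))))
        (he.mul (((hs0 hB).add (hl.mul (hs0 hB₁))).const_add 1))
    · intro q hq
      have hm := h1 q hq 0 (by norm_num)
      simp only [Complex.ofReal_zero, zero_mul, add_zero] at hm
      exact h2 q hq _ hm rfl ⟨0, by norm_num, by simp⟩
  · refine DifferentiableOn.intervalIntegral_param hW ?_ ?_
    · have e1 := hshc (fun t => t - 1) (by fun_prop) ht1 hV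
      have e2 := hshc (fun t => t - 1) (by fun_prop) ht1 hV₁
      have e3 := hshc (fun t => t - 1) (by fun_prop) ht1 hB
      have e4 := hshc (fun t => t - 1) (by fun_prop) ht1 hB₁
      have e5 := hshc (fun t => t) (by fun_prop) ht0 hVd
      have e6 := hshc (fun t => t) (by fun_prop) ht0 hVd₁
      push_cast at e1 e2 e3 e4 e5 e6
      have hlc : ContinuousOn (fun q : (ℂ × ℂ × ℂ) × ℝ => q.1.2.2) (W ×ˢ Icc 0 1) := by fun_prop
      have hec : ContinuousOn (fun q : (ℂ × ℂ × ℂ) × ℝ => q.1.2.1) (W ×ˢ Icc 0 1) := by fun_prop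
      have hA := continuousOn_const (c := (1 : ℂ)).add (e3.add (hlc.mul e4))
      refine ContinuousOn.mul (ContinuousOn.add (continuousOn_const.mul (hA.pow 2))
        ((hec.mul (hA.pow 3)).mul ?_)) (continuousOn_const.add (e5.add (hlc.mul e6)))
      refine hN₂.continuousOn.comp (f := fun q : (ℂ × ℂ × ℂ) × ℝ =>
        (q.1.1 + ((q.2 : ℂ) - 1) * q.1.2.1 + (V (q.1.1 + ((q.2 : ℂ) - 1) * q.1.2.1, q.1.2.1) +
          q.1.2.2 * V₁ (q.1.1 + ((q.2 : ℂ) - 1) * q.1.2.1, q.1.2.1)),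
        q.1.2.1 * (1 + (B (q.1.1 + ((q.2 : ℂ) - 1) * q.1.2.1, q.1.2.1) +
          q.1.2.2 * B₁ (q.1.1 + ((q.2 : ℂ) - 1) * q.1.2.1, q.1.2.1))))) ?_ ?_
      · exact ContinuousOn.prodMk (ContinuousOn.add (by fun_prop) (e1.add (hlc.mul e2)))
          (hec.mul hA)
      · intro q hq
        have hm := h1 q.1 hq.1 _ (ht1 _ hq.2)
        push_cast at hm
        exact h2 q.1 hq.1 _ hm rfl ⟨q.2 - 1, ht1 _ hq.2, by push_cast; rfl⟩
    · intro t ht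
      have e1 := hsh (t - 1) (ht1 t ht) hV
      have e2 := hsh (t - 1) (ht1 t ht) hV₁
      have e3 := hsh (t - 1) (ht1 t ht) hB
      have e4 := hsh (t - 1) (ht1 t ht) hB₁
      have e5 := hsh t (ht0 t ht) hVd
      have e6 := hsh t (ht0 t ht) hVd₁
      push_cast at e1 e2 e3 e4
      have hA := (e3.add (hl.mul e4)).const_add 1
      refine DifferentiableOn.mul (DifferentiableOn.add ((hA.pow 2).const_mul _)
        ((he.mul (hA.pow 3)).mul ?_)) ((e5.add (hl.mul e6)).const_add 1)
      refine hN₂.comp (f := fun q : ℂ × ℂ × ℂ =>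
        (q.1 + ((t : ℂ) - 1) * q.2.1 + (V (q.1 + ((t : ℂ) - 1) * q.2.1, q.2.1) +
          q.2.2 * V₁ (q.1 + ((t : ℂ) - 1) * q.2.1, q.2.1)),
        q.2.1 * (1 + (B (q.1 + ((t : ℂ) - 1) * q.2.1, q.2.1) +
          q.2.2 * B₁ (q.1 + ((t : ℂ) - 1) * q.2.1, q.2.1))))) ?_ ?_
      · exact DifferentiableOn.prodMk (DifferentiableOn.add (by fun_prop) (e1.add (hl.mul e2)))
          (he.mul hA)
      · intro q hq
        have hm := h1 q hq _ (ht1 _ ht)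
        push_cast at hm
        exact h2 q hq _ hm rfl ⟨t - 1, ht1 _ ht, by push_cast; rfl⟩

/-- At `ε = 0` the action density is `-2m X'³`. -/
theorem actionDensity_zero {m : ℝ} {N N₂ V Vd B : ℂ × ℂ → ℂ} {θ x : ℂ}
    (hB : B (θ, 0) = x) (hVd : Vd (θ, 0) = x) :
    actionDensity m N N₂ V Vd B (θ, 0) = -2 * m * (1 + x) ^ 3 := by
  simp only [actionDensity, mul_zero, add_zero, zero_mul, hB, hVd]
  rw [intervalIntegral.integral_const]
  simp
  ring

namespace IsParam

variable {ρ τ M : ℝ} {U : ℝ → Set ℂ} {V Vd B : ℂ × ℂ → ℂ}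

theorem mono {ρ' τ' M' : ℝ} (h : IsParam ρ τ M U V Vd B) (hU : U ρ' ⊆ U ρ) (hτ : τ' ≤ τ)
    (hM : M ≤ M') : IsParam ρ' τ' M' U V Vd B := by
  have hs : U ρ' ×ˢ ball (0 : ℂ) τ' ⊆ U ρ ×ˢ ball 0 τ := prod_mono hU (ball_subset_ball hτ)
  have hm : ∀ p : ℂ × ℂ, M * ‖p.2‖ ≤ M' * ‖p.2‖ := fun p => by gcongr
  exact ⟨h.V_irp.mono hs, h.Vd_irp.mono hs, h.B_irp.mono hs,
    fun p hp => (h.norm_V p (hs hp)).trans (hm p), fun p hp => (h.norm_Vd p (hs hp)).trans (hm p),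
    fun p hp => (h.norm_B p (hs hp)).trans (hm p), fun p hp => h.hasDerivAt p (hs hp),
    fun p hp hq => h.secant p (hs hp) (hU hq)⟩

end IsParam

/-- Smallness conditions under which the step `ε` with `|ε| < τ'` stays inside all domains. -/
structure StepSmall (b c ρ₁ ρ ρ' τ M τ' : ℝ) : Prop where
  pos : 0 < τ'
  le : τ' ≤ τ
  lt₁ : ρ < ρ'
  lt₂ : ρ' < ρ₁
  M_nonneg : 0 ≤ M
  step : τ' ≤ b * (ρ' - ρ)
  half : M * τ' ≤ 1 / 2
  disp : M * τ' ≤ b * (ρ₁ - ρ')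
  twist : 2 * τ' ≤ c * ρ₁

section

variable {b C m K c ρ₁ ρ ρ' τ M τ' : ℝ} {U : ℝ → Set ℂ} {G P : ℂ → ℂ → ℂ}
  {N N₂ V Vd B : ℂ × ℂ → ℂ}

theorem StripFamily.mono (hU : StripFamily b C ρ₁ U) (h : ρ ≤ ρ') (h' : ρ' ≤ ρ₁) : U ρ ⊆ U ρ' := by
  rcases h.eq_or_lt with rfl | h
  · exact subset_rfl
  · intro θ hθ
    simpa using hU.add_mem h h' hθ (t := 0) (by
      simpa using mul_pos hU.b_pos (sub_pos.2 h))

theorem StepSmall.shift_mem (hs : StepSmall b c ρ₁ ρ ρ' τ M τ') (hU : StripFamily b C ρ₁ U)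
    {p : ℂ × ℂ} (hp : p ∈ U ρ ×ˢ ball (0 : ℂ) τ') {t : ℝ} (ht : t ∈ Icc (-1 : ℝ) 1) :
    (p.1 + t * p.2, p.2) ∈ U ρ' ×ˢ ball (0 : ℂ) τ' := by
  refine ⟨hU.add_mem hs.lt₁ hs.lt₂.le hp.1 ?_, hp.2⟩
  have h1 := mem_ball_zero_iff.1 hp.2
  have h2 : |t| ≤ 1 := abs_le.2 ht
  rw [norm_mul, Complex.norm_real, Real.norm_eq_abs]
  nlinarith [norm_nonneg p.2, hs.step]

theorem StepSmall.norm_le_half (hs : StepSmall b c ρ₁ ρ ρ' τ M τ') {x : ℂ} {e : ℂ}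
    (he : e ∈ ball (0 : ℂ) τ') (hx : ‖x‖ ≤ M * ‖e‖) : ‖x‖ ≤ 1 / 2 := by
  have h1 := mem_ball_zero_iff.1 he
  nlinarith [hs.M_nonneg, hs.half]

theorem StepSmall.arg_mem (hs : StepSmall b c ρ₁ ρ ρ' τ M τ') (hU : StripFamily b C ρ₁ U)
    (hX : IsParam ρ' τ M U V Vd B) {p : ℂ × ℂ} (hp : p ∈ U ρ' ×ˢ ball (0 : ℂ) τ') :
    (p.1 + V p, p.2 * (1 + B p)) ∈ U ρ₁ ×ˢ ball (0 : ℂ) (c * ρ₁) := by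
  have hp' : p ∈ U ρ' ×ˢ ball (0 : ℂ) τ := ⟨hp.1, ball_subset_ball hs.le hp.2⟩
  have h1 := mem_ball_zero_iff.1 hp.2
  constructor
  · refine hU.add_mem hs.lt₂ le_rfl hp.1 ?_
    rcases hs.M_nonneg.eq_or_lt with h0 | h0
    · have := hX.norm_V p hp'
      rw [← h0, zero_mul] at this
      exact this.trans_lt (mul_pos hU.b_pos (sub_pos.2 hs.lt₂))
    · nlinarith [hX.norm_V p hp', hs.disp]
  · rw [mem_ball_zero_iff, norm_mul]
    have h2 := hs.norm_le_half hp.2 (hX.norm_B p hp')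
    have h3 : ‖1 + B p‖ ≤ 3 / 2 := by
      have := norm_add_le 1 (B p)
      rw [norm_one] at this
      linarith
    nlinarith [norm_nonneg p.2, norm_nonneg (1 + B p), hs.twist, hs.pos]

/-- The action density is close to `-2m`, uniformly. -/
theorem norm_actionDensity_add_le (hm : 0 < m) (hK : 0 ≤ K) (hU : StripFamily b C ρ₁ U)
    (hG : TwistGen m K c ρ₁ U G P N N₂) (hX : IsParam ρ' τ M U V Vd B)
    (hs : StepSmall b c ρ₁ ρ ρ' τ M τ') {p : ℂ × ℂ} (hp : p ∈ U ρ ×ˢ ball (0 : ℂ) τ') :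
    ‖actionDensity m N N₂ V Vd B p + (2 * m : ℂ)‖ ≤ (20 * m * M + 20 * K) * ‖p.2‖ := by
  have hup : ∀ q ∈ U ρ' ×ˢ ball (0 : ℂ) τ', q ∈ U ρ' ×ˢ ball (0 : ℂ) τ := fun q hq =>
    ⟨hq.1, ball_subset_ball hs.le hq.2⟩
  have hpow : ∀ x : ℂ, ‖x‖ ≤ M * ‖p.2‖ → ‖x‖ ≤ 1 / 2 := fun x hx => hs.norm_le_half hp.2 hx
  set e := ‖p.2‖ with he
  have he0 : 0 ≤ e := norm_nonneg _
  have hone : ∀ x : ℂ, ‖x‖ ≤ 1 / 2 → ‖1 + x‖ ≤ 3 / 2 := fun x hx => by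
    have := norm_add_le 1 x
    rw [norm_one] at this
    linarith
  have hint : ∀ t ∈ Icc (0 : ℝ) 1,
      ‖(3 * m * (1 + B (p.1 + (t - 1) * p.2, p.2)) ^ 2 +
      p.2 * (1 + B (p.1 + (t - 1) * p.2, p.2)) ^ 3 *
        N₂ (p.1 + (t - 1) * p.2 + V (p.1 + (t - 1) * p.2, p.2),
          p.2 * (1 + B (p.1 + (t - 1) * p.2, p.2)))) *
    (1 + Vd (p.1 + t * p.2, p.2)) - 3 * m‖ ≤ (15 * m * M + 6 * K) * e := by
    intro t ht
    have h1 := hs.shift_mem hU hp (t := t - 1) ⟨by linarith [ht.1], by linarith [ht.2]⟩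
    have h2 := hs.shift_mem hU hp (t := t) ⟨by linarith [ht.1], by linarith [ht.2]⟩
    push_cast at h1
    have h3 := hX.norm_B _ (hup _ h1)
    have h4 := hX.norm_Vd _ (hup _ h2)
    have h5 := hG.norm_N₂ _ (hs.arg_mem hU hX h1)
    simp only at h3 h4 h5
    set x := B (p.1 + (t - 1) * p.2, p.2)
    set y := Vd (p.1 + t * p.2, p.2)
    set z := N₂ (p.1 + (t - 1) * p.2 + V (p.1 + (t - 1) * p.2, p.2), p.2 * (1 + x))
    have hx := hpow x h3
    have hy := hpow y h4
    have e1 : (3 * m * (1 + x) ^ 2 + p.2 * (1 + x) ^ 3 * z) * (1 + y) - 3 * m =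
        3 * m * ((2 + x) * (1 + y) * x + y) + p.2 * ((1 + x) ^ 3 * (1 + y) * z) := by ring
    have n1 : ‖2 + x‖ ≤ 5 / 2 := by
      have := norm_add_le 2 x
      rw [Complex.norm_ofNat] at this
      linarith
    have n2 : ‖(2 + x) * (1 + y) * x + y‖ ≤ 5 * (M * e) := by
      refine (norm_add_le _ _).trans ?_
      rw [norm_mul, norm_mul]
      have : ‖2 + x‖ * ‖1 + y‖ * ‖x‖ ≤ 5 / 2 * (3 / 2) * (M * e) := by
        gcongr
        exact hone y hy
      nlinarith [norm_nonneg x]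
    have n3 : ‖(1 + x) ^ 3 * (1 + y) * z‖ ≤ 6 * K := by
      rw [norm_mul, norm_mul, norm_pow]
      have : ‖1 + x‖ ^ 3 * ‖1 + y‖ * ‖z‖ ≤ (3 / 2) ^ 3 * (3 / 2) * K := by
        gcongr
        · exact hone x hx
        · exact hone y hy
      linarith
    rw [e1]
    refine (norm_add_le _ _).trans ?_
    rw [norm_mul, norm_mul, norm_mul, Complex.norm_ofNat, Complex.norm_real, Real.norm_eq_abs,
      abs_of_pos hm]
    have : 3 * m * ‖(2 + x) * (1 + y) * x + y‖ ≤ 3 * m * (5 * (M * e)) := by gcongr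
    have : ‖p.2‖ * ‖(1 + x) ^ 3 * (1 + y) * z‖ ≤ e * (6 * K) := by gcongr
    linarith
  have hcont : IntervalIntegrable (fun t : ℝ =>
      (3 * m * (1 + B (p.1 + (t - 1) * p.2, p.2)) ^ 2 +
      p.2 * (1 + B (p.1 + (t - 1) * p.2, p.2)) ^ 3 *
        N₂ (p.1 + (t - 1) * p.2 + V (p.1 + (t - 1) * p.2, p.2),
          p.2 * (1 + B (p.1 + (t - 1) * p.2, p.2)))) *
    (1 + Vd (p.1 + t * p.2, p.2))) MeasureTheory.volume 0 1 := by
    apply ContinuousOn.intervalIntegrable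
    rw [uIcc_of_le zero_le_one]
    have hsh : ∀ s : ℝ → ℝ, Continuous s → (∀ t ∈ Icc (0 : ℝ) 1, s t ∈ Icc (-1 : ℝ) 1) →
        ∀ {f : ℂ × ℂ → ℂ}, IsRealAnalyticPeriodic f (U ρ' ×ˢ ball 0 τ) →
        ContinuousOn (fun t : ℝ => f (p.1 + (s t : ℂ) * p.2, p.2)) (Icc 0 1) :=
      fun s hsc hm f hf => hf.1.continuousOn.comp
        (f := fun t : ℝ => (p.1 + (s t : ℂ) * p.2, p.2)) (by fun_prop)
        (fun t ht => hup _ (hs.shift_mem hU hp (hm t ht)))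
    have ht1 : ∀ t ∈ Icc (0 : ℝ) 1, t - 1 ∈ Icc (-1 : ℝ) 1 := fun t ht =>
      ⟨by linarith [ht.1], by linarith [ht.2]⟩
    have ht0 : ∀ t ∈ Icc (0 : ℝ) 1, t ∈ Icc (-1 : ℝ) 1 := fun t ht =>
      ⟨by linarith [ht.1], by linarith [ht.2]⟩
    have e1 := hsh (fun t => t - 1) (by fun_prop) ht1 hX.V_irp
    have e3 := hsh (fun t => t - 1) (by fun_prop) ht1 hX.B_irp
    have e5 := hsh (fun t => t) (by fun_prop) ht0 hX.Vd_irp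
    push_cast at e1 e3 e5
    have hA := continuousOn_const (c := (1 : ℂ)).add e3
    refine ContinuousOn.mul (ContinuousOn.add (continuousOn_const.mul (hA.pow 2))
        ((continuousOn_const.mul (hA.pow 3)).mul ?_)) (continuousOn_const.add e5)
    refine hG.N₂_irp.1.continuousOn.comp (f := fun t : ℝ =>
      (p.1 + ((t : ℂ) - 1) * p.2 + V (p.1 + ((t : ℂ) - 1) * p.2, p.2),
          p.2 * (1 + B (p.1 + ((t : ℂ) - 1) * p.2, p.2)))) ?_ ?_
    · exact ContinuousOn.prodMk (ContinuousOn.add (by fun_prop) e1) (continuousOn_const.mul hA)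
    · intro t ht
      have := hs.shift_mem hU hp (ht1 t ht)
      push_cast at this
      exact hs.arg_mem hU hX this
  have h0 := hs.shift_mem hU hp (t := 0) (by norm_num)
  simp only [Complex.ofReal_zero, zero_mul, add_zero] at h0
  have h3 := hX.norm_B _ (hup _ h0)
  have h5 := hG.norm_N _ (hs.arg_mem hU hX h0)
  simp only [Prod.mk.eta] at h3 h5
  have hI : ‖(∫ t in (0 : ℝ)..1, (3 * m * (1 + B (p.1 + (t - 1) * p.2, p.2)) ^ 2 +
      p.2 * (1 + B (p.1 + (t - 1) * p.2, p.2)) ^ 3 *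
        N₂ (p.1 + (t - 1) * p.2 + V (p.1 + (t - 1) * p.2, p.2),
          p.2 * (1 + B (p.1 + (t - 1) * p.2, p.2)))) *
    (1 + Vd (p.1 + t * p.2, p.2))) - (3 * m : ℂ)‖ ≤ (15 * m * M + 6 * K) * e := by
    exact norm_intervalIntegral_sub_const_le hcont hint
  unfold actionDensity
  set I := (∫ t in (0 : ℝ)..1, (3 * m * (1 + B (p.1 + (t - 1) * p.2, p.2)) ^ 2 +
      p.2 * (1 + B (p.1 + (t - 1) * p.2, p.2)) ^ 3 *
        N₂ (p.1 + (t - 1) * p.2 + V (p.1 + (t - 1) * p.2, p.2),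
          p.2 * (1 + B (p.1 + (t - 1) * p.2, p.2)))) *
    (1 + Vd (p.1 + t * p.2, p.2)))
  set x := B p
  set z := N (p.1 + V p, p.2 * (1 + x))
  have hx := hpow x h3
  have e1 : m * (1 + x) ^ 3 + p.2 * (1 + x) ^ 4 * z - I + 2 * m =
      m * ((3 + 3 * x + x ^ 2) * x) + p.2 * ((1 + x) ^ 4 * z) - (I - 3 * m) := by ring
  rw [e1]
  refine (norm_sub_le _ _).trans ?_
  have n1 : ‖3 + 3 * x + x ^ 2‖ ≤ 5 := by
    refine (norm_add₃_le).trans ?_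
    rw [norm_mul, norm_pow, Complex.norm_ofNat]
    nlinarith [norm_nonneg x]
  have n2 : ‖(m : ℂ) * ((3 + 3 * x + x ^ 2) * x)‖ ≤ m * (5 * (M * e)) := by
    rw [norm_mul, norm_mul, Complex.norm_real, Real.norm_eq_abs, abs_of_pos hm]
    gcongr
  have n3 : ‖p.2 * ((1 + x) ^ 4 * z)‖ ≤ e * ((3 / 2) ^ 4 * K) := by
    rw [norm_mul, norm_mul, norm_pow]
    gcongr
    exact hone x hx
  have := norm_add_le ((m : ℂ) * ((3 + 3 * x + x ^ 2) * x)) (p.2 * ((1 + x) ^ 4 * z))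
  nlinarith [mul_nonneg he0 hK]

end

section

variable {b C m K c ρ₁ ρ ρ' τ M τ' : ℝ} {U : ℝ → Set ℂ} {G P : ℂ → ℂ → ℂ}
  {N N₂ V Vd B : ℂ × ℂ → ℂ}

theorem isRealAnalyticPeriodic_actionDensity (hU : StripFamily b C ρ₁ U)
    (hG : TwistGen m K c ρ₁ U G P N N₂) (hX : IsParam ρ' τ M U V Vd B)
    (hs : StepSmall b c ρ₁ ρ ρ' τ M τ') :
    IsRealAnalyticPeriodic (actionDensity m N N₂ V Vd B) (U ρ ×ˢ ball 0 τ') := by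
  have hup : U ρ' ×ˢ ball (0 : ℂ) τ' ⊆ U ρ' ×ˢ ball (0 : ℂ) τ :=
    prod_mono subset_rfl (ball_subset_ball hs.le)
  refine ⟨?_, ?_, ?_⟩
  · have hW : IsOpen {q : ℂ × ℂ × ℂ | (q.1, q.2.1) ∈ U ρ ×ˢ ball (0 : ℂ) τ'} :=
      ((hU.isOpen ρ (hs.lt₁.trans hs.lt₂).le).prod isOpen_ball).preimage (by fun_prop)
    have h := differentiableOn_actionDensity (m := m) hW (D := U ρ' ×ˢ ball (0 : ℂ) τ')
      (E := U ρ₁ ×ˢ ball (0 : ℂ) (c * ρ₁)) (V₁ := fun _ => 0) (Vd₁ := fun _ => 0) (B₁ := fun _ => 0)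
      hG.N_irp.1 hG.N₂_irp.1 (hX.V_irp.1.mono hup) (hX.Vd_irp.1.mono hup) (hX.B_irp.1.mono hup)
      (by fun_prop) (by fun_prop) (by fun_prop)
      (fun q hq t ht => hs.shift_mem hU hq ht)
      (fun q hq p hp _ _ => by simpa using hs.arg_mem hU hX hp)
    have := h.comp (f := fun p : ℂ × ℂ => (p.1, p.2, (0 : ℂ)))
      (t := {q : ℂ × ℂ × ℂ | (q.1, q.2.1) ∈ U ρ ×ˢ ball (0 : ℂ) τ'})
      (s := U ρ ×ˢ ball (0 : ℂ) τ') (by fun_prop) (fun p hp => hp)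
    simpa [Function.comp_def] using this
  · intro p hp
    have h0 := hs.shift_mem hU hp (t := 0) (by norm_num)
    simp only [Complex.ofReal_zero, zero_mul, add_zero, Prod.mk.eta] at h0
    have hN : ∀ {f : ℂ × ℂ → ℂ}, IsRealAnalyticPeriodic f (U ρ₁ ×ˢ ball (0 : ℂ) (c * ρ₁)) →
        ∀ q ∈ U ρ' ×ˢ ball (0 : ℂ) τ', f (q.1 + 1 + V q, q.2 * (1 + B q)) =
          f (q.1 + V q, q.2 * (1 + B q)) := fun hf q hq => by
      rw [← hf.2.1 _ (hs.arg_mem hU hX hq)]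
      congr 1
      ext <;> simp
      ring
    have hper : ∀ {f : ℂ × ℂ → ℂ}, IsRealAnalyticPeriodic f (U ρ' ×ˢ ball (0 : ℂ) τ) →
        ∀ q ∈ U ρ' ×ˢ ball (0 : ℂ) τ', f (q.1 + 1, q.2) = f q := fun hf q hq => by
      rw [← hf.2.1 _ (hup hq)]
      congr 1
      ext <;> simp
    have e0 : p + (1, 0) = (p.1 + 1, p.2) := by ext <;> simp
    rw [e0]
    unfold actionDensity
    simp only [hper hX.B_irp p h0, hper hX.V_irp p h0, hN hG.N_irp p h0]
    congr 1
    refine intervalIntegral.integral_congr fun t ht => ?_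
    rw [uIcc_of_le zero_le_one] at ht
    have h1 := hs.shift_mem hU hp (t := t - 1) ⟨by linarith [ht.1], by linarith [ht.2]⟩
    have h2 := hs.shift_mem hU hp (t := t) ⟨by linarith [ht.1], by linarith [ht.2]⟩
    push_cast at h1
    have e1 : p.1 + 1 + ((t : ℂ) - 1) * p.2 = p.1 + (t - 1) * p.2 + 1 := by ring
    have e2 : p.1 + 1 + (t : ℂ) * p.2 = p.1 + t * p.2 + 1 := by ring
    simp only [e1, e2]
    rw [hper hX.B_irp _ h1, hper hX.V_irp _ h1, hper hX.Vd_irp _ h2, hN hG.N₂_irp _ h1]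
  · intro p hp
    have h0 := hs.shift_mem hU hp (t := 0) (by norm_num)
    simp only [Complex.ofReal_zero, zero_mul, add_zero, Prod.mk.eta] at h0
    have hN : ∀ {f : ℂ × ℂ → ℂ}, IsRealAnalyticPeriodic f (U ρ₁ ×ˢ ball (0 : ℂ) (c * ρ₁)) →
        ∀ q ∈ U ρ' ×ˢ ball (0 : ℂ) τ', f (star q.1 + star (V q), star q.2 * (1 + star (B q))) =
          star (f (q.1 + V q, q.2 * (1 + B q))) := fun hf q hq => by
      rw [← hf.2.2 _ (hs.arg_mem hU hX hq)]
      congr 1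
      ext <;> simp
    have hstar : ∀ {f : ℂ × ℂ → ℂ}, IsRealAnalyticPeriodic f (U ρ' ×ˢ ball (0 : ℂ) τ) →
        ∀ q ∈ U ρ' ×ˢ ball (0 : ℂ) τ', f (star q.1, star q.2) = star (f q) := fun hf q hq => by
      rw [← hf.2.2 _ (hup hq)]
      rfl
    have e0 : star p = (star p.1, star p.2) := rfl
    rw [e0]
    unfold actionDensity
    have hint : ∀ f : ℝ → ℂ, star (∫ t in (0 : ℝ)..1, f t) = ∫ t in (0 : ℝ)..1, star (f t) := by
      intro f
      rw [intervalIntegral.integral_of_le zero_le_one, intervalIntegral.integral_of_le zero_le_one]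
      exact integral_conj.symm
    have e1 := hstar hX.B_irp p h0
    have e2 := hstar hX.V_irp p h0
    have e3 := hN hG.N_irp p h0
    simp only [e1, e2, e3, star_sub, star_add, star_mul', star_pow, hint]
    congr 1
    · simp
    · refine intervalIntegral.integral_congr fun t ht => ?_
      rw [uIcc_of_le zero_le_one] at ht
      have h1 := hs.shift_mem hU hp (t := t - 1) ⟨by linarith [ht.1], by linarith [ht.2]⟩
      have h2 := hs.shift_mem hU hp (t := t) ⟨by linarith [ht.1], by linarith [ht.2]⟩
      push_cast at h1
      have r1 : star p.1 + ((t : ℂ) - 1) * star p.2 = star (p.1 + (t - 1) * p.2) := by simp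
      have r2 : star p.1 + (t : ℂ) * star p.2 = star (p.1 + t * p.2) := by simp
      have f1 := hstar hX.B_irp _ h1
      have f2 := hstar hX.V_irp _ h1
      have f3 := hstar hX.Vd_irp _ h2
      have f4 := hN hG.N₂_irp _ h1
      simp only at f1 f2 f3 f4 ⊢
      rw [r1, r2, f1, f2, f3, f4]
      simp

/-- The first variation of the action density: adding `εⁿ⁺¹ v(θ)` to `X` changes the coefficient of
`εⁿ⁺¹` by `-6m v'(θ)`, since the action density at `ε = 0` is `-2m X'³`. -/
theorem actionDensity_variation (hU : StripFamily b C ρ₁ U)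
    (hG : TwistGen m K c ρ₁ U G P N N₂) (hX : IsParam ρ' τ M U V Vd B)
    (hs : StepSmall b c ρ₁ ρ ρ' τ M τ') {v vd : ℂ → ℂ} {bv : ℂ × ℂ → ℂ} {Cv : ℝ} {n : ℕ}
    (hv : DifferentiableOn ℂ v (U ρ')) (hvd : DifferentiableOn ℂ vd (U ρ'))
    (hbv : DifferentiableOn ℂ bv (U ρ' ×ˢ ball 0 τ'))
    (hvC : ∀ θ ∈ U ρ', ‖v θ‖ ≤ Cv) (hbC : ∀ p ∈ U ρ' ×ˢ ball (0 : ℂ) τ', ‖bv p‖ ≤ Cv)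
    {θ : ℂ} (hθ : θ ∈ U ρ) (hb0 : bv (θ, 0) = vd θ) :
    (fun ε => actionDensity m N N₂ (fun p => V p + p.2 ^ (n + 1) * v p.1)
        (fun p => Vd p + p.2 ^ (n + 1) * vd p.1) (fun p => B p + p.2 ^ (n + 1) * bv p) (θ, ε) -
      actionDensity m N N₂ V Vd B (θ, ε) + 6 * m * vd θ * ε ^ (n + 1)) =o[𝓝 0]
    fun ε : ℂ => ε ^ (n + 1) := by
  have hup : U ρ' ×ˢ ball (0 : ℂ) τ' ⊆ U ρ' ×ˢ ball (0 : ℂ) τ :=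
    prod_mono subset_rfl (ball_subset_ball hs.le)
  have hθ' : θ ∈ U ρ' := hU.mono hs.lt₁.le hs.lt₂.le hθ
  have hCv : 0 ≤ Cv := (norm_nonneg _).trans (hvC θ hθ')
  have hgap : 0 < b * (ρ₁ - ρ') := mul_pos hU.b_pos (sub_pos.2 hs.lt₂)
  have hτ := hs.pos
  obtain ⟨r, hr, hr1, hr2⟩ : ∃ r > 0, r * Cv ≤ b * (ρ₁ - ρ') / 4 ∧ r * Cv ≤ 1 / 2 := by
    refine ⟨min (b * (ρ₁ - ρ') / 4) (1 / 2) / (Cv + 1), by positivity, ?_, ?_⟩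
    · rw [div_mul_eq_mul_div, div_le_iff₀ (by positivity)]
      have := min_le_left (b * (ρ₁ - ρ') / 4) (1 / 2)
      have h0 : 0 < min (b * (ρ₁ - ρ') / 4) (1 / 2) := by positivity
      nlinarith
    · rw [div_mul_eq_mul_div, div_le_iff₀ (by positivity)]
      have := min_le_right (b * (ρ₁ - ρ') / 4) (1 / 2)
      have h0 : 0 < min (b * (ρ₁ - ρ') / 4) (1 / 2) := by positivity
      nlinarith
  set W : Set (ℂ × ℂ × ℂ) := {q | q.1 ∈ U ρ ∧ q.2.1 ∈ ball (0 : ℂ) (τ' / 2) ∧ q.2.2 ∈ ball (0 : ℂ) r}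
    with hWdef
  have hW : IsOpen W := by
    refine IsOpen.inter ((hU.isOpen ρ (hs.lt₁.trans hs.lt₂).le).preimage continuous_fst)
      (IsOpen.inter (isOpen_ball.preimage ?_) (isOpen_ball.preimage ?_)) <;> fun_prop
  have hhalf : ball (0 : ℂ) (τ' / 2) ⊆ ball 0 τ' := ball_subset_ball (by linarith)
  have hJ := differentiableOn_actionDensity (m := m) hW (D := U ρ' ×ˢ ball (0 : ℂ) τ')
      (E := U ρ₁ ×ˢ ball (0 : ℂ) (c * ρ₁)) (V₁ := fun p => v p.1) (Vd₁ := fun p => vd p.1) (B₁ := bv)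
      hG.N_irp.1 hG.N₂_irp.1 (hX.V_irp.1.mono hup) (hX.Vd_irp.1.mono hup) (hX.B_irp.1.mono hup)
      (hv.comp (f := fun p : ℂ × ℂ => p.1) (by fun_prop) (fun p hp => hp.1))
      (hvd.comp (f := fun p : ℂ × ℂ => p.1) (by fun_prop) (fun p hp => hp.1)) hbv
      (fun q hq t ht => hs.shift_mem hU (p := (q.1, q.2.1)) ⟨hq.1, hhalf hq.2.1⟩ ht)
      (fun q hq p hp hpq _ => by
        have h1 := mem_ball_zero_iff.1 hq.2.1
        have h2 := mem_ball_zero_iff.1 hq.2.2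
        rw [← hpq] at h1
        have h3 := hX.norm_V p (hup hp)
        have h4 := hs.norm_le_half hp.2 (hX.norm_B p (hup hp))
        have h5 : ‖q.2.2 * v p.1‖ ≤ r * Cv := by
          rw [norm_mul]; gcongr; exact hvC _ hp.1
        have h6 : ‖q.2.2 * bv p‖ ≤ r * Cv := by
          rw [norm_mul]; gcongr; exact hbC _ hp
        constructor
        · refine hU.add_mem hs.lt₂ le_rfl hp.1 ?_
          have := norm_add_le (V p) (q.2.2 * v p.1)
          nlinarith [hs.disp, hs.M_nonneg, norm_nonneg p.2]
        · rw [mem_ball_zero_iff, norm_mul]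
          have := norm_add_le 1 (B p + q.2.2 * bv p)
          have := norm_add_le (B p) (q.2.2 * bv p)
          rw [norm_one] at *
          have : ‖1 + (B p + q.2.2 * bv p)‖ ≤ 2 := by linarith
          nlinarith [norm_nonneg p.2, hs.twist])
  set J : ℂ → ℂ → ℂ := fun ε l => actionDensity m N N₂ (fun p => V p + l * v p.1)
        (fun p => Vd p + l * vd p.1) (fun p => B p + l * bv p) (θ, ε) with hJdef
  have hJd : DifferentiableOn ℂ (fun p : ℂ × ℂ => J p.1 p.2) (ball 0 (τ' / 2) ×ˢ ball 0 r) :=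
    hJ.comp (f := fun p : ℂ × ℂ => (θ, p.1, p.2)) (by fun_prop) (fun p hp => ⟨hθ, hp.1, hp.2⟩)
  have hFd : DifferentiableOn ℂ (fun p : ℂ × ℂ => J p.1 p.2 - J p.1 0) (ball 0 (τ' / 2) ×ˢ ball 0 r) :=
    hJd.sub (hJd.comp (f := fun p : ℂ × ℂ => (p.1, (0 : ℂ))) (by fun_prop)
      (fun p hp => ⟨hp.1, mem_ball_self hr⟩))
  obtain ⟨f, hfd, hfe, -⟩ := exists_eq_snd_pow_mul (n := 0) isOpen_ball hr hFd (fun a ha => by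
    simp only [pow_zero]
    rw [isLittleO_one_iff]
    have h1 : ContinuousAt (fun t : ℂ => J a t - J a 0) 0 :=
      (hFd.continuousOn.continuousAt ((isOpen_ball.prod isOpen_ball).mem_nhds
        (show (a, (0 : ℂ)) ∈ _ from ⟨ha, mem_ball_self hr⟩))).comp (f := fun t : ℂ => (a, t))
        (by fun_prop)
    simpa using h1.tendsto)
  have h00 : ((0 : ℂ), (0 : ℂ)) ∈ ball (0 : ℂ) (τ' / 2) ×ˢ ball (0 : ℂ) (r / 2) :=
    ⟨mem_ball_self (by positivity), mem_ball_self (by positivity)⟩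
  have hnh : ball (0 : ℂ) (τ' / 2) ×ˢ ball (0 : ℂ) (r / 2) ∈ 𝓝 ((0 : ℂ), (0 : ℂ)) :=
    (isOpen_ball.prod isOpen_ball).mem_nhds h00
  have hfc : ContinuousAt f (0, 0) := hfd.continuousOn.continuousAt hnh
  have hB0 : B (θ, 0) = 0 := by
    have := hX.norm_B (θ, 0) ⟨hθ', mem_ball_self (hs.pos.trans_le hs.le)⟩
    simpa using this
  have hVd0 : Vd (θ, 0) = 0 := by
    have := hX.norm_Vd (θ, 0) ⟨hθ', mem_ball_self (hs.pos.trans_le hs.le)⟩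
    simpa using this
  set x := vd θ with hx
  have hf0 : f (0, 0) = -6 * m * x := by
    have e1 : Tendsto (fun l : ℂ => f (0, l)) (𝓝[≠] 0) (𝓝 (f (0, 0))) :=
      ((hfc.comp (f := fun l : ℂ => ((0 : ℂ), l)) (x := 0) (by fun_prop)).tendsto).mono_left
        nhdsWithin_le_nhds
    have e2 : Tendsto (fun l : ℂ => -2 * m * (3 * x + 3 * l * x ^ 2 + l ^ 2 * x ^ 3)) (𝓝[≠] 0)
        (𝓝 (-6 * m * x)) := by
      have : ContinuousAt (fun l : ℂ => -2 * m * (3 * x + 3 * l * x ^ 2 + l ^ 2 * x ^ 3)) 0 := by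
        fun_prop
      have h := this.tendsto.mono_left (nhdsWithin_le_nhds (s := {0}ᶜ))
      convert h using 2
      ring
    refine tendsto_nhds_unique (e1.congr' ?_) e2
    filter_upwards [self_mem_nhdsWithin, nhdsWithin_le_nhds (ball_mem_nhds (0 : ℂ) (half_pos hr))]
      with l hl hl'
    have hl : l ≠ 0 := hl
    have h1 := hfe (0, l) ⟨h00.1, hl'⟩
    simp only [hJdef, zero_add, pow_one] at h1
    rw [actionDensity_zero (x := l * x) (by simp [hB0, hb0]) (by simp [hVd0, hx]),
      actionDensity_zero (x := 0) (by simp [hB0]) (by simp [hVd0])] at h1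
    apply mul_left_cancel₀ hl
    rw [← h1]
    ring
  have hlim : Tendsto (fun ε : ℂ => f (ε, ε ^ (n + 1)) - f (0, 0)) (𝓝 0) (𝓝 0) := by
    have h1 : Tendsto (fun ε : ℂ => (ε, ε ^ (n + 1))) (𝓝 0) (𝓝 (0, 0)) := by
      have : Continuous (fun ε : ℂ => (ε, ε ^ (n + 1))) := by fun_prop
      simpa using this.tendsto 0
    have h2 := (hfc.tendsto.comp h1).sub_const (f (0, 0))
    simpa using h2
  have hfin : (fun ε : ℂ => ε ^ (n + 1) * (f (ε, ε ^ (n + 1)) - f (0, 0))) =o[𝓝 0]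
      fun ε : ℂ => ε ^ (n + 1) := by
    simpa using (isBigO_refl (fun ε : ℂ => ε ^ (n + 1)) (𝓝 0)).mul_isLittleO
      ((isLittleO_one_iff ℂ).2 hlim)
  refine hfin.congr' ?_ EventuallyEq.rfl
  have hev : ∀ᶠ ε : ℂ in 𝓝 0, (ε, ε ^ (n + 1)) ∈ ball (0 : ℂ) (τ' / 2) ×ˢ ball (0 : ℂ) (r / 2) := by
    have : ContinuousAt (fun ε : ℂ => (ε, ε ^ (n + 1))) 0 := by fun_prop
    exact this.preimage_mem_nhds (by simpa using hnh)
  filter_upwards [hev] with ε hε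
  have h1 := hfe _ hε
  simp only [hJdef, zero_add, pow_one, zero_mul, add_zero] at h1
  -- inside the action density at `(θ, ε)` the second variable is always `ε`
  have h2 : actionDensity m N N₂ (fun p => V p + p.2 ^ (n + 1) * v p.1)
      (fun p => Vd p + p.2 ^ (n + 1) * vd p.1) (fun p => B p + p.2 ^ (n + 1) * bv p) (θ, ε) =
      actionDensity m N N₂ (fun p => V p + ε ^ (n + 1) * v p.1)
        (fun p => Vd p + ε ^ (n + 1) * vd p.1) (fun p => B p + ε ^ (n + 1) * bv p) (θ, ε) := rfl
  rw [hf0, mul_sub, ← h1, h2]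
  ring

end

/-! ### Curves with almost constant action -/

theorem StepSmall.of_le {b c ρ₁ ρ ρ' τ M τ' τ'' : ℝ} (h : StepSmall b c ρ₁ ρ ρ' τ M τ')
    (h0 : 0 < τ'') (hle : τ'' ≤ τ') : StepSmall b c ρ₁ ρ ρ' τ M τ'' :=
  ⟨h0, hle.trans h.le, h.lt₁, h.lt₂, h.M_nonneg, hle.trans h.step,
    (mul_le_mul_of_nonneg_left hle h.M_nonneg).trans h.half,
    (mul_le_mul_of_nonneg_left hle h.M_nonneg).trans h.disp, by linarith [h.twist]⟩

/-- The conditions `StepSmall` hold on domains proportional to `ρ₁`, with a factor that does not depend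
on `ρ₁ ≤ 1`; this is what makes the constants of the normal form independent of the width of the strip. -/
theorem exists_stepSmall {b c l l' c₂ M : ℝ} (hb : 0 < b) (hc : 0 < c) (hl : l < l') (hl' : l' < 1)
    (hc₂ : 0 < c₂) (hM : 0 ≤ M) : ∃ c' > 0, ∀ ρ₁ : ℝ, 0 < ρ₁ → ρ₁ ≤ 1 →
      StepSmall b c ρ₁ (l * ρ₁) (l' * ρ₁) (c₂ * ρ₁) M (c' * ρ₁) := by
  have h1 : 0 < b * (l' - l) := mul_pos hb (sub_pos.2 hl)
  have h2 : 0 < b * (1 - l') := mul_pos hb (sub_pos.2 hl')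
  set c' := min (min c₂ (b * (l' - l))) (min (min (1 / 2) (b * (1 - l')) / (M + 1)) (c / 2)) with hc'
  have hp : 0 < c' := by positivity
  have i1 : c' ≤ c₂ := (min_le_left _ _).trans (min_le_left _ _)
  have i2 : c' ≤ b * (l' - l) := (min_le_left _ _).trans (min_le_right _ _)
  have i3 : c' ≤ min (1 / 2) (b * (1 - l')) / (M + 1) := (min_le_right _ _).trans (min_le_left _ _)
  have i4 : c' ≤ c / 2 := (min_le_right _ _).trans (min_le_right _ _)
  rw [le_div_iff₀ (by positivity)] at i3
  have i5 : c' * M ≤ 1 / 2 := by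
    have := i3.trans (min_le_left _ _)
    nlinarith
  have i6 : c' * M ≤ b * (1 - l') := by
    have := i3.trans (min_le_right _ _)
    nlinarith
  refine ⟨c', hp, fun ρ₁ h0 hle => ⟨by positivity, by gcongr, by gcongr, by nlinarith, hM, ?_, ?_, ?_, ?_⟩⟩
  · nlinarith
  · nlinarith [mul_nonneg hp.le hM]
  · nlinarith
  · nlinarith

set_option maxHeartbeats 1000000 in
/-- The induction behind the normal form: for every order `n` there is a family of curves whose
action density is independent of `θ` up to `o(εⁿ)`. The coefficient of `εⁿ⁺¹`, minus its mean, is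
removed by a term `εⁿ⁺¹ v(θ)`, where `6m v'` is that coefficient minus its mean. As the action
density is `-2m + O(ε)` on the whole domain, the size of this term is again `O(ε)`. -/
theorem exists_isParam {b C m₀ m₁ K c : ℝ} (hb : 0 < b) (hC : 0 < C) (hm₀ : 0 < m₀) (hK : 0 ≤ K)
    (hc : 0 < c) (n : ℕ) : ∀ l : ℝ, 0 < l → l < 1 → ∃ c' M : ℝ, 0 < c' ∧ 0 < M ∧
      ∀ {m ρ₁ : ℝ} {U : ℝ → Set ℂ} {G P : ℂ → ℂ → ℂ} {N N₂ : ℂ × ℂ → ℂ}, m₀ ≤ m → m ≤ m₁ →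
        0 < ρ₁ → ρ₁ ≤ 1 → StripFamily b C ρ₁ U → TwistGen m K c ρ₁ U G P N N₂ →
        ∃ V Vd B : ℂ × ℂ → ℂ, IsParam (l * ρ₁) (c' * ρ₁) M U V Vd B ∧
          ∀ θ ∈ U (l * ρ₁), (fun ε => actionDensity m N N₂ V Vd B (θ, ε) -
            actionDensity m N N₂ V Vd B (0, ε)) =o[𝓝 0] fun ε : ℂ => ε ^ n := by
  induction n with
  | zero =>
    -- the family `X = θ`
    intro l hl0 hl
    obtain ⟨c', hc', hs⟩ := exists_stepSmall (M := 1) hb hc (show l < (1 + l) / 2 by linarith)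
      (by linarith) one_pos zero_le_one
    refine ⟨1, 1, one_pos, one_pos, ?_⟩
    intro m ρ₁ U G P N N₂ hm hm' hρ hρ1 hU hG
    have hP : ∀ ρ : ℝ, IsParam ρ (1 * ρ₁) 1 U (fun _ => 0) (fun _ => 0) (fun _ => 0) := fun ρ =>
      ⟨.const (by simp), .const (by simp), .const (by simp), fun p _ => by simp, fun p _ => by simp,
        fun p _ => by simp, fun p _ => hasDerivAt_const _ _, fun p _ _ => by simp⟩
    refine ⟨_, _, _, hP _, fun θ hθ => ?_⟩
    have hsm := hs ρ₁ hρ hρ1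
    have hbd := fun p hp => norm_actionDensity_add_le (p := p) (hm₀.trans_le hm) hK hU hG (hP _) hsm hp
    simp only [pow_zero]
    rw [isLittleO_one_iff]
    have h0 : 0 ∈ U (l * ρ₁) := hU.zero_mem (by positivity)
    refine squeeze_zero_norm' (a := fun ε : ℂ => 2 * ((20 * m * 1 + 20 * K) * ‖ε‖)) ?_ ?_
    · filter_upwards [ball_mem_nhds (0 : ℂ) hsm.pos] with ε hε
      have h1 := hbd (θ, ε) ⟨hθ, hε⟩
      have h2 := hbd (0, ε) ⟨h0, hε⟩
      have h3 := norm_sub_le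
        (actionDensity m N N₂ (fun _ => 0) (fun _ => 0) (fun _ => 0) (θ, ε) + (2 * m : ℂ))
        (actionDensity m N N₂ (fun _ => 0) (fun _ => 0) (fun _ => 0) (0, ε) + (2 * m : ℂ))
      rw [add_sub_add_right_eq_sub] at h3
      simp only at h1 h2
      linarith
    · have : Continuous (fun ε : ℂ => 2 * ((20 * m * 1 + 20 * K) * ‖ε‖)) := by fun_prop
      simpa using this.tendsto 0
  | succ n ih =>
    intro l hl0 hl
    obtain ⟨l', l₁, l₂, h1, h2, h3, h4⟩ : ∃ l' l₁ l₂ : ℝ, l < l' ∧ l' < l₁ ∧ l₁ < l₂ ∧ l₂ < 1 :=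
      ⟨(3 * l + 1) / 4, (2 * l + 2) / 4, (l + 3) / 4, by linarith, by linarith, by linarith,
        by linarith⟩
    obtain ⟨c₂, M₂, hc₂, hM₂, hih⟩ := ih l₂ (by linarith) h4
    obtain ⟨cA, hcA, hsA⟩ := exists_stepSmall hb hc h3 h4 hc₂ hM₂.le
    obtain ⟨cB, hcB, hsB⟩ := exists_stepSmall hb hc h1 (by linarith : l' < 1) hc₂ hM₂.le
    set M' := 20 * m₁ * M₂ + 20 * K with hM'
    set r₀ := min (min cB cA) (b * (l₁ - l')) with hr₀
    have hr₀p : 0 < r₀ := by have := mul_pos hb (sub_pos.2 h2); positivity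
    have hr₀B : r₀ ≤ cB := (min_le_left _ _).trans (min_le_left _ _)
    have hr₀A : r₀ ≤ cA := (min_le_left _ _).trans (min_le_right _ _)
    have hr₀b : r₀ ≤ b * (l₁ - l') := min_le_right _ _
    refine ⟨r₀ / 2, M₂ + C * (2 * |M'|) / (6 * m₀), by positivity, by positivity, ?_⟩
    intro m ρ₁ U G P N N₂ hm hm' hρ hρ1 hU hG
    have hmp : 0 < m := hm₀.trans_le hm
    obtain ⟨V, Vd, B, hX, ho⟩ := hih hm hm' hρ hρ1 hU hG
    have hsA := hsA ρ₁ hρ hρ1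
    have hsB := hsB ρ₁ hρ hρ1
    have hM'0 : 0 ≤ M' := by have := hm₀.trans_le (hm.trans hm'); positivity
    have hUl : U (l * ρ₁) ⊆ U (l' * ρ₁) := hU.mono (by gcongr) (by nlinarith)
    have hUl' : U (l' * ρ₁) ⊆ U (l₁ * ρ₁) := hU.mono (by gcongr) (by nlinarith)
    have hUl₁ : U (l₁ * ρ₁) ⊆ U (l₂ * ρ₁) := hU.mono (by gcongr) (by nlinarith)
    have h01 : (0 : ℂ) ∈ U (l₁ * ρ₁) := hU.zero_mem (by have : 0 < l₁ := by linarith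
                                                        positivity)
    -- `U (l' ρ₁) ⊆ U (l₁ ρ₁) ⊆ U (l₂ ρ₁)` absorb the losses of the shift by `ε`, of the action density
    -- and of the induction hypothesis
    set j := actionDensity m N N₂ V Vd B with hj
    have hjr := isRealAnalyticPeriodic_actionDensity hU hG hX hsA
    have hjb := fun p hp => norm_actionDensity_add_le (p := p) hmp hK hU hG hX hsA hp
    rw [← hj] at hjr hjb
    clear_value j
    -- the `θ`-dependent part of the action density, divided by `εⁿ⁺¹`
    have hFr : IsRealAnalyticPeriodic (fun p => j p - j (0, p.2)) (U (l₁ * ρ₁) ×ˢ ball 0 (cA * ρ₁)) := by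
      exact hjr.sub (hjr.zero_fst h01)
    have hFb : ∀ p ∈ U (l₁ * ρ₁) ×ˢ ball (0 : ℂ) (cA * ρ₁), ‖j p - j (0, p.2)‖ ≤ 2 * (M' * (cA * ρ₁)) := by
      intro p hp
      have e1 := hjb p hp
      have e2 := hjb (0, p.2) ⟨h01, hp.2⟩
      have e3 := norm_sub_le (j p + (2 * m : ℂ)) (j (0, p.2) + (2 * m : ℂ))
      rw [add_sub_add_right_eq_sub] at e3
      have e4 := (mem_ball_zero_iff.1 hp.2).le
      have e5 : (20 * m * M₂ + 20 * K) * ‖p.2‖ ≤ M' * (cA * ρ₁) := by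
        have : 20 * m * M₂ + 20 * K ≤ M' := by rw [hM']; gcongr
        gcongr
      simp only at e2
      linarith
    obtain ⟨k, hk, hke, hkb⟩ := hFr.exists_eq_snd_pow_mul (hU.isOpen _ (by nlinarith))
      (fun _ => hU.add_one (by nlinarith)) (fun _ => hU.star_mem (by nlinarith)) (by positivity)
        (fun a ha => ho a (hUl₁ ha))
    have hkb := hkb _ hFb
    set Kk := 2 * (M' * (cA * ρ₁)) / (cA * ρ₁) ^ (n + 1) with hKk
    have hz : (0 : ℂ) ∈ ball (0 : ℂ) (cA * ρ₁ / 2) := mem_ball_self (by positivity)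
    have hopk : IsOpen (U (l₁ * ρ₁) ×ˢ ball (0 : ℂ) (cA * ρ₁ / 2)) :=
      (hU.isOpen _ (by nlinarith)).prod isOpen_ball
    have hkc : ∀ θ ∈ U (l₁ * ρ₁), ContinuousAt (fun ε => k (θ, ε)) 0 := fun θ hθ =>
      (hk.1.continuousOn.continuousAt (hopk.mem_nhds ⟨hθ, hz⟩)).comp (f := fun ε : ℂ => (θ, ε))
        (by fun_prop)
    have hk00 : k (0, 0) = 0 := by
      refine tendsto_nhds_unique (((hkc 0 h01).tendsto.mono_left
        (nhdsWithin_le_nhds (s := {0}ᶜ))).congr' ?_) tendsto_const_nhds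
      filter_upwards [self_mem_nhdsWithin, nhdsWithin_le_nhds (isOpen_ball.mem_nhds hz)] with ε hε hε'
      have := hke (0, ε) ⟨h01, hε'⟩
      simpa [show ε ≠ 0 from hε] using this
    obtain ⟨e, Fp, he, hFd, hF1, hFs, hFC, hkC⟩ := hU.primitive (ρ := l₁ * ρ₁) (by
        have : 0 < l₁ := by linarith
        positivity) (by nlinarith) (B := Kk) (f := fun θ => k (θ, 0))
      (hk.1.comp (f := fun θ : ℂ => (θ, (0 : ℂ))) (by fun_prop) (fun θ hθ => ⟨hθ, hz⟩))
      (fun θ hθ => by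
        have := hk.2.1 (θ, 0) ⟨hθ, hz⟩
        simpa using this)
      (fun θ hθ => by
        have := hk.2.2 (θ, 0) ⟨hθ, hz⟩
        rw [← this]
        congr 1
        ext <;> simp)
      (fun θ hθ => hkb _ ⟨hθ, hz⟩)
    set v : ℂ → ℂ := fun θ => Fp θ / (6 * m) with hv
    set vd : ℂ → ℂ := fun θ => (k (θ, 0) - e) / (6 * m) with hvd
    set Cv := C * Kk / (6 * m₀) with hCv
    have hKk0 : 0 ≤ Kk := by positivity
    have h6m : ‖(6 * m : ℂ)‖ = 6 * m := by
      rw [norm_mul, Complex.norm_real, Complex.norm_ofNat, Real.norm_eq_abs, abs_of_pos hmp]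
    have hdivC : ∀ x : ℂ, ‖x‖ ≤ C * Kk → ‖x / (6 * m)‖ ≤ Cv := fun x hx => by
      rw [norm_div, h6m, hCv]
      gcongr
    have hvder : ∀ θ ∈ U (l₁ * ρ₁), HasDerivAt v (vd θ) θ := fun θ hθ => (hFd θ hθ).div_const _
    have hvdiff : DifferentiableOn ℂ v (U (l₁ * ρ₁)) := fun θ hθ =>
      (hvder θ hθ).differentiableAt.differentiableWithinAt
    have hvddiff : DifferentiableOn ℂ vd (U (l₁ * ρ₁)) :=
      ((hk.1.comp (f := fun θ : ℂ => (θ, (0 : ℂ))) (by fun_prop)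
        (fun θ hθ => ⟨hθ, hz⟩)).sub_const _).div_const _
    have hvb : ∀ θ ∈ U (l₁ * ρ₁), ‖v θ‖ ≤ Cv := fun θ hθ => hdivC _ (hFC θ hθ)
    have hvdb : ∀ θ ∈ U (l₁ * ρ₁), ‖vd θ‖ ≤ Cv := fun θ hθ => hdivC _ (hkC θ hθ)
    have hv1 : ∀ θ ∈ U (l₁ * ρ₁), v (θ + 1) = v θ := fun θ hθ => by simp only [hv, hF1 θ hθ]
    have hvs : ∀ θ ∈ U (l₁ * ρ₁), v (star θ) = star (v θ) := fun θ hθ => by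
      simp only [hv, hFs θ hθ]
      simp
    have hshift : ∀ p ∈ U (l' * ρ₁) ×ˢ ball (0 : ℂ) (r₀ * ρ₁), p.1 + p.2 ∈ U (l₁ * ρ₁) := by
      intro p hp
      refine hU.add_mem (by gcongr) (by nlinarith) hp.1 ((mem_ball_zero_iff.1 hp.2).trans_le ?_)
      nlinarith
    -- the difference quotient of `v`
    have hqr : IsRealAnalyticPeriodic (fun p => v (p.1 + p.2) - v p.1)
        (U (l' * ρ₁) ×ˢ ball 0 (r₀ * ρ₁)) := by
      refine ⟨(hvdiff.comp (f := fun p : ℂ × ℂ => p.1 + p.2) (by fun_prop) hshift).sub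
        (hvdiff.comp (f := fun p : ℂ × ℂ => p.1) (by fun_prop) (fun p hp => hUl' hp.1)), ?_, ?_⟩
      · intro p hp
        simp only [Prod.fst_add, Prod.snd_add, add_zero]
        rw [add_right_comm, hv1 _ (hshift p hp), hv1 _ (hUl' hp.1)]
      · intro p hp
        simp only [Prod.fst_star, Prod.snd_star]
        rw [← star_add, hvs _ (hshift p hp), hvs _ (hUl' hp.1), star_sub]
    have hqb : ∀ p ∈ U (l' * ρ₁) ×ˢ ball (0 : ℂ) (r₀ * ρ₁), ‖v (p.1 + p.2) - v p.1‖ ≤ Cv * (r₀ * ρ₁) := by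
      intro p hp
      have hball : ball p.1 (r₀ * ρ₁) ⊆ U (l₁ * ρ₁) := fun z hz => by
        have := hshift (p.1, z - p.1) ⟨hp.1, by simpa [dist_eq_norm] using hz⟩
        simpa using this
      have := (convex_ball p.1 (r₀ * ρ₁)).norm_image_sub_le_of_norm_hasDerivWithin_le (𝕜 := ℂ)
        (f := v) (f' := vd) (C := Cv) (fun x hx => (hvder x (hball hx)).hasDerivWithinAt)
        (fun x hx => hvdb x (hball hx)) (mem_ball_self (by positivity))
        (y := p.1 + p.2) (by simpa using hp.2)
      refine this.trans ?_
      have h5 := (mem_ball_zero_iff.1 hp.2).le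
      have : 0 ≤ Cv := by positivity
      rw [add_sub_cancel_left]
      gcongr
    obtain ⟨bv, hbv, hbve, hbvb⟩ := hqr.exists_eq_snd_pow_mul (n := 0) (hU.isOpen _ (by nlinarith))
      (fun _ => hU.add_one (by nlinarith)) (fun _ => hU.star_mem (by nlinarith)) (by positivity)
        (fun a ha => by
        simp only [pow_zero]
        rw [isLittleO_one_iff]
        have h5 : ContinuousAt (fun t => v (a + t) - v a) 0 := by
          have : ContinuousAt v (a + 0) := by
            rw [add_zero]; exact (hvder a (hUl' ha)).continuousAt
          exact (this.comp (f := fun t => a + t) (by fun_prop)).sub continuousAt_const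
        simpa using h5.tendsto)
    have hbvb : ∀ p ∈ U (l' * ρ₁) ×ˢ ball (0 : ℂ) (r₀ * ρ₁ / 2), ‖bv p‖ ≤ Cv := fun p hp => by
      refine (hbvb _ hqb p hp).trans_eq ?_
      rw [zero_add, pow_one, mul_div_cancel_right₀ _ (by positivity)]
    have hr2 : r₀ * ρ₁ / 2 = r₀ / 2 * ρ₁ := by ring
    rw [hr2] at hbv hbve hbvb
    -- at `ε = 0` the difference quotient of `v` is its derivative
    have hbv0 : ∀ θ ∈ U (l' * ρ₁), bv (θ, 0) = vd θ := by
      intro θ hθ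
      have hz' : (0 : ℂ) ∈ ball (0 : ℂ) (r₀ / 2 * ρ₁) := mem_ball_self (by positivity)
      have hc1 : ContinuousAt (fun ε => bv (θ, ε)) 0 :=
        (hbv.1.continuousOn.continuousAt (((hU.isOpen _ (by nlinarith)).prod isOpen_ball).mem_nhds
          ⟨hθ, hz'⟩)).comp (f := fun ε : ℂ => (θ, ε)) (by fun_prop)
      have hsl := (hvder θ (hUl' hθ)).tendsto_slope_zero
      refine tendsto_nhds_unique (hc1.tendsto.mono_left (nhdsWithin_le_nhds (s := {0}ᶜ)))
        (hsl.congr' ?_)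
      filter_upwards [self_mem_nhdsWithin, nhdsWithin_le_nhds (isOpen_ball.mem_nhds hz')] with ε hε hε'
      have := hbve (θ, ε) ⟨hθ, hε'⟩
      have hε : ε ≠ 0 := hε
      simp only [zero_add, pow_one] at this
      rw [this, smul_eq_mul]
      field_simp
    have hsC : StepSmall b c ρ₁ (l * ρ₁) (l' * ρ₁) (c₂ * ρ₁) M₂ (r₀ / 2 * ρ₁) :=
      hsB.of_le (by positivity) (by nlinarith)
    have hX' : IsParam (l' * ρ₁) (c₂ * ρ₁) M₂ U V Vd B := hX.mono (hUl'.trans hUl₁) le_rfl le_rfl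
    have hsubD : U (l * ρ₁) ×ˢ ball (0 : ℂ) (r₀ / 2 * ρ₁) ⊆ U (l' * ρ₁) ×ˢ ball (0 : ℂ) (c₂ * ρ₁) :=
      prod_mono hUl (ball_subset_ball hsC.le)
    have hsubE : U (l * ρ₁) ×ˢ ball (0 : ℂ) (r₀ / 2 * ρ₁) ⊆ U (l' * ρ₁) ×ˢ ball (0 : ℂ) (r₀ / 2 * ρ₁) :=
      prod_mono hUl subset_rfl
    -- the bound for `k` contains the factor `(cA ρ₁)⁻ⁿ`, which is compensated by `|ε|ⁿ`
    have hpw : ∀ p ∈ U (l * ρ₁) ×ˢ ball (0 : ℂ) (r₀ / 2 * ρ₁), ∀ x : ℂ, ‖x‖ ≤ Cv →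
        ‖p.2 ^ (n + 1) * x‖ ≤ C * (2 * |M'|) / (6 * m₀) * ‖p.2‖ := by
      intro p hp x hx
      have h5 := (mem_ball_zero_iff.1 hp.2).le
      have h6 : ‖p.2‖ ≤ cA * ρ₁ := by nlinarith
      rw [norm_mul, norm_pow]
      calc ‖p.2‖ ^ (n + 1) * ‖x‖ ≤ (‖p.2‖ * (cA * ρ₁) ^ n) * Cv := by
            rw [pow_succ']; gcongr
        _ = C * (2 * |M'|) / (6 * m₀) * ‖p.2‖ := by
            rw [hCv, hKk, abs_of_nonneg hM'0, pow_succ]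
            field_simp
    have hbd : ∀ p ∈ U (l * ρ₁) ×ˢ ball (0 : ℂ) (r₀ / 2 * ρ₁), ∀ x y : ℂ, ‖x‖ ≤ M₂ * ‖p.2‖ → ‖y‖ ≤ Cv →
        ‖x + p.2 ^ (n + 1) * y‖ ≤ (M₂ + C * (2 * |M'|) / (6 * m₀)) * ‖p.2‖ := by
      intro p hp x y hx hy
      refine (norm_add_le _ _).trans ?_
      have := hpw p hp y hy
      linarith
    have hvirp : IsRealAnalyticPeriodic (fun p => v p.1) (U (l * ρ₁) ×ˢ ball (0 : ℂ) (r₀ / 2 * ρ₁)) :=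
      ⟨hvdiff.comp (f := fun p : ℂ × ℂ => p.1) (by fun_prop) (fun p hp => hUl' (hUl hp.1)),
        fun p hp => hv1 _ (hUl' (hUl hp.1)), fun p hp => hvs _ (hUl' (hUl hp.1))⟩
    have hvdirp : IsRealAnalyticPeriodic (fun p => vd p.1) (U (l * ρ₁) ×ˢ ball (0 : ℂ) (r₀ / 2 * ρ₁)) := by
      refine ⟨hvddiff.comp (f := fun p : ℂ × ℂ => p.1) (by fun_prop) (fun p hp => hUl' (hUl hp.1)),
        fun p hp => ?_, fun p hp => ?_⟩
      · have := hk.2.1 (p.1, 0) ⟨hUl' (hUl hp.1), hz⟩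
        simp only [Prod.mk_add_mk, add_zero] at this
        simp only [hvd, Prod.fst_add, this]
      · have := hk.2.2 (p.1, 0) ⟨hUl' (hUl hp.1), hz⟩
        have h5 : star (p.1, (0 : ℂ)) = (star p.1, 0) := by ext <;> simp
        rw [h5] at this
        simp only [hvd, Prod.fst_star, this, star_div₀, star_sub, he]
        simp
    refine ⟨fun p => V p + p.2 ^ (n + 1) * v p.1, fun p => Vd p + p.2 ^ (n + 1) * vd p.1,
      fun p => B p + p.2 ^ (n + 1) * bv p, ⟨?_, ?_, ?_, ?_, ?_, ?_, ?_, ?_⟩, ?_⟩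
    · exact (hX'.V_irp.mono hsubD).add ((IsRealAnalyticPeriodic.snd.pow _).mul hvirp)
    · exact (hX'.Vd_irp.mono hsubD).add ((IsRealAnalyticPeriodic.snd.pow _).mul hvdirp)
    · exact (hX'.B_irp.mono hsubD).add ((IsRealAnalyticPeriodic.snd.pow _).mul (hbv.mono hsubE))
    · exact fun p hp => hbd p hp _ _ (hX'.norm_V p (hsubD hp)) (hvb _ (hUl' (hUl hp.1)))
    · exact fun p hp => hbd p hp _ _ (hX'.norm_Vd p (hsubD hp)) (hvdb _ (hUl' (hUl hp.1)))
    · exact fun p hp => hbd p hp _ _ (hX'.norm_B p (hsubD hp)) (hbvb _ (hsubE hp))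
    · exact fun p hp => (hX'.hasDerivAt p (hsubD hp)).add
        ((hvder _ (hUl' (hUl hp.1))).const_mul (p.2 ^ (n + 1)))
    · intro p hp hp'
      have e1 := hX'.secant p (hsubD hp) (hUl hp')
      have e2 := hbve p (hsubE hp)
      simp only [zero_add, pow_one] at e2
      linear_combination e1 + p.2 ^ (n + 1) * e2
    · intro θ hθ
      have h0 : (0 : ℂ) ∈ U (l * ρ₁) := hU.zero_mem (by positivity)
      have var := fun θ hθ => actionDensity_variation (n := n) (θ := θ) hU hG hX' hsC (hvdiff.mono hUl')
        (hvddiff.mono hUl') hbv.1 (fun θ hθ => hvb θ (hUl' hθ)) hbvb hθ (hbv0 θ (hUl hθ))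
      have hrest : (fun ε : ℂ => ε ^ (n + 1) * (k (θ, ε) - k (θ, 0))) =o[𝓝 0]
          fun ε : ℂ => ε ^ (n + 1) := by
        have hl : Tendsto (fun ε => k (θ, ε) - k (θ, 0)) (𝓝 0) (𝓝 0) := by
          simpa using (hkc θ (hUl' (hUl hθ))).tendsto.sub_const (k (θ, 0))
        simpa using (isBigO_refl (fun ε : ℂ => ε ^ (n + 1)) (𝓝 0)).mul_isLittleO
          ((isLittleO_one_iff ℂ).2 hl)
      refine (((var θ hθ).sub (var 0 h0)).add hrest).congr' ?_ EventuallyEq.rfl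
      filter_upwards [isOpen_ball.mem_nhds hz] with ε hε
      have e1 := hke (θ, ε) ⟨hUl' (hUl hθ), hε⟩
      simp only [hj] at e1
      have e2 : 6 * (m : ℂ) * (vd θ - vd 0) = k (θ, 0) := by
        have : (m : ℂ) ≠ 0 := by exact_mod_cast hmp.ne'
        simp only [hvd, hk00]
        field_simp
        ring
      linear_combination -e1 + ε ^ (n + 1) * e2

/-! ### The Euler-Lagrange equation -/

section

variable {b C m K c ρ₁ ρ ρ' τ M τ' : ℝ} {U : ℝ → Set ℂ} {G P : ℂ → ℂ → ℂ}
  {N N₂ V Vd B : ℂ × ℂ → ℂ}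

/-- Chain rule for the generating function. -/
theorem TwistGen.hasDerivAt_comp (hG : TwistGen m K c ρ₁ U G P N N₂) (hU : IsOpen (U ρ₁))
    {α β : ℂ → ℂ} {α' β' θ : ℂ} (hα : HasDerivAt α α' θ) (hβ : HasDerivAt β β' θ)
    (ha : α θ ∈ U ρ₁) (hb : β θ ∈ U ρ₁) (hh : β θ - α θ ∈ ball (0 : ℂ) (c * ρ₁)) :
    HasDerivAt (fun t => G (α t) (β t)) (P (α θ) (β θ) * β' - P (β θ) (α θ) * α') θ := by
  set g : ℂ × ℂ → ℂ := fun p => m * (p.2 - p.1) ^ 3 + (p.2 - p.1) ^ 4 * N (p.1, p.2 - p.1) with hg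
  set a₀ := α θ with ha₀
  set b₀ := β θ with hb₀
  have hO : {p : ℂ × ℂ | p.1 ∈ U ρ₁ ∧ p.2 ∈ U ρ₁ ∧ p.2 - p.1 ∈ ball (0 : ℂ) (c * ρ₁)} ∈ 𝓝 (a₀, b₀) := by
    refine IsOpen.mem_nhds (IsOpen.inter (hU.preimage continuous_fst)
      (IsOpen.inter (hU.preimage continuous_snd) (isOpen_ball.preimage (by fun_prop)))) ⟨ha, hb, hh⟩
  have hgd : DifferentiableAt ℂ g (a₀, b₀) := by
    have hN : DifferentiableAt ℂ (fun p : ℂ × ℂ => N (p.1, p.2 - p.1)) (a₀, b₀) :=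
      (hG.N_irp.1.differentiableAt ((hU.prod isOpen_ball).mem_nhds ⟨ha, hh⟩)).comp
        (f := fun p : ℂ × ℂ => (p.1, p.2 - p.1)) (a₀, b₀) (by fun_prop)
    exact DifferentiableAt.add (by fun_prop) (DifferentiableAt.mul (by fun_prop) hN)
  have hGg : ∀ p ∈ {p : ℂ × ℂ | p.1 ∈ U ρ₁ ∧ p.2 ∈ U ρ₁ ∧ p.2 - p.1 ∈ ball (0 : ℂ) (c * ρ₁)},
      G p.1 p.2 = g p := fun p hp => by
    have := hG.G_eq p.1 hp.1 _ hp.2.2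
    rwa [add_sub_cancel] at this
  have hcomp : ∀ {x y : ℂ → ℂ} {x' y' t : ℂ}, HasDerivAt x x' t → HasDerivAt y y' t →
      (x t, y t) = (a₀, b₀) →
      HasDerivAt (fun s => G (x s) (y s)) (fderiv ℂ g (a₀, b₀) (x', y')) t := by
    intro x y x' y' t hx hy hxy
    have h1 : HasDerivAt (fun s => g (x s, y s)) (fderiv ℂ g (a₀, b₀) (x', y')) t := by
      have := hgd.hasFDerivAt
      rw [← hxy] at this ⊢
      exact this.comp_hasDerivAt t (hx.prodMk hy)
    refine h1.congr_of_eventuallyEq ?_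
    have hc : ContinuousAt (fun s => (x s, y s)) t := hx.continuousAt.prodMk hy.continuousAt
    filter_upwards [hc.preimage_mem_nhds (by rw [hxy]; exact hO)] with s hs
    exact hGg _ hs
  have e1 : fderiv ℂ g (a₀, b₀) (0, 1) = P a₀ b₀ := by
    have h1 := hcomp (hasDerivAt_const b₀ a₀) (hasDerivAt_id b₀) rfl
    have h2 := hG.hasDerivAt a₀ ha _ hh
    rw [add_sub_cancel] at h2
    exact h1.unique h2
  have e2 : fderiv ℂ g (a₀, b₀) (1, 0) = -P b₀ a₀ := by
    have h1 := hcomp (hasDerivAt_id a₀) (hasDerivAt_const a₀ b₀) rfl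
    have h2 := (hG.hasDerivAt b₀ hb (a₀ - b₀)
      (by rw [← neg_sub, mem_ball_zero_iff, norm_neg]; simpa using hh)).neg
    rw [add_sub_cancel] at h2
    refine h1.unique (h2.congr_of_eventuallyEq ?_)
    have hc : ContinuousAt (fun s : ℂ => (s, b₀)) a₀ := by fun_prop
    filter_upwards [hc.preimage_mem_nhds hO] with s hs
    exact hG.antisymm s hs.1 b₀ hb hs.2.2
  have h := hcomp hα hβ rfl
  have e3 : ((α', β') : ℂ × ℂ) = α' • (1, 0) + β' • (0, 1) := by ext <;> simp
  rw [e3, map_add, map_smul, map_smul, e1, e2] at h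
  convert h using 1
  simp only [smul_eq_mul]
  ring

/-- The conservation law: the `θ`-derivative of the action `ε³ j(θ, ε)` is `X'` times the residual of
the discrete Euler-Lagrange equation. -/
theorem hasDerivAt_actionDensity (hU : StripFamily b C ρ₁ U)
    (hG : TwistGen m K c ρ₁ U G P N N₂) (hX : IsParam ρ' τ M U V Vd B)
    (hs : StepSmall b c ρ₁ ρ ρ' τ M τ') {θ ε : ℂ} (hε : ε ∈ ball (0 : ℂ) τ') {R : ℝ}
    (hR : ball θ R ⊆ U ρ') (hεR : ‖ε‖ < R / 4) :
    HasDerivAt (fun t => ε ^ 3 * actionDensity m N N₂ V Vd B (t, ε))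
      ((1 + Vd (θ, ε)) * (P (θ - ε + V (θ - ε, ε)) (θ + V (θ, ε)) -
        P (θ + ε + V (θ + ε, ε)) (θ + V (θ, ε)))) θ := by
  have hR0 : 0 < R := by linarith [norm_nonneg ε]
  have hup : ∀ t ∈ ball θ R, (t, ε) ∈ U ρ' ×ˢ ball (0 : ℂ) τ' := fun t ht => ⟨hR ht, hε⟩
  have hup' : ∀ t ∈ ball θ R, (t, ε) ∈ U ρ' ×ˢ ball (0 : ℂ) τ := fun t ht =>
    ⟨hR ht, ball_subset_ball hs.le hε⟩
  set A : ℂ → ℂ := fun t => 1 + B (t, ε) with hA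
  set X : ℂ → ℂ := fun t => t + V (t, ε) with hXdef
  set I : ℂ → ℂ := fun t => (3 * m * A (t - ε) ^ 2 +
    ε * A (t - ε) ^ 3 * N₂ (X (t - ε), ε * A (t - ε))) * (1 + Vd (t, ε)) with hI
  have hsub : ∀ t ∈ ball θ (R / 2), t - ε ∈ ball θ R := fun t ht => by
    rw [mem_ball, dist_eq_norm] at ht ⊢
    calc ‖t - ε - θ‖ = ‖(t - θ) - ε‖ := by ring_nf
      _ ≤ ‖t - θ‖ + ‖ε‖ := norm_sub_le _ _
      _ < R := by linarith
  have hadd : ∀ t ∈ ball θ (R / 2), t + ε ∈ ball θ R := fun t ht => by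
    rw [mem_ball, dist_eq_norm] at ht ⊢
    calc ‖t + ε - θ‖ = ‖(t - θ) + ε‖ := by ring_nf
      _ ≤ ‖t - θ‖ + ‖ε‖ := norm_add_le _ _
      _ < R := by linarith
  have hsec : ∀ {f : ℂ × ℂ → ℂ}, IsRealAnalyticPeriodic f (U ρ' ×ˢ ball 0 τ) →
      DifferentiableOn ℂ (fun t => f (t, ε)) (ball θ R) := fun hf =>
    hf.1.comp (f := fun t : ℂ => (t, ε)) (by fun_prop) (fun t ht => hup' t ht)
  have hAd : DifferentiableOn ℂ (fun t => A (t - ε)) (ball θ (R / 2)) :=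
    ((hsec hX.B_irp).const_add 1).comp (f := fun t : ℂ => t - ε) (by fun_prop) hsub
  have hXd : DifferentiableOn ℂ (fun t => X (t - ε)) (ball θ (R / 2)) :=
    (differentiableOn_id.add (hsec hX.V_irp)).comp (f := fun t : ℂ => t - ε) (by fun_prop) hsub
  have hballs : ball θ (R / 2) ⊆ ball θ R := ball_subset_ball (by linarith)
  have hId : DifferentiableOn ℂ I (ball θ (R / 2)) := by
    refine DifferentiableOn.mul (((hAd.pow 2).const_mul _).add (((hAd.pow 3).const_mul _).mul ?_))
      (((hsec hX.Vd_irp).mono hballs).const_add 1)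
    exact hG.N₂_irp.1.comp (f := fun t => (X (t - ε), ε * A (t - ε))) (hXd.prodMk (hAd.const_mul _))
      (fun t ht => hs.arg_mem hU hX (hup _ (hsub t ht)))
  obtain ⟨Q, hQ⟩ := hId.isExactOn_ball
  have hθ : θ ∈ ball θ (R / 2) := mem_ball_self (by positivity)
  have hθ4 : θ ∈ ball θ (R / 4) := mem_ball_self (by positivity)
  have hX' : ∀ t ∈ ball θ R, HasDerivAt X (1 + Vd (t, ε)) t := fun t ht =>
    (hasDerivAt_id t).add (hX.hasDerivAt (t, ε) (hup' t ht))
  have hstep : ∀ t ∈ ball θ (R / 2), X (t + ε) = X t + ε * A t := fun t ht => by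
    have := hX.secant (t, ε) (hup' t (hballs ht)) (hR (hadd t ht))
    simp only [hXdef, hA] at this ⊢
    linear_combination this
  have hXm : ∀ t ∈ ball θ R, X t ∈ U ρ₁ := fun t ht => (hs.arg_mem hU hX (hup t ht)).1
  have hAm : ∀ t ∈ ball θ R, ε * A t ∈ ball (0 : ℂ) (c * ρ₁) := fun t ht =>
    (hs.arg_mem hU hX (hup t ht)).2
  -- the action as a difference of two functions of `t` whose derivatives are explicit
  have hEq : ∀ t ∈ ball θ (R / 4), ε ^ 3 * actionDensity m N N₂ V Vd B (t, ε) =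
      G (X t) (X (t + ε)) - ε ^ 2 * (Q (t + ε) - Q t) := by
    intro t ht
    have ht2 : t ∈ ball θ (R / 2) := ball_subset_ball (by linarith) ht
    have hseg : ∀ s ∈ Icc (0 : ℝ) 1, t + s * ε ∈ ball θ (R / 2) := fun s hs => by
      rw [mem_ball, dist_eq_norm] at ht ⊢
      calc ‖t + s * ε - θ‖ = ‖(t - θ) + s * ε‖ := by ring_nf
        _ ≤ ‖t - θ‖ + ‖(s : ℂ) * ε‖ := norm_add_le _ _
        _ < R / 2 := by
          rw [norm_mul, Complex.norm_real, Real.norm_eq_abs, abs_of_nonneg hs.1]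
          nlinarith [norm_nonneg ε, hs.2]
    have hint : ∫ s in (0 : ℝ)..1, ε * I (t + s * ε) = Q (t + ε) - Q t := by
      have := intervalIntegral.integral_eq_sub_of_hasDerivAt (a := 0) (b := 1)
        (f := fun s : ℝ => Q (t + s * ε)) (f' := fun s : ℝ => ε * I (t + s * ε)) (fun s hs => by
          rw [uIcc_of_le zero_le_one] at hs
          have h1 := hQ _ (hseg s hs)
          have h2 : HasDerivAt (fun s : ℝ => t + (s : ℂ) * ε) ε s := by
            simpa using (Complex.ofRealCLM.hasDerivAt (x := s)).mul_const ε |>.const_add t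
          have := h1.scomp s h2
          simpa [smul_eq_mul, Function.comp_def] using this) (by
          apply ContinuousOn.intervalIntegrable
          rw [uIcc_of_le zero_le_one]
          exact continuousOn_const.mul (hId.continuousOn.comp (f := fun s : ℝ => t + (s : ℂ) * ε)
            (by fun_prop) hseg))
      simpa using this
    have hGt : G (X t) (X (t + ε)) = m * (ε * A t) ^ 3 + (ε * A t) ^ 4 * N (X t, ε * A t) := by
      rw [hstep t ht2]
      exact hG.G_eq _ (hXm t (hballs ht2)) _ (hAm t (hballs ht2))
    have hj : actionDensity m N N₂ V Vd B (t, ε) = m * A t ^ 3 + ε * A t ^ 4 * N (X t, ε * A t) -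
        ∫ s in (0 : ℝ)..1, I (t + s * ε) := by
      simp only [actionDensity, hI, hA, hXdef]
      congr 1
      refine intervalIntegral.integral_congr fun s _ => ?_
      have : t + s * ε - ε = t + ((s : ℂ) - 1) * ε := by ring
      simp only [this]
    rw [intervalIntegral.integral_const_mul] at hint
    rw [hj, hGt, ← hint]
    ring
  have hder : HasDerivAt (fun t => G (X t) (X (t + ε)) - ε ^ 2 * (Q (t + ε) - Q t))
      (P (X θ) (X (θ + ε)) * (1 + Vd (θ + ε, ε)) - P (X (θ + ε)) (X θ) * (1 + Vd (θ, ε)) -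
        ε ^ 2 * (I (θ + ε) - I θ)) θ := by
    have hθR : θ ∈ ball θ R := hballs hθ
    have hθε : θ + ε ∈ ball θ (R / 2) := by
      rw [mem_ball, dist_eq_norm, add_sub_cancel_left]; linarith
    have h1 := hX' θ hθR
    have h2 : HasDerivAt (fun t => X (t + ε)) (1 + Vd (θ + ε, ε)) θ :=
      (hX' _ (hballs hθε)).comp_add_const θ ε
    have h3 := hG.hasDerivAt_comp (hU.isOpen _ le_rfl) h1 h2 (hXm _ hθR) (hXm _ (hballs hθε)) (by
      rw [hstep θ hθ, add_sub_cancel_left]; exact hAm _ hθR)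
    have h4 : HasDerivAt (fun t => Q (t + ε)) (I (θ + ε)) θ := (hQ _ hθε).comp_add_const θ ε
    exact h3.sub ((h4.sub (hQ _ hθ)).const_mul _)
  refine (hder.congr_of_eventuallyEq ?_).congr_deriv ?_
  · filter_upwards [ball_mem_nhds θ (show 0 < R / 4 by positivity)] with t ht
    exact hEq t ht
  · have hθR : θ ∈ ball θ R := hballs hθ
    have hm' : θ - ε ∈ ball θ (R / 2) := by
      rw [mem_ball, dist_eq_norm, sub_sub_cancel_left, norm_neg]; linarith
    have p1 : P (X θ) (X (θ + ε)) * (1 + Vd (θ + ε, ε)) = ε ^ 2 * I (θ + ε) := by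
      rw [hstep θ hθ, hG.P_eq _ (hXm θ hθR) _ (hAm θ hθR)]
      simp only [hI, add_sub_cancel_right]
      ring
    have p2 : P (X (θ - ε)) (X θ) * (1 + Vd (θ, ε)) = ε ^ 2 * I θ := by
      have h1 := hstep _ hm'
      rw [sub_add_cancel] at h1
      rw [h1, hG.P_eq _ (hXm _ (hballs hm')) _ (hAm _ (hballs hm'))]
      simp only [hI]
      ring
    change _ = (1 + Vd (θ, ε)) * (P (X (θ - ε)) (X θ) - P (X (θ + ε)) (X θ))
    linear_combination p1 - p2

/-- If the action density is independent of `θ` up to `o(εⁿ)`, then the Euler-Lagrange equation holds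
up to `O(εⁿ⁺⁴)`. -/
theorem eulerLagrange_isBigO (hU : StripFamily b C ρ₁ U)
    (hG : TwistGen m K c ρ₁ U G P N N₂) (hX : IsParam ρ' τ M U V Vd B)
    (hs : StepSmall b c ρ₁ ρ ρ' τ M τ') (hρ : 0 < ρ) {n : ℕ}
    (ho : ∀ θ ∈ U ρ', (fun ε => actionDensity m N N₂ V Vd B (θ, ε) -
            actionDensity m N N₂ V Vd B (0, ε)) =o[𝓝 0] fun ε : ℂ => ε ^ n)
    {θ : ℂ} (hθ : θ ∈ U ρ) :
    (fun ε => P (θ - ε + V (θ - ε, ε)) (θ + V (θ, ε)) -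
        P (θ + ε + V (θ + ε, ε)) (θ + V (θ, ε))) =O[𝓝 0] fun ε : ℂ => ε ^ (n + 4) := by
  have hopen := hU.isOpen ρ (hs.lt₁.trans hs.lt₂).le
  have hsub := hU.mono hs.lt₁.le hs.lt₂.le
  have hjr := isRealAnalyticPeriodic_actionDensity hU hG hX hs
  have hFr := hjr.sub (hjr.zero_fst (hU.zero_mem hρ))
  obtain ⟨k, hk, hke, -⟩ := exists_eq_snd_pow_mul hopen hs.pos hFr.1 (fun a ha => ho a (hsub ha))
  have hopk : IsOpen (U ρ ×ˢ ball (0 : ℂ) (τ' / 2)) := hopen.prod isOpen_ball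
  have hmem : (θ, (0 : ℂ)) ∈ U ρ ×ˢ ball (0 : ℂ) (τ' / 2) := ⟨hθ, mem_ball_self (half_pos hs.pos)⟩
  have hkc : ContinuousAt k (θ, 0) := hk.continuousOn.continuousAt (hopk.mem_nhds hmem)
  -- `k` is bounded near `(θ, 0)`
  obtain ⟨δ, hδ, hδs⟩ := Metric.mem_nhds_iff.1 (inter_mem (hopk.mem_nhds hmem)
    (hkc.norm.preimage_mem_nhds (Iio_mem_nhds (lt_add_one ‖k (θ, 0)‖))))
  have hprod : ∀ t ∈ ball θ δ, ∀ ε ∈ ball (0 : ℂ) δ, (t, ε) ∈ ball (θ, (0 : ℂ)) δ := fun t ht ε hε => by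
    rw [← ball_prod_same]; exact ⟨ht, hε⟩
  have hballU : ball θ δ ⊆ U ρ := fun t ht => (hδs (hprod t ht 0 (mem_ball_self hδ))).1.1
  refine IsBigO.of_bound (2 * (2 * (‖k (θ, 0)‖ + 1) / δ)) ?_
  filter_upwards [ball_mem_nhds (0 : ℂ) (show 0 < δ / 4 by positivity),
    ball_mem_nhds (0 : ℂ) hs.pos] with ε hε hετ
  have hεδ : ε ∈ ball (0 : ℂ) δ := ball_subset_ball (by linarith) hε
  have hder := hasDerivAt_actionDensity hU hG hX hs hετ (hballU.trans hsub)
    (mem_ball_zero_iff.1 hε)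
  have hkd : DifferentiableOn ℂ (fun t => k (t, ε)) (ball θ δ) :=
    hk.comp (f := fun t : ℂ => (t, ε)) (by fun_prop) (fun t ht => (hδs (hprod t ht ε hεδ)).1)
  have hkb := norm_deriv_le_of_bounded_ball hδ hkd
    (fun t ht => (show ‖k (t, ε)‖ < _ from (hδs (hprod t ht ε hεδ)).2).le)
  have hder2 : HasDerivAt (fun t => ε ^ 3 * actionDensity m N N₂ V Vd B (t, ε))
      (ε ^ (n + 4) * deriv (fun t => k (t, ε)) θ) θ := by
    have h1 : HasDerivAt (fun t => ε ^ 3 * actionDensity m N N₂ V Vd B (0, ε) +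
        ε ^ (n + 4) * k (t, ε)) (ε ^ (n + 4) * deriv (fun t => k (t, ε)) θ) θ :=
      (((hkd.differentiableAt (ball_mem_nhds θ hδ)).hasDerivAt).const_mul _).const_add _
    refine h1.congr_of_eventuallyEq ?_
    filter_upwards [ball_mem_nhds θ hδ] with t ht
    have h2 := hke (t, ε) (hδs (hprod t ht ε hεδ)).1
    simp only at h2
    linear_combination ε ^ 3 * h2
  have heq := hder.unique hder2
  have hVd : ‖Vd (θ, ε)‖ ≤ 1 / 2 := hs.norm_le_half hετ
    (hX.norm_Vd (θ, ε) ⟨hsub hθ, ball_subset_ball hs.le hετ⟩)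
  have hge : 1 / 2 ≤ ‖1 + Vd (θ, ε)‖ := by
    have := norm_sub_le (1 + Vd (θ, ε)) (Vd (θ, ε))
    rw [add_sub_cancel_right, norm_one] at this
    linarith
  have hn := congrArg norm heq
  rw [norm_mul, norm_mul] at hn
  have h5 : ‖ε ^ (n + 4)‖ * ‖deriv (fun t => k (t, ε)) θ‖ ≤
      ‖ε ^ (n + 4)‖ * (2 * (‖k (θ, 0)‖ + 1) / δ) := by gcongr
  set EL := P (θ - ε + V (θ - ε, ε)) (θ + V (θ, ε)) - P (θ + ε + V (θ + ε, ε)) (θ + V (θ, ε))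
  nlinarith [norm_nonneg EL]

end

/-! ### Holomorphic functions on strips -/

section strip

theorem isOpen_strip (σ : ℝ) : IsOpen (strip σ) :=
  isOpen_lt (by fun_prop) continuous_const

theorem strip_mono {σ σ' : ℝ} (h : σ ≤ σ') : strip σ ⊆ strip σ' := fun _ hz => lt_of_lt_of_le hz h

theorem convex_strip (σ : ℝ) : Convex ℝ (strip σ) := by
  have : strip σ = Complex.imLm ⁻¹' ball (0 : ℝ) σ := by
    ext z; simp [strip]
  rw [this]
  exact (convex_ball 0 σ).linear_preimage _

theorem strip_add_ofReal {σ : ℝ} {z : ℂ} (hz : z ∈ strip σ) (t : ℝ) : z + t ∈ strip σ := by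
  simpa [strip] using hz

theorem strip_add_one {σ : ℝ} {z : ℂ} (hz : z ∈ strip σ) : z + 1 ∈ strip σ := by
  simpa [strip] using hz

theorem strip_star {σ : ℝ} {z : ℂ} (hz : z ∈ strip σ) : star z ∈ strip σ := by
  simpa [strip] using hz

theorem ofReal_mem_strip {σ : ℝ} (hσ : 0 < σ) (t : ℝ) : (t : ℂ) ∈ strip σ := by
  simpa [strip] using hσ

theorem strip_add {σ σ' : ℝ} {z t : ℂ} (hz : z ∈ strip σ) (ht : ‖t‖ ≤ σ' - σ) :
    z + t ∈ strip σ' := by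
  have h1 := Complex.abs_im_le_norm t
  have h2 : |z.im| < σ := hz
  have : |(z + t).im| ≤ |z.im| + |t.im| := by rw [Complex.add_im]; exact abs_add_le _ _
  change |(z + t).im| < σ'
  linarith

theorem strip_ofReal_mul {σ : ℝ} {z : ℂ} (hz : z ∈ strip σ) {t : ℝ} (ht : t ∈ Icc (0 : ℝ) 1) :
    (t : ℂ) * z ∈ strip σ := by
  have h2 : |z.im| < σ := hz
  change |((t : ℂ) * z).im| < σ
  rw [Complex.im_ofReal_mul, abs_mul, abs_of_nonneg ht.1]
  exact lt_of_le_of_lt (mul_le_of_le_one_left (abs_nonneg _) ht.2) h2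

theorem star_intervalIntegral (f : ℝ → ℂ) (a b : ℝ) :
    star (∫ t in a..b, f t) = ∫ t in a..b, star (f t) := by
  simpa using (intervalIntegral.intervalIntegral_conj (f := f) (a := a) (b := b)
    (μ := MeasureTheory.volume)).symm

/-- A holomorphic function on a strip has a primitive, obtained by integration along rays. -/
theorem hasDerivAt_strip_primitive {σ : ℝ} {f : ℂ → ℂ}
    (hf : DifferentiableOn ℂ f (strip σ)) {z : ℂ} (hz : z ∈ strip σ) :
    HasDerivAt (fun z => z * ∫ t in (0 : ℝ)..1, f (t * z)) (f z) z := by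
  have hA : DifferentiableOn ℂ (fun z => ∫ t in (0 : ℝ)..1, f (t * z)) (strip σ) := by
    refine DifferentiableOn.intervalIntegral_param (isOpen_strip σ) (H := fun z t => f (t * z)) ?_ ?_
    · exact hf.continuousOn.comp (by fun_prop) fun q hq => strip_ofReal_mul hq.1 hq.2
    · intro t ht
      exact hf.comp (by fun_prop) fun z hz => strip_ofReal_mul hz ht
  have hAz := (hA.differentiableAt ((isOpen_strip σ).mem_nhds hz)).hasDerivAt
  have hd := (hasDerivAt_id z).mul hAz
  by_cases h0 : z = 0
  · exact hd.congr_deriv (by simp [h0])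
  · -- compare with the derivative along the ray through `z`
    set F : ℂ → ℂ := fun z => z * ∫ t in (0 : ℝ)..1, f (t * z) with hF
    have hFd : HasDerivAt F (1 * (∫ t in (0 : ℝ)..1, f (t * z)) +
        z * deriv (fun z => ∫ t in (0 : ℝ)..1, f (t * z)) z) z := hd
    set F' := 1 * (∫ t in (0 : ℝ)..1, f (t * z)) +
        z * deriv (fun z => ∫ t in (0 : ℝ)..1, f (t * z)) z with hF'
    have h1 : HasDerivAt (fun l : ℝ => F (l * z)) (F' * z) 1 := by
      have hl : HasDerivAt (fun l : ℝ => (l : ℂ) * z) z 1 := by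
        simpa using (Complex.ofRealCLM.hasDerivAt (x := 1)).mul_const z
      refine HasDerivAt.comp (𝕜 := ℝ) (𝕜' := ℂ) (1 : ℝ) (h₂ := F) (h := fun l : ℝ => (l : ℂ) * z) ?_ hl
      simpa using hFd
    have hfc : ContinuousOn (fun t : ℝ => z * f (t * z)) (Icc 0 1) :=
      continuousOn_const.mul (hf.continuousOn.comp (by fun_prop) fun t ht => strip_ofReal_mul hz ht)
    have hlt : |z.im| < σ := hz
    obtain ⟨δ, hδ, hδ'⟩ : ∃ δ > 0, ∀ t : ℝ, |t - 1| < δ → (t : ℂ) * z ∈ strip σ := by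
      have : Tendsto (fun t : ℝ => |((t : ℂ) * z).im|) (𝓝 1) (𝓝 |z.im|) := by
        have : Continuous (fun t : ℝ => |((t : ℂ) * z).im|) := by fun_prop
        simpa using this.tendsto 1
      have := this.eventually (gt_mem_nhds hlt)
      obtain ⟨δ, hδ, h⟩ := Metric.eventually_nhds_iff.1 this
      exact ⟨δ, hδ, fun t ht => h (by rwa [Real.dist_eq])⟩
    have h2 : HasDerivAt (fun l : ℝ => ∫ t in (0 : ℝ)..l, z * f (t * z)) (z * f z) 1 := by
      have hc1 : ContinuousAt (fun t : ℝ => z * f (t * z)) 1 := by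
        refine continuousAt_const.mul (ContinuousAt.comp (g := f)
          (f := fun t : ℝ => (t : ℂ) * z) ?_ (by fun_prop))
        simpa using (hf.differentiableAt ((isOpen_strip σ).mem_nhds hz)).continuousAt
      have hsm : StronglyMeasurableAtFilter (fun t : ℝ => z * f (t * z)) (𝓝 1) := by
        refine ContinuousOn.stronglyMeasurableAtFilter (s := ball 1 δ) isOpen_ball ?_ 1 (mem_ball_self hδ)
        exact continuousOn_const.mul (hf.continuousOn.comp (by fun_prop) fun t ht =>
          hδ' t (by simpa [Real.dist_eq] using ht))
      have := intervalIntegral.integral_hasDerivAt_right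
        (hfc.intervalIntegrable_of_Icc zero_le_one) hsm hc1
      simpa using this
    have h3 : (fun l : ℝ => F (l * z)) =ᶠ[𝓝 1] fun l : ℝ => ∫ t in (0 : ℝ)..l, z * f (t * z) := by
      filter_upwards [lt_mem_nhds (zero_lt_one (α := ℝ))] with l hl
      have := intervalIntegral.integral_comp_mul_left (a := 0) (b := 1) (fun t : ℝ => z * f (t * z)) hl.ne'
      simp only [mul_zero, mul_one] at this
      have h4 : ∫ t in (0 : ℝ)..l, z * f (t * z) = l • ∫ t in (0 : ℝ)..1, z * f ((l * t : ℝ) * z) := by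
        rw [this, smul_smul, mul_inv_cancel₀ hl.ne', one_smul]
      rw [h4, hF, intervalIntegral.integral_const_mul, Complex.real_smul]
      simp only [mul_assoc, Complex.ofReal_mul, mul_left_comm (l : ℂ)]
    have h5 := (h1.congr_of_eventuallyEq h3.symm).unique h2
    have h6 : F' = f z := by
      rw [mul_comm] at h5
      exact mul_left_cancel₀ h0 h5
    rw [← h6]
    exact hFd

theorem eqOn_strip_of_hasDerivAt {σ : ℝ} (hσ : 0 < σ) {f g f' : ℂ → ℂ}
    (hf : ∀ z ∈ strip σ, HasDerivAt f (f' z) z) (hg : ∀ z ∈ strip σ, HasDerivAt g (f' z) z)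
    (h0 : f 0 = g 0) : ∀ z ∈ strip σ, f z = g z := by
  intro z hz
  have h := (convex_strip σ).is_const_of_fderivWithin_eq_zero (𝕜 := ℂ) (f := fun z => f z - g z)
    (fun z hz => ((hf z hz).sub (hg z hz)).differentiableAt.differentiableWithinAt) (by
      intro z hz
      have : HasFDerivWithinAt (fun z => f z - g z) _ (strip σ) z :=
        ((hf z hz).sub (hg z hz)).hasFDerivAt.hasFDerivWithinAt
      rw [this.fderivWithin ((isOpen_strip σ).uniqueDiffWithinAt hz)]
      simp) hz (show (0 : ℂ) ∈ strip σ by simpa [strip] using hσ)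
  simp only [h0, sub_self] at h
  exact sub_eq_zero.1 h

/-- The primitive vanishing at `0` of a holomorphic function on a strip that is real on the reals
and periodic. -/
theorem exists_strip_primitive {σ : ℝ} (hσ : 0 < σ) {f : ℂ → ℂ}
    (hf : DifferentiableOn ℂ f (strip σ)) (h1 : ∀ z ∈ strip σ, f (z + 1) = f z)
    (hs : ∀ z ∈ strip σ, f (star z) = star (f z)) :
    ∃ F : ℂ → ℂ, F 0 = 0 ∧ (∀ z ∈ strip σ, HasDerivAt F (f z) z) ∧
      (∀ z ∈ strip σ, F (z + 1) = F z + ∫ t in (0 : ℝ)..1, f t) ∧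
      (∀ z ∈ strip σ, F (star z) = star (F z)) ∧
      ∀ B : ℝ, (∀ z ∈ strip σ, ‖f z‖ ≤ B) → ∀ z ∈ strip σ, ‖F z‖ ≤ ‖z‖ * B := by
  refine ⟨fun z => z * ∫ t in (0 : ℝ)..1, f (t * z), by simp,
    fun z hz => hasDerivAt_strip_primitive hf hz, ?_, ?_, ?_⟩
  · refine eqOn_strip_of_hasDerivAt hσ (f' := f) ?_ ?_ ?_
    · intro z hz
      have := (hasDerivAt_strip_primitive hf (strip_add_one hz)).comp_add_const z 1
      rwa [h1 z hz] at this
    · intro z hz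
      exact (hasDerivAt_strip_primitive hf hz).add_const _
    · simp
  · intro z hz
    simp only [star_mul', star_intervalIntegral]
    congr 1
    refine intervalIntegral.integral_congr fun t ht => ?_
    rw [uIcc_of_le zero_le_one] at ht
    have := hs _ (strip_ofReal_mul hz ht)
    simpa using this
  · intro B hB z hz
    rw [norm_mul]
    gcongr
    have := intervalIntegral.norm_integral_le_of_norm_le_const (a := 0) (b := 1) (C := B)
      (f := fun t : ℝ => f (t * z)) (fun t ht => hB _ (strip_ofReal_mul hz (by
        rw [uIoc_of_le zero_le_one] at ht; exact Ioc_subset_Icc_self ht)))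
    simpa using this

end strip

/-! ### Real-analytic reparametrizations of a strip -/

/-- A real-analytic change of the parameter `z` on the strip of half-width `R`: a function `χ` with
`χ(z + 1) = χ(z) + 1` whose derivative `g` has real part at least `b₀`, and its inverse `S`. -/
structure StripChart (b₀ B₀ R : ℝ) (g χ S : ℂ → ℂ) : Prop where
  b₀_pos : 0 < b₀
  R_pos : 0 < R
  differentiableOn : DifferentiableOn ℂ g (strip R)
  periodic : ∀ z ∈ strip R, g (z + 1) = g z
  g_star : ∀ z ∈ strip R, g (star z) = star (g z)
  le_re : ∀ z ∈ strip R, b₀ ≤ (g z).re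
  norm_le : ∀ z ∈ strip R, ‖g z‖ ≤ B₀
  lipschitz : ∀ z ∈ strip R, ∀ w ∈ strip R, ‖g z - g w‖ ≤ B₀ * ‖z - w‖
  map_zero : χ 0 = 0
  hasDerivAt : ∀ z ∈ strip R, HasDerivAt χ (g z) z
  map_add_one : ∀ z ∈ strip R, χ (z + 1) = χ z + 1
  map_star : ∀ z ∈ strip R, χ (star z) = star (χ z)
  le_norm_sub : ∀ z ∈ strip R, ∀ w ∈ strip R, b₀ * ‖z - w‖ ≤ ‖χ z - χ w‖
  left_inv : ∀ z ∈ strip R, S (χ z) = z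

/-- A holomorphic function on a strip whose derivative has real part at least `b₀` expands
distances by the factor `b₀`. -/
theorem le_norm_sub_of_le_re_deriv {R b₀ : ℝ} {g χ : ℂ → ℂ}
    (hχ : ∀ z ∈ strip R, HasDerivAt χ (g z) z) (hg : ∀ z ∈ strip R, b₀ ≤ (g z).re) {z w : ℂ}
    (hz : z ∈ strip R) (hw : w ∈ strip R) : b₀ * ‖z - w‖ ≤ ‖χ z - χ w‖ := by
  rcases eq_or_ne z w with rfl | hne
  · simp
  set d := z - w with hd
  have hd0 : 0 < ‖d‖ := norm_pos_iff.2 (sub_ne_zero.2 hne)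
  have hmem : ∀ t ∈ Icc (0 : ℝ) 1, w + t * d ∈ strip R := by
    intro t ht
    have := (convex_strip R).add_smul_sub_mem hw hz ht
    simpa using this
  -- the mean value theorem for the projection of `χ` to the direction of `z - w`
  have hder : ∀ t ∈ Icc (0 : ℝ) 1, HasDerivAt (fun t : ℝ => ((starRingEnd ℂ) d * χ (w + t * d)).re)
      (((starRingEnd ℂ) d * (g (w + t * d) * d)).re) t := by
    intro t ht
    have hl : HasDerivAt (fun t : ℝ => w + (t : ℂ) * d) d t := by
      simpa using ((Complex.ofRealCLM.hasDerivAt (x := t)).mul_const d).const_add w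
    have h1 : HasDerivAt (fun t : ℝ => χ (w + t * d)) (g (w + t * d) * d) t :=
      HasDerivAt.comp (𝕜 := ℝ) (𝕜' := ℂ) t (h₂ := χ) (h := fun t : ℝ => w + (t : ℂ) * d)
        (hχ _ (hmem t ht)) hl
    exact Complex.reCLM.hasFDerivAt.comp_hasDerivAt t (h1.const_mul _)
  obtain ⟨t, ht, heq⟩ := exists_hasDerivAt_eq_slope
    (fun t : ℝ => ((starRingEnd ℂ) d * χ (w + t * d)).re) _ zero_lt_one
    (fun t ht => (hder t ht).continuousAt.continuousWithinAt)
    (fun t ht => hder t (Ioo_subset_Icc_self ht))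
  have ht' := hmem t (Ioo_subset_Icc_self ht)
  have e1 : (starRingEnd ℂ) d * (g (w + t * d) * d) = ((‖d‖ ^ 2 : ℝ) : ℂ) * g (w + t * d) := by
    rw [mul_comm (g _) d, ← mul_assoc, mul_comm _ d, Complex.mul_conj, Complex.normSq_eq_norm_sq]
  have e2 : ((starRingEnd ℂ) d * (g (w + t * d) * d)).re = ((starRingEnd ℂ) d * (χ z - χ w)).re := by
    have hw1 : w + ((1 : ℝ) : ℂ) * d = z := by rw [hd]; push_cast; ring
    rw [heq, hw1, mul_sub ((starRingEnd ℂ) d), Complex.sub_re]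
    simp
  have e3 : ((starRingEnd ℂ) d * (χ z - χ w)).re ≤ ‖d‖ * ‖χ z - χ w‖ := by
    refine (Complex.re_le_norm _).trans ?_
    rw [norm_mul, RCLike.norm_conj]
  rw [← e2, e1, Complex.re_ofReal_mul] at e3
  have := mul_le_mul_of_nonneg_left (hg _ ht') (sq_nonneg ‖d‖)
  have h4 : ‖d‖ * (b₀ * ‖d‖) ≤ ‖d‖ * ‖χ z - χ w‖ := by nlinarith
  exact le_of_mul_le_mul_left h4 hd0

theorem exists_stripChart {b₀ B₀ R : ℝ} {g : ℂ → ℂ} (hb : 0 < b₀) (hR : 0 < R)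
    (hg : DifferentiableOn ℂ g (strip R)) (h1 : ∀ z ∈ strip R, g (z + 1) = g z)
    (hs : ∀ z ∈ strip R, g (star z) = star (g z)) (hre : ∀ z ∈ strip R, b₀ ≤ (g z).re)
    (hB : ∀ z ∈ strip R, ‖g z‖ ≤ B₀)
    (hlip : ∀ z ∈ strip R, ∀ w ∈ strip R, ‖g z - g w‖ ≤ B₀ * ‖z - w‖)
    (hint : ∫ t in (0 : ℝ)..1, g t = 1) : ∃ χ S : ℂ → ℂ, StripChart b₀ B₀ R g χ S := by
  obtain ⟨χ, h0, hd, hχ1, hχs, -⟩ := exists_strip_primitive hR hg h1 hs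
  have hle : ∀ z ∈ strip R, ∀ w ∈ strip R, b₀ * ‖z - w‖ ≤ ‖χ z - χ w‖ := fun z hz w hw =>
    le_norm_sub_of_le_re_deriv hd hre hz hw
  have hinj : InjOn χ (strip R) := by
    intro z hz w hw h
    have := hle z hz w hw
    rw [h, sub_self, norm_zero] at this
    have h2 : ‖z - w‖ ≤ 0 := by
      by_contra hc
      push Not at hc
      nlinarith
    exact sub_eq_zero.1 (norm_le_zero_iff.1 h2)
  refine ⟨χ, Function.invFunOn χ (strip R), hb, hR, hg, h1, hs, hre, hB, hlip, h0, hd, ?_, hχs, hle,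
    fun z hz => hinj.leftInvOn_invFunOn hz⟩
  intro z hz
  rw [hχ1 z hz, hint]

/-- A periodic holomorphic function on a strip of half-width at most `1` with mean zero has a
periodic primitive, bounded by twice the bound of the function. -/
theorem exists_periodic_strip_primitive {ρ : ℝ} (hρ : 0 < ρ) (hρ1 : ρ ≤ 1) {f : ℂ → ℂ} {B : ℝ}
    (hf : DifferentiableOn ℂ f (strip ρ)) (h1 : ∀ z ∈ strip ρ, f (z + 1) = f z)
    (hs : ∀ z ∈ strip ρ, f (star z) = star (f z)) (hB : ∀ z ∈ strip ρ, ‖f z‖ ≤ B)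
    (hint : ∫ t in (0 : ℝ)..1, f t = 0) :
    ∃ F : ℂ → ℂ, (∀ z ∈ strip ρ, HasDerivAt F (f z) z) ∧
      (∀ z ∈ strip ρ, F (z + 1) = F z) ∧ (∀ z ∈ strip ρ, F (star z) = star (F z)) ∧
      ∀ z ∈ strip ρ, ‖F z‖ ≤ 2 * B := by
  obtain ⟨F, -, hd, hF1, hFs, hFB⟩ := exists_strip_primitive hρ hf h1 hs
  have hp : ∀ z ∈ strip ρ, F (z + 1) = F z := fun z hz => by rw [hF1 z hz, hint, add_zero]
  have hB0 : 0 ≤ B := (norm_nonneg _).trans (hB _ (ofReal_mem_strip hρ 0))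
  have hnat : ∀ n : ℕ, ∀ z ∈ strip ρ, F (z + n) = F z := by
    intro n
    induction n with
    | zero => simp
    | succ n ih =>
      intro z hz
      have := hp (z + n) (by simpa using strip_add_ofReal hz n)
      rw [← ih z hz, ← this]
      push_cast
      ring_nf
  have hZ : ∀ n : ℤ, ∀ z ∈ strip ρ, F (z + n) = F z := by
    intro n z hz
    rcases Int.eq_nat_or_neg n with ⟨k, rfl | rfl⟩
    · exact_mod_cast hnat k z hz
    · have := hnat k (z + ((-(k : ℤ) : ℤ) : ℂ)) (by
        simpa using strip_add_ofReal hz (-(k : ℝ)))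
      rw [← this]
      congr 1
      push_cast
      ring
  refine ⟨F, hd, hp, hFs, fun z hz => ?_⟩
  have hz' : z + ((-⌊z.re⌋ : ℤ) : ℂ) ∈ strip ρ := by
    have := strip_add_ofReal hz (((-⌊z.re⌋ : ℤ) : ℝ))
    rwa [Complex.ofReal_intCast] at this
  rw [← hZ (-⌊z.re⌋) z hz]
  refine (hFB B hB _ hz').trans (mul_le_mul_of_nonneg_right ?_ hB0)
  have h2 : (z + ((-⌊z.re⌋ : ℤ) : ℂ)).re = Int.fract z.re := by
    simp [Int.fract, sub_eq_add_neg]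
  have h3 : |z.im| < ρ := hz
  have h4 : (z + ((-⌊z.re⌋ : ℤ) : ℂ)).im = z.im := by simp
  refine (Complex.norm_le_abs_re_add_abs_im _).trans ?_
  rw [h2, h4, abs_of_nonneg (Int.fract_nonneg _)]
  linarith [Int.fract_lt_one z.re]

namespace StripChart

variable {b₀ B₀ R : ℝ} {g χ S : ℂ → ℂ} (h : StripChart b₀ B₀ R g χ S)
include h

theorem b₀_le_B₀ : b₀ ≤ B₀ := by
  have h0 := ofReal_mem_strip h.R_pos 0
  exact (h.le_re _ h0).trans ((Complex.re_le_norm _).trans (h.norm_le _ h0))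

theorem B₀_pos : 0 < B₀ := h.b₀_pos.trans_le h.b₀_le_B₀

theorem g_ne_zero {z : ℂ} (hz : z ∈ strip R) : g z ≠ 0 := by
  intro h0
  have := h.le_re z hz
  rw [h0, Complex.zero_re] at this
  exact absurd h.b₀_pos (not_lt.2 this)

theorem b₀_le_norm {z : ℂ} (hz : z ∈ strip R) : b₀ ≤ ‖g z‖ :=
  (h.le_re z hz).trans (Complex.re_le_norm _)

theorem integral_eq_one : ∫ t in (0 : ℝ)..1, g t = 1 := by
  have h2 : ∀ t : ℝ, HasDerivAt (fun t : ℝ => χ t) (g t) t := fun t =>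
    (h.hasDerivAt _ (ofReal_mem_strip h.R_pos t)).comp_ofReal
  have h3 : Continuous fun t : ℝ => g t :=
    h.differentiableOn.continuousOn.comp_continuous (by fun_prop) (ofReal_mem_strip h.R_pos)
  rw [intervalIntegral.integral_eq_sub_of_hasDerivAt (fun t _ => h2 t)
    (h3.intervalIntegrable _ _)]
  have := h.map_add_one 0 (by simpa using ofReal_mem_strip h.R_pos 0)
  simp only [zero_add] at this
  simp [this, h.map_zero]

theorem S_mem {ρ : ℝ} (hρ : ρ ≤ R) {θ : ℂ} (hθ : θ ∈ χ '' strip ρ) : S θ ∈ strip ρ := by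
  obtain ⟨z, hz, rfl⟩ := hθ
  rwa [h.left_inv z (strip_mono hρ hz)]

theorem χ_S {θ : ℂ} (hθ : θ ∈ χ '' strip R) : χ (S θ) = θ := by
  obtain ⟨z, hz, rfl⟩ := hθ
  rw [h.left_inv z hz]

theorem norm_S_sub_le {θ θ' : ℂ} (hθ : θ ∈ χ '' strip R) (hθ' : θ' ∈ χ '' strip R) :
    b₀ * ‖S θ - S θ'‖ ≤ ‖θ - θ'‖ := by
  have := h.le_norm_sub _ (h.S_mem le_rfl hθ) _ (h.S_mem le_rfl hθ')
  rwa [h.χ_S hθ, h.χ_S hθ'] at this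

theorem norm_χ_sub_le {z w : ℂ} (hz : z ∈ strip R) (hw : w ∈ strip R) :
    ‖χ z - χ w‖ ≤ B₀ * ‖z - w‖ :=
  (convex_strip R).norm_image_sub_le_of_norm_hasDerivWithin_le
    (fun z hz => (h.hasDerivAt z hz).hasDerivWithinAt) h.norm_le hw hz

/-- The image of a disc under the chart contains a disc of radius proportional to `b₀`. -/
theorem ball_subset_image {z : ℂ} {r : ℝ} (hr : 0 < r) (hz : closedBall z r ⊆ strip R) :
    ball (χ z) (b₀ * r / 2) ⊆ χ '' closedBall z r := by
  have hd : DiffContOnCl ℂ χ (ball z r) := by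
    refine DifferentiableOn.diffContOnCl (fun w hw => ?_)
    rw [closure_ball z hr.ne'] at hw
    exact (h.hasDerivAt w (hz hw)).differentiableAt.differentiableWithinAt
  refine hd.ball_subset_image_closedBall hr (fun w hw => ?_) ?_
  · have := h.le_norm_sub w (hz (sphere_subset_closedBall hw)) z (hz (mem_closedBall_self hr.le))
    rwa [mem_sphere_iff_norm.1 hw] at this
  · by_contra hc
    have hc' : ∀ᶠ w in 𝓝 z, χ w = χ z := by simpa using Filter.not_frequently.1 hc
    have hm : z ∈ strip R := hz (mem_closedBall_self hr.le)
    have := (h.hasDerivAt z hm).unique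
      ((hasDerivAt_const z (χ z)).congr_of_eventuallyEq hc')
    exact h.g_ne_zero hm this

theorem add_mem {ρ ρ' : ℝ} {θ t : ℂ} (hρ : ρ < ρ') (hρ' : ρ' ≤ R) (hθ : θ ∈ χ '' strip ρ)
    (ht : ‖t‖ < b₀ / 4 * (ρ' - ρ)) : θ + t ∈ χ '' strip ρ' := by
  obtain ⟨z, hz, rfl⟩ := hθ
  have hsub : closedBall z ((ρ' - ρ) / 2) ⊆ strip ρ' := by
    intro w hw
    have := strip_add (σ' := ρ') hz (t := w - z) (by
      rw [mem_closedBall, dist_eq_norm] at hw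
      linarith)
    simpa using this
  refine image_mono hsub ?_
  refine h.ball_subset_image (by linarith) (hsub.trans (strip_mono hρ')) ?_
  rw [mem_ball, dist_eq_norm, add_sub_cancel_left]
  linarith

theorem isOpen_image {ρ : ℝ} (hρ : ρ ≤ R) : IsOpen (χ '' strip ρ) := by
  rw [Metric.isOpen_iff]
  rintro _ ⟨z, hz, rfl⟩
  obtain ⟨r, hr, hb⟩ := Metric.isOpen_iff.1 (isOpen_strip ρ) z hz
  have hsub : closedBall z (r / 2) ⊆ strip ρ := (closedBall_subset_ball (by linarith)).trans hb
  refine ⟨b₀ * (r / 2) / 2, by have := h.b₀_pos; positivity, ?_⟩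
  exact (h.ball_subset_image (by linarith) (hsub.trans (strip_mono hρ))).trans (image_mono hsub)

theorem hasDerivAt_S {θ : ℂ} (hθ : θ ∈ χ '' strip R) : HasDerivAt S (g (S θ))⁻¹ θ := by
  have hO := h.isOpen_image le_rfl
  refine HasDerivAt.of_local_left_inverse ?_ (h.hasDerivAt _ (h.S_mem le_rfl hθ))
    (h.g_ne_zero (h.S_mem le_rfl hθ)) ?_
  · rw [Metric.continuousAt_iff]
    intro ε hε
    have h1 : ∀ᶠ y in 𝓝 θ, y ∈ χ '' strip R ∧ dist y θ < b₀ * ε :=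
      (show ∀ᶠ y in 𝓝 θ, y ∈ χ '' strip R from hO.mem_nhds hθ).and (ball_mem_nhds θ (mul_pos h.b₀_pos hε))
    obtain ⟨δ, hδ, h2⟩ := Metric.eventually_nhds_iff.1 h1
    refine ⟨δ, hδ, fun y hy => ?_⟩
    obtain ⟨h3, h4⟩ := h2 hy
    have := h.norm_S_sub_le h3 hθ
    rw [dist_eq_norm] at h4 ⊢
    exact lt_of_mul_lt_mul_left (this.trans_lt h4) h.b₀_pos.le
  · filter_upwards [hO.mem_nhds hθ] with y hy using h.χ_S hy

theorem differentiableOn_S : DifferentiableOn ℂ S (χ '' strip R) := fun _ hθ =>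
  (h.hasDerivAt_S hθ).differentiableAt.differentiableWithinAt

theorem image_add_one {ρ : ℝ} (hρ : ρ ≤ R) {θ : ℂ} (hθ : θ ∈ χ '' strip ρ) :
    θ + 1 ∈ χ '' strip ρ := by
  obtain ⟨z, hz, rfl⟩ := hθ
  exact ⟨z + 1, strip_add_one hz, h.map_add_one z (strip_mono hρ hz)⟩

theorem image_star {ρ : ℝ} (hρ : ρ ≤ R) {θ : ℂ} (hθ : θ ∈ χ '' strip ρ) :
    star θ ∈ χ '' strip ρ := by
  obtain ⟨z, hz, rfl⟩ := hθ
  exact ⟨star z, strip_star hz, h.map_star z (strip_mono hρ hz)⟩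

theorem S_add_one {θ : ℂ} (hθ : θ ∈ χ '' strip R) : S (θ + 1) = S θ + 1 := by
  obtain ⟨z, hz, rfl⟩ := hθ
  rw [← h.map_add_one z hz, h.left_inv z hz, h.left_inv _ (strip_add_one hz)]

theorem S_star {θ : ℂ} (hθ : θ ∈ χ '' strip R) : S (star θ) = star (S θ) := by
  obtain ⟨z, hz, rfl⟩ := hθ
  rw [← h.map_star z hz, h.left_inv z hz, h.left_inv _ (strip_star hz)]

/-- The images of the strips under a chart form a strip family. -/
theorem stripFamily (hR1 : R ≤ 1) {ρ₁ : ℝ} (hρ₁ : ρ₁ ≤ R) :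
    StripFamily (b₀ / 4) (2 * (1 + B₀) ^ 2) ρ₁ (fun ρ => χ '' strip ρ) where
  b_pos := by have := h.b₀_pos; positivity
  isOpen := fun ρ hρ => h.isOpen_image (hρ.trans hρ₁)
  add_mem := fun hρ hρ' hθ ht => h.add_mem hρ (hρ'.trans hρ₁) hθ ht
  add_one := fun hρ hθ => h.image_add_one (hρ.trans hρ₁) hθ
  star_mem := fun hρ hθ => h.image_star (hρ.trans hρ₁) hθ
  zero_mem := fun hρ => ⟨0, by simpa using ofReal_mem_strip hρ 0, h.map_zero⟩
  primitive := by
    intro ρ hρ hρρ B f hf h1 hs hB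
    have hρR := hρρ.trans hρ₁
    have hsub := strip_mono hρR
    have hχm : ∀ {z}, z ∈ strip ρ → χ z ∈ χ '' strip ρ := fun hz => mem_image_of_mem χ hz
    have hB₀ := h.B₀_pos
    have hBn : 0 ≤ B := (norm_nonneg _).trans (hB _ (hχm (ofReal_mem_strip hρ 0)))
    have hfχ : DifferentiableOn ℂ (fun z => f (χ z)) (strip ρ) :=
      hf.comp (fun z hz => (h.hasDerivAt z (hsub hz)).differentiableAt.differentiableWithinAt)
        fun z hz => hχm hz
    set e : ℂ := ∫ t in (0 : ℝ)..1, f (χ t) * g t with he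
    have hes : star e = e := by
      rw [he, star_intervalIntegral]
      refine intervalIntegral.integral_congr fun t _ => ?_
      have ht := ofReal_mem_strip hρ t
      have e1 := h.g_star _ (hsub ht)
      have e2 := h.map_star _ (hsub ht)
      have e3 := hs _ (hχm ht)
      rw [← e2] at e3
      simp only [RCLike.star_def, Complex.conj_ofReal] at e1 e2 e3
      simp only [star_mul', RCLike.star_def, ← e1, ← e3]
    have hen : ‖e‖ ≤ B * B₀ := by
      have := intervalIntegral.norm_integral_le_of_norm_le_const (a := 0) (b := 1) (C := B * B₀)
        (f := fun t : ℝ => f (χ t) * g t) (fun t _ => by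
          rw [norm_mul]
          exact mul_le_mul (hB _ (hχm (ofReal_mem_strip hρ t)))
            (h.norm_le _ (ofReal_mem_strip h.R_pos t)) (norm_nonneg _) hBn)
      simpa using this
    have hfe : ∀ θ ∈ χ '' strip ρ, ‖f θ - e‖ ≤ B * (1 + B₀) := by
      intro θ hθ
      have := norm_sub_le (f θ) e
      have := hB θ hθ
      nlinarith
    obtain ⟨F, hFd, hF1, hFs, hFB⟩ := exists_periodic_strip_primitive hρ (hρR.trans hR1)
      (f := fun z => (f (χ z) - e) * g z) (B := B * (1 + B₀) * B₀)
      ((hfχ.sub_const e).mul (h.differentiableOn.mono hsub))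
      (fun z hz => by
        simp only [h.periodic z (hsub hz), h.map_add_one z (hsub hz), h1 _ (hχm hz)])
      (fun z hz => by
        simp only [h.g_star z (hsub hz), h.map_star z (hsub hz), hs _ (hχm hz), star_mul', star_sub, hes])
      (fun z hz => by
        rw [norm_mul]
        exact mul_le_mul (hfe _ (hχm hz)) (h.norm_le _ (hsub hz)) (norm_nonneg _) (by positivity))
      (by
        have c1 : Continuous fun t : ℝ => f (χ t) * g t :=
          (hfχ.mul (h.differentiableOn.mono hsub)).continuousOn.comp_continuous
            (by fun_prop) (ofReal_mem_strip hρ)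
        have c2 : Continuous fun t : ℝ => e * g t :=
          ((h.differentiableOn.mono hsub).const_mul e).continuousOn.comp_continuous
            (by fun_prop) (ofReal_mem_strip hρ)
        simp only [sub_mul]
        rw [intervalIntegral.integral_sub (c1.intervalIntegrable _ _) (c2.intervalIntegrable _ _),
          intervalIntegral.integral_const_mul, h.integral_eq_one, mul_one, sub_self])
    have hSm : ∀ {θ}, θ ∈ χ '' strip ρ → S θ ∈ strip ρ := fun hθ => h.S_mem hρR hθ
    have hIm : χ '' strip ρ ⊆ χ '' strip R := image_mono (strip_mono hρR)
    have hle1 : 2 * (B * (1 + B₀) * B₀) ≤ 2 * (1 + B₀) ^ 2 * B := by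
      have : 0 ≤ B * (1 + B₀) := by positivity
      nlinarith
    have hle2 : B * (1 + B₀) ≤ 2 * (1 + B₀) ^ 2 * B := by
      have h1 : 0 ≤ B * (1 + B₀) := by positivity
      have h2 : 0 ≤ B * (1 + B₀) * B₀ := by positivity
      nlinarith
    refine ⟨e, fun θ => F (S θ), hes, ?_, ?_, ?_, fun θ hθ => (hFB _ (hSm hθ)).trans hle1,
      fun θ hθ => (hfe θ hθ).trans hle2⟩
    · intro θ hθ
      have := (hFd _ (hSm hθ)).comp θ (h.hasDerivAt_S (hIm hθ))
      rw [h.χ_S (hIm hθ), mul_assoc, mul_inv_cancel₀ (h.g_ne_zero (hsub (hSm hθ))), mul_one] at this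
      exact this
    · intro θ hθ
      simp only [h.S_add_one (hIm hθ), hF1 _ (hSm hθ)]
    · intro θ hθ
      simp only [h.S_star (hIm hθ), hFs _ (hSm hθ)]

end StripChart

/-! ### Chords of a complexified curve -/

section chordMean

/-- The mean of `f` over the segment from `s` to `s'`. For the complexified tangent vector this is
the chord divided by the difference of the parameters, and it stays holomorphic at `s = s'`. -/
noncomputable def chordMean (f : ℂ → ℂ) (s s' : ℂ) : ℂ := ∫ t in (0 : ℝ)..1, f (s + t * (s' - s))

theorem strip_segment_mem {R : ℝ} {s s' : ℂ} (hs : s ∈ strip R) (hs' : s' ∈ strip R) {t : ℝ}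
    (ht : t ∈ Icc (0 : ℝ) 1) : s + t * (s' - s) ∈ strip R := by
  simpa using (convex_strip R).add_smul_sub_mem hs hs' ht

theorem chordMean_comm (f : ℂ → ℂ) (s s' : ℂ) : chordMean f s s' = chordMean f s' s := by
  have := intervalIntegral.integral_comp_sub_left (a := 0) (b := 1)
    (fun t : ℝ => f (s' + t * (s - s'))) 1
  simp only [sub_zero, sub_self] at this
  rw [chordMean, chordMean, ← this]
  refine intervalIntegral.integral_congr fun t _ => ?_
  congr 1
  push_cast
  ring

theorem chordMean_add_one {R : ℝ} {f : ℂ → ℂ} (hf : ∀ z ∈ strip R, f (z + 1) = f z) {s s' : ℂ}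
    (hs : s ∈ strip R) (hs' : s' ∈ strip R) : chordMean f (s + 1) (s' + 1) = chordMean f s s' := by
  refine intervalIntegral.integral_congr fun t ht => ?_
  rw [uIcc_of_le zero_le_one] at ht
  rw [← hf _ (strip_segment_mem hs hs' ht)]
  congr 1
  ring

theorem chordMean_star {R : ℝ} {f g : ℂ → ℂ} (hf : ∀ z ∈ strip R, f (star z) = star (g z))
    {s s' : ℂ} (hs : s ∈ strip R) (hs' : s' ∈ strip R) :
    chordMean f (star s) (star s') = star (chordMean g s s') := by
  rw [chordMean, chordMean, star_intervalIntegral]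
  refine intervalIntegral.integral_congr fun t ht => ?_
  rw [uIcc_of_le zero_le_one] at ht
  rw [← hf _ (strip_segment_mem hs hs' ht)]
  simp

theorem differentiableOn_chordMean {R : ℝ} {f : ℂ → ℂ} (hf : DifferentiableOn ℂ f (strip R)) :
    DifferentiableOn ℂ (fun p : ℂ × ℂ => chordMean f p.1 p.2) (strip R ×ˢ strip R) := by
  refine DifferentiableOn.intervalIntegral_param ((isOpen_strip R).prod (isOpen_strip R))
    (H := fun p t => f (p.1 + t * (p.2 - p.1))) ?_ ?_
  · exact hf.continuousOn.comp (by fun_prop) fun q hq => strip_segment_mem hq.1.1 hq.1.2 hq.2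
  · intro t ht
    exact hf.comp (by fun_prop) fun q hq => strip_segment_mem hq.1 hq.2 ht

theorem continuousOn_segment {R : ℝ} {f : ℂ → ℂ} (hf : DifferentiableOn ℂ f (strip R)) {s s' : ℂ}
    (hs : s ∈ strip R) (hs' : s' ∈ strip R) :
    ContinuousOn (fun t : ℝ => f (s + t * (s' - s))) (Icc 0 1) :=
  hf.continuousOn.comp (by fun_prop) fun _ ht => strip_segment_mem hs hs' ht

theorem sub_mul_chordMean {R : ℝ} {f F : ℂ → ℂ} (hf : DifferentiableOn ℂ f (strip R))
    (hF : ∀ z ∈ strip R, HasDerivAt F (f z) z) {s s' : ℂ} (hs : s ∈ strip R) (hs' : s' ∈ strip R) :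
    (s' - s) * chordMean f s s' = F s' - F s := by
  have h1 : ∀ t ∈ uIcc (0 : ℝ) 1, HasDerivAt (fun t : ℝ => F (s + t * (s' - s)))
      ((s' - s) * f (s + t * (s' - s))) t := by
    intro t ht
    rw [uIcc_of_le zero_le_one] at ht
    have hl : HasDerivAt (fun t : ℝ => s + (t : ℂ) * (s' - s)) (s' - s) t := by
      simpa using ((Complex.ofRealCLM.hasDerivAt (x := t)).mul_const (s' - s)).const_add s
    rw [mul_comm]
    exact HasDerivAt.comp (𝕜 := ℝ) (𝕜' := ℂ) t (h₂ := F) (h := fun t : ℝ => s + (t : ℂ) * (s' - s))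
      (hF _ (strip_segment_mem hs hs' ht)) hl
  have := intervalIntegral.integral_eq_sub_of_hasDerivAt h1
    ((continuousOn_const.mul (continuousOn_segment hf hs hs')).intervalIntegrable_of_Icc zero_le_one)
  rw [chordMean, ← intervalIntegral.integral_const_mul, this]
  simp

theorem hasDerivAt_sub_mul_chordMean {R : ℝ} {f F : ℂ → ℂ} (hf : DifferentiableOn ℂ f (strip R))
    (hF : ∀ z ∈ strip R, HasDerivAt F (f z) z) {s s' : ℂ} (hs : s ∈ strip R) (hs' : s' ∈ strip R) :
    HasDerivAt (fun x => (x - s) * chordMean f s x) (f s') s' := by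
  refine ((hF s' hs').sub_const (F s)).congr_of_eventuallyEq ?_
  filter_upwards [(isOpen_strip R).mem_nhds hs'] with x hx using sub_mul_chordMean hf hF hs hx

end chordMean

/-- The complexification of an arclength parametrized curve `r = (r₁, r₂)` of the plane on the strip
of half-width `R`: `u = r₁ + i r₂` and `v = r₁ - i r₂` with their derivatives `p` and `q`, and the
curvature `κ`. The lower bound `β` for the curvature and the upper bounds `Λ` hold on the whole
strip. -/
structure CurveFrame (Λ β R : ℝ) (u v p q κ : ℂ → ℂ) : Prop where
  one_le : 1 ≤ Λ
  β_pos : 0 < β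
  β_le_one : β ≤ 1
  R_pos : 0 < R
  R_le_one : R ≤ 1
  hasDerivAt_u : ∀ z ∈ strip R, HasDerivAt u (p z) z
  hasDerivAt_v : ∀ z ∈ strip R, HasDerivAt v (q z) z
  hasDerivAt_p : ∀ z ∈ strip R, HasDerivAt p (Complex.I * κ z * p z) z
  hasDerivAt_q : ∀ z ∈ strip R, HasDerivAt q (-Complex.I * κ z * q z) z
  differentiableOn_κ : DifferentiableOn ℂ κ (strip R)
  mul_eq_one : ∀ z ∈ strip R, p z * q z = 1
  p_add_one : ∀ z ∈ strip R, p (z + 1) = p z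
  q_add_one : ∀ z ∈ strip R, q (z + 1) = q z
  κ_add_one : ∀ z ∈ strip R, κ (z + 1) = κ z
  p_star : ∀ z ∈ strip R, p (star z) = star (q z)
  κ_star : ∀ z ∈ strip R, κ (star z) = star (κ z)
  norm_p : ∀ z ∈ strip R, ‖p z‖ ≤ Λ
  norm_q : ∀ z ∈ strip R, ‖q z‖ ≤ Λ
  norm_κ : ∀ z ∈ strip R, ‖κ z‖ ≤ Λ
  lipschitz_κ : ∀ z ∈ strip R, ∀ w ∈ strip R, ‖κ z - κ w‖ ≤ Λ * ‖z - w‖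
  le_re : ∀ z ∈ strip R, β ≤ (κ z).re

/-- The square root of the product of the chord means of `p` and `q`: the chord length divided by
the difference of the parameters. -/
noncomputable def chordRatio (p q : ℂ → ℂ) (s s' : ℂ) : ℂ :=
  Complex.exp (Complex.log (chordMean p s s' * chordMean q s s') / 2)

/-- The angle at `r(s)` from the tangent to the chord through `r(s)` and `r(s')`, oriented so that
it is holomorphic in `(s, s')` and has the sign of `s' - s`. -/
noncomputable def chordAngle (p q : ℂ → ℂ) (s s' : ℂ) : ℂ :=
  -Complex.I / 2 * (Complex.log (q s * chordMean p s s') - Complex.log (p s * chordMean q s s'))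

/-- First-order Taylor estimate for a solution of `f' = j κ f` along a segment, with `k f = 1`. -/
theorem norm_mul_chordMean_sub_le {R Λ : ℝ} {f k κ : ℂ → ℂ} {j : ℂ} (hΛ : 1 ≤ Λ) (hj : ‖j‖ = 1)
    (hf : ∀ z ∈ strip R, HasDerivAt f (j * κ z * f z) z) (hkf : ∀ z ∈ strip R, k z * f z = 1)
    (hfn : ∀ z ∈ strip R, ‖f z‖ ≤ Λ) (hkn : ∀ z ∈ strip R, ‖k z‖ ≤ Λ)
    (hκn : ∀ z ∈ strip R, ‖κ z‖ ≤ Λ)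
    (hκl : ∀ z ∈ strip R, ∀ w ∈ strip R, ‖κ z - κ w‖ ≤ Λ * ‖z - w‖)
    {s s' : ℂ} (hs : s ∈ strip R) (hs' : s' ∈ strip R) :
    ‖k s * chordMean f s s' - (1 + j * κ s * (s' - s) / 2)‖ ≤ 2 * Λ ^ 4 * ‖s' - s‖ ^ 2 := by
  have hΛ0 : 0 < Λ := by linarith
  have hfl : ∀ z ∈ strip R, ‖f z - f s‖ ≤ Λ ^ 2 * ‖z - s‖ := fun z hz =>
    (convex_strip R).norm_image_sub_le_of_norm_hasDerivWithin_le
      (fun z hz => (hf z hz).hasDerivWithinAt) (fun z hz => by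
        rw [norm_mul, norm_mul, hj, one_mul, sq]
        exact mul_le_mul (hκn z hz) (hfn z hz) (norm_nonneg _) hΛ0.le) hs hz
  set h := s' - s with hh
  have hT : ∀ t ∈ Icc (0 : ℝ) 1,
      ‖f (s + t * h) - f s - j * κ s * f s * (t * h)‖ ≤ 2 * Λ ^ 3 * ‖h‖ ^ 2 := by
    intro t ht
    have hsub : segment ℝ s s' ⊆ strip R := (convex_strip R).segment_subset hs hs'
    have hmem : s + t * h ∈ segment ℝ s s' := by
      rw [segment_eq_image']
      exact ⟨t, ht, by simp [hh]⟩
    have hder : ∀ z ∈ segment ℝ s s', HasDerivWithinAt (fun z => f z - j * κ s * f s * z)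
        (j * κ z * f z - j * κ s * f s) (segment ℝ s s') z := fun z hz => by
      have : HasDerivAt (fun z => f z - j * κ s * f s * z) _ z :=
        (hf z (hsub hz)).sub ((hasDerivAt_id z).const_mul (j * κ s * f s))
      simpa using this.hasDerivWithinAt (s := segment ℝ s s')
    have hbd : ∀ z ∈ segment ℝ s s', ‖j * κ z * f z - j * κ s * f s‖ ≤ 2 * Λ ^ 3 * ‖h‖ := by
      intro z hz
      have hzs : ‖z - s‖ ≤ ‖h‖ := norm_sub_le_of_mem_segment hz
      have e : j * κ z * f z - j * κ s * f s = j * ((κ z - κ s) * f z + κ s * (f z - f s)) := by ring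
      rw [e, norm_mul, hj, one_mul]
      have h1 : ‖(κ z - κ s) * f z‖ ≤ Λ * ‖h‖ * Λ := by
        rw [norm_mul]
        exact mul_le_mul ((hκl z (hsub hz) s hs).trans (by gcongr)) (hfn z (hsub hz))
          (norm_nonneg _) (by positivity)
      have h2 : ‖κ s * (f z - f s)‖ ≤ Λ * (Λ ^ 2 * ‖h‖) := by
        rw [norm_mul]
        exact mul_le_mul (hκn s hs) ((hfl z (hsub hz)).trans (by gcongr))
          (norm_nonneg _) (by positivity)
      have h3 : Λ * ‖h‖ * Λ ≤ Λ ^ 3 * ‖h‖ := by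
        have : Λ ^ 2 * 1 ≤ Λ ^ 2 * Λ := by gcongr
        have := mul_le_mul_of_nonneg_right this (norm_nonneg h)
        nlinarith
      have := norm_add_le ((κ z - κ s) * f z) (κ s * (f z - f s))
      nlinarith
    have := (convex_segment s s').norm_image_sub_le_of_norm_hasDerivWithin_le hder hbd
      (left_mem_segment ℝ s s') hmem
    have e1 : f (s + t * h) - j * κ s * f s * (s + t * h) - (f s - j * κ s * f s * s) =
      f (s + t * h) - f s - j * κ s * f s * (t * h) := by ring
    rw [e1, add_sub_cancel_left, norm_mul] at this
    refine this.trans ?_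
    have h5 : ‖(t : ℂ)‖ ≤ 1 := by simpa [abs_of_nonneg ht.1] using ht.2
    calc 2 * Λ ^ 3 * ‖h‖ * (‖(t : ℂ)‖ * ‖h‖) ≤ 2 * Λ ^ 3 * ‖h‖ * (1 * ‖h‖) := by gcongr
      _ = _ := by ring
  have hfd : DifferentiableOn ℂ f (strip R) := fun z hz =>
    (hf z hz).differentiableAt.differentiableWithinAt
  have hc : IntervalIntegrable (fun t : ℝ => k s * f (s + t * h)) MeasureTheory.volume 0 1 :=
    (continuousOn_const.mul (continuousOn_segment hfd hs hs')).intervalIntegrable_of_Icc zero_le_one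
  have hc' : IntervalIntegrable (fun t : ℝ => j * κ s * ((t : ℂ) * h)) MeasureTheory.volume 0 1 :=
    Continuous.intervalIntegrable (by fun_prop) _ _
  have hint : ∫ t in (0 : ℝ)..1, (k s * f (s + t * h) - j * κ s * ((t : ℂ) * h)) =
      k s * chordMean f s s' - j * κ s * h / 2 := by
    have hi : ∫ t in (0 : ℝ)..1, (t : ℂ) = 1 / 2 := by
      rw [intervalIntegral.integral_ofReal]; norm_num
    rw [intervalIntegral.integral_sub hc hc', intervalIntegral.integral_const_mul,
      intervalIntegral.integral_const_mul, intervalIntegral.integral_mul_const, hi, chordMean]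
    ring
  have := norm_intervalIntegral_sub_const_le (c := 1) (K := 2 * Λ ^ 4 * ‖h‖ ^ 2)
    (hc.sub hc')
    (fun t ht => by
      have e : k s * f (s + t * h) - j * κ s * (t * h) - 1 =
          k s * (f (s + t * h) - f s - j * κ s * f s * (t * h)) := by
        have := hkf s hs
        linear_combination (1 + j * κ s * (t * h)) * this
      rw [e, norm_mul]
      calc ‖k s‖ * ‖f (s + t * h) - f s - j * κ s * f s * (t * h)‖ ≤ Λ * (2 * Λ ^ 3 * ‖h‖ ^ 2) :=
            mul_le_mul (hkn s hs) (hT t ht) (norm_nonneg _) hΛ0.le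
        _ = _ := by ring)
  rw [hint] at this
  refine (le_of_eq ?_).trans this
  congr 1
  ring

theorem norm_log_sub_le {a x : ℂ} {C η : ℝ} (hx : ‖a - (1 + x)‖ ≤ C) (h1 : ‖a - 1‖ ≤ η)
    (hη : η ≤ 1 / 2) : ‖Complex.log a - x‖ ≤ C + η ^ 2 := by
  have h2 : ‖a - 1‖ < 1 := by linarith
  have h3 := Complex.norm_log_one_add_sub_self_le h2
  rw [add_sub_cancel] at h3
  have h4 : (1 - ‖a - 1‖)⁻¹ ≤ 2 := by
    rw [inv_le_comm₀ (by linarith) (by norm_num)]; linarith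
  have h5 : ‖Complex.log a - (a - 1)‖ ≤ η ^ 2 := by
    calc _ ≤ ‖a - 1‖ ^ 2 * (1 - ‖a - 1‖)⁻¹ / 2 := h3
      _ ≤ ‖a - 1‖ ^ 2 * 2 / 2 := by gcongr
      _ = ‖a - 1‖ ^ 2 := by ring
      _ ≤ η ^ 2 := by gcongr
  calc ‖Complex.log a - x‖ = ‖(Complex.log a - (a - 1)) + (a - (1 + x))‖ := by congr 1; ring
    _ ≤ _ := norm_add_le _ _
    _ ≤ C + η ^ 2 := by linarith

namespace CurveFrame

variable {Λ β R : ℝ} {u v p q κ : ℂ → ℂ} (h : CurveFrame Λ β R u v p q κ)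
include h

theorem Λ_pos : 0 < Λ := by linarith [h.one_le]

theorem differentiableOn_p : DifferentiableOn ℂ p (strip R) := fun z hz =>
  (h.hasDerivAt_p z hz).differentiableAt.differentiableWithinAt

theorem differentiableOn_q : DifferentiableOn ℂ q (strip R) := fun z hz =>
  (h.hasDerivAt_q z hz).differentiableAt.differentiableWithinAt

theorem q_star {z : ℂ} (hz : z ∈ strip R) : q (star z) = star (p z) := by
  rw [← star_star (q (star z)), ← h.p_star _ (strip_star hz), star_star]

theorem norm_q_mul_chordMean_p_sub_le {s s' : ℂ} (hs : s ∈ strip R) (hs' : s' ∈ strip R) :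
    ‖q s * chordMean p s s' - (1 + Complex.I * κ s * (s' - s) / 2)‖ ≤
      2 * Λ ^ 4 * ‖s' - s‖ ^ 2 :=
  norm_mul_chordMean_sub_le h.one_le Complex.norm_I h.hasDerivAt_p
    (fun z hz => by rw [mul_comm]; exact h.mul_eq_one z hz) h.norm_p h.norm_q h.norm_κ
    h.lipschitz_κ hs hs'

theorem norm_p_mul_chordMean_q_sub_le {s s' : ℂ} (hs : s ∈ strip R) (hs' : s' ∈ strip R) :
    ‖p s * chordMean q s s' - (1 + -Complex.I * κ s * (s' - s) / 2)‖ ≤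
      2 * Λ ^ 4 * ‖s' - s‖ ^ 2 :=
  norm_mul_chordMean_sub_le h.one_le (by simp) h.hasDerivAt_q h.mul_eq_one h.norm_q h.norm_p
    h.norm_κ h.lipschitz_κ hs hs'

/-- For chords of length `x ≤ 1 / (8 Λ⁴)` the quadratic errors are dominated by the linear terms. -/
theorem quad_le {x : ℝ} (hx : 0 ≤ x) (hx' : x ≤ 1 / (8 * Λ ^ 4)) : Λ ^ 4 * x ^ 2 ≤ x / 8 := by
  have := h.Λ_pos
  rw [le_div_iff₀ (by positivity)] at hx'
  nlinarith

theorem le_eighth {x : ℝ} (hx : 0 ≤ x) (hx' : x ≤ 1 / (8 * Λ ^ 4)) : Λ * x ≤ 1 / 8 := by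
  have := h.Λ_pos
  rw [le_div_iff₀ (by positivity)] at hx'
  have h3 : Λ * 1 ≤ Λ * Λ ^ 3 := by gcongr; exact one_le_pow₀ h.one_le
  nlinarith

theorem norm_sub_one_le {s s' a : ℂ} {j : ℂ} (hj : ‖j‖ = 1) (hs : s ∈ strip R)
    (hd : ‖s' - s‖ ≤ 1 / (8 * Λ ^ 4))
    (ha : ‖a - (1 + j * κ s * (s' - s) / 2)‖ ≤ 2 * Λ ^ 4 * ‖s' - s‖ ^ 2) :
    ‖a - 1‖ ≤ Λ * ‖s' - s‖ := by
  have h1 := h.quad_le (norm_nonneg _) hd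
  have h2 : ‖j * κ s * (s' - s) / 2‖ ≤ Λ * ‖s' - s‖ / 2 := by
    rw [norm_div, norm_mul, norm_mul, hj, one_mul, Complex.norm_ofNat]
    have := h.norm_κ s hs
    gcongr
  have h3 : ‖a - 1‖ ≤ ‖a - (1 + j * κ s * (s' - s) / 2)‖ + ‖j * κ s * (s' - s) / 2‖ := by
    refine (le_of_eq ?_).trans (norm_add_le _ _)
    congr 1
    ring
  have h4 := h.one_le
  nlinarith [norm_nonneg (s' - s)]

theorem norm_a_sub_one_le {s s' : ℂ} (hs : s ∈ strip R) (hs' : s' ∈ strip R)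
    (hd : ‖s' - s‖ ≤ 1 / (8 * Λ ^ 4)) : ‖q s * chordMean p s s' - 1‖ ≤ Λ * ‖s' - s‖ :=
  h.norm_sub_one_le Complex.norm_I hs hd (h.norm_q_mul_chordMean_p_sub_le hs hs')

theorem norm_b_sub_one_le {s s' : ℂ} (hs : s ∈ strip R) (hs' : s' ∈ strip R)
    (hd : ‖s' - s‖ ≤ 1 / (8 * Λ ^ 4)) : ‖p s * chordMean q s s' - 1‖ ≤ Λ * ‖s' - s‖ :=
  h.norm_sub_one_le (by simp) hs hd (h.norm_p_mul_chordMean_q_sub_le hs hs')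

/-- The chord angle is half the curvature times the difference of the parameters, up to a quadratic
error. -/
theorem norm_chordAngle_sub_le {s s' : ℂ} (hs : s ∈ strip R) (hs' : s' ∈ strip R)
    (hd : ‖s' - s‖ ≤ 1 / (8 * Λ ^ 4)) :
    ‖chordAngle p q s s' - κ s * (s' - s) / 2‖ ≤ 3 * Λ ^ 4 * ‖s' - s‖ ^ 2 := by
  have h8 := h.le_eighth (norm_nonneg _) hd
  have ha := norm_log_sub_le (h.norm_q_mul_chordMean_p_sub_le hs hs') (h.norm_a_sub_one_le hs hs' hd)
    (by linarith)
  have hb := norm_log_sub_le (h.norm_p_mul_chordMean_q_sub_le hs hs') (h.norm_b_sub_one_le hs hs' hd)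
    (by linarith)
  set la := Complex.log (q s * chordMean p s s')
  set lb := Complex.log (p s * chordMean q s s')
  have e : chordAngle p q s s' - κ s * (s' - s) / 2 =
      -Complex.I / 2 * ((la - Complex.I * κ s * (s' - s) / 2) -
        (lb - -Complex.I * κ s * (s' - s) / 2)) := by
    change -Complex.I / 2 * (la - lb) - _ = _
    linear_combination (-κ s * (s' - s) / 2) * Complex.I_sq
  rw [e, norm_mul]
  have h1 : ‖-Complex.I / 2‖ = 1 / 2 := by simp
  rw [h1]
  have h2 := norm_sub_le (la - Complex.I * κ s * (s' - s) / 2) (lb - -Complex.I * κ s * (s' - s) / 2)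
  have h3 : Λ ^ 2 ≤ Λ ^ 4 := pow_le_pow_right₀ h.one_le (by norm_num)
  have h4 : (Λ * ‖s' - s‖) ^ 2 ≤ Λ ^ 4 * ‖s' - s‖ ^ 2 := by rw [mul_pow]; gcongr
  linarith

theorem norm_chordAngle_le {s s' : ℂ} (hs : s ∈ strip R) (hs' : s' ∈ strip R)
    (hd : ‖s' - s‖ ≤ 1 / (8 * Λ ^ 4)) : ‖chordAngle p q s s'‖ ≤ Λ * ‖s' - s‖ := by
  have h1 := h.quad_le (norm_nonneg _) hd
  have h2 := h.norm_chordAngle_sub_le hs hs' hd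
  have h3 : ‖κ s * (s' - s) / 2‖ ≤ Λ * ‖s' - s‖ / 2 := by
    rw [norm_div, norm_mul, Complex.norm_ofNat]
    have := h.norm_κ s hs
    gcongr
  have h4 := norm_add_le (chordAngle p q s s' - κ s * (s' - s) / 2) (κ s * (s' - s) / 2)
  rw [sub_add_cancel] at h4
  have := h.one_le
  nlinarith [norm_nonneg (s' - s)]

omit h in
theorem _root_.mem_slitPlane_of_norm_sub_one_lt {a : ℂ} (ha : ‖a - 1‖ < 1) : a ∈ Complex.slitPlane := by
  refine Complex.mem_slitPlane_of_norm_lt_one (z := a - 1) ha |> fun h => by simpa using h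

/-- The chord means are recovered from length and angle. -/
theorem mul_chordRatio {s s' : ℂ} (hs : s ∈ strip R) (hs' : s' ∈ strip R)
    (hd : ‖s' - s‖ ≤ 1 / (8 * Λ ^ 4)) :
    q s * chordMean p s s' = chordRatio p q s s' * Complex.exp (Complex.I * chordAngle p q s s') ∧
    p s * chordMean q s s' = chordRatio p q s s' * Complex.exp (-Complex.I * chordAngle p q s s') := by
  have h8 := h.le_eighth (norm_nonneg _) hd
  have ha := h.norm_a_sub_one_le hs hs' hd
  have hb := h.norm_b_sub_one_le hs hs' hd
  set a := q s * chordMean p s s' with hadef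
  set b := p s * chordMean q s s' with hbdef
  have hpos : ∀ {c : ℂ}, ‖c - 1‖ ≤ Λ * ‖s' - s‖ → 0 < c.re := fun {c} hc => by
    have := (Complex.abs_re_le_norm (c - 1)).trans (hc.trans h8)
    rw [abs_le, Complex.sub_re, Complex.one_re] at this
    linarith [this.1]
  have ha0 : a ≠ 0 := fun h0 => by have := hpos ha; rw [h0] at this; simp at this
  have hb0 : b ≠ 0 := fun h0 => by have := hpos hb; rw [h0] at this; simp at this
  have hab : chordMean p s s' * chordMean q s s' = a * b := by
    rw [hadef, hbdef]
    linear_combination (-(chordMean p s s' * chordMean q s s')) * h.mul_eq_one s hs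
  have hlog : Complex.log (a * b) = Complex.log a + Complex.log b := by
    refine Complex.log_mul ha0 hb0 ?_
    have h1 := abs_lt.1 (Complex.abs_arg_lt_pi_div_two_iff.2 (Or.inl (hpos ha)))
    have h2 := abs_lt.1 (Complex.abs_arg_lt_pi_div_two_iff.2 (Or.inl (hpos hb)))
    constructor <;> linarith [h1.1, h1.2, h2.1, h2.2]
  rw [chordRatio, hab, hlog, ← Complex.exp_add, ← Complex.exp_add]
  constructor
  · conv_lhs => rw [← Complex.exp_log ha0]
    congr 1
    rw [chordAngle]
    linear_combination (1 / 2) * (Complex.log a - Complex.log b) * Complex.I_sq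
  · conv_lhs => rw [← Complex.exp_log hb0]
    congr 1
    rw [chordAngle]
    linear_combination (-1 / 2) * (Complex.log a - Complex.log b) * Complex.I_sq

omit h in
theorem _root_.chordRatio_comm (p q : ℂ → ℂ) (s s' : ℂ) : chordRatio p q s s' = chordRatio p q s' s := by
  rw [chordRatio, chordRatio, chordMean_comm p, chordMean_comm q]

/-- The first variation of length: the derivative of the chord length at its end point is the cosine
of the angle there. -/
theorem hasDerivAt_length {s s' : ℂ} (hs : s ∈ strip R) (hs' : s' ∈ strip R)
    (hd : ‖s' - s‖ < 1 / (8 * Λ ^ 4)) :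
    HasDerivAt (fun x => (x - s) * chordRatio p q s x) (Complex.cos (chordAngle p q s' s)) s' := by
  have hd' : ‖s - s'‖ ≤ 1 / (8 * Λ ^ 4) := by rw [norm_sub_rev]; exact hd.le
  have hTd : ∀ {f : ℂ → ℂ}, DifferentiableOn ℂ f (strip R) →
      HasDerivAt (chordMean f s) (deriv (chordMean f s) s') s' := fun {f} hf => by
    have := (differentiableOn_chordMean hf).differentiableAt
      (((isOpen_strip R).prod (isOpen_strip R)).mem_nhds (mk_mem_prod hs hs'))
    exact (DifferentiableAt.comp (g := fun p : ℂ × ℂ => chordMean f p.1 p.2) (f := fun x => (s, x)) s'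
      this (by fun_prop)).hasDerivAt
  have hp := hTd h.differentiableOn_p
  have hq := hTd h.differentiableOn_q
  set dp := deriv (chordMean p s) s'
  set dq := deriv (chordMean q s) s'
  -- `T + (s' - s) T'` is the tangent at the end point
  have hp1 : chordMean p s s' + (s' - s) * dp = p s' := by
    have h1 := ((hasDerivAt_id s').sub_const s).mul hp
    have := h1.unique (hasDerivAt_sub_mul_chordMean h.differentiableOn_p h.hasDerivAt_u hs hs')
    simpa using this
  have hq1 : chordMean q s s' + (s' - s) * dq = q s' := by
    have h1 := ((hasDerivAt_id s').sub_const s).mul hq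
    have := h1.unique (hasDerivAt_sub_mul_chordMean h.differentiableOn_q h.hasDerivAt_v hs hs')
    simpa using this
  have h8 := h.le_eighth (norm_nonneg _) hd.le
  obtain ⟨ea, eb⟩ := h.mul_chordRatio hs' hs hd'
  rw [chordMean_comm p, chordRatio_comm] at ea
  rw [chordMean_comm q, chordRatio_comm] at eb
  set Tp := chordMean p s s' with hTp
  set Tq := chordMean q s s' with hTq
  have hmul := h.mul_eq_one s hs
  have hnear : ‖Tp * Tq - 1‖ < 1 := by
    have ha := h.norm_a_sub_one_le hs hs' hd.le
    have hb := h.norm_b_sub_one_le hs hs' hd.le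
    have e : Tp * Tq - 1 = (q s * Tp - 1) * (p s * Tq - 1) + (q s * Tp - 1) + (p s * Tq - 1) := by
      linear_combination (-Tp * Tq) * hmul
    rw [e]
    have h1 := norm_add₃_le (a := (q s * Tp - 1) * (p s * Tq - 1)) (b := q s * Tp - 1) (c := p s * Tq - 1)
    rw [norm_mul] at h1
    nlinarith [norm_nonneg (q s * Tp - 1), norm_nonneg (p s * Tq - 1)]
  have hslit : Tp * Tq ∈ Complex.slitPlane := mem_slitPlane_of_norm_sub_one_lt hnear
  have hne : Tp * Tq ≠ 0 := Complex.slitPlane_ne_zero hslit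
  have hTp0 : Tp ≠ 0 := left_ne_zero_of_mul hne
  have hTq0 : Tq ≠ 0 := right_ne_zero_of_mul hne
  have hsq : chordRatio p q s s' ^ 2 = Tp * Tq := by
    rw [chordRatio, ← Complex.exp_nat_mul]
    push_cast
    rw [mul_div_cancel₀ _ (two_ne_zero), Complex.exp_log hne]
  have hsq0 : chordRatio p q s s' ≠ 0 := Complex.exp_ne_zero _
  have hder : HasDerivAt (fun x => chordRatio p q s x)
      (chordRatio p q s s' * ((dp * Tq + Tp * dq) / (Tp * Tq) / 2)) s' :=
    (((hp.mul hq).clog hslit).div_const 2).cexp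
  refine (((hasDerivAt_id s').sub_const s).mul hder).congr_deriv ?_
  have hcos : 2 * chordRatio p q s s' * Complex.cos (chordAngle p q s' s) = q s' * Tp + p s' * Tq := by
    rw [ea, eb, Complex.cos]
    rw [mul_comm (chordAngle p q s' s) Complex.I,
      show -chordAngle p q s' s * Complex.I = -Complex.I * chordAngle p q s' s by ring]
    ring
  have hgoal : 2 * chordRatio p q s s' * (chordRatio p q s s' + (s' - s) * (chordRatio p q s s' *
      ((dp * Tq + Tp * dq) / (Tp * Tq) / 2))) = q s' * Tp + p s' * Tq := by
    rw [← hp1, ← hq1]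
    field_simp
    rw [hsq]
    ring
  have := hgoal.trans hcos.symm
  have h2 : (2 : ℂ) * chordRatio p q s s' ≠ 0 := mul_ne_zero two_ne_zero hsq0
  simpa using mul_left_cancel₀ h2 this

end CurveFrame

/-! ### Equivariant lifts -/

/-- `α` is a holomorphic function on `V`, real on real points, with
`α(x + 1, y) = α(x, y) + 1`. -/
structure IsRealAnalyticLift (α : ℂ × ℂ → ℂ) (V : Set (ℂ × ℂ)) : Prop where
  differentiableOn : DifferentiableOn ℂ α V
  add_one : ∀ p ∈ V, α (p + (1, 0)) = α p + 1
  map_star : ∀ p ∈ V, α (star p) = star (α p)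

namespace IsRealAnalyticLift

variable {α α' f : ℂ × ℂ → ℂ} {V W : Set (ℂ × ℂ)}

theorem fst : IsRealAnalyticLift (fun p => p.1) V :=
  ⟨differentiableOn_fst, fun p _ => by simp, fun p _ => rfl⟩

theorem mono (h : IsRealAnalyticLift α W) (hVW : V ⊆ W) : IsRealAnalyticLift α V :=
  ⟨h.1.mono hVW, fun p hp => h.2 p (hVW hp), fun p hp => h.3 p (hVW hp)⟩

theorem sub (h : IsRealAnalyticLift α V) (h' : IsRealAnalyticLift α' V) :
    IsRealAnalyticPeriodic (fun p => α p - α' p) V :=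
  ⟨h.1.sub h'.1, fun p hp => by simp only [h.2 p hp, h'.2 p hp]; ring,
    fun p hp => by simp only [h.3 p hp, h'.3 p hp, star_sub]⟩

theorem add_periodic (h : IsRealAnalyticLift α V) (hf : IsRealAnalyticPeriodic f V) :
    IsRealAnalyticLift (fun p => α p + f p) V :=
  ⟨h.1.add hf.1, fun p hp => by simp only [h.2 p hp, hf.2.1 p hp]; ring,
    fun p hp => by simp only [h.3 p hp, hf.2.2 p hp, star_add]⟩

/-- Composition with a periodic real-analytic function of one variable. -/
theorem periodic_comp (h : IsRealAnalyticLift α V) {k : ℂ → ℂ} {s : Set ℂ}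
    (hk : DifferentiableOn ℂ k s) (h1 : ∀ z ∈ s, k (z + 1) = k z)
    (hs : ∀ z ∈ s, k (star z) = star (k z)) (hm : MapsTo α V s) :
    IsRealAnalyticPeriodic (fun p => k (α p)) V :=
  ⟨hk.comp h.1 hm, fun p hp => by simp only [h.2 p hp, h1 _ (hm hp)],
    fun p hp => by simp only [h.3 p hp, hs _ (hm hp)]⟩

/-- Composition with a lift in one variable. -/
theorem lift_comp (h : IsRealAnalyticLift α V) {k : ℂ → ℂ} {s : Set ℂ}
    (hk : DifferentiableOn ℂ k s) (h1 : ∀ z ∈ s, k (z + 1) = k z + 1)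
    (hs : ∀ z ∈ s, k (star z) = star (k z)) (hm : MapsTo α V s) :
    IsRealAnalyticLift (fun p => k (α p)) V :=
  ⟨hk.comp h.1 hm, fun p hp => by simp only [h.2 p hp, h1 _ (hm hp)],
    fun p hp => by simp only [h.3 p hp, hs _ (hm hp)]⟩

end IsRealAnalyticLift

theorem StripChart.lift_comp_S {b₀ B₀ R : ℝ} {g χ S : ℂ → ℂ} (h : StripChart b₀ B₀ R g χ S)
    {α : ℂ × ℂ → ℂ} {V : Set (ℂ × ℂ)} (hα : IsRealAnalyticLift α V)
    (hm : MapsTo α V (χ '' strip R)) : IsRealAnalyticLift (fun p => S (α p)) V :=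
  hα.lift_comp h.differentiableOn_S (fun _ => h.S_add_one) (fun _ => h.S_star) hm

/-- Second-order Taylor estimate for the chart. -/
theorem StripChart.norm_χ_sub_sub_le {b₀ B₀ R : ℝ} {g χ S : ℂ → ℂ} (h : StripChart b₀ B₀ R g χ S)
    {z w : ℂ} (hz : z ∈ strip R) (hw : w ∈ strip R) :
    ‖χ z - χ w - g w * (z - w)‖ ≤ B₀ * ‖z - w‖ ^ 2 := by
  have hsub : segment ℝ w z ⊆ strip R := (convex_strip R).segment_subset hw hz
  have hder : ∀ x ∈ segment ℝ w z, HasDerivWithinAt (fun x => χ x - g w * x) (g x - g w)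
      (segment ℝ w z) x := fun x hx => by
    have : HasDerivAt (fun x => χ x - g w * x) _ x :=
      (h.hasDerivAt x (hsub hx)).sub ((hasDerivAt_id x).const_mul (g w))
    simpa using this.hasDerivWithinAt (s := segment ℝ w z)
  have hB := h.B₀_pos
  have := (convex_segment w z).norm_image_sub_le_of_norm_hasDerivWithin_le hder
    (C := B₀ * ‖z - w‖) (fun x hx => (h.lipschitz x (hsub hx) w hw).trans (by
      have : ‖x - w‖ ≤ ‖z - w‖ := norm_sub_le_of_mem_segment hx
      gcongr)) (left_mem_segment ℝ w z) (right_mem_segment ℝ w z)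
  refine (le_of_eq ?_).trans (this.trans_eq (by ring))
  congr 1
  ring

theorem norm_one_sub_cos_sub_le {x : ℂ} (hx : ‖x‖ ≤ 1) :
    ‖1 - Complex.cos x - x ^ 2 / 2‖ ≤ ‖x‖ ^ 3 := by
  have key : ∀ y : ℂ, ‖y‖ ≤ 1 → ‖Complex.exp y - (1 + y + y ^ 2 / 2)‖ ≤ ‖y‖ ^ 3 := fun y hy => by
    have := Complex.exp_bound hy (n := 3) (by norm_num)
    rw [show ∑ m ∈ Finset.range 3, y ^ m / (m.factorial : ℂ) = 1 + y + y ^ 2 / 2 by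
      simp [Finset.sum_range_succ, Nat.factorial]] at this
    refine this.trans (mul_le_of_le_one_right (by positivity) ?_)
    norm_num [Nat.factorial]
  have h1 := key (x * Complex.I) (by simpa using hx)
  have h2 := key (-x * Complex.I) (by simpa using hx)
  have e : 1 - Complex.cos x - x ^ 2 / 2 =
      -((Complex.exp (x * Complex.I) - (1 + x * Complex.I + (x * Complex.I) ^ 2 / 2)) +
        (Complex.exp (-x * Complex.I) - (1 + -x * Complex.I + (-x * Complex.I) ^ 2 / 2))) / 2 := by
    rw [Complex.cos]
    linear_combination (-(x ^ 2) / 2) * Complex.I_sq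
  rw [e, norm_div, norm_neg, Complex.norm_ofNat]
  have h3 := norm_add_le (Complex.exp (x * Complex.I) - (1 + x * Complex.I + (x * Complex.I) ^ 2 / 2))
    (Complex.exp (-x * Complex.I) - (1 + -x * Complex.I + (-x * Complex.I) ^ 2 / 2))
  rw [norm_mul, Complex.norm_I, mul_one] at h1
  rw [norm_mul, norm_neg, Complex.norm_I, mul_one] at h2
  linarith

namespace CurveFrame

variable {Λ β R : ℝ} {u v p q κ : ℂ → ℂ}

section regularity

variable {α α' : ℂ × ℂ → ℂ} {V : Set (ℂ × ℂ)}

theorem periodic_q_mul_chordMean (h : CurveFrame Λ β R u v p q κ) (hα : IsRealAnalyticLift α V)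
    (hα' : IsRealAnalyticLift α' V) (hm : MapsTo α V (strip R)) (hm' : MapsTo α' V (strip R)) :
    DifferentiableOn ℂ (fun x => q (α x) * chordMean p (α x) (α' x)) V ∧
    DifferentiableOn ℂ (fun x => p (α x) * chordMean q (α x) (α' x)) V ∧
    (∀ x ∈ V, q (α (x + (1, 0))) * chordMean p (α (x + (1, 0))) (α' (x + (1, 0))) =
      q (α x) * chordMean p (α x) (α' x)) ∧
    (∀ x ∈ V, p (α (x + (1, 0))) * chordMean q (α (x + (1, 0))) (α' (x + (1, 0))) =
      p (α x) * chordMean q (α x) (α' x)) ∧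
    (∀ x ∈ V, q (α (star x)) * chordMean p (α (star x)) (α' (star x)) =
      star (p (α x) * chordMean q (α x) (α' x))) ∧
    ∀ x ∈ V, p (α (star x)) * chordMean q (α (star x)) (α' (star x)) =
      star (q (α x) * chordMean p (α x) (α' x)) := by
  have hpair : DifferentiableOn ℂ (fun x => (α x, α' x)) V := hα.1.prodMk hα'.1
  have hpm : MapsTo (fun x => (α x, α' x)) V (strip R ×ˢ strip R) := fun x hx => ⟨hm hx, hm' hx⟩
  refine ⟨(h.differentiableOn_q.comp hα.1 hm).mul
    ((differentiableOn_chordMean h.differentiableOn_p).comp hpair hpm),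
    (h.differentiableOn_p.comp hα.1 hm).mul
    ((differentiableOn_chordMean h.differentiableOn_q).comp hpair hpm),
    fun x hx => ?_, fun x hx => ?_, fun x hx => ?_, fun x hx => ?_⟩
  · rw [hα.2 x hx, hα'.2 x hx, h.q_add_one _ (hm hx), chordMean_add_one h.p_add_one (hm hx) (hm' hx)]
  · rw [hα.2 x hx, hα'.2 x hx, h.p_add_one _ (hm hx), chordMean_add_one h.q_add_one (hm hx) (hm' hx)]
  · rw [hα.3 x hx, hα'.3 x hx, h.q_star (hm hx), chordMean_star h.p_star (hm hx) (hm' hx), star_mul']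
  · rw [hα.3 x hx, hα'.3 x hx, h.p_star _ (hm hx), chordMean_star (fun _ => h.q_star) (hm hx) (hm' hx),
      star_mul']

theorem mem_slitPlane {s s' a : ℂ} (h : CurveFrame Λ β R u v p q κ)
    (hd : ‖s' - s‖ ≤ 1 / (8 * Λ ^ 4)) (ha : ‖a - 1‖ ≤ Λ * ‖s' - s‖) : a ∈ Complex.slitPlane :=
  mem_slitPlane_of_norm_sub_one_lt (ha.trans_lt (by linarith [h.le_eighth (norm_nonneg _) hd]))

theorem periodic_chordAngle (h : CurveFrame Λ β R u v p q κ) (hα : IsRealAnalyticLift α V)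
    (hα' : IsRealAnalyticLift α' V) (hm : MapsTo α V (strip R)) (hm' : MapsTo α' V (strip R))
    (hd : ∀ x ∈ V, ‖α' x - α x‖ ≤ 1 / (8 * Λ ^ 4)) :
    IsRealAnalyticPeriodic (fun x => chordAngle p q (α x) (α' x)) V := by
  obtain ⟨d1, d2, e1, e2, s1, s2⟩ := h.periodic_q_mul_chordMean hα hα' hm hm'
  have m1 := fun x hx => h.mem_slitPlane (hd x hx) (h.norm_a_sub_one_le (hm hx) (hm' hx) (hd x hx))
  have m2 := fun x hx => h.mem_slitPlane (hd x hx) (h.norm_b_sub_one_le (hm hx) (hm' hx) (hd x hx))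
  refine ⟨((d1.clog m1).sub (d2.clog m2)).const_mul _, fun x hx => ?_, fun x hx => ?_⟩
  · simp only [chordAngle, e1 x hx, e2 x hx]
  · simp only [chordAngle, s1 x hx, s2 x hx]
    have l1 := Complex.log_conj _ (Complex.mem_slitPlane_iff_arg.1 (m1 x hx)).1
    have l2 := Complex.log_conj _ (Complex.mem_slitPlane_iff_arg.1 (m2 x hx)).1
    simp only [RCLike.star_def, map_mul, map_sub, map_div₀, map_neg, Complex.conj_I,
      Complex.conj_ofNat] at l1 l2 ⊢
    rw [l1, l2]
    ring

theorem periodic_chordRatio (h : CurveFrame Λ β R u v p q κ) (hα : IsRealAnalyticLift α V)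
    (hα' : IsRealAnalyticLift α' V) (hm : MapsTo α V (strip R)) (hm' : MapsTo α' V (strip R))
    (hd : ∀ x ∈ V, ‖α' x - α x‖ ≤ 1 / (8 * Λ ^ 4)) :
    IsRealAnalyticPeriodic (fun x => chordRatio p q (α x) (α' x)) V := by
  obtain ⟨d1, d2, e1, e2, s1, s2⟩ := h.periodic_q_mul_chordMean hα hα' hm hm'
  have hA := h.periodic_chordAngle hα hα' hm hm' hd
  -- the length is the first chord mean divided by `exp (i A)`
  have key : ∀ x ∈ V, chordRatio p q (α x) (α' x) = q (α x) * chordMean p (α x) (α' x) *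
      Complex.exp (-Complex.I * chordAngle p q (α x) (α' x)) := fun x hx => by
    rw [(h.mul_chordRatio (hm hx) (hm' hx) (hd x hx)).1, mul_assoc, ← Complex.exp_add]
    simp
  have key' : ∀ x ∈ V, chordRatio p q (α x) (α' x) = p (α x) * chordMean q (α x) (α' x) *
      Complex.exp (Complex.I * chordAngle p q (α x) (α' x)) := fun x hx => by
    rw [(h.mul_chordRatio (hm hx) (hm' hx) (hd x hx)).2, mul_assoc, ← Complex.exp_add]
    simp
  refine ⟨(d1.mul (hA.1.const_mul (-Complex.I)).cexp).congr key, fun x hx => ?_, fun x hx => ?_⟩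
  · simp only [hα.2 x hx, hα'.2 x hx]
    rw [chordRatio, chordRatio, chordMean_add_one h.p_add_one (hm hx) (hm' hx),
      chordMean_add_one h.q_add_one (hm hx) (hm' hx)]
  · have hs := hA.2.2 x hx
    simp only [hα.3 x hx, hα'.3 x hx] at hs ⊢
    have hd' : ‖star (α' x) - star (α x)‖ ≤ 1 / (8 * Λ ^ 4) := by
      rw [← star_sub, norm_star]; exact hd x hx
    have k1 := (h.mul_chordRatio (strip_star (hm hx)) (strip_star (hm' hx)) hd').1
    have k2 : chordRatio p q (star (α x)) (star (α' x)) =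
        q (star (α x)) * chordMean p (star (α x)) (star (α' x)) *
        Complex.exp (-Complex.I * chordAngle p q (star (α x)) (star (α' x))) := by
      rw [k1, mul_assoc, ← Complex.exp_add]
      simp
    have s3 := s1 x hx
    rw [hα.3 x hx, hα'.3 x hx] at s3
    rw [k2, s3, key' x hx, hs]
    simp only [RCLike.star_def, map_mul, ← Complex.exp_conj, Complex.conj_I]

end regularity

end CurveFrame

/-! ### The generating function of the billiard map -/

/-- The generating function of the billiard map in the chart `χ`: parameter distance minus chord
length, as a function of the chart coordinates of the end points of the chord. -/
noncomputable def billiardGen (p q S : ℂ → ℂ) (a b : ℂ) : ℂ :=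
  S b - S a - (S b - S a) * chordRatio p q (S a) (S b)

/-- The derivative of the generating function in its second variable. -/
noncomputable def billiardGenDeriv (p q g S : ℂ → ℂ) (a b : ℂ) : ℂ :=
  (g (S b))⁻¹ * (1 - Complex.cos (chordAngle p q (S b) (S a)))

section

variable {Λ β R b₀ B₀ m : ℝ} {u v p q κ g χ S : ℂ → ℂ}

/-- Chart coordinates close enough together stay in the strip, where the estimates for the chord
angle hold. -/
theorem StripChart.close_mem (hS : StripChart b₀ B₀ R g χ S) (hΛ : 1 ≤ Λ) (hR1 : R ≤ 1)
    {ρ : ℝ} (hρ : ρ < R) {a h : ℂ} (ha : a ∈ χ '' strip ρ)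
    (hh : ‖h‖ < b₀ / (8 * Λ ^ 4) * (R - ρ)) (hρ0 : 0 < ρ) :
    a + h ∈ χ '' strip R ∧ ‖S (a + h) - S a‖ ≤ ‖h‖ / b₀ ∧ ‖h‖ / b₀ < 1 / (8 * Λ ^ 4) := by
  have hb := hS.b₀_pos
  have hΛ4 : 1 ≤ Λ ^ 4 := one_le_pow₀ hΛ
  have h1 : a + h ∈ χ '' strip R := by
    refine hS.add_mem hρ le_rfl ha (hh.trans_le ?_)
    have : b₀ / (8 * Λ ^ 4) ≤ b₀ / 4 := by gcongr; linarith
    exact mul_le_mul_of_nonneg_right this (by linarith)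
  refine ⟨h1, ?_, ?_⟩
  · have := hS.norm_S_sub_le h1 (image_mono (strip_mono hρ.le) ha)
    rw [add_sub_cancel_left] at this
    rwa [le_div_iff₀' hb]
  · rw [div_lt_iff₀ hb]
    refine hh.trans_le ?_
    have : b₀ / (8 * Λ ^ 4) * (R - ρ) ≤ b₀ / (8 * Λ ^ 4) * 1 := by gcongr; linarith
    refine this.trans_eq (by ring)

/-- In the chart with `κ² = 24 m g³` the generating function starts with `m (b - a)³` for a constant
`m`. -/
theorem norm_billiardGenDeriv_sub_le (hF : CurveFrame Λ β R u v p q κ)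
    (hS : StripChart b₀ B₀ R g χ S) (hm : 0 < m)
    (hκg : ∀ z ∈ strip R, κ z ^ 2 = 24 * m * g z ^ 3) {ρ : ℝ} (hρ0 : 0 < ρ) (hρ : ρ < R) {a h : ℂ}
    (ha : a ∈ χ '' strip ρ) (hh : ‖h‖ < b₀ / (8 * Λ ^ 4) * (R - ρ)) :
    ‖billiardGenDeriv p q g S a (a + h) - 3 * m * h ^ 2‖ ≤
      (4 * Λ ^ 5 / b₀ ^ 4 + 3 * m * (B₀ * (B₀ / b₀ + 1) / b₀ ^ 2)) * ‖h‖ ^ 3 := by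
  obtain ⟨h1, h2, h3⟩ := hS.close_mem hF.one_le hF.R_le_one hρ ha hh hρ0
  have hb := hS.b₀_pos
  have hB := hS.B₀_pos
  have hΛ := hF.Λ_pos
  have ha' : a ∈ χ '' strip R := image_mono (strip_mono hρ.le) ha
  have hs1 := hS.S_mem le_rfl h1
  have hs0 := hS.S_mem le_rfl ha'
  set s := S (a + h) with hs
  set η := S a - s with hη
  have hηn : ‖η‖ ≤ ‖h‖ / b₀ := by rw [hη, norm_sub_rev]; exact h2
  have hd : ‖S a - s‖ ≤ 1 / (8 * Λ ^ 4) := hηn.trans h3.le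
  have hA1 := hF.norm_chordAngle_sub_le hs1 hs0 hd
  have hA2 := hF.norm_chordAngle_le hs1 hs0 hd
  have hA3 := hF.le_eighth (norm_nonneg _) hd
  rw [← hη] at hA1 hA2 hA3
  set A := chordAngle p q s (S a) with hA
  have hcos := norm_one_sub_cos_sub_le (x := A) (by linarith)
  have hκn := hF.norm_κ s hs1
  have hq : ‖1 - Complex.cos A - κ s ^ 2 * η ^ 2 / 8‖ ≤ 4 * Λ ^ 5 * ‖η‖ ^ 3 := by
    have e : 1 - Complex.cos A - κ s ^ 2 * η ^ 2 / 8 = (1 - Complex.cos A - A ^ 2 / 2) +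
        (A - κ s * η / 2) * (A + κ s * η / 2) / 2 := by ring
    have e1 : ‖A + κ s * η / 2‖ ≤ 2 * Λ * ‖η‖ := by
      have : ‖κ s * η / 2‖ ≤ Λ * ‖η‖ / 2 := by
        rw [norm_div, norm_mul, Complex.norm_ofNat]; gcongr
      have := norm_add_le A (κ s * η / 2)
      nlinarith [mul_nonneg hΛ.le (norm_nonneg η)]
    have e2 : ‖(A - κ s * η / 2) * (A + κ s * η / 2) / 2‖ ≤ 3 * Λ ^ 5 * ‖η‖ ^ 3 := by
      rw [norm_div, norm_mul, Complex.norm_ofNat]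
      calc _ ≤ (3 * Λ ^ 4 * ‖η‖ ^ 2) * (2 * Λ * ‖η‖) / 2 := by gcongr
        _ = _ := by ring
    have e3 : ‖A‖ ^ 3 ≤ Λ ^ 5 * ‖η‖ ^ 3 := by
      calc ‖A‖ ^ 3 ≤ (Λ * ‖η‖) ^ 3 := by gcongr
        _ = Λ ^ 3 * ‖η‖ ^ 3 := by ring
        _ ≤ Λ ^ 5 * ‖η‖ ^ 3 := by
          gcongr
          exact hF.one_le
          norm_num
    rw [e]
    linarith [norm_add_le (1 - Complex.cos A - A ^ 2 / 2) ((A - κ s * η / 2) * (A + κ s * η / 2) / 2)]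
  have hg0 := hS.g_ne_zero hs1
  have hgn : ‖(g s)⁻¹‖ ≤ 1 / b₀ := by
    rw [norm_inv, ← one_div]
    exact one_div_le_one_div_of_le hb (hS.b₀_le_norm hs1)
  have hT : ‖g s * η + h‖ ≤ B₀ * ‖η‖ ^ 2 := by
    have := hS.norm_χ_sub_sub_le hs0 hs1
    rw [hS.χ_S ha', hS.χ_S h1] at this
    rw [← norm_neg]
    refine (le_of_eq ?_).trans this
    congr 1
    ring
  have hg2 : ‖g s ^ 2 * η ^ 2 - h ^ 2‖ ≤ B₀ * (B₀ / b₀ + 1) / b₀ ^ 2 * ‖h‖ ^ 3 := by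
    have e : g s ^ 2 * η ^ 2 - h ^ 2 = (g s * η + h) * (g s * η - h) := by ring
    have e1 : ‖g s * η - h‖ ≤ (B₀ / b₀ + 1) * ‖h‖ := by
      have h5 := norm_sub_le (g s * η) h
      rw [norm_mul] at h5
      have : ‖g s‖ * ‖η‖ ≤ B₀ * (‖h‖ / b₀) :=
        mul_le_mul (hS.norm_le s hs1) hηn (norm_nonneg _) hB.le
      calc _ ≤ _ := h5
        _ ≤ B₀ * (‖h‖ / b₀) + ‖h‖ := by linarith
        _ = _ := by ring
    rw [e, norm_mul]
    calc _ ≤ (B₀ * (‖h‖ / b₀) ^ 2) * ((B₀ / b₀ + 1) * ‖h‖) := by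
          refine mul_le_mul (hT.trans (by gcongr)) e1 (norm_nonneg _) (by positivity)
      _ = _ := by ring
  have e : billiardGenDeriv p q g S a (a + h) - 3 * m * h ^ 2 =
      (g s)⁻¹ * (1 - Complex.cos A - κ s ^ 2 * η ^ 2 / 8) + 3 * m * (g s ^ 2 * η ^ 2 - h ^ 2) := by
    rw [billiardGenDeriv, ← hs, ← hA, hκg s hs1]
    field_simp
    ring
  rw [e]
  have f1 : ‖(g s)⁻¹ * (1 - Complex.cos A - κ s ^ 2 * η ^ 2 / 8)‖ ≤ 4 * Λ ^ 5 / b₀ ^ 4 * ‖h‖ ^ 3 := by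
    rw [norm_mul]
    calc _ ≤ 1 / b₀ * (4 * Λ ^ 5 * (‖h‖ / b₀) ^ 3) := by
          refine mul_le_mul hgn (hq.trans (by gcongr)) (norm_nonneg _) (by positivity)
      _ = _ := by field_simp
  have f2 : ‖3 * (m : ℂ) * (g s ^ 2 * η ^ 2 - h ^ 2)‖ ≤
      3 * m * (B₀ * (B₀ / b₀ + 1) / b₀ ^ 2 * ‖h‖ ^ 3) := by
    rw [norm_mul, norm_mul, Complex.norm_ofNat, Complex.norm_real, Real.norm_of_nonneg hm.le]
    gcongr
  calc _ ≤ _ := norm_add_le _ _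
    _ ≤ _ := add_le_add f1 f2
    _ = _ := by ring

theorem hasDerivAt_billiardGen (hF : CurveFrame Λ β R u v p q κ)
    (hS : StripChart b₀ B₀ R g χ S) {a b : ℂ} (ha : a ∈ χ '' strip R) (hb : b ∈ χ '' strip R)
    (hd : ‖S b - S a‖ < 1 / (8 * Λ ^ 4)) :
    HasDerivAt (billiardGen p q S a) (billiardGenDeriv p q g S a b) b := by
  have h1 := hS.hasDerivAt_S hb
  have h2 := (hF.hasDerivAt_length (hS.S_mem le_rfl ha) (hS.S_mem le_rfl hb) hd).comp b h1
  have h3 := (h1.sub_const (S a)).sub h2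
  refine h3.congr_deriv ?_
  rw [billiardGenDeriv]
  ring

theorem norm_billiardGen_sub_le (hF : CurveFrame Λ β R u v p q κ)
    (hS : StripChart b₀ B₀ R g χ S) (hm : 0 < m)
    (hκg : ∀ z ∈ strip R, κ z ^ 2 = 24 * m * g z ^ 3) {ρ : ℝ} (hρ0 : 0 < ρ) (hρ : ρ < R) {a h : ℂ}
    (ha : a ∈ χ '' strip ρ) (hh : ‖h‖ < b₀ / (8 * Λ ^ 4) * (R - ρ)) :
    ‖billiardGen p q S a (a + h) - m * h ^ 3‖ ≤
      (4 * Λ ^ 5 / b₀ ^ 4 + 3 * m * (B₀ * (B₀ / b₀ + 1) / b₀ ^ 2)) * ‖h‖ ^ 4 := by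
  set K := 4 * Λ ^ 5 / b₀ ^ 4 + 3 * m * (B₀ * (B₀ / b₀ + 1) / b₀ ^ 2) with hK
  have hK0 : 0 ≤ K := by have := hS.b₀_pos; have := hS.B₀_pos; have := hF.Λ_pos; positivity
  have hder : ∀ x ∈ segment ℝ 0 h, HasDerivWithinAt (fun x => billiardGen p q S a (a + x) - m * x ^ 3)
      (billiardGenDeriv p q g S a (a + x) - 3 * m * x ^ 2) (segment ℝ 0 h) x ∧
      ‖billiardGenDeriv p q g S a (a + x) - 3 * m * x ^ 2‖ ≤ K * ‖h‖ ^ 3 := fun x hx => by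
    have hxh : ‖x‖ ≤ ‖h‖ := by simpa using norm_sub_le_of_mem_segment hx
    have hx1 := hxh.trans_lt hh
    obtain ⟨h1, h2, h3⟩ := hS.close_mem hF.one_le hF.R_le_one hρ ha hx1 hρ0
    have hG := hasDerivAt_billiardGen hF hS (image_mono (strip_mono hρ.le) ha) h1 (h2.trans_lt h3)
    have h4 : HasDerivAt (fun x => billiardGen p q S a (a + x) - m * x ^ 3) _ x :=
      (hG.comp_const_add a x).sub ((hasDerivAt_pow 3 x).const_mul (m : ℂ))
    refine ⟨(h4.congr_deriv ?_).hasDerivWithinAt,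
      (norm_billiardGenDeriv_sub_le hF hS hm hκg hρ0 hρ ha hx1).trans (by gcongr)⟩
    push_cast
    ring
  have := (convex_segment 0 h).norm_image_sub_le_of_norm_hasDerivWithin_le
    (fun x hx => (hder x hx).1) (fun x hx => (hder x hx).2) (left_mem_segment ℝ 0 h)
    (right_mem_segment ℝ 0 h)
  have h0 : billiardGen p q S a (a + 0) - m * 0 ^ 3 = 0 := by simp [billiardGen]
  rw [h0, sub_zero, sub_zero] at this
  exact this.trans_eq (by ring)

theorem isLittleO_pow_of_norm_le {E : Type*} [SeminormedAddCommGroup E] {f : ℂ → E}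
    {K r : ℝ} (hr : 0 < r) {n : ℕ}
    (h : ∀ x ∈ ball (0 : ℂ) r, ‖f x‖ ≤ K * ‖x‖ ^ (n + 1)) : f =o[𝓝 0] fun x : ℂ => x ^ n := by
  have h1 : f =O[𝓝 0] fun x : ℂ => x ^ (n + 1) := by
    refine IsBigO.of_bound K ?_
    filter_upwards [ball_mem_nhds (0 : ℂ) hr] with x hx
    simpa using h x hx
  refine h1.trans_isLittleO ?_
  simpa using isLittleO_pow_pow (𝕜 := ℂ) (Nat.lt_succ_self n)

/-- The billiard generating function is a twist generating function in the sense of `TwistGen`. -/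
theorem exists_twistGen (hF : CurveFrame Λ β R u v p q κ)
    (hS : StripChart b₀ B₀ R g χ S) (hm : 0 < m)
    (hκg : ∀ z ∈ strip R, κ z ^ 2 = 24 * m * g z ^ 3) {ρ₁ c : ℝ} (hρ0 : 0 < ρ₁) (hρ : ρ₁ < R)
    (hc : 0 < c) (hcR : 2 * (c * ρ₁) ≤ b₀ / (8 * Λ ^ 4) * (R - ρ₁)) :
    ∃ N N₂ : ℂ × ℂ → ℂ, TwistGen m
      (4 * Λ ^ 5 / b₀ ^ 4 + 3 * m * (B₀ * (B₀ / b₀ + 1) / b₀ ^ 2)) c ρ₁ (fun ρ => χ '' strip ρ)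
      (billiardGen p q S) (billiardGenDeriv p q g S) N N₂ := by
  set K := 4 * Λ ^ 5 / b₀ ^ 4 + 3 * m * (B₀ * (B₀ / b₀ + 1) / b₀ ^ 2) with hK
  have hK0 : 0 ≤ K := by have := hS.b₀_pos; have := hS.B₀_pos; have := hF.Λ_pos; positivity
  set U := χ '' strip ρ₁ with hU
  obtain ⟨r, hr⟩ : ∃ r, r = 2 * (c * ρ₁) := ⟨_, rfl⟩
  rw [← hr] at hcR
  have hr0 : 0 < r := by rw [hr]; positivity
  have hr2 : r / 2 = c * ρ₁ := by rw [hr]; ring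
  have hlt : ∀ {x : ℂ}, x ∈ ball (0 : ℂ) r → ‖x‖ < b₀ / (8 * Λ ^ 4) * (R - ρ₁) := fun hx =>
    (mem_ball_zero_iff.1 hx).trans_le hcR
  have hUR : U ⊆ χ '' strip R := image_mono (strip_mono hρ.le)
  have hUo : IsOpen U := hS.isOpen_image hρ.le
  have hU1 : ∀ θ ∈ U, θ + 1 ∈ U := fun θ hθ => hS.image_add_one hρ.le hθ
  have hUs : ∀ θ ∈ U, star θ ∈ U := fun θ hθ => hS.image_star hρ.le hθ
  have hclose : ∀ x ∈ U ×ˢ ball (0 : ℂ) r, x.1 + x.2 ∈ χ '' strip R ∧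
      ‖S (x.1 + x.2) - S x.1‖ < 1 / (8 * Λ ^ 4) := fun x hx => by
    obtain ⟨h1, h2, h3⟩ := hS.close_mem hF.one_le hF.R_le_one hρ hx.1 (hlt hx.2) hρ0
    exact ⟨h1, h2.trans_lt h3⟩
  have hα : IsRealAnalyticLift (fun x : ℂ × ℂ => S x.1) (U ×ˢ ball (0 : ℂ) r) :=
    hS.lift_comp_S IsRealAnalyticLift.fst fun x hx => hUR hx.1
  have hα' : IsRealAnalyticLift (fun x : ℂ × ℂ => S (x.1 + x.2)) (U ×ˢ ball (0 : ℂ) r) :=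
    hS.lift_comp_S (IsRealAnalyticLift.fst.add_periodic IsRealAnalyticPeriodic.snd)
      fun x hx => (hclose x hx).1
  have hαm : MapsTo (fun x : ℂ × ℂ => S x.1) (U ×ˢ ball (0 : ℂ) r) (strip R) :=
    fun x hx => hS.S_mem le_rfl (hUR hx.1)
  have hαm' : MapsTo (fun x : ℂ × ℂ => S (x.1 + x.2)) (U ×ˢ ball (0 : ℂ) r) (strip R) :=
    fun x hx => hS.S_mem le_rfl (hclose x hx).1
  have hmc : star (m : ℂ) = m := Complex.conj_ofReal m
  have hG : IsRealAnalyticPeriodic (fun x => billiardGen p q S x.1 (x.1 + x.2) - m * x.2 ^ 3)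
      (U ×ˢ ball (0 : ℂ) r) :=
    ((hα'.sub hα).sub ((hα'.sub hα).mul
      (hF.periodic_chordRatio hα hα' hαm hαm' fun x hx => (hclose x hx).2.le))).sub
      ((IsRealAnalyticPeriodic.const hmc).mul (IsRealAnalyticPeriodic.snd.pow 3))
  have hA := hF.periodic_chordAngle hα' hα hαm' hαm fun x hx => by
    rw [norm_sub_rev]; exact (hclose x hx).2.le
  have hginv : IsRealAnalyticPeriodic (fun x : ℂ × ℂ => (g (S (x.1 + x.2)))⁻¹) (U ×ˢ ball (0 : ℂ) r) :=
    hα'.periodic_comp (k := fun z => (g z)⁻¹)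
      (hS.differentiableOn.inv fun z hz => hS.g_ne_zero hz)
      (fun z hz => by simp only [hS.periodic z hz])
      (fun z hz => by simp only [hS.g_star z hz, star_inv₀]) hαm'
  have hcos : IsRealAnalyticPeriodic (fun x : ℂ × ℂ =>
      1 - Complex.cos (chordAngle p q (S (x.1 + x.2)) (S x.1))) (U ×ˢ ball (0 : ℂ) r) := by
    refine (IsRealAnalyticPeriodic.const (c := 1) (by simp)).sub
      ⟨hA.1.ccos, fun x hx => congrArg Complex.cos (hA.2.1 x hx),
        fun x hx => (congrArg Complex.cos (hA.2.2 x hx)).trans (Complex.cos_conj _)⟩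
  have hP : IsRealAnalyticPeriodic
      (fun x => billiardGenDeriv p q g S x.1 (x.1 + x.2) - 3 * m * x.2 ^ 2) (U ×ˢ ball (0 : ℂ) r) :=
    (hginv.mul hcos).sub ((IsRealAnalyticPeriodic.const (c := 3 * m) (by
      rw [star_mul', hmc]; simp)).mul (IsRealAnalyticPeriodic.snd.pow 2))
  have hGb : ∀ x ∈ U ×ˢ ball (0 : ℂ) r,
      ‖billiardGen p q S x.1 (x.1 + x.2) - m * x.2 ^ 3‖ ≤ K * ‖x.2‖ ^ 4 := fun x hx =>
    norm_billiardGen_sub_le hF hS hm hκg hρ0 hρ hx.1 (hlt hx.2)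
  have hPb : ∀ x ∈ U ×ˢ ball (0 : ℂ) r,
      ‖billiardGenDeriv p q g S x.1 (x.1 + x.2) - 3 * m * x.2 ^ 2‖ ≤ K * ‖x.2‖ ^ 3 := fun x hx =>
    norm_billiardGenDeriv_sub_le hF hS hm hκg hρ0 hρ hx.1 (hlt hx.2)
  obtain ⟨N, hN, hNe, hNb⟩ := hG.exists_eq_snd_pow_mul hUo hU1 hUs hr0 (n := 3) fun a ha =>
    isLittleO_pow_of_norm_le hr0 fun x hx => hGb (a, x) ⟨ha, hx⟩
  obtain ⟨N₂, hN₂, hN₂e, hN₂b⟩ := hP.exists_eq_snd_pow_mul hUo hU1 hUs hr0 (n := 2) fun a ha =>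
    isLittleO_pow_of_norm_le hr0 fun x hx => hPb (a, x) ⟨ha, hx⟩
  have hNb := hNb (K * r ^ (3 + 1)) fun x hx => (hGb x hx).trans (by
    have := (mem_ball_zero_iff.1 hx.2).le; gcongr)
  have hN₂b := hN₂b (K * r ^ (2 + 1)) fun x hx => (hPb x hx).trans (by
    have := (mem_ball_zero_iff.1 hx.2).le; gcongr)
  rw [mul_div_assoc, div_self (pow_ne_zero _ hr0.ne'), mul_one] at hNb hN₂b
  rw [hr2] at hN hNe hNb hN₂ hN₂e hN₂b
  have hsub : ball (0 : ℂ) (c * ρ₁) ⊆ ball 0 r := ball_subset_ball (by rw [← hr2]; linarith)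
  refine ⟨N, N₂, hN, hN₂, hNb, hN₂b, fun a ha h hh => ?_, fun a ha h hh => ?_, fun a ha h hh => ?_,
    fun a ha b hb hh => ?_⟩
  · linear_combination hNe (a, h) ⟨ha, hh⟩
  · linear_combination hN₂e (a, h) ⟨ha, hh⟩
  · have := hclose (a, h) ⟨ha, hsub hh⟩
    exact hasDerivAt_billiardGen hF hS (hUR ha) this.1 this.2
  · rw [billiardGen, billiardGen, chordRatio_comm]
    ring

end

/-! ### The Lazutkin parameter -/

section

variable {Λ β R : ℝ} {u v p q κ : ℂ → ℂ}

/-- Holomorphic functions on a strip that agree on the real line are equal. -/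
theorem eqOn_strip_of_eq_ofReal {R : ℝ} {f g : ℂ → ℂ} (hf : DifferentiableOn ℂ f (strip R))
    (hg : DifferentiableOn ℂ g (strip R)) (hfg : ∀ t : ℝ, f t = g t) : EqOn f g (strip R) := by
  intro z hz
  have hR : 0 < R := (abs_nonneg _).trans_lt hz
  have hO := isOpen_strip R
  refine (hf.analyticOnNhd hO).eqOn_of_preconnected_of_frequently_eq (hg.analyticOnNhd hO)
    (convex_strip R).isPreconnected (z₀ := 0) (by simpa using ofReal_mem_strip hR 0) ?_ hz
  have h1 : Tendsto (fun t : ℝ => (t : ℂ)) (𝓝[≠] 0) (𝓝[≠] 0) := by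
    refine tendsto_nhdsWithin_iff.2 ⟨?_, ?_⟩
    · have : Tendsto (fun t : ℝ => (t : ℂ)) (𝓝 0) (𝓝 ((0 : ℝ) : ℂ)) :=
        Complex.continuous_ofReal.tendsto 0
      simpa using this.mono_left nhdsWithin_le_nhds
    · filter_upwards [self_mem_nhdsWithin] with t ht
      simpa using ht
  exact h1.frequently (Frequently.of_forall hfg)

/-- The Lazutkin parameter `χ`, the primitive of `κ^{2/3}` normalized to have period one. -/
theorem CurveFrame.exists_chart (h : CurveFrame Λ β R u v p q κ) :
    ∃ (m : ℝ) (g χ S : ℂ → ℂ), β ^ 3 / 24 ≤ m ∧ m ≤ Λ ^ 3 / 24 ∧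
      StripChart (β / (2 * Λ)) (Λ / β ^ 2) R g χ S ∧
      ∀ z ∈ strip R, κ z ^ 2 = 24 * m * g z ^ 3 := by
  have hΛ := h.Λ_pos
  have hΛ1 := h.one_le
  have hβ := h.β_pos
  have hβ1 := h.β_le_one
  -- the principal branch of `z ^ (2/3)` on the half-plane containing the values of `κ`
  set w : ℂ → ℂ := fun z => κ z ^ (2 / 3 : ℂ) with hw
  have hre : ∀ z ∈ strip R, 0 < (κ z).re := fun z hz => hβ.trans_le (h.le_re z hz)
  have hsl : ∀ z ∈ strip R, κ z ∈ Complex.slitPlane := fun z hz => Or.inl (hre z hz)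
  have hne : ∀ z ∈ strip R, κ z ≠ 0 := fun z hz => Complex.slitPlane_ne_zero (hsl z hz)
  have hβκ : ∀ z ∈ strip R, β ≤ ‖κ z‖ := fun z hz => (h.le_re z hz).trans (Complex.re_le_norm _)
  have hnorm : ∀ z ∈ strip R, ‖w z‖ = ‖κ z‖ ^ (2 / 3 : ℝ) := fun z hz => by
    have : (2 / 3 : ℂ) = ((2 / 3 : ℝ) : ℂ) := by push_cast; ring
    rw [hw]
    simp only [this]
    rw [Complex.norm_cpow_real]
  have hwΛ : ∀ z ∈ strip R, ‖w z‖ ≤ Λ := fun z hz => by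
    rw [hnorm z hz]
    calc ‖κ z‖ ^ (2 / 3 : ℝ) ≤ Λ ^ (2 / 3 : ℝ) :=
          Real.rpow_le_rpow (norm_nonneg _) (h.norm_κ z hz) (by norm_num)
      _ ≤ Λ ^ (1 : ℝ) := Real.rpow_le_rpow_of_exponent_le hΛ1 (by norm_num)
      _ = Λ := Real.rpow_one _
  have hwβ : ∀ z ∈ strip R, β ≤ ‖w z‖ := fun z hz => by
    rw [hnorm z hz]
    calc β = β ^ (1 : ℝ) := (Real.rpow_one _).symm
      _ ≤ β ^ (2 / 3 : ℝ) := Real.rpow_le_rpow_of_exponent_ge hβ hβ1 (by norm_num)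
      _ ≤ ‖κ z‖ ^ (2 / 3 : ℝ) := Real.rpow_le_rpow hβ.le (hβκ z hz) (by norm_num)
  have hwre : ∀ z ∈ strip R, ‖w z‖ / 2 ≤ (w z).re := fun z hz => by
    have harg := abs_lt.1 (Complex.abs_arg_lt_pi_div_two_iff.2 (Or.inl (hre z hz)))
    have e1 : (w z).re = ‖w z‖ * Real.cos (2 / 3 * Complex.arg (κ z)) := by
      have : w z = Complex.exp (Complex.log (κ z) * (2 / 3)) := Complex.cpow_def_of_ne_zero (hne z hz) _
      rw [this, Complex.exp_re, Complex.norm_exp]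
      have h2 : (2 / 3 : ℂ) = ((2 / 3 : ℝ) : ℂ) := by push_cast; ring
      rw [h2, Complex.im_mul_ofReal, Complex.log_im, mul_comm (Complex.arg (κ z))]
    have e2 : 1 / 2 ≤ Real.cos (2 / 3 * Complex.arg (κ z)) := by
      rw [← Real.cos_pi_div_three, ← Real.cos_abs (2 / 3 * _)]
      have : |2 / 3 * Complex.arg (κ z)| ≤ Real.pi / 3 := by
        rw [abs_le]; constructor <;> linarith [harg.1, harg.2]
      exact Real.cos_le_cos_of_nonneg_of_le_pi (abs_nonneg _) (by linarith [Real.pi_pos]) this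
    rw [e1]
    nlinarith [norm_nonneg (w z)]
  have hwd : DifferentiableOn ℂ w (strip R) := fun z hz =>
    (h.differentiableOn_κ z hz).cpow (differentiableWithinAt_const _) (hsl z hz)
  have hw1 : ∀ z ∈ strip R, w (z + 1) = w z := fun z hz => by
    simp only [hw, h.κ_add_one z hz]
  have hws : ∀ z ∈ strip R, w (star z) = star (w z) := fun z hz => by
    simp only [hw, h.κ_star z hz]
    simp only [RCLike.star_def]
    rw [Complex.conj_cpow _ _ (Complex.mem_slitPlane_iff_arg.1 (hsl z hz)).1, map_div₀,
      map_ofNat, map_ofNat]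
  have hwl : ∀ z ∈ strip R, ∀ z' ∈ strip R, ‖w z - w z'‖ ≤ 1 / β * (Λ * ‖z - z'‖) := by
    intro z hz z' hz'
    have hcv : Convex ℝ {x : ℂ | β ≤ x.re} := by
      have : {x : ℂ | β ≤ x.re} = Complex.reLm ⁻¹' Ici β := by ext; simp
      rw [this]
      exact (convex_Ici β).linear_preimage _
    have := hcv.norm_image_sub_le_of_norm_hasDerivWithin_le (𝕜 := ℂ)
      (f := fun x : ℂ => x ^ (2 / 3 : ℂ)) (f' := fun x => (2 / 3 : ℂ) * x ^ (2 / 3 - 1 : ℂ))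
      (C := 1 / β) (fun x hx => by
        have hx' : x ∈ Complex.slitPlane := Or.inl (hβ.trans_le hx)
        simpa using ((hasDerivAt_id x).cpow_const (c := (2 / 3 : ℂ)) hx').hasDerivWithinAt
          (s := {x : ℂ | β ≤ x.re}))
      (fun x hx => by
        have hxn : β ≤ ‖x‖ := le_trans hx (Complex.re_le_norm _)
        have h2 : (2 / 3 - 1 : ℂ) = ((-(1 / 3) : ℝ) : ℂ) := by push_cast; ring
        rw [norm_mul, h2, Complex.norm_cpow_real]
        have h3 : ‖x‖ ^ (-(1 / 3) : ℝ) ≤ 1 / β := by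
          calc ‖x‖ ^ (-(1 / 3) : ℝ) ≤ β ^ (-(1 / 3) : ℝ) :=
                Real.rpow_le_rpow_of_nonpos hβ hxn (by norm_num)
            _ ≤ β ^ (-1 : ℝ) := Real.rpow_le_rpow_of_exponent_ge hβ hβ1 (by norm_num)
            _ = 1 / β := by rw [Real.rpow_neg_one, one_div]
        have h4 : ‖(2 / 3 : ℂ)‖ ≤ 1 := by rw [norm_div, Complex.norm_ofNat, Complex.norm_ofNat]; norm_num
        calc _ ≤ 1 * (1 / β) := by gcongr
          _ = _ := one_mul _)
      (h.le_re z' hz') (h.le_re z hz)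
    refine this.trans ?_
    have := h.lipschitz_κ z hz z' hz'
    gcongr
  have hwc : Continuous fun t : ℝ => w t :=
    hwd.continuousOn.comp_continuous (by fun_prop) (ofReal_mem_strip h.R_pos)
  have hwreal : ∀ t : ℝ, ((w t).re : ℂ) = w t := fun t => by
    have := hws t (ofReal_mem_strip h.R_pos t)
    simp only [RCLike.star_def, Complex.conj_ofReal] at this
    exact (Complex.conj_eq_iff_re.1 this.symm)
  set I : ℝ := ∫ t in (0 : ℝ)..1, (w t).re with hI
  have hIc : (∫ t in (0 : ℝ)..1, w t) = I := by
    rw [hI, ← intervalIntegral.integral_ofReal]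
    exact intervalIntegral.integral_congr fun t _ => (hwreal t).symm
  have hrec : Continuous fun t : ℝ => (w t).re := Complex.continuous_re.comp hwc
  have hwt : ∀ t : ℝ, (w t).re = ‖w t‖ := fun t => by
    have h1 := hwreal t
    have h3 : 0 ≤ (w t).re := le_trans (by positivity) (hwre t (ofReal_mem_strip h.R_pos t))
    conv_rhs => rw [← h1]
    rw [Complex.norm_real, Real.norm_of_nonneg h3]
  have hIβ : β ≤ I := by
    have := intervalIntegral.integral_mono_on (μ := MeasureTheory.volume)
      (f := fun _ : ℝ => β) (g := fun t : ℝ => (w t).re) zero_le_one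
      (continuous_const.intervalIntegrable _ _) (hrec.intervalIntegrable _ _)
      fun t _ => by rw [hwt]; exact hwβ _ (ofReal_mem_strip h.R_pos t)
    simpa using this
  have hIΛ : I ≤ Λ := by
    have := intervalIntegral.integral_mono_on (μ := MeasureTheory.volume)
      (f := fun t : ℝ => (w t).re) (g := fun _ : ℝ => Λ) zero_le_one
      (hrec.intervalIntegrable _ _) (continuous_const.intervalIntegrable _ _)
      fun t _ => by rw [hwt]; exact hwΛ _ (ofReal_mem_strip h.R_pos t)
    simpa using this
  have hI0 : 0 < I := hβ.trans_le hIβ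
  have hIne : (I : ℂ) ≠ 0 := Complex.ofReal_ne_zero.2 hI0.ne'
  have hIn : ‖(I : ℂ)‖ = I := by rw [Complex.norm_real, Real.norm_of_nonneg hI0.le]
  obtain ⟨χ, S, hS⟩ := exists_stripChart (b₀ := β / (2 * Λ)) (B₀ := Λ / β ^ 2) (R := R)
    (g := fun z => w z / I) (by positivity) h.R_pos (hwd.div_const _)
    (fun z hz => by simp only [hw1 z hz])
    (fun z hz => by
      simp only [hws z hz]
      simp only [RCLike.star_def, map_div₀, Complex.conj_ofReal])
    (fun z hz => by
      rw [Complex.div_ofReal_re]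
      have := (hwβ z hz)
      have h2 := hwre z hz
      rw [div_le_div_iff₀ (by positivity) hI0]
      nlinarith)
    (fun z hz => by
      rw [norm_div, hIn, div_le_div_iff₀ hI0 (by positivity)]
      have h1 := hwΛ z hz
      have h2 : β ^ 2 ≤ β := by nlinarith
      calc ‖w z‖ * β ^ 2 ≤ Λ * I := by gcongr; linarith)
    (fun z hz z' hz' => by
      rw [← sub_div, norm_div, hIn, div_le_iff₀ hI0]
      refine (hwl z hz z' hz').trans ?_
      have : 1 / β * (Λ * ‖z - z'‖) = Λ / β ^ 2 * ‖z - z'‖ * β := by field_simp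
      rw [this]
      gcongr)
    (by rw [intervalIntegral.integral_div, hIc, div_self hIne])
  refine ⟨I ^ 3 / 24, _, χ, S, by gcongr, by gcongr, hS, fun z hz => ?_⟩
  have hw3 : w z ^ 3 = κ z ^ 2 := by
    rw [hw]
    simp only
    rw [← Complex.cpow_nat_mul]
    have : ((3 : ℕ) : ℂ) * (2 / 3) = ((2 : ℕ) : ℂ) := by push_cast; ring
    rw [this, Complex.cpow_natCast]
  rw [div_pow, hw3]
  push_cast
  field_simp

end

/-! ### Complexification of the boundary curve -/

/-- The vector `(v₀, v₁)` of the plane as the complex number `v₀ + i v₁`. -/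
def planeToComplex (v : Plane) : ℂ := ⟨v 0, v 1⟩

/-- `Q` is a holomorphic extension of the closed curve `ρ` to the strip of half-width `R`. -/
structure IsHolExtension (R : ℝ) (Q : ℂ → EuclideanSpace ℂ (Fin 2)) (ρ : ℝ → Plane) : Prop where
  pos : 0 < R
  differentiableOn : DifferentiableOn ℂ Q (strip R)
  apply_ofReal : ∀ (t : ℝ) (i : Fin 2), Q t i = ((ρ t i : ℝ) : ℂ)
  periodic : Function.Periodic ρ 1

namespace IsHolExtension

variable {R : ℝ} {Q : ℂ → EuclideanSpace ℂ (Fin 2)} {ρ : ℝ → Plane}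

theorem hasDerivAt_apply (h : IsHolExtension R Q ρ) {z : ℂ} (hz : z ∈ strip R) (i : Fin 2) :
    HasDerivAt (fun z => Q z i) (deriv Q z i) z :=
  (EuclideanSpace.proj (𝕜 := ℂ) i).hasFDerivAt.comp_hasDerivAt z
    (h.differentiableOn.differentiableAt ((isOpen_strip R).mem_nhds hz)).hasDerivAt

theorem differentiableOn_apply (h : IsHolExtension R Q ρ) (i : Fin 2) :
    DifferentiableOn ℂ (fun z => Q z i) (strip R) := fun _ hz =>
  (h.hasDerivAt_apply hz i).differentiableAt.differentiableWithinAt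

theorem hasDerivAt_re (h : IsHolExtension R Q ρ) (t : ℝ) (i : Fin 2) :
    HasDerivAt (fun t => ρ t i) (deriv Q t i).re t := by
  refine (h.hasDerivAt_apply (ofReal_mem_strip h.pos t) i).real_of_complex.congr_of_eventuallyEq ?_
  filter_upwards with x
  simp only [h.apply_ofReal x i, Complex.ofReal_re]

theorem differentiableAt (h : IsHolExtension R Q ρ) (t : ℝ) : DifferentiableAt ℝ ρ t :=
  differentiableAt_euclidean.2 fun i => (h.hasDerivAt_re t i).differentiableAt

theorem deriv_apply (h : IsHolExtension R Q ρ) (t : ℝ) (i : Fin 2) :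
    deriv Q t i = ((deriv ρ t i : ℝ) : ℂ) := by
  have h1 : HasDerivAt (fun t => ρ t i) (deriv ρ t i) t :=
    (EuclideanSpace.proj (𝕜 := ℝ) i).hasFDerivAt.comp_hasDerivAt t (h.differentiableAt t).hasDerivAt
  have h2 := (h.hasDerivAt_apply (ofReal_mem_strip h.pos t) i).comp_ofReal
  refine h2.unique (h1.ofReal_comp.congr_of_eventuallyEq ?_)
  filter_upwards with x using h.apply_ofReal x i

protected theorem deriv (h : IsHolExtension R Q ρ) : IsHolExtension R (deriv Q) (deriv ρ) where
  pos := h.pos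
  differentiableOn := h.differentiableOn.deriv (isOpen_strip R)
  apply_ofReal := h.deriv_apply
  periodic := fun t => by
    rw [← deriv_comp_add_const]
    exact congrArg (fun f => deriv f t) (funext h.periodic)

theorem apply_add_one (h : IsHolExtension R Q ρ) {z : ℂ} (hz : z ∈ strip R) (i : Fin 2) :
    Q (z + 1) i = Q z i := by
  refine eqOn_strip_of_eq_ofReal (f := fun z => Q (z + 1) i) (g := fun z => Q z i)
    ((h.differentiableOn_apply i).comp (by fun_prop) fun z hz => strip_add_one hz)
    (h.differentiableOn_apply i) (fun t => ?_) hz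
  have := h.apply_ofReal (t + 1) i
  push_cast at this
  rw [this, h.periodic t, h.apply_ofReal]

theorem apply_star (h : IsHolExtension R Q ρ) {z : ℂ} (hz : z ∈ strip R) (i : Fin 2) :
    Q (star z) i = star (Q z i) := by
  have hd : DifferentiableOn ℂ ((starRingEnd ℂ) ∘ (fun z => Q z i) ∘ (starRingEnd ℂ)) (strip R) := by
    intro z hz
    refine (differentiableAt_conj_conj_iff.2 ?_).differentiableWithinAt
    exact (h.hasDerivAt_apply (strip_star hz) i).differentiableAt
  have := eqOn_strip_of_eq_ofReal hd (h.differentiableOn_apply i) (fun t => by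
    simp [h.apply_ofReal]) hz
  simpa using congrArg star this

end IsHolExtension

theorem norm_add_I_mul_le {x : EuclideanSpace ℂ (Fin 2)} {D : ℝ} (h : ‖x‖ ≤ D) (j : ℂ)
    (hj : ‖j‖ = 1) : ‖x 0 + j * x 1‖ ≤ 2 * D := by
  have h0 := PiLp.norm_apply_le x 0
  have h1 := PiLp.norm_apply_le x 1
  have := norm_add_le (x 0) (j * x 1)
  rw [norm_mul, hj, one_mul] at this
  linarith

/-- The complexified curve satisfies the bounds of a `CurveFrame`. The curvature is bounded below on the
whole strip since it varies there by at most `8 D² σ₀ ≤ 1 / (2 D)` from its values on the real line. -/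
theorem exists_curveFrame {D σ₀ : ℝ} {r : ℝ → Plane} (hD : 1 < D) (hσ : 0 < σ₀)
    (hσD : σ₀ < (16 * D ^ 3)⁻¹) (hper : Function.Periodic r 1) (hunit : ∀ s, ‖deriv r s‖ = 1)
    (hκ : SpeedCurvatureBound D r) (hr : AnalyticBound D σ₀ r) :
    ∃ u v p q κ : ℂ → ℂ, CurveFrame (8 * D ^ 2) (1 / (2 * D)) σ₀ u v p q κ ∧
      (∀ t : ℝ, HasDerivAt r (deriv r t) t) ∧ (∀ t : ℝ, u t = planeToComplex (r t)) ∧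
      ∀ t : ℝ, p t = planeToComplex (deriv r t) := by
  obtain ⟨Q, hQ, hQr, hQb⟩ := hr
  have hD0 : 0 < D := by linarith
  have h0 : IsHolExtension σ₀ Q r := ⟨hσ, hQ, hQr, hper⟩
  have h1 := h0.deriv
  have h2 := h1.deriv
  have h3 := h2.deriv
  have b1 : ∀ z ∈ strip σ₀, ‖deriv Q z‖ ≤ D := fun z hz => by
    simpa [iteratedDeriv_one] using hQb 1 (by norm_num) z hz
  have b2 : ∀ z ∈ strip σ₀, ‖deriv (deriv Q) z‖ ≤ D := fun z hz => by
    simpa [iteratedDeriv_succ, iteratedDeriv_zero] using hQb 2 (by norm_num) z hz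
  have b3 : ∀ z ∈ strip σ₀, ‖deriv (deriv (deriv Q)) z‖ ≤ D := fun z hz => by
    simpa [iteratedDeriv_succ, iteratedDeriv_zero] using hQb 3 (by norm_num) z hz
  -- `r₁ ± i r₂` on the level of vectors of `ℂ²`
  set ep : EuclideanSpace ℂ (Fin 2) → ℂ := fun x => x 0 + Complex.I * x 1 with hep
  set em : EuclideanSpace ℂ (Fin 2) → ℂ := fun x => x 0 + -Complex.I * x 1 with hem
  have ebp : ∀ {x : EuclideanSpace ℂ (Fin 2)}, ‖x‖ ≤ D → ‖ep x‖ ≤ 2 * D := fun h =>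
    norm_add_I_mul_le h _ Complex.norm_I
  have ebm : ∀ {x : EuclideanSpace ℂ (Fin 2)}, ‖x‖ ≤ D → ‖em x‖ ≤ 2 * D := fun h =>
    norm_add_I_mul_le h _ (by simp)
  have dp : ∀ {F : ℂ → EuclideanSpace ℂ (Fin 2)} {ρ : ℝ → Plane}, IsHolExtension σ₀ F ρ →
      ∀ z ∈ strip σ₀, HasDerivAt (fun z => ep (F z)) (ep (deriv F z)) z := fun h z hz =>
    (h.hasDerivAt_apply hz 0).add ((h.hasDerivAt_apply hz 1).const_mul _)
  have dm : ∀ {F : ℂ → EuclideanSpace ℂ (Fin 2)} {ρ : ℝ → Plane}, IsHolExtension σ₀ F ρ →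
      ∀ z ∈ strip σ₀, HasDerivAt (fun z => em (F z)) (em (deriv F z)) z := fun h z hz =>
    (h.hasDerivAt_apply hz 0).add ((h.hasDerivAt_apply hz 1).const_mul _)
  have dO : ∀ {f f' : ℂ → ℂ}, (∀ z ∈ strip σ₀, HasDerivAt f (f' z) z) →
      DifferentiableOn ℂ f (strip σ₀) := fun h z hz => (h z hz).differentiableAt.differentiableWithinAt
  have sp : ∀ {F : ℂ → EuclideanSpace ℂ (Fin 2)} {ρ : ℝ → Plane}, IsHolExtension σ₀ F ρ →
      ∀ z ∈ strip σ₀, ep (F (star z)) = star (em (F z)) := fun h z hz => by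
    simp only [hep, hem, h.apply_star hz]
    simp
  have sm : ∀ {F : ℂ → EuclideanSpace ℂ (Fin 2)} {ρ : ℝ → Plane}, IsHolExtension σ₀ F ρ →
      ∀ z ∈ strip σ₀, em (F (star z)) = star (ep (F z)) := fun h z hz => by
    simp only [hep, hem, h.apply_star hz]
    simp
  have pp : ∀ {F : ℂ → EuclideanSpace ℂ (Fin 2)} {ρ : ℝ → Plane}, IsHolExtension σ₀ F ρ →
      ∀ z ∈ strip σ₀, ep (F (z + 1)) = ep (F z) := fun h z hz => by
    simp only [hep, h.apply_add_one hz]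
  have pm : ∀ {F : ℂ → EuclideanSpace ℂ (Fin 2)} {ρ : ℝ → Plane}, IsHolExtension σ₀ F ρ →
      ∀ z ∈ strip σ₀, em (F (z + 1)) = em (F z) := fun h z hz => by
    simp only [hem, h.apply_add_one hz]
  -- the extended tangent has unit length
  have hmul : ∀ z ∈ strip σ₀, ep (deriv Q z) * em (deriv Q z) = 1 := by
    refine fun z hz => eqOn_strip_of_eq_ofReal (f := fun z => ep (deriv Q z) * em (deriv Q z))
      (g := fun _ => 1) ((dO (dp h1)).mul (dO (dm h1))) (by fun_prop) (fun t => ?_) hz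
    have hn := hunit t
    have hn2 : (deriv r t 0) ^ 2 + (deriv r t 1) ^ 2 = 1 := by
      have := EuclideanSpace.real_norm_sq_eq (deriv r t)
      rw [hn, Fin.sum_univ_two] at this
      linarith
    have hn3 : ((deriv r t 0 : ℝ) : ℂ) ^ 2 + ((deriv r t 1 : ℝ) : ℂ) ^ 2 = 1 := by
      rw [← Complex.ofReal_pow, ← Complex.ofReal_pow, ← Complex.ofReal_add, hn2, Complex.ofReal_one]
    simp only [hep, hem, h1.apply_ofReal]
    linear_combination hn3 - ((deriv r t 1 : ℝ) : ℂ) ^ 2 * Complex.I_sq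
  -- the derivative of `p q = 1`
  have hmul' : ∀ z ∈ strip σ₀, ep (deriv (deriv Q) z) * em (deriv Q z) +
      ep (deriv Q z) * em (deriv (deriv Q) z) = 0 := by
    intro z hz
    refine ((dp h1 z hz).mul (dm h1 z hz)).unique ((hasDerivAt_const z (1 : ℂ)).congr_of_eventuallyEq ?_)
    filter_upwards [(isOpen_strip σ₀).mem_nhds hz] with x hx using hmul x hx
  set κ : ℂ → ℂ := fun z => -Complex.I * (ep (deriv (deriv Q) z) * em (deriv Q z)) with hκdef
  have hκd : ∀ z ∈ strip σ₀, HasDerivAt κ (-Complex.I * (ep (deriv (deriv (deriv Q)) z) * em (deriv Q z) +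
      ep (deriv (deriv Q) z) * em (deriv (deriv Q) z))) z := fun z hz =>
    ((dp h2 z hz).mul (dm h1 z hz)).const_mul _
  have hκl : ∀ z ∈ strip σ₀, ∀ w ∈ strip σ₀, ‖κ z - κ w‖ ≤ 8 * D ^ 2 * ‖z - w‖ := fun z hz w hw =>
    (convex_strip σ₀).norm_image_sub_le_of_norm_hasDerivWithin_le
      (fun z hz => (hκd z hz).hasDerivWithinAt) (fun z hz => by
        rw [norm_mul, norm_neg, Complex.norm_I, one_mul]
        refine (norm_add_le _ _).trans ?_
        rw [norm_mul, norm_mul]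
        have e1 := mul_le_mul (ebp (b3 z hz)) (ebm (b1 z hz)) (norm_nonneg _) (by positivity)
        have e2 := mul_le_mul (ebp (b2 z hz)) (ebm (b2 z hz)) (norm_nonneg _) (by positivity)
        nlinarith) hw hz
  have hκre : ∀ t : ℝ, 1 / D ≤ (κ t).re := fun t => by
    have h5 := (hκ t).2
    rw [signedCurvature, hunit t] at h5
    have : (κ t).re = (deriv r t 0 * deriv (deriv r) t 1 - deriv r t 1 * deriv (deriv r) t 0) / 1 ^ 3 := by
      simp only [hκdef, hep, hem, h1.apply_ofReal, h2.apply_ofReal]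
      simp
      ring
    rw [this, one_div]
    exact h5
  have h8 : 2 * D ≤ 8 * D ^ 2 := by nlinarith
  have hD3 : 1 < 16 * D ^ 3 := by nlinarith [one_lt_pow₀ hD (n := 3) (by norm_num)]
  refine ⟨fun z => ep (Q z), fun z => em (Q z), fun z => ep (deriv Q z), fun z => em (deriv Q z), κ,
    ⟨by nlinarith, by positivity, ?_, hσ, ?_, dp h0, dm h0, ?_, ?_, dO hκd, hmul, pp h1, pm h1, ?_,
      sp h1, ?_, fun z hz => (ebp (b1 z hz)).trans h8, fun z hz => (ebm (b1 z hz)).trans h8,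
      ?_, hκl, ?_⟩,
    fun t => (h0.differentiableAt t).hasDerivAt, fun t => ?_, fun t => ?_⟩
  · rw [div_le_one (by positivity)]; linarith
  · exact (hσD.trans (inv_lt_one_of_one_lt₀ hD3)).le
  · intro z hz
    refine (dp h1 z hz).congr_deriv ?_
    simp only [hκdef]
    linear_combination (-(ep (deriv (deriv Q) z))) * hmul z hz -
      ep (deriv (deriv Q) z) * em (deriv Q z) * ep (deriv Q z) * (-Complex.I_sq)
  · intro z hz
    refine (dm h1 z hz).congr_deriv ?_
    simp only [hκdef]
    linear_combination (-(em (deriv (deriv Q) z))) * hmul z hz + em (deriv Q z) * hmul' z hz -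
      ep (deriv (deriv Q) z) * em (deriv Q z) ^ 2 * Complex.I_sq
  · intro z hz
    simp only [hκdef, pp h2 z hz, pm h1 z hz]
  · intro z hz
    simp only [hκdef, sp h2 z hz, sm h1 z hz]
    simp only [star_mul', star_neg, RCLike.star_def, Complex.conj_I]
    have := congrArg (starRingEnd ℂ) (hmul' z hz)
    simp only [map_add, map_mul, map_zero] at this
    linear_combination (-Complex.I) * this
  · intro z hz
    simp only [hκdef]
    rw [norm_mul, norm_neg, Complex.norm_I, one_mul, norm_mul]
    have e1 := mul_le_mul (ebp (b2 z hz)) (ebm (b1 z hz)) (norm_nonneg _) (by positivity)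
    nlinarith
  · intro z hz
    have e1 := hκre z.re
    have e2 := hκl _ (ofReal_mem_strip hσ z.re) z hz
    have e3 := (Complex.abs_re_le_norm _).trans e2
    have e4 : ‖(z.re : ℂ) - z‖ ≤ σ₀ := by
      have : (z.re : ℂ) - z = -(z.im * Complex.I) := by
        linear_combination Complex.re_add_im z
      rw [this, norm_neg, norm_mul, Complex.norm_I, mul_one, Complex.norm_real]
      exact le_of_lt hz
    rw [Complex.sub_re] at e3
    have e5 := (abs_le.1 e3).2
    have e6 : 8 * D ^ 2 * ‖(z.re : ℂ) - z‖ ≤ 1 / (2 * D) := by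
      calc _ ≤ 8 * D ^ 2 * (16 * D ^ 3)⁻¹ := by gcongr; linarith
        _ = 1 / (2 * D) := by field_simp; norm_num
    have e7 : 1 / D = 1 / (2 * D) + 1 / (2 * D) := by field_simp; norm_num
    linarith
  · simp only [hep, h0.apply_ofReal]
    apply Complex.ext <;> simp [planeToComplex]
  · simp only [hep, h1.apply_ofReal]
    apply Complex.ext <;> simp [planeToComplex]

/-! ### Approximately invariant curves of the billiard map -/

section

variable {Λ β R b₀ B₀ m : ℝ} {u v p q κ g χ S : ℂ → ℂ}

theorem TwistGen.mono {m K K' c ρ₁ : ℝ} {U : ℝ → Set ℂ} {G P : ℂ → ℂ → ℂ} {N N₂ : ℂ × ℂ → ℂ}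
    (h : TwistGen m K c ρ₁ U G P N N₂) (hK : K ≤ K') : TwistGen m K' c ρ₁ U G P N N₂ :=
  { h with
    norm_N := fun p hp => (h.norm_N p hp).trans hK
    norm_N₂ := fun p hp => (h.norm_N₂ p hp).trans hK }

/-- A family of approximately invariant curves `θ ↦ x + V(x, y)` of the billiard map in the chart,
for which the Euler-Lagrange equation holds to order `n + 4` in the step `y`. -/
structure ApproxInvariant (n : ℕ) (c M R : ℝ) (p q g χ S : ℂ → ℂ) (V : ℂ × ℂ → ℂ) : Prop where
  periodic : IsRealAnalyticPeriodic V ((χ '' strip (4 / 5 * R)) ×ˢ ball 0 (c * R))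
  norm_le : ∀ x ∈ (χ '' strip (4 / 5 * R)) ×ˢ ball (0 : ℂ) (c * R), ‖V x‖ ≤ M * ‖x.2‖
  norm_sub_le : ∀ x ∈ (χ '' strip (4 / 5 * R)) ×ˢ ball (0 : ℂ) (c * R),
    x.1 + x.2 ∈ χ '' strip (4 / 5 * R) → ‖V (x.1 + x.2, x.2) - V x‖ ≤ M * ‖x.2‖ ^ 2
  isBigO : ∀ θ ∈ χ '' strip (3 / 4 * R),
    (fun ε => billiardGenDeriv p q g S (θ - ε + V (θ - ε, ε)) (θ + V (θ, ε)) -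
        billiardGenDeriv p q g S (θ + ε + V (θ + ε, ε)) (θ + V (θ, ε))) =O[𝓝 0]
      fun ε : ℂ => ε ^ (n + 4)

/-- The billiard map in the Lazutkin parameter has approximately invariant curves of every order, on a
domain whose size is proportional to the width of the strip. -/
theorem exists_approxInvariant {Λ b₀ B₀ m₀ m₁ : ℝ} (hΛ : 1 ≤ Λ) (hb₀ : 0 < b₀) (hB₀ : 0 < B₀)
    (hm₀ : 0 < m₀) (hm₀₁ : m₀ ≤ m₁) (n : ℕ) : ∃ c M : ℝ, 0 < c ∧ 0 < M ∧
      ∀ {β R m : ℝ} {u v p q κ g χ S : ℂ → ℂ}, CurveFrame Λ β R u v p q κ →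
        StripChart b₀ B₀ R g χ S → m₀ ≤ m → m ≤ m₁ → (∀ z ∈ strip R, κ z ^ 2 = 24 * m * g z ^ 3) →
        ∃ V : ℂ × ℂ → ℂ, ApproxInvariant n c M R p q g χ S V := by
  set K := 4 * Λ ^ 5 / b₀ ^ 4 + 3 * m₁ * (B₀ * (B₀ / b₀ + 1) / b₀ ^ 2) with hK
  have hm₁ : 0 < m₁ := hm₀.trans_le hm₀₁
  have hΛ0 : 0 < Λ := by linarith
  set c := b₀ / (200 * Λ ^ 4) with hc
  have hc0 : 0 < c := by positivity
  obtain ⟨c₂, M, hc₂, hM, hP⟩ := exists_isParam (b := b₀ / 4) (C := 2 * (1 + B₀) ^ 2) (m₀ := m₀) (m₁ := m₁)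
    (K := K) (c := c) (by positivity) (by positivity) hm₀ (by positivity) hc0 n (8 / 9)
    (by norm_num) (by norm_num)
  obtain ⟨c₃, hc₃, hSt⟩ := exists_stepSmall (b := b₀ / 4) (c := c) (l := 5 / 6) (l' := 8 / 9)
    (c₂ := c₂) (M := M) (by positivity) hc0 (by norm_num) (by norm_num) hc₂ hM.le
  refine ⟨c₂ * (9 / 10), M, by positivity, hM, ?_⟩
  intro β R m u v p q κ g χ S hF hS hm hm' hκg
  have hR := hF.R_pos
  have hR1 := hF.R_le_one
  have hρ₁ : 0 < 9 / 10 * R := by positivity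
  have hρ₁1 : 9 / 10 * R ≤ 1 := by linarith
  have hm0 : 0 < m := hm₀.trans_le hm
  obtain ⟨N, N₂, hTw⟩ := exists_twistGen hF hS hm0 hκg (ρ₁ := 9 / 10 * R) (c := c) hρ₁ (by linarith) hc0 (by
    rw [hc]
    have : 2 * (b₀ / (200 * Λ ^ 4) * (9 / 10 * R)) = b₀ / (8 * Λ ^ 4) * R * (9 / 125) := by
      field_simp; ring
    rw [this]
    have h2 : b₀ / (8 * Λ ^ 4) * (R - 9 / 10 * R) = b₀ / (8 * Λ ^ 4) * R * (1 / 10) := by ring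
    rw [h2]
    exact mul_le_mul_of_nonneg_left (by norm_num) (by positivity))
  have hTw' := hTw.mono (K' := K) (by rw [hK]; gcongr)
  have hU := hS.stripFamily hR1 (ρ₁ := 9 / 10 * R) (by linarith)
  obtain ⟨V, Vd, B, hX, ho⟩ := hP hm hm' hρ₁ hρ₁1 hU hTw'
  have hs := hSt (9 / 10 * R) hρ₁ hρ₁1
  have e1 : 8 / 9 * (9 / 10 * R) = 4 / 5 * R := by ring
  have e2 : 5 / 6 * (9 / 10 * R) = 3 / 4 * R := by ring
  have e3 : c₂ * (9 / 10 * R) = c₂ * (9 / 10) * R := by ring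
  rw [e1, e2, e3] at hs
  rw [e1, e3] at hX
  rw [e1] at ho
  refine ⟨V, hX.V_irp, hX.norm_V, fun x hx hx' => ?_, fun θ hθ =>
    eulerLagrange_isBigO hU hTw' hX hs (by positivity) ho hθ⟩
  rw [hX.secant x hx hx', norm_mul]
  have := hX.norm_B x hx
  calc ‖x.2‖ * ‖B x‖ ≤ ‖x.2‖ * (M * ‖x.2‖) := by gcongr
    _ = _ := by ring

end

/-! ### Inversion of a perturbation of the identity -/

/-- Inversion of a holomorphic perturbation of the identity with Lipschitz constant `1/2`, with an
explicit domain for the inverse. -/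
theorem exists_inverse_id_add {E : Type*} [NormedAddCommGroup E] [NormedSpace ℂ E] [CompleteSpace E]
    {s : Set E} (hs : IsOpen s) {e : E → E} (he : DifferentiableOn ℂ e s)
    (hl : ∀ z ∈ s, ∀ w ∈ s, ‖e z - e w‖ ≤ 1 / 2 * ‖z - w‖) :
    ∃ (G : E → E) (T : Set E), IsOpen T ∧ DifferentiableOn ℂ G T ∧
      (∀ t ∈ T, G t ∈ s ∧ G t + e (G t) = t) ∧ (∀ w ∈ s, w + e w ∈ T ∧ G (w + e w) = w) ∧
      ∀ t ε, 0 ≤ ε → closedBall t ε ⊆ s → ‖e t‖ ≤ ε / 2 → t ∈ T := by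
  set f : E → E := fun w => w + e w with hf
  rcases subsingleton_or_nontrivial E with hE | hE
  · refine ⟨id, s, hs, differentiableOn_id, fun t ht => ⟨ht, Subsingleton.elim _ _⟩,
      fun w hw => ⟨by rwa [Subsingleton.elim (w + e w) w], Subsingleton.elim _ _⟩,
      fun t ε hε h _ => h (mem_closedBall_self hε)⟩
  have hap : ApproximatesLinearOn f ((ContinuousLinearEquiv.refl ℂ E : E ≃L[ℂ] E) : E →L[ℂ] E) s
      (1 / 2 : NNReal) := by
    intro x hx y hy
    have := hl x hx y hy
    refine (le_of_eq ?_).trans (this.trans_eq (by simp))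
    congr 1
    simp [hf]
    abel
  have hN : ‖(((ContinuousLinearEquiv.refl ℂ E).symm : E ≃L[ℂ] E) : E →L[ℂ] E)‖₊⁻¹ = 1 := by
    have : ‖(((ContinuousLinearEquiv.refl ℂ E).symm : E ≃L[ℂ] E) : E →L[ℂ] E)‖₊ = 1 := by
      rw [ContinuousLinearEquiv.refl_symm, ContinuousLinearEquiv.coe_refl]
      exact NNReal.eq ContinuousLinearMap.norm_id
    rw [this, inv_one]
  have hc : Subsingleton E ∨
      (1 / 2 : NNReal) < ‖(((ContinuousLinearEquiv.refl ℂ E).symm : E ≃L[ℂ] E) : E →L[ℂ] E)‖₊⁻¹ := by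
    right
    rw [hN]
    exact NNReal.half_lt_self one_ne_zero
  set Ψ := hap.toOpenPartialHomeomorph f s hc hs with hΨ
  have hΨf : ∀ x, Ψ x = f x := fun x => rfl
  have hsrc : Ψ.source = s := rfl
  refine ⟨Ψ.symm, Ψ.target, Ψ.open_target, ?_, ?_, ?_, ?_⟩
  · intro t ht
    have hx : Ψ.symm t ∈ s := Ψ.map_target ht
    set x := Ψ.symm t with hxdef
    have hed := (he.differentiableAt (hs.mem_nhds hx)).hasFDerivAt
    have hn : ‖-fderiv ℂ e x‖ < 1 := by
      rw [norm_neg]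
      refine (norm_fderiv_le_of_lip' ℂ (C := 1 / 2) (by norm_num) ?_).trans_lt (by norm_num)
      filter_upwards [hs.mem_nhds hx] with y hy using hl y hy x hx
    -- the derivative `1 + De` is invertible
    set A : E ≃L[ℂ] E := ContinuousLinearEquiv.unitsEquiv ℂ E (Units.oneSub (-fderiv ℂ e x) hn) with hA
    have hfd : HasFDerivAt Ψ (A : E →L[ℂ] E) x := by
      have h1 : HasFDerivAt f (ContinuousLinearMap.id ℂ E + fderiv ℂ e x) x := (hasFDerivAt_id x).add hed
      refine h1.congr_fderiv ?_
      ext y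
      simp [hA]
    exact (Ψ.hasFDerivAt_symm ht hfd).differentiableAt.differentiableWithinAt
  · intro t ht
    exact ⟨Ψ.map_target ht, Ψ.right_inv ht⟩
  · intro w hw
    exact ⟨Ψ.map_source hw, Ψ.left_inv hw⟩
  · intro t ε hε hball hle
    have := hap.closedBall_subset_target hc hs hε hball
    refine this ?_
    rw [hN, mem_closedBall, dist_eq_norm]
    have e1 : t - f t = -e t := by simp [hf]
    rw [e1, norm_neg]
    refine hle.trans (le_of_eq ?_)
    push_cast
    ring

/-! ### Angles along the approximate orbits -/

/-- The point with chart coordinate `x + V(x, y)`, as a parameter on the curve. -/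
def approxCurve (S : ℂ → ℂ) (V : ℂ × ℂ → ℂ) (x : ℂ × ℂ) : ℂ := S (x.1 + V x)

/-- The angle at the point `(x, y)` of the approximate orbit towards the next point. -/
noncomputable def forwardAngle (p q S : ℂ → ℂ) (V : ℂ × ℂ → ℂ) (x : ℂ × ℂ) : ℂ :=
  chordAngle p q (approxCurve S V x) (approxCurve S V (x.1 + x.2, x.2))

/-- The angle at the point `(x, y)` of the approximate orbit towards the previous point. -/
noncomputable def backwardAngle (p q S : ℂ → ℂ) (V : ℂ × ℂ → ℂ) (x : ℂ × ℂ) : ℂ :=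
  chordAngle p q (approxCurve S V x) (approxCurve S V (x.1 - x.2, x.2))

/-- Conditions on the relative size `δ` of the step under which the approximate orbit stays in the
domains where the estimates hold. -/
structure StepRadius (Λ b₀ c M δ : ℝ) : Prop where
  pos : 0 < δ
  le_c : δ ≤ c
  le_b : δ ≤ b₀ / 100
  mul_le_b : M * δ ≤ b₀ / 100
  mul_le_one : M * δ ≤ 1
  le_chord : 2 * δ / b₀ ≤ 1 / (8 * Λ ^ 4)

theorem exists_stepRadius {Λ b₀ c M : ℝ} (hΛ : 0 < Λ) (hb : 0 < b₀) (hc : 0 < c) (hM : 0 < M) :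
    ∃ δ, StepRadius Λ b₀ c M δ := by
  refine ⟨min c (min (b₀ / 100) (min (b₀ / 100 / M) (min (1 / M) (b₀ / (16 * Λ ^ 4))))), ?_⟩
  set δ := min c (min (b₀ / 100) (min (b₀ / 100 / M) (min (1 / M) (b₀ / (16 * Λ ^ 4)))))
  have h2 : δ ≤ b₀ / 100 / M :=
    (min_le_right _ _).trans ((min_le_right _ _).trans (min_le_left _ _))
  have h3 : δ ≤ 1 / M := (min_le_right _ _).trans ((min_le_right _ _).trans
    ((min_le_right _ _).trans (min_le_left _ _)))
  have h4 : δ ≤ b₀ / (16 * Λ ^ 4) := (min_le_right _ _).trans ((min_le_right _ _).trans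
    ((min_le_right _ _).trans (min_le_right _ _)))
  refine ⟨by positivity, min_le_left _ _, (min_le_right _ _).trans (min_le_left _ _), ?_, ?_, ?_⟩
  · rwa [le_div_iff₀' hM] at h2
  · rwa [le_div_iff₀' hM] at h3
  · rw [div_le_div_iff₀ hb (by positivity)]
    rw [le_div_iff₀ (by positivity)] at h4
    linarith

theorem norm_le_two_mul_norm_sin {x : ℂ} (hx : ‖x‖ ≤ 1 / 2) : ‖x‖ ≤ 2 * ‖Complex.sin x‖ := by
  have h1 := Complex.norm_exp_sub_one_sub_id_le (x := x * Complex.I) (by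
    rw [norm_mul, Complex.norm_I]; linarith)
  have h2 := Complex.norm_exp_sub_one_sub_id_le (x := -x * Complex.I) (by
    rw [norm_mul, norm_neg, Complex.norm_I]; linarith)
  rw [norm_mul, Complex.norm_I, mul_one] at h1
  rw [norm_mul, norm_neg, Complex.norm_I, mul_one] at h2
  have e : Complex.sin x - x = ((Complex.exp (-x * Complex.I) - 1 - -x * Complex.I) -
      (Complex.exp (x * Complex.I) - 1 - x * Complex.I)) * Complex.I / 2 := by
    rw [Complex.sin]
    linear_combination (-x) * Complex.I_sq
  have h3 : ‖Complex.sin x - x‖ ≤ ‖x‖ ^ 2 := by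
    rw [e, norm_div, norm_mul, Complex.norm_I, Complex.norm_ofNat]
    have := norm_sub_le (Complex.exp (-x * Complex.I) - 1 - -x * Complex.I)
      (Complex.exp (x * Complex.I) - 1 - x * Complex.I)
    linarith
  have h4 := norm_sub_norm_le x (Complex.sin x)
  rw [norm_sub_rev] at h4
  nlinarith [norm_nonneg x]

/-- The constant in the first-order expansion of the angles of the approximate orbit. -/
noncomputable def angleConst (Λ b₀ B₀ M : ℝ) : ℝ :=
  12 * Λ ^ 4 / b₀ ^ 2 + Λ / (2 * b₀) * (M + 4 * B₀ / b₀ ^ 2)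

section

variable {Λ β R b₀ B₀ m c M δ : ℝ} {u v p q κ g χ S : ℂ → ℂ} {V : ℂ × ℂ → ℂ} {n : ℕ}

/-- A chord whose end points have the chart coordinates `X` and `X + y + O(y²)` makes an angle
`κ / (2 g) y + O(y²)` with the tangent. -/
theorem norm_chordAngle_sub_mul_le (hF : CurveFrame Λ β R u v p q κ)
    (hS : StripChart b₀ B₀ R g χ S) {X X' y : ℂ} (hX : X ∈ χ '' strip R)
    (hX' : X' ∈ χ '' strip R) (hy : ‖X' - X - y‖ ≤ M * ‖y‖ ^ 2) (hMy : M * ‖y‖ ≤ 1)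
    (hyr : 2 * ‖y‖ / b₀ ≤ 1 / (8 * Λ ^ 4)) :
    ‖S X' - S X‖ ≤ 2 * ‖y‖ / b₀ ∧
    ‖chordAngle p q (S X) (S X') - κ (S X) / (2 * g (S X)) * y‖ ≤
      angleConst Λ b₀ B₀ M * ‖y‖ ^ 2 := by
  have hb := hS.b₀_pos
  have hB := hS.B₀_pos
  have hΛ := hF.Λ_pos
  have hs := hS.S_mem le_rfl hX
  have hs' := hS.S_mem le_rfl hX'
  have hXn : ‖X' - X‖ ≤ 2 * ‖y‖ := by
    have := norm_add_le (X' - X - y) y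
    rw [sub_add_cancel] at this
    nlinarith [norm_nonneg y]
  have hd : ‖S X' - S X‖ ≤ 2 * ‖y‖ / b₀ := by
    rw [le_div_iff₀' hb]
    exact (hS.norm_S_sub_le hX' hX).trans hXn
  refine ⟨hd, ?_⟩
  have hA := hF.norm_chordAngle_sub_le hs hs' (hd.trans hyr)
  have hT := hS.norm_χ_sub_sub_le hs' hs
  rw [hS.χ_S hX, hS.χ_S hX'] at hT
  set s := S X
  set η := S X' - s
  have hg0 := hS.g_ne_zero hs
  have e : chordAngle p q s (S X') - κ s / (2 * g s) * y =
      (chordAngle p q s (S X') - κ s * η / 2) +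
      κ s / (2 * g s) * ((X' - X - y) - (X' - X - g s * η)) := by
    field_simp
    ring
  have hk : ‖κ s / (2 * g s)‖ ≤ Λ / (2 * b₀) := by
    rw [norm_div, norm_mul, Complex.norm_ofNat]
    have := hF.norm_κ s hs
    have := hS.b₀_le_norm hs
    gcongr
  have hη2 : ‖η‖ ^ 2 ≤ 4 * ‖y‖ ^ 2 / b₀ ^ 2 := by
    calc ‖η‖ ^ 2 ≤ (2 * ‖y‖ / b₀) ^ 2 := by gcongr
      _ = _ := by ring
  have h5 : ‖(X' - X - y) - (X' - X - g s * η)‖ ≤ (M + 4 * B₀ / b₀ ^ 2) * ‖y‖ ^ 2 := by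
    have h6 := norm_sub_le (X' - X - y) (X' - X - g s * η)
    have h7 : B₀ * ‖η‖ ^ 2 ≤ B₀ * (4 * ‖y‖ ^ 2 / b₀ ^ 2) := by gcongr
    have h8 : B₀ * (4 * ‖y‖ ^ 2 / b₀ ^ 2) = 4 * B₀ / b₀ ^ 2 * ‖y‖ ^ 2 := by ring
    linarith
  rw [e]
  calc _ ≤ _ := norm_add_le _ _
    _ ≤ 3 * Λ ^ 4 * (4 * ‖y‖ ^ 2 / b₀ ^ 2) + Λ / (2 * b₀) * ((M + 4 * B₀ / b₀ ^ 2) * ‖y‖ ^ 2) := by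
      refine add_le_add (hA.trans (by gcongr)) ?_
      rw [norm_mul]
      exact mul_le_mul hk h5 (norm_nonneg _) (by positivity)
    _ = _ := by rw [angleConst]; ring

/-- The domain of the approximate orbits: `x` in the image of the strip of half-width `ρ` under the
chart, and `|y| < τ`. -/
def orbitDomain (χ : ℂ → ℂ) (ρ τ : ℝ) : Set (ℂ × ℂ) := (χ '' strip ρ) ×ˢ ball (0 : ℂ) τ

variable (hF : CurveFrame Λ β R u v p q κ) (hS : StripChart b₀ B₀ R g χ S)
  (hV : ApproxInvariant n c M R p q g χ S V) (hδ : StepRadius Λ b₀ c M δ) (hM : 0 < M)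
include hF hS hV hδ hM

theorem orbitDomain_facts {x : ℂ × ℂ} (hx : x ∈ orbitDomain χ (4 / 5 * R) (δ * R)) :
    ‖x.2‖ < δ * R ∧ ‖x.2‖ < δ ∧ x ∈ (χ '' strip (4 / 5 * R)) ×ˢ ball (0 : ℂ) (c * R) ∧
      ‖V x‖ ≤ M * ‖x.2‖ ∧ x.1 + V x ∈ χ '' strip R := by
  have hR := hF.R_pos
  have h1 : ‖x.2‖ < δ * R := mem_ball_zero_iff.1 hx.2
  have h2 : δ * R ≤ δ := mul_le_of_le_one_right hδ.pos.le hF.R_le_one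
  have h3 : x ∈ (χ '' strip (4 / 5 * R)) ×ˢ ball (0 : ℂ) (c * R) :=
    ⟨hx.1, ball_subset_ball (by have := hδ.le_c; gcongr) hx.2⟩
  have h4 := hV.norm_le x h3
  refine ⟨h1, h1.trans_le h2, h3, h4, hS.add_mem (ρ := 4 / 5 * R) (by linarith) le_rfl hx.1 ?_⟩
  have h5 : M * ‖x.2‖ ≤ M * (δ * R) := by gcongr
  have h6 : M * (δ * R) ≤ b₀ / 100 * R := by
    rw [← mul_assoc]; exact mul_le_mul_of_nonneg_right hδ.mul_le_b hR.le
  have := mul_pos hS.b₀_pos hR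
  linarith

omit hV hM in
theorem shift_mem_orbitDomain {a : ℝ} (ha' : a ≤ 3 / 4) {x : ℂ × ℂ}
    (hx : x ∈ orbitDomain χ (a * R) (δ * R)) :
    (x.1 + x.2, x.2) ∈ orbitDomain χ ((a + 1 / 20) * R) (δ * R) ∧
    (x.1 - x.2, x.2) ∈ orbitDomain χ ((a + 1 / 20) * R) (δ * R) ∧
    x ∈ orbitDomain χ ((a + 1 / 20) * R) (δ * R) := by
  have hR := hF.R_pos
  have h1 : ‖x.2‖ < δ * R := mem_ball_zero_iff.1 hx.2
  have h2 : ‖x.2‖ < b₀ / 4 * ((a + 1 / 20) * R - a * R) := by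
    have h6 : δ * R ≤ b₀ / 100 * R := mul_le_mul_of_nonneg_right hδ.le_b hR.le
    have := mul_pos hS.b₀_pos hR
    linarith
  have h3 : a * R < (a + 1 / 20) * R := by nlinarith
  have h4 : (a + 1 / 20) * R ≤ R := by nlinarith
  refine ⟨⟨hS.add_mem h3 h4 hx.1 h2, hx.2⟩, ⟨?_, hx.2⟩, ⟨image_mono (strip_mono h3.le) hx.1, hx.2⟩⟩
  have := hS.add_mem h3 h4 hx.1 (t := -x.2) (by rwa [norm_neg])
  rwa [← sub_eq_add_neg] at this

theorem lift_approxCurve :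
    IsRealAnalyticLift (approxCurve S V) (orbitDomain χ (4 / 5 * R) (δ * R)) := by
  refine hS.lift_comp_S (α := fun x => x.1 + V x) (IsRealAnalyticLift.fst.add_periodic
    (hV.periodic.mono fun x hx => (orbitDomain_facts hF hS hV hδ hM hx).2.2.1)) fun x hx =>
      (orbitDomain_facts hF hS hV hδ hM hx).2.2.2.2

theorem approxCurve_mem {x : ℂ × ℂ} (hx : x ∈ orbitDomain χ (4 / 5 * R) (δ * R)) :
    approxCurve S V x ∈ strip R :=
  hS.S_mem le_rfl (orbitDomain_facts hF hS hV hδ hM hx).2.2.2.2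

theorem norm_approxCurve_sub_le {x : ℂ × ℂ} (hx : x ∈ orbitDomain χ (4 / 5 * R) (δ * R)) :
    ‖approxCurve S V x - S x.1‖ ≤ M * ‖x.2‖ / b₀ := by
  have h := orbitDomain_facts hF hS hV hδ hM hx
  have := hS.norm_S_sub_le h.2.2.2.2 (image_mono (strip_mono (by linarith [hF.R_pos])) hx.1)
  rw [add_sub_cancel_left] at this
  rw [le_div_iff₀' hS.b₀_pos]
  exact this.trans h.2.2.2.1

omit hF hS hV hδ hM in
theorem lift_shift {α : ℂ × ℂ → ℂ} {W W' : Set (ℂ × ℂ)} (h : IsRealAnalyticLift α W) (j : ℂ)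
    (hj : star j = j) (hm : ∀ x ∈ W', (x.1 + j * x.2, x.2) ∈ W) :
    IsRealAnalyticLift (fun x => α (x.1 + j * x.2, x.2)) W' where
  differentiableOn := h.1.comp (f := fun x : ℂ × ℂ => (x.1 + j * x.2, x.2)) (by fun_prop) hm
  add_one := fun x hx => by
    rw [← h.2 _ (hm x hx)]
    congr 1
    ext <;> simp
    ring
  map_star := fun x hx => by
    rw [← h.3 _ (hm x hx)]
    congr 1
    ext <;> simp
    exact Or.inl (by simpa using hj.symm)

theorem lift_approxCurve_shift :
    IsRealAnalyticLift (fun x => approxCurve S V (x.1 + x.2, x.2)) (orbitDomain χ (3 / 4 * R) (δ * R)) ∧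
    IsRealAnalyticLift (fun x => approxCurve S V (x.1 - x.2, x.2)) (orbitDomain χ (3 / 4 * R) (δ * R)) := by
  have h := lift_approxCurve hF hS hV hδ hM
  have e : (3 / 4 + 1 / 20 : ℝ) = 4 / 5 := by norm_num
  have hm := fun x (hx : x ∈ orbitDomain χ (3 / 4 * R) (δ * R)) =>
    shift_mem_orbitDomain hF hS hδ (a := 3 / 4) le_rfl hx
  rw [e] at hm
  constructor
  · have := lift_shift h 1 (by simp) (W' := orbitDomain χ (3 / 4 * R) (δ * R)) fun x hx => by
      simpa using (hm x hx).1
    simpa using this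
  · have := lift_shift h (-1) (by simp) (W' := orbitDomain χ (3 / 4 * R) (δ * R)) fun x hx => by
      simpa [← sub_eq_add_neg] using (hm x hx).2.1
    simpa [← sub_eq_add_neg] using this

/-- The chords of the approximate orbit and their angles, to first order in the step. -/
theorem orbit_estimates {x : ℂ × ℂ} (hx : x ∈ orbitDomain χ (3 / 4 * R) (δ * R)) :
    (‖approxCurve S V (x.1 + x.2, x.2) - approxCurve S V x‖ ≤ 2 * ‖x.2‖ / b₀ ∧
      ‖forwardAngle p q S V x - κ (approxCurve S V x) / (2 * g (approxCurve S V x)) * x.2‖ ≤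
        angleConst Λ b₀ B₀ M * ‖x.2‖ ^ 2) ∧
    (‖approxCurve S V (x.1 - x.2, x.2) - approxCurve S V x‖ ≤ 2 * ‖x.2‖ / b₀ ∧
      ‖backwardAngle p q S V x - κ (approxCurve S V x) / (2 * g (approxCurve S V x)) * (-x.2)‖ ≤
        angleConst Λ b₀ B₀ M * ‖x.2‖ ^ 2) ∧
    2 * ‖x.2‖ / b₀ ≤ 1 / (8 * Λ ^ 4) := by
  have e : (3 / 4 + 1 / 20 : ℝ) = 4 / 5 := by norm_num
  obtain ⟨m1, m2, m0⟩ := shift_mem_orbitDomain hF hS hδ (a := 3 / 4) le_rfl hx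
  rw [e] at m1 m2 m0
  have f0 := orbitDomain_facts hF hS hV hδ hM m0
  have f1 := orbitDomain_facts hF hS hV hδ hM m1
  have f2 := orbitDomain_facts hF hS hV hδ hM m2
  have hb := hS.b₀_pos
  have hyr : 2 * ‖x.2‖ / b₀ ≤ 1 / (8 * Λ ^ 4) := by
    refine le_trans ?_ hδ.le_chord
    have := f0.2.1.le
    gcongr
  have hMy : M * ‖x.2‖ ≤ 1 := le_trans (by have := f0.2.1.le; gcongr) hδ.mul_le_one
  refine ⟨?_, ?_, hyr⟩
  · refine norm_chordAngle_sub_mul_le hF hS f0.2.2.2.2 f1.2.2.2.2 (y := x.2) ?_ hMy hyr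
    have := hV.norm_sub_le x f0.2.2.1 m1.1
    refine (le_of_eq ?_).trans this
    congr 1
    simp only
    ring
  · have h := norm_chordAngle_sub_mul_le hF hS f0.2.2.2.2 f2.2.2.2.2 (y := -x.2) (by
      have := hV.norm_sub_le _ f2.2.2.1 (by simpa using m0.1)
      simp only [sub_add_cancel] at this
      rw [norm_neg, ← norm_neg]
      refine (le_of_eq ?_).trans this
      congr 1
      simp only
      ring) (by rwa [norm_neg]) (by rwa [norm_neg])
    rw [norm_neg] at h
    exact h

theorem periodic_angles :
    IsRealAnalyticPeriodic (forwardAngle p q S V) (orbitDomain χ (3 / 4 * R) (δ * R)) ∧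
    IsRealAnalyticPeriodic (backwardAngle p q S V) (orbitDomain χ (3 / 4 * R) (δ * R)) := by
  have e : (3 / 4 + 1 / 20 : ℝ) = 4 / 5 := by norm_num
  have hm := fun x (hx : x ∈ orbitDomain χ (3 / 4 * R) (δ * R)) =>
    shift_mem_orbitDomain hF hS hδ (a := 3 / 4) le_rfl hx
  rw [e] at hm
  have h0 := (lift_approxCurve hF hS hV hδ hM).mono fun x hx => (hm x hx).2.2
  obtain ⟨h1, h2⟩ := lift_approxCurve_shift hF hS hV hδ hM
  have k := fun x hx => orbit_estimates hF hS hV hδ hM (x := x) hx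
  have hmem := fun x (hx : x ∈ orbitDomain χ (4 / 5 * R) (δ * R)) =>
    approxCurve_mem hF hS hV hδ hM hx
  exact ⟨hF.periodic_chordAngle h0 h1 (fun x hx => hmem _ (hm x hx).2.2)
      (fun x hx => hmem _ (hm x hx).1) fun x hx => (k x hx).1.1.trans (k x hx).2.2,
    hF.periodic_chordAngle h0 h2 (fun x hx => hmem _ (hm x hx).2.2)
      (fun x hx => hmem _ (hm x hx).2.1) fun x hx => (k x hx).2.1.1.trans (k x hx).2.2⟩

end

/-! ### The reflection law along the approximate orbits -/

section

variable {Λ β R b₀ B₀ m c M δ : ℝ} {u v p q κ g χ S : ℂ → ℂ} {V : ℂ × ℂ → ℂ} {n : ℕ}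
variable (hF : CurveFrame Λ β R u v p q κ) (hS : StripChart b₀ B₀ R g χ S)
  (hV : ApproxInvariant n c M R p q g χ S V) (hδ : StepRadius Λ b₀ c M δ) (hM : 0 < M)
include hF hS hV hδ hM

theorem norm_angle_le {x : ℂ × ℂ} (hx : x ∈ orbitDomain χ (3 / 4 * R) (δ * R)) :
    (‖forwardAngle p q S V x‖ ≤ 2 * Λ / b₀ * ‖x.2‖ ∧
      ‖backwardAngle p q S V x‖ ≤ 2 * Λ / b₀ * ‖x.2‖) ∧ ‖forwardAngle p q S V x‖ ≤ 1 / 8 ∧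
      ‖backwardAngle p q S V x‖ ≤ 1 / 8 := by
  have e : (3 / 4 + 1 / 20 : ℝ) = 4 / 5 := by norm_num
  obtain ⟨m1, m2, m0⟩ := shift_mem_orbitDomain hF hS hδ (a := 3 / 4) le_rfl hx
  rw [e] at m1 m2 m0
  have s0 := approxCurve_mem hF hS hV hδ hM m0
  have s1 := approxCurve_mem hF hS hV hδ hM m1
  have s2 := approxCurve_mem hF hS hV hδ hM m2
  obtain ⟨h1, h2, h3⟩ := orbit_estimates hF hS hV hδ hM hx
  have a1 := hF.norm_chordAngle_le s0 s1 (h1.1.trans h3)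
  have a2 := hF.norm_chordAngle_le s0 s2 (h2.1.trans h3)
  have hΛ := hF.Λ_pos
  have e1 : Λ * (2 * ‖x.2‖ / b₀) = 2 * Λ / b₀ * ‖x.2‖ := by ring
  refine ⟨⟨(a1.trans (mul_le_mul_of_nonneg_left h1.1 hΛ.le)).trans_eq e1,
    (a2.trans (mul_le_mul_of_nonneg_left h2.1 hΛ.le)).trans_eq e1⟩,
    a1.trans (hF.le_eighth (norm_nonneg _) (h1.1.trans h3)),
    a2.trans (hF.le_eighth (norm_nonneg _) (h2.1.trans h3))⟩

/-- The reflection law holds along the approximate orbit to order `n + 3` in the step: the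
Euler-Lagrange residual is the difference of the cosines of the two angles, which are themselves of
first order in the step. -/
theorem forwardAngle_add_backwardAngle_isBigO {θ : ℂ} (hθ : θ ∈ χ '' strip (3 / 4 * R)) :
    (fun ε => forwardAngle p q S V (θ, ε) + backwardAngle p q S V (θ, ε)) =O[𝓝 0]
      fun ε : ℂ => ε ^ (n + 3) := by
  have hb := hS.b₀_pos
  have hB := hS.B₀_pos
  have hβ := hF.β_pos
  have hR := hF.R_pos
  have hΛ := hF.Λ_pos
  have e : (3 / 4 + 1 / 20 : ℝ) = 4 / 5 := by norm_num
  obtain ⟨C, hC, hEL⟩ := (hV.isBigO θ hθ).exists_pos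
  have hCA : 0 < angleConst Λ b₀ B₀ M := by rw [angleConst]; positivity
  set CA := angleConst Λ b₀ B₀ M
  refine IsBigO.of_bound (16 * B₀ ^ 2 * C / β) ?_
  filter_upwards [hEL.bound, ball_mem_nhds (0 : ℂ) (mul_pos hδ.pos hR),
    ball_mem_nhds (0 : ℂ) (show 0 < β / (4 * B₀ * CA) by positivity)] with ε h1 h2 h3
  have hx : (θ, ε) ∈ orbitDomain χ (3 / 4 * R) (δ * R) := ⟨hθ, h2⟩
  obtain ⟨k1, k2, k3⟩ := orbit_estimates hF hS hV hδ hM hx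
  obtain ⟨-, n1, n2⟩ := norm_angle_le hF hS hV hδ hM hx
  have m0 := (shift_mem_orbitDomain hF hS hδ (a := 3 / 4) le_rfl hx).2.2
  rw [e] at m0
  have hs := approxCurve_mem hF hS hV hδ hM m0
  have k1 := k1.2
  have k2 := k2.2
  -- the Euler-Lagrange residual in terms of the two angles
  have hcos : billiardGenDeriv p q g S (θ - ε + V (θ - ε, ε)) (θ + V (θ, ε)) -
      billiardGenDeriv p q g S (θ + ε + V (θ + ε, ε)) (θ + V (θ, ε)) =
      (g (approxCurve S V (θ, ε)))⁻¹ * (Complex.cos (forwardAngle p q S V (θ, ε)) -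
        Complex.cos (backwardAngle p q S V (θ, ε))) := by
    simp only [billiardGenDeriv, forwardAngle, backwardAngle, approxCurve]
    ring
  rw [hcos] at h1
  set s := approxCurve S V (θ, ε)
  set A := forwardAngle p q S V (θ, ε)
  set A' := backwardAngle p q S V (θ, ε)
  simp only at k1 k2
  rcases eq_or_ne ε 0 with rfl | hε
  · simp only [norm_zero, mul_zero, sub_zero, ne_eq, OfNat.ofNat_ne_zero, not_false_eq_true, zero_pow,
      neg_zero, norm_le_zero_iff] at k1 k2
    rw [k1, k2, add_zero, norm_zero]
    positivity
  have hε0 : 0 < ‖ε‖ := norm_pos_iff.2 hε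
  have hg0 := hS.g_ne_zero hs
  have hgB := hS.norm_le s hs
  have h4 : ‖Complex.cos A - Complex.cos A'‖ ≤ B₀ * (C * ‖ε‖ ^ (n + 4)) := by
    rw [norm_mul, norm_inv, norm_pow, inv_mul_le_iff₀ (norm_pos_iff.2 hg0)] at h1
    exact h1.trans (by gcongr)
  have h5 : β / (2 * B₀) * ‖ε‖ ≤ ‖A - A'‖ := by
    have e1 : ‖(A - A') - κ s / g s * ε‖ ≤ 2 * CA * ‖ε‖ ^ 2 := by
      have : (A - A') - κ s / g s * ε =
          (A - κ s / (2 * g s) * ε) - (A' - κ s / (2 * g s) * -ε) := by field_simp; ring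
      rw [this]
      refine (norm_sub_le _ _).trans ?_
      linarith
    have e2 : β / B₀ * ‖ε‖ ≤ ‖κ s / g s * ε‖ := by
      rw [norm_mul, norm_div]
      have := (hF.le_re s hs).trans (Complex.re_le_norm _)
      have := norm_pos_iff.2 hg0
      gcongr
    have e3 : 2 * CA * ‖ε‖ ^ 2 ≤ β / (2 * B₀) * ‖ε‖ := by
      have h6 : ‖ε‖ ≤ β / (4 * B₀ * CA) := (mem_ball_zero_iff.1 h3).le
      calc 2 * CA * ‖ε‖ ^ 2 = 2 * CA * ‖ε‖ * ‖ε‖ := by ring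
        _ ≤ 2 * CA * (β / (4 * B₀ * CA)) * ‖ε‖ := by gcongr
        _ = _ := by field_simp; ring
    have e4 := norm_sub_norm_le (κ s / g s * ε) (κ s / g s * ε - (A - A'))
    rw [sub_sub_cancel, norm_sub_rev (κ s / g s * ε) (A - A')] at e4
    have e5 : β / B₀ * ‖ε‖ = β / (2 * B₀) * ‖ε‖ + β / (2 * B₀) * ‖ε‖ := by field_simp; ring
    linarith
  -- `cos A - cos A' = -2 sin ((A + A') / 2) sin ((A - A') / 2)`
  have h6 : ‖A + A'‖ * ‖A - A'‖ ≤ 8 * ‖Complex.cos A - Complex.cos A'‖ := by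
    have s1 := norm_le_two_mul_norm_sin (x := (A + A') / 2) (by
      rw [norm_div, Complex.norm_ofNat]; linarith [norm_add_le A A'])
    have s2 := norm_le_two_mul_norm_sin (x := (A - A') / 2) (by
      rw [norm_div, Complex.norm_ofNat]; linarith [norm_sub_le A A'])
    rw [norm_div, Complex.norm_ofNat] at s1 s2
    rw [Complex.cos_sub_cos, norm_mul, norm_mul, norm_neg, Complex.norm_ofNat]
    have := mul_le_mul s1 s2 (by positivity) (by positivity)
    linarith
  have h7 : ‖A + A'‖ * (β / (2 * B₀) * ‖ε‖) ≤ 8 * (B₀ * (C * ‖ε‖ ^ (n + 4))) :=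
    (mul_le_mul_of_nonneg_left h5 (norm_nonneg _)).trans (h6.trans (by gcongr))
  rw [norm_pow]
  have h8 : ‖A + A'‖ * (β / (2 * B₀) * ‖ε‖) ≤
      16 * B₀ ^ 2 * C / β * ‖ε‖ ^ (n + 3) * (β / (2 * B₀) * ‖ε‖) := by
    refine h7.trans (le_of_eq ?_)
    field_simp
    ring
  exact le_of_mul_le_mul_right h8 (by positivity)

/-- The reflection law along the approximate orbit, uniformly on the domain: the pointwise order of
vanishing allows a division by `yⁿ⁺³` with a bounded quotient. -/
theorem exists_angle_defect_bound : ∃ K : ℝ, ∀ x ∈ orbitDomain χ (3 / 4 * R) (δ * R / 2),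
    ‖forwardAngle p q S V x + backwardAngle p q S V x‖ ≤ K * ‖x.2‖ ^ (n + 3) := by
  have hR := hF.R_pos
  have h34 : 3 / 4 * R ≤ R := by linarith
  obtain ⟨h1, h2⟩ := periodic_angles hF hS hV hδ hM
  obtain ⟨ω, hω, hωe, hωb⟩ := (h1.add h2).exists_eq_snd_pow_mul (hS.isOpen_image h34)
    (fun _ => hS.image_add_one h34) (fun _ => hS.image_star h34) (mul_pos hδ.pos hR) (n := n + 2)
    fun θ hθ => (forwardAngle_add_backwardAngle_isBigO hF hS hV hδ hM hθ).trans_isLittleO (by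
      simpa using isLittleO_pow_pow (𝕜 := ℂ) (show n + 2 < n + 3 by omega))
  have hb := hωb (1 / 4) fun x hx => by
    obtain ⟨-, a1, a2⟩ := norm_angle_le hF hS hV hδ hM hx
    linarith [norm_add_le (forwardAngle p q S V x) (backwardAngle p q S V x)]
  refine ⟨1 / 4 / (δ * R) ^ (n + 2 + 1), fun x hx => ?_⟩
  rw [hωe x hx, norm_mul, norm_pow, mul_comm]
  exact mul_le_mul_of_nonneg_right (hb x hx) (by positivity)

end

/-! ### The normalizing coordinates -/

/-- The coordinate change `Φ` from `(s, ϑ)` to `(x, y)`, on the domain `𝕋_{13R/20} × B_{c R}`: the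
inverse of `(x, y) ↦ (s, ϑ)`, where `s` is the point `(x, y)` of the approximate orbit and `ϑ` the
angle there towards the next point. -/
structure NormalChart (μ c R : ℝ) (p q κ g χ S : ℂ → ℂ) (V : ℂ × ℂ → ℂ) (Φ : ℂ × ℂ → ℂ × ℂ) :
    Prop where
  differentiableOn : DifferentiableOn ℂ Φ (stripProd (13 / 20 * R) (c * R))
  mem : ∀ x ∈ stripProd (13 / 20 * R) (c * R), Φ x ∈ orbitDomain χ (7 / 10 * R) (μ * R)
  exists_near : ∀ x ∈ stripProd (13 / 20 * R) (c * R),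
    ∃ z ∈ strip (7 / 10 * R), (Φ x).1 = χ z ∧ ‖z - x.1‖ ≤ R / 80
  approxCurve_eq : ∀ x ∈ stripProd (13 / 20 * R) (c * R), approxCurve S V (Φ x) = x.1
  forwardAngle_eq : ∀ x ∈ stripProd (13 / 20 * R) (c * R), forwardAngle p q S V (Φ x) = x.2
  left_inv : ∀ x ∈ orbitDomain χ (7 / 10 * R) (μ * R),
    Φ (approxCurve S V x, forwardAngle p q S V x) = x
  norm_sub_le : ∀ x ∈ stripProd (13 / 20 * R) (c * R),
    ‖(Φ x).2 - 2 * g x.1 / κ x.1 * x.2‖ ≤ 1 / 2 * ‖(Φ x).2‖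
  lipschitz : ∃ K : ℝ, ∀ s ϑ ϑ' : ℂ, (s, ϑ) ∈ stripProd (13 / 20 * R) (c * R) →
    (s, ϑ') ∈ stripProd (13 / 20 * R) (c * R) → ‖Φ (s, ϑ) - Φ (s, ϑ')‖ ≤ K * ‖ϑ - ϑ'‖

theorem norm_pair_le {a : ℂ × ℂ} {C : ℝ} (h1 : ‖a.1‖ ≤ C) (h2 : ‖a.2‖ ≤ C) : ‖a‖ ≤ C := by
  rw [Prod.norm_def]; exact max_le h1 h2

section

variable {Λ β R b₀ B₀ m c M δ : ℝ} {u v p q κ g χ S : ℂ → ℂ} {V : ℂ × ℂ → ℂ} {n : ℕ}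
variable (hF : CurveFrame Λ β R u v p q κ) (hS : StripChart b₀ B₀ R g χ S)
  (hV : ApproxInvariant n c M R p q g χ S V) (hδ : StepRadius Λ b₀ c M δ) (hM : 0 < M)
include hF hS hV hδ hM

/-- The map `(x, y) ↦ (s, ϑ)` defined by the approximate orbits is invertible. With `x = χ(z)`, `y = μ ŷ`
and `ϑ = μ κ(s) η / (2 g(s))` it takes the form `(z, ŷ) ↦ (s, η)` and is a perturbation of the identity
of relative size `O(μ)`, so that `exists_inverse_id_add` applies. -/
theorem exists_normalChart {μ : ℝ} (hμ : 0 < μ) (hμδ : 2 * μ ≤ δ)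
    (hμe : 80 * (2 * M / b₀ + 8 * B₀ * angleConst Λ b₀ B₀ M / β) * μ ≤ 1) :
    ∃ Φ, NormalChart μ (μ * β / (8 * B₀)) R p q κ g χ S V Φ := by
  have hb := hS.b₀_pos
  have hB := hS.B₀_pos
  have hβ := hF.β_pos
  have hR := hF.R_pos
  have hR1 := hF.R_le_one
  have hΛ := hF.Λ_pos
  have hCA : 0 < angleConst Λ b₀ B₀ M := by rw [angleConst]; positivity
  set CA := angleConst Λ b₀ B₀ M with hCAdef
  set Ce := 2 * M / b₀ + 8 * B₀ * CA / β with hCe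
  have hCe0 : 0 < Ce := by positivity
  set ν : ℂ → ℂ := fun s => 2 * g s / κ s with hν
  have hκ0 : ∀ s ∈ strip R, κ s ≠ 0 := fun s hs h0 => by
    have := hF.le_re s hs
    rw [h0, Complex.zero_re] at this
    linarith
  have hν0 : ∀ s ∈ strip R, ν s ≠ 0 := fun s hs =>
    div_ne_zero (mul_ne_zero two_ne_zero (hS.g_ne_zero hs)) (hκ0 s hs)
  have hνn : ∀ s ∈ strip R, ‖ν s‖ ≤ 2 * B₀ / β := fun s hs => by
    rw [hν]
    simp only
    rw [norm_div, norm_mul, Complex.norm_ofNat]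
    have h1 := hS.norm_le s hs
    have h2 := (hF.le_re s hs).trans (Complex.re_le_norm _)
    gcongr
  have hνd : DifferentiableOn ℂ ν (strip R) :=
    (hS.differentiableOn.const_mul 2).div hF.differentiableOn_κ hκ0
  -- `J` is the rescaling `(z, ŷ) ↦ (χ z, μ ŷ)`
  set J : ℂ × ℂ → ℂ × ℂ := fun w => (χ w.1, μ * w.2) with hJ
  set N : Set (ℂ × ℂ) := strip (3 / 4 * R) ×ˢ ball (0 : ℂ) (2 * R) with hN
  have hμc : (μ : ℂ) ≠ 0 := Complex.ofReal_ne_zero.2 hμ.ne'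
  have hμn : ‖(μ : ℂ)‖ = μ := by rw [Complex.norm_real, Real.norm_of_nonneg hμ.le]
  have hsub34 : strip (3 / 4 * R) ⊆ strip R := strip_mono (by linarith)
  have hsub70 : strip (7 / 10 * R) ⊆ strip (3 / 4 * R) := strip_mono (by linarith)
  have hsub65 : strip (13 / 20 * R) ⊆ strip (7 / 10 * R) := strip_mono (by linarith)
  have hJm : MapsTo J N (orbitDomain χ (3 / 4 * R) (δ * R)) := fun w hw => by
    refine ⟨mem_image_of_mem χ hw.1, ?_⟩
    have h1 := mem_ball_zero_iff.1 hw.2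
    rw [mem_ball_zero_iff]
    simp only [hJ]
    rw [norm_mul, hμn]
    calc μ * ‖w.2‖ < μ * (2 * R) := by gcongr
      _ = 2 * μ * R := by ring
      _ ≤ δ * R := by gcongr
  have e45 : (3 / 4 + 1 / 20 : ℝ) = 4 / 5 := by norm_num
  have hD45 : ∀ x ∈ orbitDomain χ (3 / 4 * R) (δ * R), x ∈ orbitDomain χ (4 / 5 * R) (δ * R) :=
    fun x hx => by
      have := (shift_mem_orbitDomain hF hS hδ (a := 3 / 4) le_rfl hx).2.2
      rwa [e45] at this
  have hJd : DifferentiableOn ℂ J N := fun w hw => by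
    refine DifferentiableAt.differentiableWithinAt (DifferentiableAt.prodMk ?_ (by fun_prop))
    exact (hS.hasDerivAt _ (hsub34 hw.1)).differentiableAt.comp (f := Prod.fst) w differentiableAt_fst
  have hΓd := ((lift_approxCurve hF hS hV hδ hM).1.mono hD45).comp hJd hJm
  have hAd := (periodic_angles hF hS hV hδ hM).1.1.comp hJd hJm
  have hΓm : ∀ w ∈ N, approxCurve S V (J w) ∈ strip R := fun w hw =>
    approxCurve_mem hF hS hV hδ hM (hD45 _ (hJm hw))
  -- `e` is the deviation of `(z, ŷ) ↦ (s, η)` from the identity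
  set e : ℂ × ℂ → ℂ × ℂ := fun w => (approxCurve S V (J w) - w.1,
    ν (approxCurve S V (J w)) * forwardAngle p q S V (J w) / μ - w.2) with he
  have hd1 : DifferentiableOn ℂ (fun w => (e w).1) N := hΓd.sub differentiableOn_fst
  have hνA : DifferentiableOn ℂ
      (fun w => ν (approxCurve S V (J w)) * forwardAngle p q S V (J w)) N :=
    (hνd.comp hΓd hΓm).mul hAd
  have hd2 : DifferentiableOn ℂ (fun w => (e w).2) N := by
    simp only [he, div_eq_mul_inv]
    exact (hνA.mul_const _).sub differentiableOn_snd
  have hR2 : ∀ w ∈ N, ‖w.2‖ < 2 * R := fun w hw => mem_ball_zero_iff.1 hw.2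
  have hJ2 : ∀ w, ‖(J w).2‖ = μ * ‖w.2‖ := fun w => by simp only [hJ]; rw [norm_mul, hμn]
  have hb1 : ∀ w ∈ N, ‖(e w).1‖ ≤ Ce * μ * R := fun w hw => by
    have h1 := norm_approxCurve_sub_le hF hS hV hδ hM (hD45 _ (hJm hw))
    rw [hJ2] at h1
    have h2 : S (J w).1 = w.1 := hS.left_inv _ (hsub34 hw.1)
    rw [h2] at h1
    calc ‖(e w).1‖ ≤ M * (μ * ‖w.2‖) / b₀ := h1
      _ ≤ M * (μ * (2 * R)) / b₀ := by have := (hR2 w hw).le; gcongr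
      _ = 2 * M / b₀ * (μ * R) := by ring
      _ ≤ Ce * (μ * R) := by
          gcongr
          rw [hCe]
          have : 0 ≤ 8 * B₀ * CA / β := by positivity
          linarith
      _ = _ := by ring
  have hb2 : ∀ w ∈ N, ‖(e w).2‖ ≤ Ce * μ * R := fun w hw => by
    have h1 := (orbit_estimates hF hS hV hδ hM (hJm hw)).1.2
    rw [hJ2] at h1
    have hs := hΓm w hw
    set s := approxCurve S V (J w) with hsdef
    have e1 : (e w).2 = ν s / μ * (forwardAngle p q S V (J w) - κ s / (2 * g s) * (J w).2) := by
      have key : ∀ a y : ℂ, ν s * a / μ - y = ν s / μ * (a - κ s / (2 * g s) * (μ * y)) := by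
        intro a y
        have := hκ0 s hs
        have := hS.g_ne_zero hs
        simp only [hν]
        field_simp
      exact key _ _
    have h2 : ‖ν s / μ‖ ≤ 2 * B₀ / β / μ := by
      rw [norm_div, hμn]
      have := hνn s hs
      gcongr
    rw [e1, norm_mul]
    have h3 : (μ * ‖w.2‖) ^ 2 ≤ 4 * μ ^ 2 * R := by
      calc (μ * ‖w.2‖) ^ 2 ≤ (μ * (2 * R)) ^ 2 := by have := (hR2 w hw).le; gcongr
        _ = 4 * μ ^ 2 * (R * R) := by ring
        _ ≤ 4 * μ ^ 2 * (R * 1) := by gcongr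
        _ = _ := by ring
    calc _ ≤ 2 * B₀ / β / μ * (CA * (4 * μ ^ 2 * R)) := by
          refine mul_le_mul h2 (h1.trans (by gcongr)) (norm_nonneg _) (by positivity)
      _ = 8 * B₀ * CA / β * (μ * R) := by field_simp; ring
      _ ≤ Ce * (μ * R) := by
          gcongr
          rw [hCe]
          have : 0 ≤ 2 * M / b₀ := by positivity
          linarith
      _ = _ := by ring
  have hsmall : Ce * μ * R ≤ R / 80 := by
    have : Ce * μ ≤ 1 / 80 := by linarith
    calc Ce * μ * R ≤ 1 / 80 * R := by gcongr
      _ = _ := by ring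
  set s : Set (ℂ × ℂ) := strip (7 / 10 * R) ×ˢ ball (0 : ℂ) R with hs
  have hso : IsOpen s := (isOpen_strip _).prod isOpen_ball
  have hscv : Convex ℝ s := (convex_strip _).prod (convex_ball _ _)
  have hsN : ∀ w ∈ s, ball w (R / 20) ⊆ N := by
    intro w hw x hx
    rw [mem_ball, Prod.dist_eq, max_lt_iff, dist_eq_norm, dist_eq_norm] at hx
    refine ⟨?_, ?_⟩
    · have := strip_add (σ' := 3 / 4 * R) hw.1 (t := x.1 - w.1) (by linarith [hx.1])
      rwa [add_sub_cancel] at this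
    · rw [mem_ball_zero_iff]
      have := mem_ball_zero_iff.1 hw.2
      have h2 := norm_le_norm_add_norm_sub' x.2 w.2
      linarith [hx.2]
  have hsN' : s ⊆ N := fun w hw => hsN w hw (mem_ball_self (by positivity))
  have hlip : ∀ z ∈ s, ∀ w ∈ s, ‖e z - e w‖ ≤ 1 / 2 * ‖z - w‖ := by
    intro z hz w hw
    have h1 := norm_sub_le_of_bounded_nhd (by positivity) hscv hsN hd1 hb1 hz hw
    have h2 := norm_sub_le_of_bounded_nhd (by positivity) hscv hsN hd2 hb2 hz hw
    have h3 : 2 * (Ce * μ * R) / (R / 20) ≤ 1 / 2 := by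
      rw [div_le_iff₀ (by positivity)]
      linarith
    have h4 := mul_le_mul_of_nonneg_right h3 (norm_nonneg (z - w))
    exact norm_pair_le (h1.trans h4) (h2.trans h4)
  have hed : DifferentiableOn ℂ e s := (hd1.prodMk hd2).mono hsN'
  obtain ⟨G, T, hT, hGd, hGT, hGl, hTmem⟩ := exists_inverse_id_add hso hed hlip
  -- the zero section is fixed
  have he0 : ∀ z ∈ strip (7 / 10 * R), e (z, 0) = 0 := fun z hz => by
    have hw : ((z, 0) : ℂ × ℂ) ∈ N := ⟨hsub70 hz, by simpa using hR⟩
    have h1 := norm_approxCurve_sub_le hF hS hV hδ hM (hD45 _ (hJm hw))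
    have h2 := (orbit_estimates hF hS hV hδ hM (hJm hw)).1.2
    have h3 : S (J (z, 0)).1 = z := hS.left_inv _ (hsub34 hw.1)
    have h4 : (J (z, 0)).2 = 0 := by simp [hJ]
    rw [h3, h4, norm_zero, mul_zero, zero_div, norm_le_zero_iff] at h1
    rw [h4, norm_zero, mul_zero, sub_zero, zero_pow two_ne_zero, mul_zero, norm_le_zero_iff] at h2
    simp only [he, h1, h2, mul_zero, zero_div, sub_zero]
    rfl
  have hhalf : ∀ w ∈ s, ‖e w‖ ≤ 1 / 2 * ‖w.2‖ := fun w hw => by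
    have := hlip w hw (w.1, 0) ⟨hw.1, by simpa using hR⟩
    rw [he0 _ hw.1, sub_zero] at this
    refine this.trans (mul_le_mul_of_nonneg_left (norm_pair_le ?_ ?_) (by norm_num)) <;> simp
  set c₄ := μ * β / (8 * B₀) with hc₄
  -- `L` is the rescaling `(s, ϑ) ↦ (s, η)`
  set L : ℂ × ℂ → ℂ × ℂ := fun x => (x.1, ν x.1 * x.2 / μ) with hL
  have hER : ∀ x ∈ stripProd (13 / 20 * R) (c₄ * R), x.1 ∈ strip R := fun x hx =>
    hsub34 (hsub70 (hsub65 hx.1))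
  have hLT : ∀ x ∈ stripProd (13 / 20 * R) (c₄ * R), L x ∈ T := by
    intro x hx
    have h2 : ‖(L x).2‖ ≤ R / 4 := by
      simp only [hL]
      rw [norm_div, norm_mul, hμn]
      have h3 := hνn _ (hER x hx)
      have h4 := (mem_ball_zero_iff.1 hx.2).le
      calc ‖ν x.1‖ * ‖x.2‖ / μ ≤ 2 * B₀ / β * (c₄ * R) / μ := by gcongr
        _ = R / 4 := by rw [hc₄]; field_simp; norm_num
    have hsubs : closedBall (L x) (R / 25) ⊆ s := by
      intro w hw
      rw [mem_closedBall, Prod.dist_eq, max_le_iff, dist_eq_norm, dist_eq_norm] at hw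
      refine ⟨?_, ?_⟩
      · have := strip_add (σ' := 7 / 10 * R) hx.1 (t := w.1 - x.1) (hw.1.trans (by linarith))
        rwa [add_sub_cancel] at this
      · rw [mem_ball_zero_iff]
        have := norm_le_norm_add_norm_sub' w.2 (L x).2
        linarith [hw.2]
    refine hTmem _ (R / 25) (by positivity) hsubs ?_
    have hm := hsN' (hsubs (mem_closedBall_self (by positivity)))
    refine (norm_pair_le (hb1 _ hm) (hb2 _ hm)).trans (hsmall.trans ?_)
    linarith
  have hLd : DifferentiableOn ℂ L (stripProd (13 / 20 * R) (c₄ * R)) := by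
    simp only [hL, div_eq_mul_inv]
    exact differentiableOn_fst.prodMk (((hνd.comp differentiableOn_fst fun x hx => hER x hx).mul
      differentiableOn_snd).mul_const _)
  -- the coordinates `w = (z, ŷ)` of the point `x = (s, ϑ)`
  have hGL : ∀ x ∈ stripProd (13 / 20 * R) (c₄ * R), G (L x) ∈ s ∧ G (L x) + e (G (L x)) = L x :=
    fun x hx => hGT _ (hLT x hx)
  refine ⟨fun x => J (G (L x)), ?_, ?_, ?_, ?_, ?_, ?_, ?_, ?_⟩
  · exact hJd.comp (hGd.comp hLd hLT) fun x hx => hsN' (hGL x hx).1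
  · intro x hx
    have := (hGL x hx).1
    refine ⟨mem_image_of_mem χ this.1, ?_⟩
    rw [mem_ball_zero_iff, hJ2]
    exact mul_lt_mul_of_pos_left (mem_ball_zero_iff.1 this.2) hμ
  · intro x hx
    obtain ⟨h1, h2⟩ := hGL x hx
    refine ⟨(G (L x)).1, h1.1, rfl, ?_⟩
    have h3 : (G (L x)).1 + (e (G (L x))).1 = x.1 := congrArg Prod.fst h2
    rw [← h3, sub_add_cancel_left, norm_neg]
    exact (hb1 _ (hsN' h1)).trans hsmall
  · intro x hx
    obtain ⟨h1, h2⟩ := hGL x hx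
    have h3 : (G (L x)).1 + (e (G (L x))).1 = x.1 := congrArg Prod.fst h2
    rw [← h3]
    simp only [he]
    ring
  · intro x hx
    obtain ⟨h1, h2⟩ := hGL x hx
    have h3 : (G (L x)).1 + (e (G (L x))).1 = x.1 := congrArg Prod.fst h2
    have h4 : (G (L x)).2 + (e (G (L x))).2 = ν x.1 * x.2 / μ := congrArg Prod.snd h2
    have h5 : approxCurve S V (J (G (L x))) = x.1 := by
      rw [← h3]
      simp only [he]
      ring
    simp only [he, h5, add_sub_cancel] at h4
    have h6 : ν x.1 * forwardAngle p q S V (J (G (L x))) = ν x.1 * x.2 := by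
      have := congrArg (· * (μ : ℂ)) h4
      simpa [div_mul_cancel₀ _ hμc] using this
    exact mul_left_cancel₀ (hν0 _ (hER x hx)) h6
  · intro x hx
    obtain ⟨z, hz, hzx⟩ := hx.1
    have hw : ((z, x.2 / μ) : ℂ × ℂ) ∈ s := by
      refine ⟨hz, ?_⟩
      rw [mem_ball_zero_iff]
      simp only
      rw [norm_div, hμn, div_lt_iff₀ hμ, mul_comm]
      exact mem_ball_zero_iff.1 hx.2
    have hJw : J (z, x.2 / μ) = x := by
      simp only [hJ, hzx, mul_div_cancel₀ _ hμc]
    have h1 := (hGl _ hw).2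
    have h2 : ((z, x.2 / μ) : ℂ × ℂ) + e (z, x.2 / μ) =
        L (approxCurve S V x, forwardAngle p q S V x) := by
      simp only [he, hJw, hL]
      ext <;> simp
    rw [h2] at h1
    simp only [h1, hJw]
  · intro x hx
    obtain ⟨h1, h2⟩ := hGL x hx
    have h4 : (G (L x)).2 + (e (G (L x))).2 = ν x.1 * x.2 / μ := congrArg Prod.snd h2
    have h5 : (J (G (L x))).2 - ν x.1 * x.2 = -(μ * (e (G (L x))).2) := by
      have h6 : ν x.1 * x.2 = μ * ((G (L x)).2 + (e (G (L x))).2) := by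
        rw [h4]; field_simp
      rw [h6]
      simp only [hJ]
      ring
    change ‖(J (G (L x))).2 - ν x.1 * x.2‖ ≤ 1 / 2 * ‖(J (G (L x))).2‖
    rw [h5, norm_neg, norm_mul, hμn, hJ2]
    have := (norm_snd_le (e (G (L x)))).trans (hhalf _ h1)
    nlinarith
  · refine ⟨(B₀ + μ) * (2 * (2 * B₀ / β / μ)), fun a ϑ ϑ' h h' => ?_⟩
    obtain ⟨h1, h2⟩ := hGL _ h
    obtain ⟨h1', h2'⟩ := hGL _ h'
    set w := G (L (a, ϑ))
    set w' := G (L (a, ϑ'))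
    have e1 : ‖L (a, ϑ) - L (a, ϑ')‖ ≤ 2 * B₀ / β / μ * ‖ϑ - ϑ'‖ := by
      refine norm_pair_le (by simp [hL]; positivity) ?_
      have : (L (a, ϑ) - L (a, ϑ')).2 = ν a / μ * (ϑ - ϑ') := by simp only [hL, Prod.snd_sub]; ring
      rw [this, norm_mul, norm_div, hμn]
      have := hνn a (hER _ h)
      gcongr
    have e2 : ‖w - w'‖ ≤ 2 * (2 * B₀ / β / μ) * ‖ϑ - ϑ'‖ := by
      have e3 : w - w' = (L (a, ϑ) - L (a, ϑ')) - (e w - e w') := by rw [← h2, ← h2']; abel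
      have e4 := norm_sub_le (L (a, ϑ) - L (a, ϑ')) (e w - e w')
      rw [← e3] at e4
      have := hlip w h1 w' h1'
      linarith
    have e5 : ‖J w - J w'‖ ≤ (B₀ + μ) * ‖w - w'‖ := by
      refine norm_pair_le ?_ ?_
      · have e6 := hS.norm_χ_sub_le (hsub34 (hsub70 h1.1)) (hsub34 (hsub70 h1'.1))
        have e7 : ‖w.1 - w'.1‖ ≤ ‖w - w'‖ := norm_fst_le (w - w')
        calc _ ≤ B₀ * ‖w.1 - w'.1‖ := e6
          _ ≤ (B₀ + μ) * ‖w - w'‖ := by gcongr; linarith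
      · have e7 : ‖w.2 - w'.2‖ ≤ ‖w - w'‖ := norm_snd_le (w - w')
        have e8 : (J w - J w').2 = μ * (w.2 - w'.2) := by simp only [hJ, Prod.snd_sub]; ring
        rw [e8, norm_mul, hμn]
        gcongr
        linarith
    calc ‖J w - J w'‖ ≤ (B₀ + μ) * ‖w - w'‖ := e5
      _ ≤ (B₀ + μ) * (2 * (2 * B₀ / β / μ) * ‖ϑ - ϑ'‖) := by gcongr
      _ = _ := by ring

end

/-! ### The billiard map in the normalizing coordinates -/

section

variable {Λ β R b₀ B₀ m c M δ μ c₄ : ℝ} {u v p q κ g χ S : ℂ → ℂ} {V : ℂ × ℂ → ℂ} {n : ℕ}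
  {Φ : ℂ × ℂ → ℂ × ℂ}
variable (hF : CurveFrame Λ β R u v p q κ) (hS : StripChart b₀ B₀ R g χ S)
  (hV : ApproxInvariant n c M R p q g χ S V) (hδ : StepRadius Λ b₀ c M δ) (hM : 0 < M)
  (hΦ : NormalChart μ c₄ R p q κ g χ S V Φ)

include hF in
theorem CurveFrame.orbitDomain_mono {a a' τ τ' : ℝ} (ha : a ≤ a') (hτ : τ ≤ τ') :
    orbitDomain χ (a * R) (τ * R) ⊆ orbitDomain χ (a' * R) (τ' * R) := by
  have := hF.R_pos
  exact prod_mono (image_mono (strip_mono (by gcongr))) (ball_subset_ball (by gcongr))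

include hF hS hV hδ hM hΦ

theorem NormalChart.add_one (hμ : μ ≤ δ) {x : ℂ × ℂ} (hx : x ∈ stripProd (13 / 20 * R) (c₄ * R)) :
    Φ (x + (1, 0)) = Φ x + (1, 0) := by
  have h1 := hΦ.mem x hx
  have h2 : Φ x + (1, 0) ∈ orbitDomain χ (7 / 10 * R) (μ * R) :=
    ⟨hS.image_add_one (by linarith [hF.R_pos]) h1.1, by simpa using h1.2⟩
  have h3 := hΦ.left_inv _ h2
  rw [(lift_approxCurve hF hS hV hδ hM).2 _ (hF.orbitDomain_mono (by norm_num) hμ h1),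
    (periodic_angles hF hS hV hδ hM).1.2.1 _ (hF.orbitDomain_mono (by norm_num) hμ h1),
    hΦ.approxCurve_eq x hx, hΦ.forwardAngle_eq x hx] at h3
  rw [← h3]
  congr 1
  ext <;> simp

theorem NormalChart.map_star (hμ : μ ≤ δ) {x : ℂ × ℂ}
    (hx : x ∈ stripProd (13 / 20 * R) (c₄ * R)) : Φ (star x) = star (Φ x) := by
  have h1 := hΦ.mem x hx
  have h2 : star (Φ x) ∈ orbitDomain χ (7 / 10 * R) (μ * R) :=
    ⟨hS.image_star (by linarith [hF.R_pos]) h1.1, by simpa using h1.2⟩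
  have h3 := hΦ.left_inv _ h2
  rw [(lift_approxCurve hF hS hV hδ hM).3 _ (hF.orbitDomain_mono (by norm_num) hμ h1),
    (periodic_angles hF hS hV hδ hM).1.2.2 _ (hF.orbitDomain_mono (by norm_num) hμ h1),
    hΦ.approxCurve_eq x hx, hΦ.forwardAngle_eq x hx] at h3
  rw [← h3]
  rfl

/-- The billiard map in the normalizing coordinates. -/
noncomputable def conjugatedMap (p q S : ℂ → ℂ) (V : ℂ × ℂ → ℂ) (Φ : ℂ × ℂ → ℂ × ℂ) (x : ℂ × ℂ) :
    ℂ × ℂ :=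
  Φ (approxCurve S V (x.1 + x.2, x.2), -backwardAngle p q S V (x.1 + x.2, x.2))

/-- The remainder of the billiard map in the normalizing coordinates is `O(yⁿ⁺³)`, since the
coordinate change is defined by the forward angle and the reflection law holds to that order; after
division it is bounded by its size on the domain. -/
theorem NormalChart.exists_remainder (hμ0 : 0 < μ) (hμ : μ ≤ δ) {τ : ℝ} (hτ0 : 0 < τ) (hτμ : τ ≤ μ)
    (hτδ : τ ≤ δ / 2) (hτb : (1 + M) * τ ≤ b₀ / 100) (hτc : 2 * Λ / b₀ * τ ≤ c₄) :
    ∃ f f' : ℂ × ℂ → ℂ, IsRealAnalyticPeriodic f (orbitDomain χ (3 / 5 * R) (τ * R / 2)) ∧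
      IsRealAnalyticPeriodic f' (orbitDomain χ (3 / 5 * R) (τ * R / 2)) ∧
      ∀ x ∈ orbitDomain χ (3 / 5 * R) (τ * R / 2),
        conjugatedMap p q S V Φ x = normalFormMap (n + 3) f f' x ∧
        ‖f x‖ ≤ (B₀ + b₀ + 2 * μ) * R / (τ * R) ^ (n + 3) ∧
        ‖f' x‖ ≤ (B₀ + b₀ + 2 * μ) * R / (τ * R) ^ (n + 3) := by
  have hR := hF.R_pos
  have hb := hS.b₀_pos
  have hB := hS.B₀_pos
  have hΛ := hF.Λ_pos
  have hτδ' : τ ≤ δ := by linarith [hδ.pos]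
  have e65 : (3 / 5 + 1 / 20 : ℝ) = 13 / 20 := by norm_num
  set W := orbitDomain χ (3 / 5 * R) (τ * R) with hW
  set E := stripProd (13 / 20 * R) (c₄ * R) with hE
  have hW34 : W ⊆ orbitDomain χ (3 / 4 * R) (δ * R) := hF.orbitDomain_mono (by norm_num) hτδ'
  have hsh : ∀ x ∈ W, (x.1 + x.2, x.2) ∈ orbitDomain χ (13 / 20 * R) (τ * R) := fun x hx => by
    have h1 := (shift_mem_orbitDomain hF hS hδ (a := 3 / 5) (by norm_num)
      (hF.orbitDomain_mono le_rfl hτδ' hx)).1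
    rw [e65] at h1
    exact ⟨h1.1, hx.2⟩
  have hsh34 : ∀ x ∈ W, (x.1 + x.2, x.2) ∈ orbitDomain χ (3 / 4 * R) (δ * R) := fun x hx =>
    hF.orbitDomain_mono (by norm_num) hτδ' (hsh x hx)
  have hsh45 : ∀ x ∈ W, (x.1 + x.2, x.2) ∈ orbitDomain χ (4 / 5 * R) (δ * R) := fun x hx =>
    hF.orbitDomain_mono (by norm_num) hτδ' (hsh x hx)
  have hyn : ∀ x ∈ W, ‖x.2‖ < τ * R := fun x hx => mem_ball_zero_iff.1 hx.2
  have hVn : ∀ x ∈ W, ‖V (x.1 + x.2, x.2)‖ ≤ M * ‖x.2‖ := fun x hx =>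
    (orbitDomain_facts hF hS hV hδ hM (hsh45 x hx)).2.2.2.1
  have hX65 : ∀ x ∈ W, x.1 + x.2 + V (x.1 + x.2, x.2) ∈ χ '' strip (13 / 20 * R) := fun x hx => by
    rw [add_assoc]
    refine hS.add_mem (ρ := 3 / 5 * R) (by linarith) (by linarith) hx.1 ?_
    calc ‖x.2 + V (x.1 + x.2, x.2)‖ ≤ ‖x.2‖ + M * ‖x.2‖ :=
          (norm_add_le _ _).trans (by linarith [hVn x hx])
      _ = (1 + M) * ‖x.2‖ := by ring
      _ ≤ (1 + M) * (τ * R) := by have := (hyn x hx).le; gcongr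
      _ = (1 + M) * τ * R := by ring
      _ ≤ b₀ / 100 * R := by gcongr
      _ < b₀ / 4 * (13 / 20 * R - 3 / 5 * R) := by nlinarith [mul_pos hb hR]
  have hΓE : ∀ x ∈ W, approxCurve S V (x.1 + x.2, x.2) ∈ strip (13 / 20 * R) := fun x hx =>
    hS.S_mem (by linarith) (hX65 x hx)
  have hang : ∀ x ∈ W, ∀ a : ℂ, ‖a‖ ≤ 2 * Λ / b₀ * ‖x.2‖ → a ∈ ball (0 : ℂ) (c₄ * R) :=
    fun x hx a ha => by
      rw [mem_ball_zero_iff]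
      calc ‖a‖ ≤ 2 * Λ / b₀ * ‖x.2‖ := ha
        _ < 2 * Λ / b₀ * (τ * R) := by have := hyn x hx; gcongr
        _ = 2 * Λ / b₀ * τ * R := by ring
        _ ≤ c₄ * R := by gcongr
  have hn := fun x (hx : x ∈ W) => (norm_angle_le hF hS hV hδ hM (hsh34 x hx)).1
  have hE1 : ∀ x ∈ W, (approxCurve S V (x.1 + x.2, x.2), -backwardAngle p q S V (x.1 + x.2, x.2)) ∈ E :=
    fun x hx => ⟨hΓE x hx, hang x hx _ (by rw [norm_neg]; exact (hn x hx).2)⟩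
  have hE2 : ∀ x ∈ W, (approxCurve S V (x.1 + x.2, x.2), forwardAngle p q S V (x.1 + x.2, x.2)) ∈ E :=
    fun x hx => ⟨hΓE x hx, hang x hx _ (hn x hx).1⟩
  -- symmetries of the conjugated map
  have hΓl := (lift_approxCurve_shift hF hS hV hδ hM).1.mono hW34
  have hΨ1 : ∀ x : ℂ × ℂ, ((x + (1, 0)).1 + (x + (1, 0)).2, (x + (1, 0)).2) =
      ((x.1 + x.2, x.2) + (1, 0) : ℂ × ℂ) := fun x => by ext <;> simp; ring
  have hΨs : ∀ x : ℂ × ℂ, ((star x).1 + (star x).2, (star x).2) = (star (x.1 + x.2, x.2) : ℂ × ℂ) :=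
    fun x => by ext <;> simp
  have hAl : IsRealAnalyticPeriodic (fun x => backwardAngle p q S V (x.1 + x.2, x.2)) W :=
    (periodic_angles hF hS hV hδ hM).2.comp (Ψ := fun x => (x.1 + x.2, x.2)) (by fun_prop) hsh34
      (fun x _ => hΨ1 x) fun x _ => hΨs x
  have hTd : DifferentiableOn ℂ (conjugatedMap p q S V Φ) W :=
    hΦ.differentiableOn.comp (hΓl.1.prodMk hAl.1.neg) hE1
  have hT1 : ∀ x ∈ W, conjugatedMap p q S V Φ (x + (1, 0)) = conjugatedMap p q S V Φ x + (1, 0) := by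
    intro x hx
    rw [conjugatedMap, conjugatedMap, ← hΦ.add_one hF hS hV hδ hM hμ (hE1 x hx)]
    have h1 := hΓl.2 x hx
    have h2 := hAl.2.1 x hx
    simp only at h1 h2
    rw [h1, h2]
    congr 1
    ext <;> simp
  have hTs : ∀ x ∈ W, conjugatedMap p q S V Φ (star x) = star (conjugatedMap p q S V Φ x) := by
    intro x hx
    rw [conjugatedMap, conjugatedMap, ← hΦ.map_star hF hS hV hδ hM hμ (hE1 x hx)]
    have h1 := hΓl.3 x hx
    have h2 := hAl.2.2 x hx
    simp only at h1 h2
    rw [h1, h2]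
    congr 1
  have hl1 : IsRealAnalyticLift (fun x => (conjugatedMap p q S V Φ x).1) W :=
    ⟨hTd.fst, fun x hx => by rw [hT1 x hx]; simp, fun x hx => by rw [hTs x hx]; rfl⟩
  have hl2 : IsRealAnalyticPeriodic (fun x => (conjugatedMap p q S V Φ x).2) W :=
    ⟨hTd.snd, fun x hx => by simp only [hT1 x hx]; simp, fun x hx => by simp only [hTs x hx]; rfl⟩
  have hF1 := hl1.sub (IsRealAnalyticLift.fst.add_periodic IsRealAnalyticPeriodic.snd)
  have hF2 := hl2.sub IsRealAnalyticPeriodic.snd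
  -- the remainder vanishes to order `n + 3`
  obtain ⟨K, hK⟩ := hΦ.lipschitz
  obtain ⟨K', hK'⟩ := exists_angle_defect_bound hF hS hV hδ hM
  have hrem : ∀ x ∈ W, ‖conjugatedMap p q S V Φ x - (x.1 + x.2, x.2)‖ ≤ |K| * |K'| * ‖x.2‖ ^ (n + 3) := by
    intro x hx
    have h1 := hΦ.left_inv _ (hF.orbitDomain_mono (by norm_num) hτμ (hsh x hx))
    have h2 := hK _ _ _ (hE1 x hx) (hE2 x hx)
    rw [h1] at h2
    have h3 := hK' _ (show ((x.1 + x.2, x.2) : ℂ × ℂ) ∈ orbitDomain χ (3 / 4 * R) (δ * R / 2) from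
      ⟨(hsh34 x hx).1, ball_subset_ball (by nlinarith) hx.2⟩)
    have h4 : ‖-backwardAngle p q S V (x.1 + x.2, x.2) - forwardAngle p q S V (x.1 + x.2, x.2)‖ ≤
        |K'| * ‖x.2‖ ^ (n + 3) := by
      rw [← norm_neg, neg_sub, sub_neg_eq_add]
      exact h3.trans (mul_le_mul_of_nonneg_right (le_abs_self K') (by positivity))
    calc _ ≤ _ := h2
      _ ≤ |K| * (|K'| * ‖x.2‖ ^ (n + 3)) := by
        refine mul_le_mul (le_abs_self K) h4 (norm_nonneg _) (abs_nonneg _)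
      _ = _ := by ring
  have hsize : ∀ x ∈ W, ‖(conjugatedMap p q S V Φ x).1 - (x.1 + x.2)‖ ≤ (B₀ + b₀ + 2 * μ) * R ∧
      ‖(conjugatedMap p q S V Φ x).2 - x.2‖ ≤ (B₀ + b₀ + 2 * μ) * R := by
    intro x hx
    constructor
    · obtain ⟨z, hz, hz1, hz2⟩ := hΦ.exists_near _ (hE1 x hx)
      have h1 : χ (approxCurve S V (x.1 + x.2, x.2)) = x.1 + x.2 + V (x.1 + x.2, x.2) :=
        hS.χ_S (image_mono (strip_mono (by linarith)) (hX65 x hx))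
      have h2 := hS.norm_χ_sub_le (strip_mono (by linarith) hz)
        (strip_mono (by linarith : 13 / 20 * R ≤ R) (hΓE x hx))
      rw [h1] at h2
      have h3 : (conjugatedMap p q S V Φ x).1 - (x.1 + x.2) =
          (χ z - (x.1 + x.2 + V (x.1 + x.2, x.2))) + V (x.1 + x.2, x.2) := by
        rw [conjugatedMap, hz1]; ring
      rw [h3]
      have h4 := hVn x hx
      have h5 : M * ‖x.2‖ ≤ b₀ * R := by
        have h6 := (hyn x hx).le
        have h7 : M * τ ≤ b₀ := by nlinarith
        calc M * ‖x.2‖ ≤ M * (τ * R) := by gcongr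
          _ = M * τ * R := by ring
          _ ≤ b₀ * R := by gcongr
      have h8 : B₀ * ‖z - approxCurve S V (x.1 + x.2, x.2)‖ ≤ B₀ * R := by
        have : ‖z - approxCurve S V (x.1 + x.2, x.2)‖ ≤ R := hz2.trans (by linarith)
        gcongr
      have := norm_add_le (χ z - (x.1 + x.2 + V (x.1 + x.2, x.2))) (V (x.1 + x.2, x.2))
      have : 0 ≤ μ * R := by positivity
      nlinarith
    · have h1 := mem_ball_zero_iff.1 (hΦ.mem _ (hE1 x hx)).2
      have h2 := hyn x hx
      have h3 := _root_.norm_sub_le (conjugatedMap p q S V Φ x).2 x.2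
      have h4 : ‖(conjugatedMap p q S V Φ x).2‖ < μ * R := h1
      have h5 : τ * R ≤ μ * R := by gcongr
      have : 0 ≤ (B₀ + b₀) * R := by positivity
      nlinarith
  have hlo : ∀ a ∈ χ '' strip (3 / 5 * R), (fun t => conjugatedMap p q S V Φ (a, t) - (a + t, t))
      =o[𝓝 0] fun t : ℂ => t ^ (n + 2) := fun a ha =>
    isLittleO_pow_of_norm_le (mul_pos hτ0 hR) fun t ht => hrem (a, t) ⟨ha, ht⟩
  have h35 : 3 / 5 * R ≤ R := by linarith
  obtain ⟨f, hf, hfe, hfb⟩ := hF1.exists_eq_snd_pow_mul (hS.isOpen_image h35)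
    (fun _ => hS.image_add_one h35) (fun _ => hS.image_star h35) (mul_pos hτ0 hR) (n := n + 2)
    fun a ha => (isBigO_of_le _ fun t =>
      norm_fst_le (conjugatedMap p q S V Φ (a, t) - (a + t, t))).trans_isLittleO (hlo a ha)
  obtain ⟨f', hf', hfe', hfb'⟩ := hF2.exists_eq_snd_pow_mul (hS.isOpen_image h35)
    (fun _ => hS.image_add_one h35) (fun _ => hS.image_star h35) (mul_pos hτ0 hR) (n := n + 2)
    fun a ha => (isBigO_of_le _ fun t =>
      norm_snd_le (conjugatedMap p q S V Φ (a, t) - (a + t, t))).trans_isLittleO (hlo a ha)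
  refine ⟨f, f', hf, hf', fun x hx => ⟨?_, hfb _ (fun x hx => (hsize x hx).1) x hx,
    hfb' _ (fun x hx => (hsize x hx).2) x hx⟩⟩
  have h1 := hfe x hx
  have h2 := hfe' x hx
  refine Prod.ext ?_ ?_
  · simp only [normalFormMap]
    linear_combination h1
  · simp only [normalFormMap]
    linear_combination h2

end

/-! ### The coordinate change -/

theorem eventually_mul_lt_nhdsGT_zero (K : ℝ) {a : ℝ} (ha : 0 < a) : ∀ᶠ t : ℝ in 𝓝[>] 0, K * t < a := by
  have h : Tendsto (fun t : ℝ => K * t) (𝓝[>] 0) (𝓝 (K * 0)) :=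
    ((continuous_const.mul continuous_id).tendsto 0).mono_left nhdsWithin_le_nhds
  rw [mul_zero] at h
  exact h.eventually (gt_mem_nhds ha)

/-- At a short distance a point of the boundary curve is determined by the chord angle. -/
theorem CurveFrame.eq_of_chordAngle_eq {Λ β R : ℝ} {u v p q κ : ℂ → ℂ}
    (hF : CurveFrame Λ β R u v p q κ) {s z w : ℂ} (hs : s ∈ strip (R / 2))
    (hz : ‖z - s‖ < β / (100 * Λ ^ 4) * R) (hw : ‖w - s‖ < β / (100 * Λ ^ 4) * R)
    (h : chordAngle p q s z = chordAngle p q s w) : z = w := by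
  have hR := hF.R_pos
  have hβ := hF.β_pos
  have hΛ := hF.Λ_pos
  have hΛ4 : 1 ≤ Λ ^ 4 := one_le_pow₀ hF.one_le
  set ρ := β / (100 * Λ ^ 4) * R with hρ
  have hρ0 : 0 < ρ := by positivity
  have hρΛ : 100 * Λ ^ 4 * ρ = β * R := by rw [hρ]; field_simp
  have hβR : β * R ≤ 1 := mul_le_one₀ hF.β_le_one hR.le hF.R_le_one
  have hρR : 100 * ρ ≤ R := by nlinarith [hF.β_le_one]
  have hsub : ball s (2 * ρ) ⊆ strip R := fun x hx => by
    have h1 := strip_add (σ' := R) (t := x - s) hs (by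
      have := mem_ball_iff_norm.1 hx
      linarith)
    simpa using h1
  have hsR : s ∈ strip R := strip_mono (by linarith) hs
  have hd : ∀ x ∈ ball s (2 * ρ), ‖x - s‖ ≤ 1 / (8 * Λ ^ 4) := fun x hx => by
    have := mem_ball_iff_norm.1 hx
    rw [le_div_iff₀ (by positivity)]
    nlinarith
  have hdiff : DifferentiableOn ℂ (fun x => chordAngle p q s x - κ s * (x - s) / 2) (ball s (2 * ρ)) := by
    have h1 : DifferentiableOn ℂ (fun x => chordAngle p q s x) (ball s (2 * ρ)) := by
      have ha : DifferentiableOn ℂ (fun x => chordMean p s x) (ball s (2 * ρ)) :=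
        (differentiableOn_chordMean hF.differentiableOn_p).comp
          (f := fun x => (s, x)) (by fun_prop) fun x hx => ⟨hsR, hsub hx⟩
      have hb : DifferentiableOn ℂ (fun x => chordMean q s x) (ball s (2 * ρ)) :=
        (differentiableOn_chordMean hF.differentiableOn_q).comp
          (f := fun x => (s, x)) (by fun_prop) fun x hx => ⟨hsR, hsub hx⟩
      have hA := (ha.const_mul (q s)).clog fun x hx =>
        hF.mem_slitPlane (hd x hx) (hF.norm_a_sub_one_le hsR (hsub hx) (hd x hx))
      have hB := (hb.const_mul (p s)).clog fun x hx =>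
        hF.mem_slitPlane (hd x hx) (hF.norm_b_sub_one_le hsR (hsub hx) (hd x hx))
      exact (hA.sub hB).const_mul _
    exact h1.sub (by fun_prop)
  have hbd : ∀ x ∈ ball s (2 * ρ), ‖chordAngle p q s x - κ s * (x - s) / 2‖ ≤ 12 * Λ ^ 4 * ρ ^ 2 :=
    fun x hx => (hF.norm_chordAngle_sub_le hsR (hsub hx) (hd x hx)).trans (by
      have h1 := (mem_ball_iff_norm.1 hx).le
      calc 3 * Λ ^ 4 * ‖x - s‖ ^ 2 ≤ 3 * Λ ^ 4 * (2 * ρ) ^ 2 := by gcongr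
        _ = 12 * Λ ^ 4 * ρ ^ 2 := by ring)
  -- by the Cauchy estimate `h ↦ A(s, s + h) - κ(s) h / 2` has a small Lipschitz constant
  have hlip := norm_sub_le_of_bounded_nhd hρ0 (convex_ball s ρ) (W := ball s (2 * ρ))
    (fun x hx => ball_subset_ball' (by have := mem_ball.1 hx; linarith)) hdiff hbd
    (mem_ball_iff_norm.2 hz) (mem_ball_iff_norm.2 hw)
  have h2 : chordAngle p q s z - κ s * (z - s) / 2 - (chordAngle p q s w - κ s * (w - s) / 2) =
      -(κ s / 2 * (z - w)) := by rw [h]; ring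
  rw [h2, norm_neg, norm_mul, norm_div] at hlip
  have h3 : 2 * (12 * Λ ^ 4 * ρ ^ 2) / ρ = 24 * Λ ^ 4 * ρ := by field_simp; ring
  rw [h3] at hlip
  have h4 : β ≤ ‖κ s‖ := (hF.le_re s hsR).trans (Complex.re_le_norm _)
  have h5 : 24 * Λ ^ 4 * ρ ≤ β / 4 := by nlinarith [hF.R_le_one]
  have h6 : ‖z - w‖ = 0 := by
    have : (0 : ℝ) ≤ ‖z - w‖ := norm_nonneg _
    have h7 : ‖(2 : ℂ)‖ = 2 := by simp
    rw [h7] at hlip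
    nlinarith
  exact sub_eq_zero.1 (norm_eq_zero.1 h6)

section

variable {Λ β R b₀ B₀ m c M δ μ c₄ : ℝ} {u v p q κ g χ S : ℂ → ℂ} {V : ℂ × ℂ → ℂ} {n : ℕ}
  {Φ : ℂ × ℂ → ℂ × ℂ}
variable (hF : CurveFrame Λ β R u v p q κ) (hS : StripChart b₀ B₀ R g χ S)
  (hV : ApproxInvariant n c M R p q g χ S V) (hδ : StepRadius Λ b₀ c M δ) (hM : 0 < M)
  (hΦ : NormalChart μ c₄ R p q κ g χ S V Φ)

include hF hS hΦ in
/-- The second coordinate of the normal chart is comparable to `2 g ϑ / κ`. -/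
theorem NormalChart.norm_snd_le {x : ℂ × ℂ} (hx : x ∈ stripProd (13 / 20 * R) (c₄ * R)) :
    ‖(Φ x).2‖ ≤ 4 * B₀ / β * ‖x.2‖ := by
  have hβ := hF.β_pos
  have hR := hF.R_pos
  have hB := hS.B₀_pos
  have hx1 : x.1 ∈ strip R := strip_mono (by linarith) hx.1
  have h1 := hΦ.norm_sub_le x hx
  have h2 := norm_sub_norm_le (Φ x).2 (2 * g x.1 / κ x.1 * x.2)
  have h3 : ‖2 * g x.1 / κ x.1 * x.2‖ ≤ 2 * B₀ / β * ‖x.2‖ := by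
    rw [norm_mul, norm_div, norm_mul]
    have h4 : β ≤ ‖κ x.1‖ := (hF.le_re _ hx1).trans (Complex.re_le_norm _)
    have h5 := hS.norm_le _ hx1
    have h6 : ‖(2 : ℂ)‖ = 2 := by simp
    rw [h6]
    gcongr
  have h4 : 4 * B₀ / β * ‖x.2‖ = 2 * (2 * B₀ / β * ‖x.2‖) := by ring
  linarith

include hF hS hV hδ hM hΦ

/-- On real points the second coordinate `y` is real and within `|y| / 2` of `2 g ϑ / κ > 0`. -/
theorem NormalChart.re_snd_pos (hμ : μ ≤ δ) {s ϑ : ℝ}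
    (hx : ((s : ℂ), (ϑ : ℂ)) ∈ stripProd (13 / 20 * R) (c₄ * R)) (hϑ : 0 < ϑ) :
    0 < (Φ ((s : ℂ), (ϑ : ℂ))).2.re := by
  have hR := hF.R_pos
  have hsR : (s : ℂ) ∈ strip R := strip_mono (by linarith) hx.1
  have hreal : ∀ z : ℂ, star z = z → ((z.re : ℝ) : ℂ) = z := fun z hz =>
    Complex.conj_eq_iff_re.1 hz
  have e1 : star ((s : ℂ), (ϑ : ℂ)) = ((s : ℂ), (ϑ : ℂ)) := by ext <;> simp
  have hs : star (s : ℂ) = s := Complex.conj_ofReal s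
  have hy := hΦ.map_star hF hS hV hδ hM hμ hx
  rw [e1] at hy
  have hy2 := hreal _ (congrArg Prod.snd hy).symm
  have hg := hS.g_star _ hsR
  have hk := hF.κ_star _ hsR
  rw [hs] at hg hk
  have hg' := hreal _ hg.symm
  have hk' := hreal _ hk.symm
  have h1 := hΦ.norm_sub_le _ hx
  have hg0 : 0 < (g s).re := hS.b₀_pos.trans_le (hS.le_re _ hsR)
  have hk0 : 0 < (κ s).re := hF.β_pos.trans_le (hF.le_re _ hsR)
  simp only at h1
  rw [← hy2, ← hg', ← hk'] at h1
  set Y := (Φ ((s : ℂ), (ϑ : ℂ))).2.re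
  set G := (g s).re
  set K := (κ s).re
  have h2 : ((Y : ℂ) - 2 * G / K * ϑ) = ((Y - 2 * G / K * ϑ : ℝ) : ℂ) := by push_cast; ring
  rw [h2, Complex.norm_real, Complex.norm_real, Real.norm_eq_abs, Real.norm_eq_abs] at h1
  have h3 : 0 < 2 * G / K * ϑ := by positivity
  by_contra hY
  rw [not_lt] at hY
  rw [abs_of_nonpos hY, abs_of_nonpos (by linarith)] at h1
  linarith

/-- The normal chart, on a smaller domain, is a coordinate change. Its inverse takes `(x, y)` to the
point and the forward angle of the approximate orbit. -/
theorem NormalChart.exists_coordinateChange (hμ : μ ≤ δ) {c₁ : ℝ} (hc0 : 0 < c₁) (hc : c₁ ≤ c₄) :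
    ∃ P : OpenPartialHomeomorph (ℂ × ℂ) (ℂ × ℂ), IsCoordinateChange (R / 2) (c₁ * R) P ∧
      (∀ x, P x = Φ x) ∧ P.target ⊆ orbitDomain χ (7 / 10 * R) (μ * R) := by
  have hR := hF.R_pos
  have hsub : stripProd (R / 2) (c₁ * R) ⊆ stripProd (13 / 20 * R) (c₄ * R) :=
    prod_mono (strip_mono (by linarith)) (ball_subset_ball (by gcongr))
  have h34 : orbitDomain χ (7 / 10 * R) (μ * R) ⊆ orbitDomain χ (3 / 4 * R) (δ * R) :=
    hF.orbitDomain_mono (by norm_num) hμ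
  have h45 : orbitDomain χ (7 / 10 * R) (μ * R) ⊆ orbitDomain χ (4 / 5 * R) (δ * R) :=
    hF.orbitDomain_mono (by norm_num) hμ
  have hopen : IsOpen (stripProd (R / 2) (c₁ * R)) := (isOpen_strip _).prod isOpen_ball
  have hopen' : IsOpen (orbitDomain χ (7 / 10 * R) (μ * R)) :=
    (hS.isOpen_image (by linarith)).prod isOpen_ball
  let Ξ : ℂ × ℂ → ℂ × ℂ := fun x => (approxCurve S V x, forwardAngle p q S V x)
  have hΞ : DifferentiableOn ℂ Ξ (orbitDomain χ (7 / 10 * R) (μ * R)) :=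
    ((lift_approxCurve hF hS hV hδ hM).1.mono h45).prodMk ((periodic_angles hF hS hV hδ hM).1.1.mono h34)
  have hΞΦ : ∀ x ∈ stripProd (R / 2) (c₁ * R), Ξ (Φ x) = x := fun x hx =>
    Prod.ext (hΦ.approxCurve_eq x (hsub hx)) (hΦ.forwardAngle_eq x (hsub hx))
  have hΦd : DifferentiableOn ℂ Φ (stripProd (R / 2) (c₁ * R)) := hΦ.differentiableOn.mono hsub
  have hΞd : DifferentiableOn ℂ Ξ (orbitDomain χ (7 / 10 * R) (μ * R) ∩ Ξ ⁻¹' stripProd (R / 2) (c₁ * R)) :=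
    hΞ.mono inter_subset_left
  let P : OpenPartialHomeomorph (ℂ × ℂ) (ℂ × ℂ) :=
    { toFun := Φ
      invFun := Ξ
      source := stripProd (R / 2) (c₁ * R)
      target := orbitDomain χ (7 / 10 * R) (μ * R) ∩ Ξ ⁻¹' stripProd (R / 2) (c₁ * R)
      map_source' := fun x hx => ⟨hΦ.mem x (hsub hx), by rw [mem_preimage, hΞΦ x hx]; exact hx⟩
      map_target' := fun x hx => hx.2
      left_inv' := hΞΦ
      right_inv' := fun x hx => hΦ.left_inv x hx.1
      open_source := hopen
      open_target := hΞ.continuousOn.isOpen_inter_preimage hopen' hopen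
      continuousOn_toFun := hΦd.continuousOn
      continuousOn_invFun := hΞd.continuousOn }
  refine ⟨P, ⟨rfl, hΦd, hΞd, fun x hx => hΦ.add_one hF hS hV hδ hM hμ (hsub hx),
    fun x hx => hΦ.map_star hF hS hV hδ hM hμ (hsub hx), fun s hs => ?_, fun s ϑ h0 h1 => ?_⟩,
    fun _ => rfl, inter_subset_left⟩
  · have hx : (s, (0 : ℂ)) ∈ stripProd (13 / 20 * R) (c₄ * R) :=
      hsub ⟨hs, mem_ball_self (by positivity)⟩
    have := hΦ.norm_snd_le hF hS hx
    simp only [norm_zero, mul_zero] at this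
    exact norm_le_zero_iff.1 this
  · exact hΦ.re_snd_pos hF hS hV hδ hM hμ (hsub ⟨ofReal_mem_strip (by positivity) _, by
      rw [mem_ball_zero_iff, Complex.norm_real, Real.norm_of_nonneg h0.le]; exact h1⟩) h0

end

/-! ### The normal form of the complexified billiard map -/

section

variable {Λ β R b₀ B₀ m c M δ μ c₄ : ℝ} {u v p q κ g χ S : ℂ → ℂ} {V : ℂ × ℂ → ℂ} {n : ℕ}
  {Φ : ℂ × ℂ → ℂ × ℂ}
variable (hF : CurveFrame Λ β R u v p q κ) (hS : StripChart b₀ B₀ R g χ S)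
  (hV : ApproxInvariant n c M R p q g χ S V) (hδ : StepRadius Λ b₀ c M δ) (hM : 0 < M)
  (hΦ : NormalChart μ c₄ R p q κ g χ S V Φ)

include hS in
/-- The chart maps the real line onto itself. -/
theorem StripChart.exists_eq_ofReal (x : ℝ) : ∃ t : ℝ, χ t = x := by
  have hR := hS.R_pos
  have hper : Function.Periodic (fun t : ℝ => χ t - t) 1 := fun t => by
    have := hS.map_add_one t (ofReal_mem_strip hR t)
    push_cast
    rw [this]
    ring
  have hint : ∀ k : ℤ, (χ (k : ℝ)).re = k := fun k => by
    have h1 := hper.int_mul_eq k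
    simp only [mul_one, Complex.ofReal_zero, hS.map_zero, sub_zero] at h1
    rw [sub_eq_zero.1 h1]
    simp
  have hc : Continuous fun t : ℝ => (χ t).re := Complex.continuous_re.comp <|
    continuous_iff_continuousAt.2 fun t =>
      (hS.hasDerivAt t (ofReal_mem_strip hR t)).continuousAt.comp Complex.continuous_ofReal.continuousAt
  obtain ⟨t, -, ht⟩ := intermediate_value_Icc (show ((⌊x⌋ : ℤ) : ℝ) ≤ ((⌊x⌋ + 1 : ℤ) : ℝ) by simp)
    hc.continuousOn (show x ∈ _ by
      rw [hint, hint]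
      exact ⟨Int.floor_le x, by push_cast; exact (Int.lt_floor_add_one x).le⟩)
  refine ⟨t, ?_⟩
  have h1 := hS.map_star t (ofReal_mem_strip hR t)
  rw [show star (t : ℂ) = t from Complex.conj_ofReal t] at h1
  rw [← Complex.conj_eq_iff_re.1 h1.symm]
  exact congrArg _ ht

include hF hS hV hδ hM hΦ

/-- The normal chart takes the next point of a billiard orbit, with its angle, to the image under the
conjugated map, since for short chords the chord angle determines the end point of the chord. -/
theorem NormalChart.apply_step (hμ : μ ≤ δ) {s ϑ s' ϑ' : ℂ} (hs : s ∈ strip (R / 2))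
    (hx : (s, ϑ) ∈ stripProd (13 / 20 * R) (c₄ * R))
    (hy : 2 * ‖(Φ (s, ϑ)).2‖ / b₀ < β / (100 * Λ ^ 4) * R) (hd : ‖s' - s‖ < β / (100 * Λ ^ 4) * R)
    (h : chordAngle p q s s' = ϑ) (h' : chordAngle p q s' s = -ϑ') :
    Φ (s', ϑ') = conjugatedMap p q S V Φ (Φ (s, ϑ)) := by
  subst h
  have hm := hF.orbitDomain_mono (by norm_num : (7 / 10 : ℝ) ≤ 3 / 4) hμ (hΦ.mem _ hx)
  have h1 := hΦ.approxCurve_eq _ hx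
  have h2 := hΦ.forwardAngle_eq _ hx
  have h3 := (orbit_estimates hF hS hV hδ hM hm).1.1
  simp only at h1 h2
  rw [h1] at h3
  rw [forwardAngle, h1] at h2
  have h4 := hF.eq_of_chordAngle_eq hs (h3.trans_lt hy) hd h2
  rw [conjugatedMap, h4, backwardAngle]
  simp only [add_sub_cancel_right, Prod.mk.eta]
  rw [h4, h1, h', neg_neg]

/-- The image of a strip of width `σ` contains a proportional neighbourhood of the boundary. -/
theorem NormalChart.stripProd_subset (hμ : μ ≤ δ) {c₁ c₂ σ : ℝ} (hσ : 0 < σ) (hσR : σ < R / 2)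
    (h2 : 0 < c₂) (h2b : c₂ ≤ b₀ / 4) (h2M : M / b₀ * c₂ < 1 / 4) (h21 : 2 * Λ / b₀ * c₂ < c₁)
    (h2μ : c₂ ≤ μ) : stripProd (c₂ * σ) (c₂ * σ) ⊆ Φ '' stripProd σ (c₁ * R) := by
  rintro ⟨x, y⟩ ⟨hx, hy⟩
  have hb := hS.b₀_pos
  have hR := hF.R_pos
  have hy' : ‖y‖ < c₂ * σ := mem_ball_zero_iff.1 hy
  simp only at hx
  -- the real part of `x` is attained by the chart on the real line
  obtain ⟨t, ht⟩ := hS.exists_eq_ofReal x.re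
  have hball : closedBall (t : ℂ) (σ / 2) ⊆ strip (σ / 2 + σ / 4) := fun z hz => by
    have := strip_add (σ := σ / 4) (σ' := σ / 2 + σ / 4) (ofReal_mem_strip (by positivity) t)
      (t := z - t) (by have := mem_closedBall_iff_norm.1 hz; linarith)
    simpa using this
  have hx1 : x ∈ χ '' strip (σ / 2 + σ / 4) := by
    refine image_mono hball (hS.ball_subset_image (by positivity)
      (hball.trans (strip_mono (by linarith))) ?_)
    rw [ht, mem_ball_iff_norm]
    have e1 : x - x.re = x.im * Complex.I := by
      apply Complex.ext <;> simp
    rw [e1, norm_mul, Complex.norm_I, mul_one, Complex.norm_real, Real.norm_eq_abs]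
    have : |x.im| < c₂ * σ := hx
    nlinarith
  have hsub : (x, y) ∈ orbitDomain χ (7 / 10 * R) (μ * R) :=
    ⟨image_mono (strip_mono (by linarith)) hx1, mem_ball_zero_iff.2 (hy'.trans_le (by
      calc c₂ * σ ≤ μ * σ := by gcongr
        _ ≤ μ * R := by have := h2.trans_le h2μ; gcongr; linarith))⟩
  have h34 := hF.orbitDomain_mono (by norm_num : (7 / 10 : ℝ) ≤ 3 / 4) hμ hsub
  have h45 := hF.orbitDomain_mono (by norm_num : (7 / 10 : ℝ) ≤ 4 / 5) hμ hsub
  refine ⟨_, ⟨?_, ?_⟩, hΦ.left_inv _ hsub⟩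
  · have h3 := norm_approxCurve_sub_le hF hS hV hδ hM h45
    have h4 : S x ∈ strip (σ / 2 + σ / 4) := hS.S_mem (by linarith) hx1
    have h5 := strip_add (σ' := σ) (t := approxCurve S V (x, y) - S x) h4 (by
      refine h3.trans ?_
      calc M * ‖y‖ / b₀ ≤ M * (c₂ * σ) / b₀ := by gcongr
        _ = M / b₀ * c₂ * σ := by ring
        _ ≤ σ - (σ / 2 + σ / 4) := by nlinarith)
    simpa using h5
  · rw [mem_ball_zero_iff]
    calc _ ≤ 2 * Λ / b₀ * ‖y‖ := (norm_angle_le hF hS hV hδ hM h34).1.1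
      _ ≤ 2 * Λ / b₀ * (c₂ * σ) := by have := hF.Λ_pos; gcongr
      _ = 2 * Λ / b₀ * c₂ * σ := by ring
      _ < c₁ * σ := by gcongr
      _ ≤ c₁ * R := by
        have := hF.Λ_pos
        have : 0 < c₁ := lt_trans (by positivity) h21
        gcongr
        linarith

end

/-- The normal form theorem on the level of complexified curves: near the boundary there are
coordinates in which consecutive points with small step and small angles are mapped by the integrable
twist up to an error of order `n + 3`. -/
theorem exists_normalForm {Λ β c₀ : ℝ} (hΛ : 1 ≤ Λ) (hβ : 0 < β) (hβ1 : β ≤ 1) (hc₀ : 0 < c₀) (n : ℕ) :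
    ∃ c₁ c₂ C : ℝ, 0 < c₁ ∧ c₁ ≤ c₀ ∧ 0 < c₂ ∧ 1 < C ∧
      ∀ {R : ℝ} {u v p q κ : ℂ → ℂ}, CurveFrame Λ β R u v p q κ →
        ∃ (Φ : OpenPartialHomeomorph (ℂ × ℂ) (ℂ × ℂ)) (f f' : ℂ × ℂ → ℂ),
          IsCoordinateChange (R / 2) (c₁ * R) Φ ∧
          IsRealAnalyticPeriodic f Φ.target ∧ IsRealAnalyticPeriodic f' Φ.target ∧
          (∀ s ϑ s' ϑ' : ℂ, (s, ϑ) ∈ stripProd (R / 2) (c₁ * R) →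
            ‖s' - s‖ < β / (100 * Λ ^ 4) * R → chordAngle p q s s' = ϑ →
            chordAngle p q s' s = -ϑ' →
            Φ (s', ϑ') = normalFormMap (n + 3) f f' (Φ (s, ϑ))) ∧
          ∀ σ : ℝ, 0 < σ → σ < R / 2 →
            stripProd (c₂ * σ) (c₂ * σ) ⊆ Φ '' stripProd σ (c₁ * R) ∧
            ∀ x ∈ Φ '' stripProd σ (c₁ * R),
              ‖f x‖ ≤ C / (R / 2 - σ) ^ (n + 2) ∧ ‖f' x‖ ≤ C / (R / 2 - σ) ^ (n + 2) := by
  have hΛ0 : 0 < Λ := by linarith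
  obtain ⟨b₀, hb₀⟩ : ∃ b, b = β / (2 * Λ) := ⟨_, rfl⟩
  obtain ⟨B₀, hB₀⟩ : ∃ b, b = Λ / β ^ 2 := ⟨_, rfl⟩
  have hb : 0 < b₀ := by rw [hb₀]; positivity
  have hB : 0 < B₀ := by rw [hB₀]; positivity
  have hm : β ^ 3 / 24 ≤ Λ ^ 3 / 24 := by gcongr; linarith
  obtain ⟨c, M, hc, hM, H⟩ := exists_approxInvariant hΛ hb hB (by positivity) hm n
  obtain ⟨δ, hδ⟩ := exists_stepRadius hΛ0 hb hc hM
  have hδ0 := hδ.pos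
  obtain ⟨μ, hμ0, hμδ, hμe⟩ := (eventually_mem_nhdsWithin.and <|
    (eventually_mul_lt_nhdsGT_zero 2 hδ0).and (eventually_mul_lt_nhdsGT_zero
      (80 * (2 * M / b₀ + 8 * B₀ * angleConst Λ b₀ B₀ M / β)) one_pos)).exists
  replace hμ0 : 0 < μ := hμ0
  have hμ : μ ≤ δ := by linarith
  obtain ⟨c₄, hc₄⟩ : ∃ c, c = μ * β / (8 * B₀) := ⟨_, rfl⟩
  have hc₄0 : 0 < c₄ := by rw [hc₄]; positivity
  obtain ⟨τ, hτ0, hτμ, hτδ, hτb, hτc, hτd⟩ := (eventually_mem_nhdsWithin.and <|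
    (eventually_mul_lt_nhdsGT_zero 1 hμ0).and <| (eventually_mul_lt_nhdsGT_zero 2 hδ0).and <|
    (eventually_mul_lt_nhdsGT_zero (1 + M) (show 0 < b₀ / 100 by positivity)).and <|
    (eventually_mul_lt_nhdsGT_zero (2 * Λ / b₀) hc₄0).and
    (eventually_mul_lt_nhdsGT_zero (1 / b₀) (show 0 < β / (100 * Λ ^ 4) by positivity))).exists
  replace hτ0 : 0 < τ := hτ0
  obtain ⟨c₁, hc₁, hc₁0, hc₁c, hc₁τ⟩ := (eventually_mem_nhdsWithin.and <|
    (eventually_mul_lt_nhdsGT_zero 1 hc₀).and <| (eventually_mul_lt_nhdsGT_zero 1 hc₄0).and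
    (eventually_mul_lt_nhdsGT_zero (4 * B₀ / β) (show 0 < τ / 2 by positivity))).exists
  replace hc₁ : 0 < c₁ := hc₁
  obtain ⟨c₂, hc₂, hc₂b, hc₂M, hc₂1, hc₂μ⟩ := (eventually_mem_nhdsWithin.and <|
    (eventually_mul_lt_nhdsGT_zero 1 (show 0 < b₀ / 4 by positivity)).and <|
    (eventually_mul_lt_nhdsGT_zero (M / b₀) (show (0 : ℝ) < 1 / 4 by positivity)).and <|
    (eventually_mul_lt_nhdsGT_zero (2 * Λ / b₀) hc₁).and
    (eventually_mul_lt_nhdsGT_zero 1 hμ0)).exists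
  replace hc₂ : 0 < c₂ := hc₂
  rw [one_mul] at hτμ hc₁0 hc₁c hc₂b hc₂μ
  refine ⟨c₁, c₂, 1 + (B₀ + b₀ + 2 * μ) / τ ^ (n + 3), hc₁, hc₁0.le, hc₂, ?_, ?_⟩
  · have : 0 < (B₀ + b₀ + 2 * μ) / τ ^ (n + 3) := by positivity
    linarith
  intro R u v p q κ hF
  obtain ⟨m, g, χ, S, hm₀, hm₁, hS, hκ⟩ := hF.exists_chart
  rw [← hb₀, ← hB₀] at hS
  obtain ⟨V, hV⟩ := H hF hS hm₀ hm₁ hκ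
  obtain ⟨Ψ, hΨ⟩ := exists_normalChart hF hS hV hδ hM hμ0 hμδ.le hμe.le
  rw [← hc₄] at hΨ
  obtain ⟨Φ, hΦ, hΦΨ, htarget⟩ := hΨ.exists_coordinateChange hF hS hV hδ hM hμ hc₁ hc₁c.le
  obtain ⟨f, f', hf, hf', hrem⟩ := hΨ.exists_remainder hF hS hV hδ hM hμ0 hμ hτ0 hτμ.le
    (by linarith) hτb.le hτc.le
  have hR := hF.R_pos
  have hsub : stripProd (R / 2) (c₁ * R) ⊆ stripProd (13 / 20 * R) (c₄ * R) :=
    prod_mono (strip_mono (by linarith)) (ball_subset_ball (by gcongr))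
  have hsnd : ∀ x ∈ stripProd (R / 2) (c₁ * R), ‖(Φ x).2‖ < τ * R / 2 := fun x hx => by
    rw [hΦΨ]
    calc _ ≤ 4 * B₀ / β * ‖x.2‖ := hΨ.norm_snd_le hF hS (hsub hx)
      _ ≤ 4 * B₀ / β * (c₁ * R) := by have := (mem_ball_zero_iff.1 hx.2).le; gcongr
      _ = 4 * B₀ / β * c₁ * R := by ring
      _ < τ / 2 * R := by gcongr
      _ = τ * R / 2 := by ring
  have hmem : ∀ x ∈ stripProd (R / 2) (c₁ * R), Φ x ∈ orbitDomain χ (3 / 5 * R) (τ * R / 2) :=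
    fun x hx => by
      refine ⟨?_, mem_ball_zero_iff.2 (hsnd x hx)⟩
      obtain ⟨z, -, hz1, hz2⟩ := hΨ.exists_near x (hsub hx)
      rw [hΦΨ, hz1]
      refine mem_image_of_mem _ ?_
      have := strip_add (σ' := 3 / 5 * R) (t := z - x.1) hx.1 (by linarith)
      simpa using this
  have htar : Φ.target ⊆ orbitDomain χ (3 / 5 * R) (τ * R / 2) := fun x hx => by
    have h1 := hmem (Φ.symm x) (hΦ.source_eq ▸ Φ.map_target hx)
    rwa [Φ.right_inv hx] at h1
  refine ⟨Φ, f, f', hΦ, ⟨hf.1.mono htar, fun x hx => hf.2.1 x (htar hx), fun x hx => hf.2.2 x (htar hx)⟩,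
    ⟨hf'.1.mono htar, fun x hx => hf'.2.1 x (htar hx), fun x hx => hf'.2.2 x (htar hx)⟩, ?_, ?_⟩
  · intro s ϑ s' ϑ' hx hd h h'
    rw [← (hrem _ (hmem _ hx)).1, hΦΨ, hΦΨ]
    refine hΨ.apply_step hF hS hV hδ hM hμ hx.1 (hsub hx) ?_ hd h h'
    have h1 := hsnd _ hx
    rw [hΦΨ] at h1
    calc 2 * ‖(Ψ (s, ϑ)).2‖ / b₀ ≤ 2 * (τ * R / 2) / b₀ := by gcongr
      _ = 1 / b₀ * τ * R := by ring
      _ < _ := by gcongr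
  · intro σ hσ hσR
    have himg : Φ '' stripProd σ (c₁ * R) = Ψ '' stripProd σ (c₁ * R) :=
      image_congr fun x _ => hΦΨ x
    constructor
    · rw [himg]
      exact hΨ.stripProd_subset hF hS hV hδ hM hμ hσ hσR hc₂ hc₂b.le hc₂M hc₂1 hc₂μ.le
    · rintro _ ⟨x, hx, rfl⟩
      have h1 := hrem _ (hmem x ⟨strip_mono hσR.le hx.1, hx.2⟩)
      have h2 : (B₀ + b₀ + 2 * μ) * R / (τ * R) ^ (n + 3) ≤
          (1 + (B₀ + b₀ + 2 * μ) / τ ^ (n + 3)) / (R / 2 - σ) ^ (n + 2) := by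
        have h3 : 0 < R / 2 - σ := by linarith
        calc (B₀ + b₀ + 2 * μ) * R / (τ * R) ^ (n + 3)
            = (B₀ + b₀ + 2 * μ) / τ ^ (n + 3) / R ^ (n + 2) := by
              rw [mul_pow, pow_succ R]
              field_simp
          _ ≤ (1 + (B₀ + b₀ + 2 * μ) / τ ^ (n + 3)) / (R / 2 - σ) ^ (n + 2) := by
              gcongr
              · linarith
              · linarith
      exact ⟨h1.2.1.trans h2, h1.2.2.trans h2⟩

/-! ### Convex curves and their tangents -/

theorem eq_of_periodic_of_injOn {α : Type*} {γ : ℝ → α} (hper : Function.Periodic γ 1)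
    (hinj : InjOn γ (Ico 0 1)) {s t : ℝ} (h : γ s = γ t) (hst : |s - t| < 1) : s = t := by
  have hfr : ∀ x : ℝ, γ (Int.fract x) = γ x := fun x => by
    have := hper.sub_int_mul_eq (x := x) ⌊x⌋
    rwa [mul_one] at this
  have h1 : Int.fract s = Int.fract t :=
    hinj ⟨Int.fract_nonneg s, Int.fract_lt_one s⟩ ⟨Int.fract_nonneg t, Int.fract_lt_one t⟩ (by
      rw [hfr, hfr, h])
  obtain ⟨k, hk⟩ := Int.fract_eq_fract.1 h1
  rw [hk] at hst
  have h2 : |k| < 1 := by exact_mod_cast hst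
  rw [Int.abs_lt_one_iff.1 h2] at hk
  push_cast at hk
  linarith

/-- A simple closed curve that covers the boundary of a planar convex body does not leave it: if it
did, the boundary, which is a topological circle, would embed into an interval. -/
theorem frontier_eq_range_of_subset {K : Set ℂ} (hK : IsCompact K) (hc : Convex ℝ K)
    (hne : (interior K).Nonempty) {γ : ℝ → ℂ} (hγ : Continuous γ) (hper : Function.Periodic γ 1)
    (hinj : InjOn γ (Ico 0 1)) (hsub : frontier K ⊆ range γ) : frontier K = range γ := by
  refine hsub.antisymm ?_
  rintro _ ⟨t₀, rfl⟩
  by_contra ht₀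
  obtain ⟨h, -, -, hh⟩ :=
    exists_homeomorph_image_interior_closure_frontier_eq_unitBall hc hne hK.isBounded
  set A : Set ℝ := Icc t₀ (t₀ + 1) ∩ γ ⁻¹' frontier K with hA
  have hAc : IsCompact A := isCompact_Icc.inter_right (isClosed_frontier.preimage hγ)
  have : CompactSpace A := isCompact_iff_compactSpace.1 hAc
  have hAo : ∀ t ∈ A, t₀ < t ∧ t < t₀ + 1 := fun t ht =>
    ⟨ht.1.1.lt_of_ne fun h' => ht₀ (h' ▸ ht.2), ht.1.2.lt_of_ne fun h' => ht₀ (by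
      have h1 := ht.2
      rwa [mem_preimage, h', hper] at h1)⟩
  have hemb : Topology.IsClosedEmbedding fun t : A => γ t :=
    (hγ.comp continuous_subtype_val).isClosedEmbedding fun s t hst => Subtype.ext <|
      eq_of_periodic_of_injOn hper hinj hst (by
        have h1 := hAo s s.2
        have h2 := hAo t t.2
        rw [abs_lt]
        constructor <;> linarith)
  have hrange : ∀ x ∈ frontier K, x ∈ range fun t : A => γ t := fun x hx => by
    obtain ⟨t, rfl⟩ := hsub hx
    obtain ⟨t', ht', htt⟩ := hper.exists_mem_Ico one_pos t t₀
    exact ⟨⟨t', Ico_subset_Icc_self ht', by rw [mem_preimage, ← htt]; exact hx⟩, htt.symm⟩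
  let e := hemb.isEmbedding.toHomeomorph
  have hmem : ∀ θ : ℝ, h.symm (Complex.exp (θ * Complex.I)) ∈ range fun t : A => γ t := fun θ => by
    refine hrange _ ?_
    have h1 : Complex.exp (θ * Complex.I) ∈ h '' frontier K := by
      rw [hh, mem_sphere_zero_iff_norm, Complex.norm_exp_ofReal_mul_I]
    obtain ⟨x, hx, hx'⟩ := h1
    rw [← hx', h.symm_apply_apply]
    exact hx
  let c : ℝ → range fun t : A => γ t := fun θ => ⟨h.symm (Complex.exp (θ * Complex.I)), hmem θ⟩
  have hcc : Continuous c := Continuous.subtype_mk (h.symm.continuous.comp (by fun_prop)) _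
  let ψ : ℝ → ℝ := fun θ => (e.symm (c θ) : A)
  have hψ : Continuous ψ := continuous_subtype_val.comp (e.symm.continuous.comp hcc)
  have h2π : ψ (Real.pi + Real.pi) = ψ 0 := by
    have : c (Real.pi + Real.pi) = c 0 := Subtype.ext (congrArg h.symm (by
      push_cast
      rw [← two_mul, Complex.exp_two_pi_mul_I]
      simp))
    simp only [ψ, this]
  -- an antipodal pair with the same parameter
  obtain ⟨θ, hθ⟩ : (0 : ℝ) ∈ range fun θ => ψ θ - ψ (θ + Real.pi) := by
    have hG : Continuous fun θ => ψ θ - ψ (θ + Real.pi) := hψ.sub (hψ.comp (by fun_prop))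
    rcases le_total (ψ 0) (ψ Real.pi) with h1 | h1
    · exact mem_range_of_exists_le_of_exists_ge hG ⟨0, by simpa using h1⟩
        ⟨Real.pi, by simp only [h2π]; linarith⟩
    · exact mem_range_of_exists_le_of_exists_ge hG ⟨Real.pi, by simp only [h2π]; linarith⟩
        ⟨0, by simpa using h1⟩
  have h1 : c θ = c (θ + Real.pi) := e.symm.injective (Subtype.ext (sub_eq_zero.1 hθ))
  have h2 := h.symm.injective (congrArg Subtype.val h1)
  push_cast at h2
  rw [add_mul, Complex.exp_add, Complex.exp_pi_mul_I] at h2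
  have h3 := Complex.exp_ne_zero (θ * Complex.I)
  apply h3
  linear_combination h2 / 2

/-- A strictly convex body with a `C²` boundary curve of positive curvature lies to the left of each
tangent line and touches it in one point. The curvature decides the side: a supporting functional is
maximal at the point of tangency, so its second derivative along the curve is not positive. -/
theorem im_conj_tangent_mul_pos {K : Set ℂ} (hK : IsClosed K) (hs : StrictConvex ℝ K)
    {γ τ : ℝ → ℂ} {k : ℝ → ℝ} (hγK : ∀ t, γ t ∈ frontier K)
    (hγ : ∀ t, HasDerivAt γ (τ t) t) (hτ : ∀ t, HasDerivAt τ (Complex.I * k t * τ t) t)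
    (hτ1 : ∀ t, ‖τ t‖ = 1) (hk : ∀ t, 0 < k t) {t : ℝ} {x : ℂ} (hx : x ∈ K) (hxt : x ≠ γ t) :
    0 < (star (τ t) * (x - γ t)).im := by
  have hmem : ∀ t, γ t ∈ K := fun t => hK.frontier_subset (hγK t)
  obtain ⟨f, hf⟩ := geometric_hahn_banach_open_point hs.convex.interior isOpen_interior
    (fun h => (hγK t).2 h)
  have hlt : ∀ x ∈ K, x ≠ γ t → f x < f (γ t) := fun x hx hxt => by
    have h1 := hf _ (hs hx (hmem t) hxt (show (0 : ℝ) < 1 / 2 by norm_num)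
      (show (0 : ℝ) < 1 / 2 by norm_num) (by norm_num))
    simp only [map_add, map_smul, smul_eq_mul] at h1
    linarith
  have hdec : ∀ z : ℂ, f z = (star (τ t) * z).re * f (τ t) + (star (τ t) * z).im * f (Complex.I * τ t) := by
    intro z
    have h1 : τ t * star (τ t) = 1 := by
      have := Complex.mul_conj (τ t)
      rw [Complex.normSq_eq_norm_sq, hτ1] at this
      simpa using this
    have h2 : z = (star (τ t) * z).re • τ t + (star (τ t) * z).im • (Complex.I * τ t) := by
      rw [Complex.real_smul, Complex.real_smul]
      calc z = (τ t * star (τ t)) * z := by rw [h1, one_mul]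
        _ = (star (τ t) * z) * τ t := by ring
        _ = (((star (τ t) * z).re : ℂ) + (star (τ t) * z).im * Complex.I) * τ t := by
          rw [Complex.re_add_im]
        _ = _ := by ring
    conv_lhs => rw [h2]
    simp only [map_add, map_smul, smul_eq_mul]
  have hφ : ∀ t, HasDerivAt (fun t => f (γ t)) (f (τ t)) t := fun t =>
    f.hasFDerivAt.comp_hasDerivAt t (hγ t)
  have hφ' : HasDerivAt (fun t => f (τ t)) (f (Complex.I * k t * τ t)) t :=
    f.hasFDerivAt.comp_hasDerivAt t (hτ t)
  have hmax : IsLocalMax (fun t => f (γ t)) t := Eventually.of_forall fun t' => by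
    rcases eq_or_ne (γ t') (γ t) with h | h
    · simp only [h, le_refl]
    · exact (hlt _ (hmem t') h).le
  have h0 : f (τ t) = 0 := hmax.hasDerivAt_eq_zero (hφ t)
  have hkc : f (Complex.I * k t * τ t) = k t * f (Complex.I * τ t) := by
    have : Complex.I * k t * τ t = k t • (Complex.I * τ t) := by rw [Complex.real_smul]; ring
    rw [this, map_smul, smul_eq_mul]
  have hd : deriv (fun t => f (γ t)) = fun t => f (τ t) := funext fun t => (hφ t).deriv
  have hc : f (Complex.I * τ t) ≤ 0 := by
    by_contra hc
    rw [not_le] at hc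
    have hpos : 0 < f (Complex.I * k t * τ t) := by rw [hkc]; exact mul_pos (hk t) hc
    have hmin : IsLocalMin (fun t => f (γ t)) t :=
      isLocalMin_of_deriv_deriv_pos (by rw [hd, hφ'.deriv]; exact hpos) (by rw [hd]; exact h0)
        (hφ t).continuousAt
    have hconst : (fun t => f (γ t)) =ᶠ[𝓝 t] fun _ => f (γ t) := by
      filter_upwards [hmax, hmin] with t' h1 h2 using le_antisymm h1 h2
    have h3 := hconst.deriv
    rw [hd] at h3
    have h4 := h3.deriv_eq
    rw [hφ'.deriv] at h4
    simp at h4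
    exact hpos.ne' h4
  have h1 := hlt x hx hxt
  have h2 := hdec (x - γ t)
  rw [map_sub, h0, mul_zero, zero_add] at h2
  by_contra h3
  rw [not_lt] at h3
  have := mul_nonneg_of_nonpos_of_nonpos h3 hc
  linarith

/-- The tangent vector of a curve turns by the integral of the curvature; in particular it has turned
by the angle `α` within the length `α / k₀`, if the curvature is at least `k₀`. -/
theorem exists_tangent_eq {τ : ℝ → ℂ} {k : ℝ → ℝ} {k₀ : ℝ} (hk₀ : 0 < k₀) (hkc : Continuous k)
    (hk : ∀ t, k₀ ≤ k t) (hτ : ∀ t, HasDerivAt τ (Complex.I * k t * τ t) t) (s : ℝ) {α : ℝ}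
    (hα : 0 ≤ α) : ∃ t ∈ Icc s (s + α / k₀), τ t = Complex.exp (Complex.I * α) * τ s := by
  set ψ : ℝ → ℝ := fun t => ∫ x in s..t, k x with hψ
  have hψd : ∀ t, HasDerivAt ψ (k t) t := fun t =>
    intervalIntegral.integral_hasDerivAt_right (hkc.intervalIntegrable _ _)
      hkc.stronglyMeasurable.stronglyMeasurableAtFilter hkc.continuousAt
  have hconst : ∀ t, τ t * Complex.exp (-(Complex.I * ψ t)) = τ s := by
    have hd : ∀ t, HasDerivAt (fun t => τ t * Complex.exp (-(Complex.I * ψ t))) 0 t := fun t => by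
      have h1 := (hτ t).mul (((hψd t).ofReal_comp.const_mul Complex.I).neg.cexp)
      refine h1.congr_deriv ?_
      ring
    intro t
    have := is_const_of_deriv_eq_zero (fun t => (hd t).differentiableAt) (fun t => (hd t).deriv) t s
    simpa [hψ] using this
  have hcont : ContinuousOn ψ (Icc s (s + α / k₀)) := fun t _ =>
    (hψd t).continuousAt.continuousWithinAt
  have hle : s ≤ s + α / k₀ := by have : 0 ≤ α / k₀ := by positivity
                                  linarith
  have hend : α ≤ ψ (s + α / k₀) := by
    have h1 : ∫ _ in s..(s + α / k₀), k₀ ≤ ∫ x in s..(s + α / k₀), k x :=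
      intervalIntegral.integral_mono_on hle (by simp) (hkc.intervalIntegrable _ _) fun x _ => hk x
    rw [intervalIntegral.integral_const, add_sub_cancel_left, smul_eq_mul,
      div_mul_cancel₀ _ hk₀.ne'] at h1
    exact h1
  obtain ⟨t, ht, hta⟩ := intermediate_value_Icc hle hcont (show α ∈ Icc (ψ s) _ from
    ⟨by simpa [hψ] using hα, hend⟩)
  refine ⟨t, ht, ?_⟩
  have h1 := hconst t
  rw [hta] at h1
  rw [← h1, mul_comm (τ t), ← mul_assoc, ← Complex.exp_add, add_neg_cancel, Complex.exp_zero, one_mul]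

/-! ### Billiard steps with small angles -/

theorem planeToComplex_eq (v : Plane) :
    planeToComplex v = Complex.orthonormalBasisOneI.repr.symm v := by
  rw [LinearIsometryEquiv.eq_symm_apply]
  ext i
  fin_cases i <;> simp [planeToComplex]

theorem planeToComplex_rotLeft (v : Plane) : planeToComplex (rotLeft v) = Complex.I * planeToComplex v := by
  apply Complex.ext <;> simp [planeToComplex, rotLeft]

theorem planeToComplex_direction (θ : ℝ) (v : Plane) :
    planeToComplex (Real.cos θ • v + Real.sin θ • rotLeft v) =
      Complex.exp (Complex.I * θ) * planeToComplex v := by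
  rw [planeToComplex_eq, map_add, map_smul, map_smul, ← planeToComplex_eq, ← planeToComplex_eq,
    planeToComplex_rotLeft, Complex.real_smul, Complex.real_smul, mul_comm Complex.I (θ : ℂ),
    Complex.exp_mul_I, Complex.ofReal_cos, Complex.ofReal_sin]
  ring

/-- The chord angle is the argument of the mean tangent vector along the chord. -/
theorem CurveFrame.chordAngle_eq {Λ β R : ℝ} {u v p q κ : ℂ → ℂ} (hF : CurveFrame Λ β R u v p q κ)
    {s s' ρ θ : ℝ} (hρ : 0 < ρ) (hθ : θ ∈ Ioo (-Real.pi) Real.pi)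
    (h : q s * chordMean p s s' = ρ * Complex.exp (Complex.I * θ)) : chordAngle p q s s' = θ := by
  have hs := ofReal_mem_strip hF.R_pos s
  have hs' := ofReal_mem_strip hF.R_pos s'
  have hstar : ∀ x : ℝ, star (x : ℂ) = x := Complex.conj_ofReal
  have h1 : p s * chordMean q s s' = ρ * Complex.exp (-(Complex.I * θ)) := by
    have h2 := chordMean_star hF.p_star hs hs'
    have h3 := hF.q_star hs
    rw [hstar] at h3
    rw [hstar, hstar] at h2
    have h4 := congrArg star h
    rw [star_mul', h2, star_star, h3, star_star] at h4
    rw [h4, star_mul', hstar]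
    congr 1
    change (starRingEnd ℂ) _ = _
    rw [← Complex.exp_conj, map_mul, Complex.conj_I, Complex.conj_ofReal, neg_mul]
  have hlog : ∀ φ : ℝ, φ ∈ Ioo (-Real.pi) Real.pi →
      Complex.log (ρ * Complex.exp (Complex.I * φ)) = Real.log ρ + Complex.I * φ := fun φ hφ => by
    have h5 : (ρ : ℂ) * Complex.exp (Complex.I * φ) = Complex.exp (Real.log ρ + Complex.I * φ) := by
      rw [Complex.exp_add, ← Complex.ofReal_exp, Real.exp_log hρ]
    rw [h5, Complex.log_exp] <;> simp [hφ.1, hφ.2.le]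
  have h6 := hlog θ hθ
  have h7 := hlog (-θ) ⟨by linarith [hθ.2], by linarith [hθ.1]⟩
  rw [Complex.ofReal_neg, mul_neg] at h7
  rw [chordAngle, h, h1, h6, h7]
  linear_combination -(θ : ℂ) * Complex.I_sq

/-- The frontier of the closure of `Ω` may a priori be smaller than the frontier of `Ω`, but it is the
whole curve. -/
theorem IsBilliardBoundary.frontier_image_closure {Ω : Set Plane} {r : ℝ → Plane}
    (hΩ : IsBilliardBoundary Ω r) (hr : Continuous r) :
    IsClosed (planeToComplex '' closure Ω) ∧ StrictConvex ℝ (planeToComplex '' closure Ω) ∧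
    frontier (planeToComplex '' closure Ω) = range fun t => planeToComplex (r t) := by
  have he : planeToComplex = Complex.orthonormalBasisOneI.repr.symm.toHomeomorph :=
    funext planeToComplex_eq
  have hcont : Continuous planeToComplex := by rw [he]; exact Homeomorph.continuous _
  have hinj : Function.Injective planeToComplex := by rw [he]; exact Homeomorph.injective _
  have hcpt : IsCompact (planeToComplex '' closure Ω) := hΩ.isBounded.isCompact_closure.image hcont
  have hsc : StrictConvex ℝ (planeToComplex '' closure Ω) := by
    have := hΩ.strictConvex.linear_image
      Complex.orthonormalBasisOneI.repr.symm.toLinearEquiv.toLinearMap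
      Complex.orthonormalBasisOneI.repr.symm.toHomeomorph.isOpenMap
    rw [he]
    exact this
  refine ⟨hcpt.isClosed, hsc, frontier_eq_range_of_subset hcpt hsc.convex ?_ (hcont.comp hr)
    (fun t => by simp only [hΩ.periodic t]) (fun s hs t ht h => hΩ.injOn hs ht (hinj h)) ?_⟩
  · obtain ⟨x, hx⟩ := hΩ.nonempty
    refine ⟨planeToComplex x, ?_⟩
    rw [he, ← Homeomorph.image_interior]
    exact mem_image_of_mem _ (interior_maximal subset_closure hΩ.isOpen hx)
  · rw [he, ← Homeomorph.image_frontier]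
    rintro _ ⟨x, hx, rfl⟩
    obtain ⟨t, rfl⟩ : x ∈ range r := hΩ.frontier_eq ▸ frontier_closure_subset hx
    exact ⟨t, rfl⟩

/-- A billiard step with small angles is a short step, and its angles are the two chord angles. The
tangent turns by `ϑ + ϑ'` along the step. The curve has a tangent of this direction within the length
`(ϑ + ϑ') / β`, and by strict convexity only one. -/
theorem IsBilliardStep.chordAngle_eq {Λ β R : ℝ} {u v p q κ : ℂ → ℂ} {Ω : Set Plane} {r : ℝ → Plane}
    (hF : CurveFrame Λ β R u v p q κ) (hΩ : IsBilliardBoundary Ω r)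
    (hunit : ∀ s, ‖deriv r s‖ = 1) (hr : ∀ t, HasDerivAt r (deriv r t) t)
    (hu : ∀ t : ℝ, u t = planeToComplex (r t)) (hp : ∀ t : ℝ, p t = planeToComplex (deriv r t))
    {s ϑ s' ϑ' : ℝ} (h : IsBilliardStep r s ϑ s' ϑ') (hsmall : (ϑ + ϑ') / β < 1) :
    |s' - s| ≤ (ϑ + ϑ') / β ∧ chordAngle p q s s' = ϑ ∧ chordAngle p q s' s = -ϑ' := by
  obtain ⟨hϑ, hϑ', hs', hout, hin⟩ := h
  have hR := hF.R_pos
  have hβ := hF.β_pos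
  have hmem : ∀ t : ℝ, (t : ℂ) ∈ strip R := ofReal_mem_strip hR
  have hstar : ∀ x : ℝ, star (x : ℂ) = x := Complex.conj_ofReal
  have hinj : Function.Injective planeToComplex := fun x y hxy => by
    rw [planeToComplex_eq, planeToComplex_eq] at hxy
    exact (LinearIsometryEquiv.injective _) hxy
  have hκ : ∀ t : ℝ, (((κ t).re : ℝ) : ℂ) = κ t := fun t => by
    have := hF.κ_star _ (hmem t)
    rw [hstar] at this
    exact Complex.conj_eq_iff_re.1 this.symm
  have hp1 : ∀ t : ℝ, ‖p t‖ = 1 := fun t => by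
    rw [hp, planeToComplex_eq, LinearIsometryEquiv.norm_map, hunit]
  have hpd : ∀ t : ℝ, HasDerivAt (fun t : ℝ => p t) (Complex.I * ((κ t).re : ℝ) * p t) t := fun t => by
    rw [hκ]
    exact (hF.hasDerivAt_p _ (hmem t)).comp_ofReal
  have hud : ∀ t : ℝ, HasDerivAt (fun t : ℝ => u t) (p t) t := fun t =>
    (hF.hasDerivAt_u _ (hmem t)).comp_ofReal
  have hκc : Continuous fun t : ℝ => (κ t).re := Complex.continuous_re.comp <|
    continuous_iff_continuousAt.2 fun t =>
      (((hF.differentiableOn_κ _ (hmem t)).differentiableAt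
        ((isOpen_strip R).mem_nhds (hmem t))).continuousAt).comp Complex.continuous_ofReal.continuousAt
  have hκβ : ∀ t : ℝ, β ≤ (κ t).re := fun t => hF.le_re _ (hmem t)
  have htan : ∀ t, unitTangent r t = deriv r t := fun t => by rw [unitTangent, hunit, inv_one, one_smul]
  set L := ‖r s' - r s‖ with hL
  have hne : r s' ≠ r s := fun h => by
    -- the parameters differ by less than a period
    have := eq_of_periodic_of_injOn hΩ.periodic hΩ.injOn h (by
      rw [abs_lt]; constructor <;> linarith [hs'.1, hs'.2])
    exact hs'.1.ne' this
  have hL0 : 0 < L := norm_pos_iff.2 (sub_ne_zero.2 hne)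
  have hsub : planeToComplex (r s' - r s) = u s' - u s := by
    rw [hu, hu, planeToComplex_eq, map_sub, ← planeToComplex_eq, ← planeToComplex_eq]
  have hsmul : ∀ (a : ℝ) (w : Plane), planeToComplex (a • w) = a * planeToComplex w := fun a w => by
    rw [planeToComplex_eq, map_smul, ← planeToComplex_eq, Complex.real_smul]
  have h1 : u s' - u s = L * (Complex.exp (Complex.I * ϑ) * p s) := by
    rw [← hsub, hout, hsmul, planeToComplex_direction, htan, ← hp]
  have h2 : u s' - u s = L * (Complex.exp (Complex.I * (-ϑ' : ℝ)) * p s') := by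
    rw [← hsub, hin, hsmul, hp, ← planeToComplex_direction, htan, Real.cos_neg, Real.sin_neg, neg_smul,
      ← sub_eq_add_neg]
  -- the tangent at the next point
  have h3 : p s' = Complex.exp (Complex.I * ((ϑ + ϑ' : ℝ) : ℂ)) * p s := by
    have hLC : (L : ℂ) ≠ 0 := by exact_mod_cast hL0.ne'
    have h4 := mul_left_cancel₀ hLC (h1.symm.trans h2)
    have h5 : Complex.exp (Complex.I * ϑ') * Complex.exp (Complex.I * (-ϑ' : ℝ)) = 1 := by
      rw [← Complex.exp_add]
      push_cast
      simp
    push_cast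
    rw [mul_add, Complex.exp_add]
    linear_combination Complex.exp (Complex.I * ϑ') * (-h4) - p s' * h5
  obtain ⟨t, ht, htp⟩ := exists_tangent_eq hβ hκc hκβ hpd s (add_pos hϑ.1 hϑ'.1).le
  obtain ⟨hK, hKs, hKf⟩ := hΩ.frontier_image_closure
    (continuous_iff_continuousAt.2 fun t => (hr t).continuousAt)
  have hγ : ∀ t : ℝ, u t ∈ frontier (planeToComplex '' closure Ω) := fun t => by
    rw [hKf, hu]
    exact mem_range_self t
  have heq : u t = u s' := by
    by_contra hne
    have h4 := im_conj_tangent_mul_pos hK hKs hγ hud hpd hp1 (fun t => hβ.trans_le (hκβ t))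
      (hK.frontier_subset (hγ t)) hne
    have h5 := im_conj_tangent_mul_pos hK hKs hγ hud hpd hp1 (fun t => hβ.trans_le (hκβ t))
      (hK.frontier_subset (hγ s')) (Ne.symm hne)
    rw [htp, ← h3] at h5
    rw [← neg_sub, mul_neg, Complex.neg_im] at h5
    linarith
  have hts : t = s' := by
    refine eq_of_periodic_of_injOn hΩ.periodic hΩ.injOn (hinj (by rw [← hu, ← hu, heq])) ?_
    rw [abs_lt]
    constructor <;> linarith [hs'.1, hs'.2, ht.1, ht.2]
  have hh : 0 < s' - s := by linarith [hs'.1]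
  have hchord : ((s' - s : ℝ) : ℂ) * chordMean p s s' = u s' - u s := by
    rw [← sub_mul_chordMean hF.differentiableOn_p hF.hasDerivAt_u (hmem s) (hmem s')]
    push_cast
    rfl
  have hhC : ((s' - s : ℝ) : ℂ) ≠ 0 := by exact_mod_cast hh.ne'
  refine ⟨?_, ?_, ?_⟩
  · rw [abs_of_pos hh, ← hts]
    linarith [ht.2]
  · refine hF.chordAngle_eq (ρ := L / (s' - s)) (by positivity) ⟨by linarith [hϑ.1, Real.pi_pos], hϑ.2⟩ ?_
    have h4 := hF.mul_eq_one _ (hmem s)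
    apply mul_left_cancel₀ hhC
    push_cast at hchord hhC ⊢
    field_simp
    linear_combination q s * hchord + q s * h1 + L * Complex.exp (Complex.I * ϑ) * h4
  · have h4 := hF.mul_eq_one _ (hmem s')
    rw [hF.chordAngle_eq (ρ := L / (s' - s)) (θ := -ϑ') (by positivity)
      ⟨by linarith [hϑ'.2], by linarith [hϑ'.1, Real.pi_pos]⟩ ?_]
    · push_cast; rfl
    · rw [chordMean_comm]
      apply mul_left_cancel₀ hhC
      push_cast at hchord hhC h2 ⊢
      simp only [mul_neg] at h2 ⊢
      field_simp
      linear_combination q s' * hchord + q s' * h2 + L * Complex.exp (-(Complex.I * ϑ')) * h4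

/-! ### The normal form theorem -/

theorem mainTheorem5 (D : ℝ) (hD : 1 < D) :
    ∃ C₅ : ℝ, 1 < C₅ ∧ ∀ k : ℕ, ∃ c₁ c₂ C₆ : ℝ, 0 < c₁ ∧ 0 < c₂ ∧ 1 < C₆ ∧
      ∀ (σ₀ : ℝ) (Ω : Set Plane) (r : ℝ → Plane),
        0 < σ₀ → σ₀ < C₅⁻¹ →
        IsBilliardBoundary Ω r → (∀ s : ℝ, ‖deriv r s‖ = 1) →
        SpeedCurvatureBound D r → AnalyticBound D σ₀ r →
        ∃ (Φ : OpenPartialHomeomorph (ℂ × ℂ) (ℂ × ℂ)) (f g : ℂ × ℂ → ℂ),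
          IsCoordinateChange (σ₀ / 2) (c₁ * σ₀) Φ ∧
          IsRealAnalyticPeriodic f Φ.target ∧ IsRealAnalyticPeriodic g Φ.target ∧
          (∀ s ϑ s' ϑ' : ℝ, IsBilliardStep r s ϑ s' ϑ' → ϑ < c₁ * σ₀ → ϑ' < c₁ * σ₀ →
            Φ ((s' : ℂ), (ϑ' : ℂ)) =
              normalFormMap (2 * k + 4) f g (Φ ((s : ℂ), (ϑ : ℂ)))) ∧
          ∀ σ : ℝ, 0 < σ → σ < σ₀ / 2 →
            stripProd (c₂ * σ) (c₂ * σ) ⊆ Φ '' stripProd σ (c₁ * σ₀) ∧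
            ∀ p ∈ Φ '' stripProd σ (c₁ * σ₀),
              ‖f p‖ ≤ C₆ / (σ₀ / 2 - σ) ^ (2 * k + 3) ∧
              ‖g p‖ ≤ C₆ / (σ₀ / 2 - σ) ^ (2 * k + 3) := by
  have hD0 : 0 < D := by linarith
  have hD3 : 1 < D ^ 3 := one_lt_pow₀ hD (by norm_num)
  refine ⟨16 * D ^ 3, by linarith, fun k => ?_⟩
  have hΛ : 1 ≤ 8 * D ^ 2 := by nlinarith
  have hβ : 0 < 1 / (2 * D) := by positivity
  have hβ1 : 1 / (2 * D) ≤ 1 := by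
    rw [div_le_one (by positivity)]
    linarith
  -- steps with angles below `c₀ σ₀` are short enough for the chord angle to determine the next point
  obtain ⟨c₁, c₂, C, hc₁, hc₁0, hc₂, hC, H⟩ := exists_normalForm hΛ hβ hβ1
    (c₀ := 1 / (2 * D) / (100 * (8 * D ^ 2) ^ 4) / (8 * D)) (by positivity) (2 * k + 1)
  refine ⟨c₁, c₂, C, hc₁, hc₂, hC, fun σ₀ Ω r hσ hσD hΩ hunit hκ hr => ?_⟩
  obtain ⟨u, v, p, q, κ, hF, hrd, hu, hp⟩ := exists_curveFrame hD hσ hσD hΩ.periodic hunit hκ hr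
  obtain ⟨Φ, f, f', hΦ, hf, hf', hstep, hbound⟩ := H hF
  refine ⟨Φ, f, f', hΦ, hf, hf', fun s ϑ s' ϑ' h hϑ hϑ' => ?_, hbound⟩
  have hlen : (ϑ + ϑ') / (1 / (2 * D)) < 1 / (2 * D) / (100 * (8 * D ^ 2) ^ 4) * σ₀ := by
    have h1 : c₁ * σ₀ ≤ 1 / (2 * D) / (100 * (8 * D ^ 2) ^ 4) / (8 * D) * σ₀ := by gcongr
    have h2 : 1 / (2 * D) / (100 * (8 * D ^ 2) ^ 4) / (8 * D) * σ₀ * (8 * D) =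
      1 / (2 * D) / (100 * (8 * D ^ 2) ^ 4) * σ₀ := by field_simp
    rw [div_div_eq_mul_div, div_one, ← h2]
    have h3 := h.1.1
    have h4 := h.2.1.1
    nlinarith
  have hone : 1 / (2 * D) / (100 * (8 * D ^ 2) ^ 4) * σ₀ ≤ 1 := by
    have h1 : 1 / (2 * D) / (100 * (8 * D ^ 2) ^ 4) ≤ 1 := by
      rw [div_le_one (by positivity)]
      have : 1 ≤ (8 * D ^ 2) ^ 4 := one_le_pow₀ hΛ
      linarith
    exact mul_le_one₀ h1 hσ.le hF.R_le_one
  obtain ⟨h1, h2, h3⟩ := h.chordAngle_eq hF hΩ hunit hrd hu hp (hlen.trans_le hone)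
  refine hstep s ϑ s' ϑ' ⟨ofReal_mem_strip (by positivity) s, ?_⟩ ?_ h2 h3
  · rw [mem_ball_zero_iff, Complex.norm_real, Real.norm_of_nonneg h.1.1.le]
    exact hϑ
  · rw [← Complex.ofReal_sub, Complex.norm_real, Real.norm_eq_abs]
    exact h1.trans_lt hlen
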